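/- All matroids and graphs are finite; graphs may have loops and parallel edges (a loop is a cycle of length one). Definitions. A matroid $M$ is \emph{frame} if it has an extension $N$ (a matroid $N$ on a superset of $E(M)$ with $N|E(M)=M$) with a basis $B$ such that every element of $N$ is spanned by two elements of $B$. A \emph{biased graph} $\Omega=(G,\mathcal B)$ is a graph $G$ with a set $\mathcal B$ of cycles of $G$, called balanced, such that no theta subgraph of $G$ contains exactly two balanced cycles. We write $M=F(\Omega)$ if $E(M)=E(G)$ and the circuits of $M$ are exactly the edge sets of (1) balanced cycles, (2) two edge-disjoint unbalanced cycles meeting in just one vertex, (3) two vertex-disjoint unbalanced cycles together with a minimal path connecting them, and (4) theta subgraphs all three of whose cycles are unbalanced. A \emph{matroidal} is a pair $(M,L)$ of a matroid $M$ and a set $L\subseteq E(M)$; it is \emph{frame} if there is a biased graph $\Omega$ with $M=F(\Omega)$ in which every element of $L$ is an unbalanced loop. A matroid is \emph{graphic} if it is the cycle matroid of a graph. A matroid $M$ with rank function $r$ is \emph{connected} if there is no partition of $E(M)$ into nonempty sets $X,Y$ with $r(X)+r(Y)=r(M)$. For matroids $M_1,M_2$ with disjoint ground sets and non-loop elements $e_i\in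 E(M_i)$, the \emph{2-sum} $M_1\oplus_2 M_2$ on $e_1,e_2$ is the matroid on $(E(M_1)\cup E(M_2))\setminus\{e_1,e_2\}$ whose circuits are the circuits of $M_i$ avoiding $e_i$ ($i=1,2$) together with the sets $(C_1\cup C_2)\setminus\{e_1,e_2\}$, where $C_i$ is a circuit of $M_i$ containing $e_i$ ($i=1,2$). Theorem. Let $M_1,M_2$ be connected matroids with disjoint ground sets and at least two elements each, and let $e_i\in E(M_i)$ for $i=1,2$. (a) The 2-sum $M_1\oplus_2 M_2$ on $e_1,e_2$ is frame if and only if one of the following holds: (i) one of $M_1,M_2$ is graphic and the other is frame; (ii) both matroidals $(M_1,\{e_1\})$ and $(M_2,\{e_2\})$ are frame. (b) Let $L_i\subseteq E(M_i)\setminus\{e_i\}$ be such that the matroidals $(M_1,L_1)$ and $(M_2,L_2)$ are frame. Then the matroidal $(M_1\oplus_2 M_2,\ L_1\cup L_2)$ is frame if and only if one of the following holds: (i) $L_i=\emptyset$ and $M_i$ is graphic for $i=1$ or $i=2$; (ii) $(M_i,L_i\cup\{e_i\})$ is frame for both $i=1,2$. -/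

import Mathlib

open Set

namespace FrameMatroids

universe u v

/-! ### Paths, cycles and thetas in multigraphs (loops and parallel edges allowed) -/

section Graphs

variable {V : Type v} {α : Type u}

/-- `IsPath G x y W P`: the edge set `P` is the edge set of a path of `G` from `x` to `y`
whose vertex set is `W` (a single vertex is a path with no edges). -/
inductive IsPath (G : Graph V α) : V → V → Set V → Set α → Prop
  | nil {x : V} (hx : x ∈ G.vertexSet) : IsPath G x x {x} ∅
  | cons {x y z : V} {W : Set V} {e : α} {P : Set α} (he : G.IsLink e x y)
      (hP : IsPath G y z W P) (hx : x ∉ W) : IsPath G x z (insert x W) (insert e P)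

/-- `IsCycleOn G W C`: `C` is the edge set of a cycle of `G` with vertex set `W`, that is, of a path
together with one further edge joining its ends.  A loop is a cycle of length one, and two
parallel links form a cycle of length two. -/
def IsCycleOn (G : Graph V α) (W : Set V) (C : Set α) : Prop :=
  ∃ (x y : V) (P : Set α) (e : α),
    IsPath G x y W P ∧ G.IsLink e x y ∧ e ∉ P ∧ C = insert e P

/-- `C` is the edge set of a cycle of `G`. -/
def IsCycle (G : Graph V α) (C : Set α) : Prop := ∃ W : Set V, IsCycleOn G W C

/-- `P₁`, `P₂`, `P₃` are the edge sets of three internally disjoint paths joining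
a pair of distinct vertices; together they form a theta subgraph, whose cycles are
`P₁ ∪ P₂`, `P₁ ∪ P₃` and `P₂ ∪ P₃`. -/
def IsTheta (G : Graph V α) (P₁ P₂ P₃ : Set α) : Prop :=
  ∃ (x y : V) (W₁ W₂ W₃ : Set V), x ≠ y ∧
    IsPath G x y W₁ P₁ ∧ IsPath G x y W₂ P₂ ∧ IsPath G x y W₃ P₃ ∧
    W₁ ∩ W₂ = {x, y} ∧ W₁ ∩ W₃ = {x, y} ∧ W₂ ∩ W₃ = {x, y} ∧
    Disjoint P₁ P₂ ∧ Disjoint P₁ P₃ ∧ Disjoint P₂ P₃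

end Graphs

/-! ### Biased graphs and their frame matroids -/

/-- A (finite) biased graph: a graph with a collection of balanced cycles (given by their
edge sets) such that no theta subgraph contains exactly two balanced cycles. -/
structure BiasedGraph (V : Type v) (α : Type u) where
  /-- the underlying graph -/
  graph : Graph V α
  finite_vertexSet : graph.vertexSet.Finite
  finite_edgeSet : graph.edgeSet.Finite
  /-- the collection of balanced cycles -/
  balanced : Set (Set α)
  isCycle_of_balanced : ∀ C ∈ balanced, IsCycle graph C
  theta_property : ∀ P₁ P₂ P₃ : Set α, IsTheta graph P₁ P₂ P₃ →
    P₁ ∪ P₂ ∈ balanced → P₂ ∪ P₃ ∈ balanced → P₁ ∪ P₃ ∈ balanced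

namespace BiasedGraph

variable {V : Type v} {α : Type u}

/-- `C` is the edge set of an unbalanced cycle with vertex set `W`. -/
def IsUnbalancedCycleOn (Ω : BiasedGraph V α) (W : Set V) (C : Set α) : Prop :=
  IsCycleOn Ω.graph W C ∧ C ∉ Ω.balanced

/-- Two edge-disjoint unbalanced cycles meeting in exactly one vertex. -/
def IsTightHandcuffs (Ω : BiasedGraph V α) (C : Set α) : Prop :=
  ∃ (W₁ W₂ : Set V) (C₁ C₂ : Set α) (x : V),
    Ω.IsUnbalancedCycleOn W₁ C₁ ∧ Ω.IsUnbalancedCycleOn W₂ C₂ ∧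
    Disjoint C₁ C₂ ∧ W₁ ∩ W₂ = {x} ∧ C = C₁ ∪ C₂

/-- Two vertex-disjoint unbalanced cycles together with a path connecting them
(which meets each of the cycles in one of its ends only). -/
def IsLooseHandcuffs (Ω : BiasedGraph V α) (C : Set α) : Prop :=
  ∃ (W₁ W₂ W : Set V) (C₁ C₂ P : Set α) (x y : V),
    Ω.IsUnbalancedCycleOn W₁ C₁ ∧ Ω.IsUnbalancedCycleOn W₂ C₂ ∧ Disjoint W₁ W₂ ∧
    IsPath Ω.graph x y W P ∧ W ∩ W₁ = {x} ∧ W ∩ W₂ = {y} ∧ C = C₁ ∪ C₂ ∪ P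

/-- A theta subgraph all three of whose cycles are unbalanced. -/
def IsContrabalancedTheta (Ω : BiasedGraph V α) (C : Set α) : Prop :=
  ∃ P₁ P₂ P₃ : Set α, IsTheta Ω.graph P₁ P₂ P₃ ∧
    P₁ ∪ P₂ ∉ Ω.balanced ∧ P₁ ∪ P₃ ∉ Ω.balanced ∧ P₂ ∪ P₃ ∉ Ω.balanced ∧
    C = P₁ ∪ P₂ ∪ P₃

/-- The edge sets that are the circuits of the frame matroid `F(Ω)`. -/
def IsFrameCircuit (Ω : BiasedGraph V α) (C : Set α) : Prop :=
  C ∈ Ω.balanced ∨ Ω.IsTightHandcuffs C ∨ Ω.IsLooseHandcuffs C ∨ Ω.IsContrabalancedTheta C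

/-- `Ω` represents `M`, that is `M = F(Ω)`: the ground set of `M` is the edge set of `Ω`, and the
circuits of `M` are those of `F(Ω)`. -/
def Represents (Ω : BiasedGraph V α) (M : Matroid α) : Prop :=
  Ω.graph.edgeSet = M.E ∧ ∀ C : Set α, M.IsCircuit C ↔ Ω.IsFrameCircuit C

/-- `e` is an unbalanced loop of `Ω`. -/
def IsUnbalancedLoop (Ω : BiasedGraph V α) (e : α) : Prop :=
  (∃ x : V, Ω.graph.IsLoopAt e x) ∧ {e} ∉ Ω.balanced

end BiasedGraph

section Matroids

variable {α : Type u}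

/-- The matroidal `(M, L)` is frame: some biased graph `Ω` with `M = F(Ω)` has
every element of `L` as an unbalanced loop. -/
def IsFrameMatroidal (M : Matroid α) (L : Set α) : Prop :=
  ∃ (V : Type u) (Ω : BiasedGraph V α), Ω.Represents M ∧ ∀ e ∈ L, Ω.IsUnbalancedLoop e

/-- `M` is frame: it has an extension `N` (by elements of a type `β`) with a basis `B`
such that every element of `N` is spanned by two elements of `B`. -/
def IsFrame (M : Matroid α) : Prop :=
  ∃ (β : Type u) (N : Matroid (α ⊕ β)) (B : Set (α ⊕ β)), N.Finite ∧ N.comap Sum.inl = M ∧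
    N.IsBase B ∧ ∀ e ∈ N.E, ∃ x ∈ B, ∃ y ∈ B, e ∈ N.closure {x, y}

/-- `M` is graphic: it is the cycle matroid of a finite graph. -/
def IsGraphic (M : Matroid α) : Prop :=
  ∃ (V : Type u) (G : Graph V α), G.vertexSet.Finite ∧ G.edgeSet = M.E ∧
    ∀ C : Set α, M.IsCircuit C ↔ IsCycle G C

/-- `M` is connected: it has no `1`-separation, that is, no partition `(X, Y)` of its ground set
into two nonempty sets with `r(X) + r(Y) = r(M)`. -/
def IsConnected (M : Matroid α) : Prop :=
  ∀ X ⊆ M.E, X.Nonempty → (M.E \ X).Nonempty → M.eRk X + M.eRk (M.E \ X) ≠ M.eRank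

/-! ### The 2-sum -/

/-- `C` is one of the sets that are the circuits of the 2-sum of `M₁` and `M₂` on `e₁`, `e₂`. -/
def IsTwoSumCircuit (M₁ M₂ : Matroid α) (e₁ e₂ : α) (C : Set α) : Prop :=
  (M₁.IsCircuit C ∧ e₁ ∉ C) ∨ (M₂.IsCircuit C ∧ e₂ ∉ C) ∨
    ∃ C₁ C₂ : Set α, M₁.IsCircuit C₁ ∧ e₁ ∈ C₁ ∧ M₂.IsCircuit C₂ ∧ e₂ ∈ C₂ ∧
      C = (C₁ ∪ C₂) \ {e₁, e₂}

/-- `M` is the 2-sum of `M₁` and `M₂` on `e₁` and `e₂`. -/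
def IsTwoSum (M₁ M₂ : Matroid α) (e₁ e₂ : α) (M : Matroid α) : Prop :=
  M.E = (M₁.E ∪ M₂.E) \ {e₁, e₂} ∧ ∀ C : Set α, M.IsCircuit C ↔ IsTwoSumCircuit M₁ M₂ e₁ e₂ C

open Classical in
/-- The 2-sum of `M₁` and `M₂` on `e₁` and `e₂`: the matroid on `(E(M₁) ∪ E(M₂)) \ {e₁, e₂}` with
the circuits above.  It exists for finite `M₁`, `M₂` with disjoint ground sets whenever neither
`e₁` nor `e₂` is a loop (`isTwoSum_twoSum`); otherwise the value is irrelevant. -/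
noncomputable def twoSum (M₁ M₂ : Matroid α) (e₁ e₂ : α) : Matroid α :=
  if h : ∃ M, IsTwoSum M₁ M₂ e₁ e₂ M then h.choose else Matroid.emptyOn α

/-- Elements of a connected matroid with at least two elements are not loops. -/
theorem IsConnected.isNonloop {M : Matroid α} (hM : IsConnected M) (hE : M.E.Nontrivial)
    {e : α} (he : e ∈ M.E) : M.IsNonloop e := by
  by_contra hnl
  have hl : M.IsLoop e := (M.not_isNonloop_iff he).1 hnl
  obtain ⟨f, hf, hfe⟩ := hE.exists_ne e
  refine hM {e} (by simpa using he) (by simp) ⟨f, hf, by simpa using hfe⟩ ?_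
  have h1 : M.eRk {e} = 0 := hl.eRk_eq
  have h2 : M.eRk (M.E \ {e}) = M.eRank := by
    rw [Matroid.eRank_def, ← M.eRk_closure_eq (M.E \ {e}), ← M.eRk_closure_eq M.E]
    congr 1
    exact Matroid.closure_sdiff_eq_self (by simpa using hl.mem_closure _)
  rw [h1, h2, zero_add]

/-- Auxiliary construction for the existence of the 2-sum: the independent sets are those
`I ⊆ E(D) \ {a, b}` for which `I ∪ {a}` or `I ∪ {b}` is independent in `D`. -/
theorem exists_quotient (D : Matroid α) [D.Finite] (a b : α) (ha : D.Indep {a}) :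
    ∃ M : Matroid α, M.E = D.E \ {a, b} ∧ ∀ I, M.Indep I ↔
      I ⊆ D.E \ {a, b} ∧ (D.Indep (insert a I) ∨ D.Indep (insert b I)) := by
  have hfin : (D.E \ {a, b}).Finite := D.ground_finite.sdiff
  have key : ∀ p q : α, ({p, q} : Set α) = {a, b} → ∀ I J : Set α, I ⊆ D.E \ {a, b} →
      J ⊆ D.E \ {a, b} → I.ncard < J.ncard → D.Indep (insert p I) →
      (D.Indep (insert p J) ∨ D.Indep (insert q J)) →
      ∃ x ∈ J, x ∉ I ∧ (D.Indep (insert p (insert x I)) ∨ D.Indep (insert q (insert x I))) := by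
    intro p q hpq I J hI hJ hlt hpI hJ'
    have hnot : ∀ r : α, r ∈ ({p, q} : Set α) → ∀ K : Set α, K ⊆ D.E \ {a, b} → r ∉ K := by
      intro r hr K hK hrK
      rw [hpq] at hr
      exact (hK hrK).2 hr
    have hp : p ∈ ({p, q} : Set α) := by simp
    have hq : q ∈ ({p, q} : Set α) := by simp
    have hcard : ∀ r s : α, r ∈ ({p, q} : Set α) → s ∈ ({p, q} : Set α) →
        (insert r I).encard < (insert s J).encard := by
      intro r s hr hs
      rw [encard_insert_of_notMem (hnot r hr I hI), encard_insert_of_notMem (hnot s hs J hJ),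
        ← (hfin.subset hI).cast_ncard_eq, ← (hfin.subset hJ).cast_ncard_eq]
      exact_mod_cast Nat.add_lt_add_right hlt 1
    have same : ∀ r : α, r ∈ ({p, q} : Set α) → D.Indep (insert r I) → D.Indep (insert r J) →
        ∃ x ∈ J, x ∉ I ∧ D.Indep (insert r (insert x I)) := by
      intro r hr h1 h2
      obtain ⟨x, hx, hxi⟩ := h1.augment h2 (hcard r r hr hr)
      refine ⟨x, ?_, fun h => hx.2 (mem_insert_of_mem _ h), by rwa [insert_comm]⟩
      rcases hx.1 with rfl | h
      · exact absurd (mem_insert _ _) hx.2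
      · exact h
    rcases hJ' with hJ' | hJ'
    · obtain ⟨x, h1, h2, h3⟩ := same p hp hpI hJ'
      exact ⟨x, h1, h2, Or.inl h3⟩
    · obtain ⟨x, hx, hxi⟩ := hpI.augment hJ' (hcard p q hp hq)
      rcases hx.1 with rfl | h
      · have hqI : D.Indep (insert x I) := hxi.subset (insert_subset_insert (subset_insert _ _))
        obtain ⟨y, h1, h2, h3⟩ := same x hq hqI hJ'
        exact ⟨y, h1, h2, Or.inr h3⟩
      · exact ⟨x, h, fun h' => hx.2 (mem_insert_of_mem _ h'), Or.inl (by rwa [insert_comm])⟩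
  refine ⟨(IndepMatroid.ofFinite hfin
    (fun I => I ⊆ D.E \ {a, b} ∧ (D.Indep (insert a I) ∨ D.Indep (insert b I)))
    ⟨empty_subset _, Or.inl (by simpa using ha)⟩ ?_ ?_ (fun I hI => hI.1)).matroid,
    rfl, fun I => Iff.rfl⟩
  · rintro I J ⟨hJ, h⟩ hIJ
    exact ⟨hIJ.trans hJ, h.imp (fun h => h.subset (insert_subset_insert hIJ))
      (fun h => h.subset (insert_subset_insert hIJ))⟩
  · rintro I J ⟨hI, hI'⟩ ⟨hJ, hJ'⟩ hlt
    rcases hI' with hI' | hI'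
    · obtain ⟨x, h1, h2, h3⟩ := key a b rfl I J hI hJ hlt hI' hJ'
      exact ⟨x, h1, h2, insert_subset (hJ h1) hI, h3⟩
    · obtain ⟨x, h1, h2, h3⟩ := key b a (pair_comm _ _) I J hI hJ hlt hI' hJ'.symm
      exact ⟨x, h1, h2, insert_subset (hJ h1) hI, h3.symm⟩

theorem isCircuit_disjointSum_iff {M₁ M₂ : Matroid α} (hd : Disjoint M₁.E M₂.E) (C : Set α)
    [M₁.Finite] [M₂.Finite] :
    (M₁.disjointSum M₂ hd).IsCircuit C ↔ M₁.IsCircuit C ∨ M₂.IsCircuit C := by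
  have hM₁ : ∀ X ⊆ M₁.E, ((M₁.disjointSum M₂ hd).Dep X ↔ M₁.Dep X) := by
    intro X hX
    have h2 : X ∩ M₂.E = ∅ := (hd.mono_left hX).inter_eq
    have h3 : X ⊆ M₁.E ∪ M₂.E := hX.trans subset_union_left
    rw [Matroid.Dep, Matroid.Dep, Matroid.disjointSum_indep_iff, Matroid.disjointSum_ground_eq,
      inter_eq_self_of_subset_left hX, h2]
    simp only [Matroid.empty_indep, h3, and_true, hX]
  have hM₂ : ∀ X ⊆ M₂.E, ((M₁.disjointSum M₂ hd).Dep X ↔ M₂.Dep X) := by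
    intro X hX
    have h2 : X ∩ M₁.E = ∅ := (hd.symm.mono_left hX).inter_eq
    have h3 : X ⊆ M₁.E ∪ M₂.E := hX.trans subset_union_right
    rw [Matroid.Dep, Matroid.Dep, Matroid.disjointSum_indep_iff, Matroid.disjointSum_ground_eq,
      inter_eq_self_of_subset_left hX, h2]
    simp only [Matroid.empty_indep, true_and, h3, and_true, hX]
  have hsub : ∀ (N : Matroid α), (∀ X ⊆ N.E, ((M₁.disjointSum M₂ hd).Dep X ↔ N.Dep X)) →
      ∀ X ⊆ N.E, ((M₁.disjointSum M₂ hd).IsCircuit X ↔ N.IsCircuit X) := by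
    intro N hN X hX
    rw [Matroid.isCircuit_iff, Matroid.isCircuit_iff, hN X hX]
    refine and_congr_right fun _ => forall_congr' fun Y => ?_
    constructor
    · intro h hY hYX
      exact h ((hN Y (hYX.trans hX)).2 hY) hYX
    · intro h hY hYX
      exact h ((hN Y (hYX.trans hX)).1 hY) hYX
  constructor
  · intro hC
    have hCE : C ⊆ M₁.E ∪ M₂.E := by simpa using hC.subset_ground
    have hdep : ¬ (M₁.Indep (C ∩ M₁.E) ∧ M₂.Indep (C ∩ M₂.E)) := by
      intro h
      exact hC.not_indep (by simpa using ⟨h.1, h.2, hCE⟩)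
    rw [not_and_or] at hdep
    rcases hdep with h | h
    · have h' : (M₁.disjointSum M₂ hd).Dep (C ∩ M₁.E) :=
        (hM₁ _ inter_subset_right).2 ⟨h, inter_subset_right⟩
      have := hC.eq_of_dep_subset h' inter_subset_left
      have hCs : C ⊆ M₁.E := by rw [← this]; exact inter_subset_right
      exact Or.inl ((hsub M₁ hM₁ C hCs).1 hC)
    · have h' : (M₁.disjointSum M₂ hd).Dep (C ∩ M₂.E) :=
        (hM₂ _ inter_subset_right).2 ⟨h, inter_subset_right⟩
      have := hC.eq_of_dep_subset h' inter_subset_left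
      have hCs : C ⊆ M₂.E := by rw [← this]; exact inter_subset_right
      exact Or.inr ((hsub M₂ hM₂ C hCs).1 hC)
  · rintro (h | h)
    · exact (hsub M₁ hM₁ C h.subset_ground).2 h
    · exact (hsub M₂ hM₂ C h.subset_ground).2 h

/-- The 2-sum of finite matroids on disjoint ground sets exists if neither of the elements
on which it is taken is a loop. -/
theorem exists_isTwoSum {M₁ M₂ : Matroid α} [M₁.Finite] [M₂.Finite] (hd : Disjoint M₁.E M₂.E)
    {e₁ e₂ : α} (h₁ : M₁.IsNonloop e₁) (h₂ : M₂.IsNonloop e₂) :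
    ∃ M, IsTwoSum M₁ M₂ e₁ e₂ M := by
  have hfin : (M₁.disjointSum M₂ hd).Finite :=
    ⟨by simpa using ⟨M₁.ground_finite, M₂.ground_finite⟩⟩
  have hE₁ : e₁ ∈ M₁.E := h₁.mem_ground
  have hE₂ : e₂ ∈ M₂.E := h₂.mem_ground
  have hn₁ : e₁ ∉ M₂.E := fun h => hd.ne_of_mem hE₁ h rfl
  have hn₂ : e₂ ∉ M₁.E := fun h => hd.ne_of_mem h hE₂ rfl
  obtain ⟨M, hE, hI⟩ := exists_quotient (M₁.disjointSum M₂ hd) e₁ e₂ (by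
    simp only [Matroid.disjointSum_indep_iff]
    refine ⟨h₁.indep.subset inter_subset_left, ?_, by simp [hE₁]⟩
    have : ({e₁} : Set α) ∩ M₂.E = ∅ := by simpa using hn₁
    rw [this]; exact M₂.empty_indep)
  rw [Matroid.disjointSum_ground_eq] at hE
  refine ⟨M, hE, ?_⟩
  -- every dependent set contains one of the prescribed circuits
  have hA : ∀ X, M.Dep X → ∃ C ⊆ X, IsTwoSumCircuit M₁ M₂ e₁ e₂ C := by
    intro X hX
    have hXE : X ⊆ (M₁.E ∪ M₂.E) \ {e₁, e₂} := hE ▸ hX.subset_ground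
    have hXn : ∀ x ∈ X, x ≠ e₁ ∧ x ≠ e₂ := by
      intro x hx
      simpa using (hXE hx).2
    have hni := hX.not_indep
    rw [hI, Matroid.disjointSum_ground_eq, not_and, not_or] at hni
    obtain ⟨d1, d2⟩ := hni hXE
    have hXE' : X ⊆ M₁.E ∪ M₂.E := hXE.trans sdiff_subset
    have get : ∀ e ∈ M₁.E ∪ M₂.E, ¬ (M₁.disjointSum M₂ hd).Indep (insert e X) →
        ∃ K ⊆ insert e X, M₁.IsCircuit K ∨ M₂.IsCircuit K := by
      intro e he hd'
      have hdep : (M₁.disjointSum M₂ hd).Dep (insert e X) :=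
        ⟨hd', by rw [Matroid.disjointSum_ground_eq]; exact insert_subset he hXE'⟩
      obtain ⟨K, hK, hKc⟩ := hdep.exists_isCircuit_subset
      exact ⟨K, hK, (isCircuit_disjointSum_iff hd K).1 hKc⟩
    obtain ⟨K₁, hK₁, hc₁⟩ := get e₁ (Or.inl hE₁) d1
    obtain ⟨K₂, hK₂, hc₂⟩ := get e₂ (Or.inr hE₂) d2
    have avoid : ∀ e K, K ⊆ insert e X → e ∉ K → K ⊆ X := by
      intro e K hK he x hx
      rcases hK hx with rfl | h
      · exact absurd hx he
      · exact h
    have fin : ∀ K, K ⊆ X → (M₁.IsCircuit K ∨ M₂.IsCircuit K) →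
        ∃ C ⊆ X, IsTwoSumCircuit M₁ M₂ e₁ e₂ C := by
      intro K hK h
      refine ⟨K, hK, ?_⟩
      rcases h with h | h
      · exact Or.inl ⟨h, fun h' => (hXn _ (hK h')).1 rfl⟩
      · exact Or.inr (Or.inl ⟨h, fun h' => (hXn _ (hK h')).2 rfl⟩)
    by_cases m1 : e₁ ∈ K₁
    swap
    · exact fin K₁ (avoid _ _ hK₁ m1) hc₁
    by_cases m2 : e₂ ∈ K₂
    swap
    · exact fin K₂ (avoid _ _ hK₂ m2) hc₂
    have c1 : M₁.IsCircuit K₁ := hc₁.resolve_right fun h => hn₁ (h.subset_ground m1)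
    have c2 : M₂.IsCircuit K₂ := hc₂.resolve_left fun h => hn₂ (h.subset_ground m2)
    refine ⟨(K₁ ∪ K₂) \ {e₁, e₂}, ?_, Or.inr (Or.inr ⟨K₁, K₂, c1, m1, c2, m2, rfl⟩)⟩
    rintro x ⟨hx | hx, hne⟩
    · exact (hK₁ hx).resolve_left fun h => hne (by simp [h])
    · exact (hK₂ hx).resolve_left fun h => hne (by simp [h])
  -- the prescribed circuits are dependent
  have hB : ∀ C, IsTwoSumCircuit M₁ M₂ e₁ e₂ C → M.Dep C := by
    intro C hC
    have circ : ∀ K Y, (M₁.IsCircuit K ∨ M₂.IsCircuit K) → K ⊆ Y →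
        ¬ (M₁.disjointSum M₂ hd).Indep Y := by
      intro K Y hK hKY hY
      exact ((isCircuit_disjointSum_iff hd K).2 hK).not_indep (hY.subset hKY)
    rcases hC with ⟨hC, hn⟩ | ⟨hC, hn⟩ | ⟨C₁, C₂, c1, m1, c2, m2, rfl⟩
    · refine ⟨fun h => ?_, ?_⟩
      · rcases ((hI C).1 h).2 with h | h
        · exact circ C _ (Or.inl hC) (subset_insert _ _) h
        · exact circ C _ (Or.inl hC) (subset_insert _ _) h
      · rw [hE]
        refine fun x hx => ⟨Or.inl (hC.subset_ground hx), ?_⟩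
        rintro (rfl | rfl)
        · exact hn hx
        · exact hn₂ (hC.subset_ground hx)
    · refine ⟨fun h => ?_, ?_⟩
      · rcases ((hI C).1 h).2 with h | h
        · exact circ C _ (Or.inr hC) (subset_insert _ _) h
        · exact circ C _ (Or.inr hC) (subset_insert _ _) h
      · rw [hE]
        refine fun x hx => ⟨Or.inr (hC.subset_ground hx), ?_⟩
        rintro (rfl | rfl)
        · exact hn₁ (hC.subset_ground hx)
        · exact hn hx
    · refine ⟨fun h => ?_, ?_⟩
      · rcases ((hI _).1 h).2 with h | h
        · refine circ C₁ _ (Or.inl c1) (fun x hx => ?_) h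
          by_cases hx1 : x = e₁
          · exact Or.inl hx1
          · refine Or.inr ⟨Or.inl hx, ?_⟩
            rintro (h' | h')
            · exact hx1 h'
            · exact hn₂ ((show x = e₂ from h') ▸ c1.subset_ground hx)
        · refine circ C₂ _ (Or.inr c2) (fun x hx => ?_) h
          by_cases hx1 : x = e₂
          · exact Or.inl hx1
          · refine Or.inr ⟨Or.inr hx, ?_⟩
            rintro (h' | h')
            · exact hn₁ ((show x = e₁ from h') ▸ c2.subset_ground hx)
            · exact hx1 h'
      · rw [hE]
        exact sdiff_subset_sdiff_left (union_subset_union c1.subset_ground c2.subset_ground)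
  -- no prescribed circuit properly contains another one
  have other : ∀ (N : Matroid α) (e : α), N.IsNonloop e → ∀ K, N.IsCircuit K → e ∈ K →
      ∃ x ∈ K, x ≠ e := by
    intro N e he K hK heK
    by_contra! hcon
    have : K = {e} := by
      ext x
      exact ⟨fun hx => hcon x hx, fun hx => (show x = e from hx) ▸ heK⟩
    exact hK.not_indep (this ▸ he.indep)
  have hC : ∀ C D, IsTwoSumCircuit M₁ M₂ e₁ e₂ C → IsTwoSumCircuit M₁ M₂ e₁ e₂ D → D ⊆ C →
      D = C := by
    have clash : ∀ x, x ∈ M₁.E → x ∈ M₂.E → False := fun x h h' => hd.ne_of_mem h h' rfl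
    have sub1 : ∀ D C₁ C₂ : Set α, D ⊆ M₁.E → C₂ ⊆ M₂.E → D ⊆ (C₁ ∪ C₂) \ {e₁, e₂} → D ⊆ C₁ :=
      fun D C₁ C₂ hD h2 h x hx => (h hx).1.resolve_right fun h' => clash x (hD hx) (h2 h')
    have sub2 : ∀ D C₁ C₂ : Set α, D ⊆ M₂.E → C₁ ⊆ M₁.E → D ⊆ (C₁ ∪ C₂) \ {e₁, e₂} → D ⊆ C₂ :=
      fun D C₁ C₂ hD h2 h x hx => (h hx).1.resolve_left fun h' => clash x (h2 h') (hD hx)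
    rintro C D (⟨hC, hnC⟩ | ⟨hC, hnC⟩ | ⟨C₁, C₂, c1, m1, c2, m2, rfl⟩)
      (⟨hD, hnD⟩ | ⟨hD, hnD⟩ | ⟨D₁, D₂, d1, n1, d2, n2, rfl⟩) hDC
    · exact hD.eq_of_subset_isCircuit hC hDC
    · obtain ⟨x, hx⟩ := hD.nonempty
      exact (clash x (hC.subset_ground (hDC hx)) (hD.subset_ground hx)).elim
    · obtain ⟨x, hx, hne⟩ := other M₂ e₂ h₂ D₂ d2 n2
      have hx2 := d2.subset_ground hx
      have hxD : x ∈ (D₁ ∪ D₂) \ {e₁, e₂} := by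
        refine ⟨Or.inr hx, ?_⟩
        rintro (h | h)
        · exact hn₁ ((show x = e₁ from h) ▸ hx2)
        · exact hne h
      exact (clash x (hC.subset_ground (hDC hxD)) hx2).elim
    · obtain ⟨x, hx⟩ := hD.nonempty
      exact (clash x (hD.subset_ground hx) (hC.subset_ground (hDC hx))).elim
    · exact hD.eq_of_subset_isCircuit hC hDC
    · obtain ⟨x, hx, hne⟩ := other M₁ e₁ h₁ D₁ d1 n1
      have hx2 := d1.subset_ground hx
      have hxD : x ∈ (D₁ ∪ D₂) \ {e₁, e₂} := by
        refine ⟨Or.inl hx, ?_⟩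
        rintro (h | h)
        · exact hne h
        · exact hn₂ ((show x = e₂ from h) ▸ hx2)
      exact (clash x hx2 (hC.subset_ground (hDC hxD))).elim
    · have := hD.eq_of_subset_isCircuit c1 (sub1 D C₁ C₂ hD.subset_ground c2.subset_ground hDC)
      exact absurd (this ▸ m1) hnD
    · have := hD.eq_of_subset_isCircuit c2 (sub2 D C₁ C₂ hD.subset_ground c1.subset_ground hDC)
      exact absurd (this ▸ m2) hnD
    · have s1 : D₁ ⊆ C₁ := by
        intro x hx
        by_cases hx1 : x = e₁
        · rwa [hx1]
        · have hxE := d1.subset_ground hx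
          have : x ∈ (D₁ ∪ D₂) \ {e₁, e₂} := by
            refine ⟨Or.inl hx, ?_⟩
            rintro (h | h)
            · exact hx1 h
            · exact hn₂ ((show x = e₂ from h) ▸ hxE)
          exact (hDC this).1.resolve_right fun h' => clash x hxE (c2.subset_ground h')
      have s2 : D₂ ⊆ C₂ := by
        intro x hx
        by_cases hx1 : x = e₂
        · rwa [hx1]
        · have hxE := d2.subset_ground hx
          have : x ∈ (D₁ ∪ D₂) \ {e₁, e₂} := by
            refine ⟨Or.inr hx, ?_⟩
            rintro (h | h)
            · exact hn₁ ((show x = e₁ from h) ▸ hxE)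
            · exact hx1 h
          exact (hDC this).1.resolve_left fun h' => clash x (c1.subset_ground h') hxE
      rw [d1.eq_of_subset_isCircuit c1 s1, d2.eq_of_subset_isCircuit c2 s2]
  intro C
  constructor
  · intro h
    obtain ⟨D, hDC, hD⟩ := hA C h.dep
    rwa [← h.eq_of_dep_subset (hB D hD) hDC]
  · intro h
    rw [Matroid.isCircuit_iff]
    refine ⟨hB C h, fun D hD hDC => ?_⟩
    obtain ⟨K, hKD, hK⟩ := hA D hD
    exact hDC.antisymm (hC C K h hK (hKD.trans hDC) ▸ hKD)

/-- The 2-sum has the ground set and the circuits that it should have. -/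
theorem isTwoSum_twoSum {M₁ M₂ : Matroid α} [M₁.Finite] [M₂.Finite] (hd : Disjoint M₁.E M₂.E)
    {e₁ e₂ : α} (h₁ : M₁.IsNonloop e₁) (h₂ : M₂.IsNonloop e₂) :
    IsTwoSum M₁ M₂ e₁ e₂ (twoSum M₁ M₂ e₁ e₂) := by
  have h := exists_isTwoSum hd h₁ h₂
  rw [twoSum, dif_pos h]
  exact h.choose_spec

end Matroids

end FrameMatroids

namespace FrameMatroids

universe u v

/-! Everything is translated into rank functions. A frame representation (`FrameRep`) is a rank
function on the elements together with an independent set of joints, such that each element lies on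
a line spanned by two joints and the elements of `L` lie on joints. For loopless matroids this is
the same as a biased graph whose loops at the vertices include `L`: a rank function framed by a
graph has exactly the circuits of the biased graph whose balanced cycles are the dependent ones
(`Framing.circ_of_isFrameCircuit`, `Framing.isFrameCircuit_of_circ`), and conversely each biased
graph without balanced loops has such a rank function (`BiasedGraph.framing`). With `L` empty it is
the definition of a frame matroid.

Sufficiency is gluing. If both basepoints are joints, the two frames are glued at that joint
(`FrameRep.parallel`). If one side is graphic, it lives in a binary vector space, in which the line
formed by the basepoint and the unit vectors of its two ends is modular; it is glued to the line of
the two joints that span the other basepoint (`FrameRep.of_graphicRep`).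

For necessity let the sum be framed, with parts `X` and `Y`, the ground sets without basepoints.
Contracting a maximal subset `A` of `Y` skew to `X` turns any remaining nonloop `f` of `Y` into the
basepoint of the side of `X`, so that side is a minor of the sum and hence frame. What has to be
shown is that the basepoint of `X` can be made a joint or `Y` with its basepoint is graphic
(`FramedSum.rootedRep_or_rootedGraphic`); the theorem follows by applying this to both sides.

If `Y` has a partition into two skew parts, each part is treated after contracting the other, and
two graphic parts are joined in series. Otherwise `Y` forms a connected graph. If it spans one of
its ends, it spans them all, and `f` becomes parallel to a joint when `A` is contracted. If it spans
none, all its cycles are balanced; when it has just two ends in common with `X`, it is graphic, and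
the basepoint joins these two ends. With three common ends, a suitable contraction leaves of `Y`
only a path of two links through three joints (`FramedSum.rootedRep_of_three`). Since the sum is
connected, `X` cannot span exactly two of these joints, and then one of the links can be rolled into
a joint (`IsTriangle.rootedRep`): if a link joins `x` to `y` and `x` lies in a balanced component
after `y` is removed, this component and its edges to `y` have rational coordinates, in which a
change of basis makes the link a joint (`Frame.roll`). -/

/-! ### Integer-valued rank functions -/

/-- The rank function of a matroid of finite rank, described by four axioms on all subsets
of a type. -/
structure RankFn (γ : Type*) where
  /-- the rank of a set -/
  r : Set γ → ℤ
  empty' : r ∅ = 0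
  mono' : ∀ X Y : Set γ, X ⊆ Y → r X ≤ r Y
  unit' : ∀ (x : γ) (X : Set γ), r (insert x X) ≤ r X + 1
  loc' : ∀ X Y : Set γ, (∀ y ∈ Y, r (insert y X) = r X) → r (X ∪ Y) = r X

namespace RankFn

variable {γ δ : Type*}

instance : CoeFun (RankFn γ) fun _ => Set γ → ℤ := ⟨RankFn.r⟩

variable (ρ : RankFn γ) {X Y Z A : Set γ} {x y : γ}

@[simp] theorem empty : ρ ∅ = 0 := ρ.empty'

theorem mono (h : X ⊆ Y) : ρ X ≤ ρ Y := ρ.mono' X Y h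

theorem insert_le (x : γ) (X : Set γ) : ρ (insert x X) ≤ ρ X + 1 := ρ.unit' x X

theorem nonneg (X : Set γ) : 0 ≤ ρ X := by
  simpa using ρ.mono (empty_subset X)

theorem le_insert (x : γ) (X : Set γ) : ρ X ≤ ρ (insert x X) := ρ.mono (subset_insert _ _)

/-- The closure of a set. -/
def cl (X : Set γ) : Set γ := {x | ρ (insert x X) = ρ X}

theorem mem_cl : x ∈ ρ.cl X ↔ ρ (insert x X) = ρ X := Iff.rfl

theorem notMem_cl : x ∉ ρ.cl X ↔ ρ (insert x X) = ρ X + 1 := by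
  rw [mem_cl]
  have h1 := ρ.insert_le x X
  have h2 := ρ.le_insert x X
  constructor
  · intro h; omega
  · intro h; omega

theorem subset_cl (X : Set γ) : X ⊆ ρ.cl X := fun x hx => by
  rw [mem_cl, insert_eq_of_mem hx]

theorem rank_union_of_subset_cl (h : Y ⊆ ρ.cl X) : ρ (X ∪ Y) = ρ X := ρ.loc' X Y h

theorem rank_eq_of_subset_cl (hXY : X ⊆ Y) (h : Y ⊆ ρ.cl X) : ρ Y = ρ X := by
  rw [← ρ.rank_union_of_subset_cl h, union_eq_self_of_subset_left hXY]

theorem rank_le_of_subset_cl (h : Y ⊆ ρ.cl X) : ρ Y ≤ ρ X := by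
  rw [← ρ.rank_union_of_subset_cl h]
  exact ρ.mono subset_union_right

theorem rank_union_le_ncard (X : Set γ) {F : Set γ} (hF : F.Finite) :
    ρ (X ∪ F) ≤ ρ X + F.ncard := by
  induction F, hF using Set.Finite.induction_on with
  | empty => simp
  | @insert a s ha hs ih =>
    rw [union_insert, ncard_insert_of_notMem ha hs]
    have := ρ.insert_le a (X ∪ s)
    push_cast
    linarith

theorem rank_le_ncard {F : Set γ} (hF : F.Finite) : ρ F ≤ F.ncard := by
  simpa using ρ.rank_union_le_ncard ∅ hF

/-- A finite set is independent if its rank is its cardinality. -/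
def Ind (I : Set γ) : Prop := I.Finite ∧ ρ I = I.ncard

variable {ρ}

theorem Ind.subset {I J : Set γ} (hJ : ρ.Ind J) (h : I ⊆ J) : ρ.Ind I := by
  refine ⟨hJ.1.subset h, le_antisymm (ρ.rank_le_ncard (hJ.1.subset h)) ?_⟩
  have h1 := ρ.rank_union_le_ncard I (hJ.1.sdiff (t := I))
  rw [union_sdiff_cancel h, hJ.2] at h1
  have h2 := ncard_sdiff_add_ncard_of_subset h hJ.1
  omega

theorem Ind.insert {I : Set γ} (hI : ρ.Ind I) (h : x ∉ ρ.cl I) : ρ.Ind (insert x I) := by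
  refine ⟨hI.1.insert _, ?_⟩
  rw [ρ.notMem_cl.1 h, hI.2, ncard_insert_of_notMem (fun hx => h (ρ.subset_cl _ hx)) hI.1]
  push_cast
  ring

theorem Ind.exists_extension {I : Set γ} (hI : ρ.Ind I) (h : I ⊆ X) :
    ∃ J, I ⊆ J ∧ J ⊆ X ∧ ρ.Ind J ∧ ρ J = ρ X := by
  obtain ⟨n, hn⟩ : ∃ n : ℕ, ρ X - ρ I = n :=
    ⟨(ρ X - ρ I).toNat, by have := ρ.mono h; omega⟩
  induction n generalizing I with
  | zero => exact ⟨I, subset_rfl, h, hI, by push_cast at hn; linarith⟩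
  | succ n ih =>
    have : ∃ x ∈ X, x ∉ ρ.cl I := by
      by_contra! hcon
      have := ρ.rank_eq_of_subset_cl h hcon
      push_cast at hn
      linarith
    obtain ⟨x, hx, hxI⟩ := this
    obtain ⟨J, h1, h2, h3⟩ := ih (hI.insert hxI) (insert_subset hx h)
      (by rw [ρ.notMem_cl.1 hxI]; push_cast at hn; linarith)
    exact ⟨J, (subset_insert _ _).trans h1, h2, h3⟩

theorem ind_empty : ρ.Ind ∅ := ⟨finite_empty, by simp⟩

variable (ρ)

theorem exists_basis (X : Set γ) : ∃ J, J ⊆ X ∧ ρ.Ind J ∧ ρ J = ρ X := by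
  obtain ⟨J, -, h⟩ := (ind_empty (ρ := ρ)).exists_extension (empty_subset X)
  exact ⟨J, h⟩

/-- Locality rather than submodularity is taken as an axiom because it is easier to check for the
rank functions built from graphs and by gluing. Submodularity follows by extending a basis `I₀` of
the intersection to a basis `I` of `X` and then to a basis `K` of the union: `K \ I` lies in `Y`, so
`I₀ ∪ (K \ I)` is an independent subset of `Y`. -/
theorem submod (X Y : Set γ) : ρ (X ∪ Y) + ρ (X ∩ Y) ≤ ρ X + ρ Y := by
  obtain ⟨I₀, h0, i0, r0⟩ := ρ.exists_basis (X ∩ Y)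
  obtain ⟨I, hI, hIX, iI, rI⟩ := i0.exists_extension (h0.trans inter_subset_left)
  obtain ⟨K, hK, hKX, iK, rK⟩ := iI.exists_extension (hIX.trans (subset_union_left (t := Y)))
  have hsub : I₀ ∪ (K \ I) ⊆ Y := by
    rintro x (hx | ⟨hx, hxI⟩)
    · exact (h0 hx).2
    · rcases hKX hx with h | h
      · exfalso
        have h1 : ρ.Ind (insert x I) := iK.subset (insert_subset hx hK)
        have h2 := ρ.mono (insert_subset h hIX)
        rw [h1.2, ncard_insert_of_notMem hxI iI.1, ← rI, iI.2] at h2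
        push_cast at h2
        linarith
      · exact h
  have hi : ρ.Ind (I₀ ∪ (K \ I)) := iK.subset (union_subset (hI.trans hK) sdiff_subset)
  have h1 := ρ.mono hsub
  have hd : Disjoint I₀ (K \ I) := disjoint_sdiff_right.mono_left hI
  have h2 := ncard_union_eq hd i0.1 iK.1.sdiff
  have h3 := ncard_sdiff_add_ncard_of_subset hK iK.1
  rw [hi.2, h2] at h1
  rw [← r0, ← rI, ← rK, i0.2, iI.2, iK.2]
  push_cast at h1 ⊢
  omega

/-- The form in which submodularity is used: the intersection and the union need only be estimated
from one side. -/
theorem submod_of_subset {W : Set γ} (h1 : Z ⊆ X) (h2 : Z ⊆ Y) (h3 : W ⊆ X ∪ Y) :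
    ρ W + ρ Z ≤ ρ X + ρ Y := by
  have := ρ.submod X Y
  have := ρ.mono h3
  have := ρ.mono (subset_inter h1 h2)
  linarith

theorem union_le (X Y : Set γ) : ρ (X ∪ Y) ≤ ρ X + ρ Y := by
  have := ρ.submod X Y
  have := ρ.nonneg (X ∩ Y)
  linarith

theorem cl_mono (h : X ⊆ Y) : ρ.cl X ⊆ ρ.cl Y := by
  intro x hx
  rw [mem_cl] at hx ⊢
  have h1 := ρ.submod_of_subset (W := insert x Y) (Z := X) (X := insert x X) (Y := Y)
    (subset_insert _ _) h (insert_subset (Or.inl (mem_insert _ _)) subset_union_right)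
  have := ρ.le_insert x Y
  linarith

theorem rank_cl (X : Set γ) : ρ (ρ.cl X) = ρ X := ρ.rank_eq_of_subset_cl (ρ.subset_cl X) subset_rfl

theorem cl_subset_cl (h : Y ⊆ ρ.cl X) : ρ.cl Y ⊆ ρ.cl X := by
  intro x hx
  have h1 : x ∈ ρ.cl (X ∪ Y) := ρ.cl_mono subset_union_right hx
  rw [mem_cl] at h1 ⊢
  have h2 := ρ.rank_union_of_subset_cl h
  have h3 := ρ.mono (insert_subset_insert (a := x) (subset_union_left (s := X) (t := Y)))
  have := ρ.le_insert x X
  linarith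

theorem cl_cl (X : Set γ) : ρ.cl (ρ.cl X) = ρ.cl X :=
  (ρ.cl_subset_cl subset_rfl).antisymm (ρ.subset_cl _)

/-- Two sets with the same rank, one in the closure of the other, have the same closure. -/
theorem subset_cl_of_rank_le (h : X ⊆ Y) (hr : ρ Y ≤ ρ X) : Y ⊆ ρ.cl X := by
  intro y hy
  rw [mem_cl]
  have := ρ.mono (insert_subset hy h)
  have := ρ.le_insert y X
  linarith

theorem exchange (h : y ∈ ρ.cl (insert x X)) (hy : y ∉ ρ.cl X) : x ∈ ρ.cl (insert y X) := by
  rw [mem_cl] at h ⊢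
  rw [notMem_cl] at hy
  rw [insert_comm] at h
  have := ρ.insert_le x X
  have := ρ.le_insert x (insert y X)
  linarith

theorem mem_cl_of_mem (h : x ∈ X) : x ∈ ρ.cl X := ρ.subset_cl _ h

theorem parallel_symm (h : x ∈ ρ.cl {y}) (hx : ρ {x} = 1) :
    y ∈ ρ.cl {x} := by
  have := ρ.exchange (X := ∅) (x := y) (y := x) (by simpa using h) (by
    rw [notMem_cl]
    simpa using hx)
  simpa using this

theorem rank_congr_cl {X' : Set γ} (h1 : X ⊆ ρ.cl X') (h2 : X' ⊆ ρ.cl X) : ρ X = ρ X' :=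
  le_antisymm (ρ.rank_le_of_subset_cl h1) (ρ.rank_le_of_subset_cl h2)

/-- Skewness is inherited by subsets. -/
theorem skew_mono {X' Y' : Set γ} (h : ρ (X ∪ Y) = ρ X + ρ Y) (hX : X' ⊆ ρ.cl X)
    (hY : Y' ⊆ ρ.cl Y) : ρ (X' ∪ Y') = ρ X' + ρ Y' := by
  have h1 := ρ.union_le X' Y'
  have h2 := ρ.submod_of_subset (W := ρ.cl X ∪ Y') (Z := X') (X := ρ.cl X) (Y := X' ∪ Y')
    hX subset_union_left (union_subset_union_right _ subset_union_right)
  have h3 := ρ.submod_of_subset (W := X ∪ Y) (Z := Y') (X := ρ.cl X ∪ Y') (Y := ρ.cl Y)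
    subset_union_right hY (union_subset_union (fun x hx => Or.inl (ρ.subset_cl _ hx))
      (ρ.subset_cl _))
  rw [rank_cl] at h2 h3
  linarith

theorem cl_inter_of_skew (h : ρ (X ∪ Y) = ρ X + ρ Y) (hx : x ∈ ρ.cl X) (hy : x ∈ ρ.cl Y) :
    ρ {x} = 0 := by
  have := ρ.skew_mono h (singleton_subset_iff.2 hx) (singleton_subset_iff.2 hy)
  rw [union_self] at this
  linarith

/-- In a direct sum, closures can be computed in the summand. -/
theorem mem_cl_of_skew (h : ρ (X ∪ Y) = ρ X + ρ Y) {X' Y' : Set γ} (hX' : X' ⊆ ρ.cl X)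
    (hY' : Y' ⊆ ρ.cl Y) (hx : x ∈ ρ.cl X) (hxc : x ∈ ρ.cl (X' ∪ Y')) : x ∈ ρ.cl X' := by
  have h1 := ρ.skew_mono h hX' hY'
  have h2 := ρ.skew_mono h (insert_subset hx hX') hY'
  rw [mem_cl] at hxc ⊢
  rw [insert_union] at h2
  linarith

/-! #### Constructions -/

/-- The pull-back of a rank function along a map. -/
def comap (f : δ → γ) : RankFn δ where
  r X := ρ (f '' X)
  empty' := by simp
  mono' X Y h := ρ.mono (image_mono h)
  unit' x X := by rw [image_insert_eq]; exact ρ.insert_le _ _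
  loc' X Y h := by
    rw [image_union]
    refine ρ.loc' _ _ ?_
    rintro _ ⟨y, hy, rfl⟩
    rw [← image_insert_eq]
    exact h y hy

theorem comap_apply (f : δ → γ) (X : Set δ) : ρ.comap f X = ρ (f '' X) := rfl

theorem mem_cl_comap (f : δ → γ) {X : Set δ} {x : δ} :
    x ∈ (ρ.comap f).cl X ↔ f x ∈ ρ.cl (f '' X) := by
  rw [mem_cl, mem_cl, comap_apply, comap_apply, image_insert_eq]

/-- The rank function of a contraction. -/
def contract (A : Set γ) : RankFn γ where
  r X := ρ (X ∪ A) - ρ A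
  empty' := by simp
  mono' X Y h := sub_le_sub_right (ρ.mono (union_subset_union_left _ h)) _
  unit' x X := by
    have := ρ.insert_le x (X ∪ A)
    rw [insert_union]
    linarith
  loc' X Y h := by
    rw [union_right_comm, ρ.loc' (X ∪ A) Y]
    intro y hy
    have := h y hy
    rw [insert_union] at this
    linarith

theorem contract_apply (A X : Set γ) : ρ.contract A X = ρ (X ∪ A) - ρ A := rfl

theorem mem_cl_contract : x ∈ (ρ.contract A).cl X ↔ x ∈ ρ.cl (X ∪ A) := by
  rw [mem_cl, mem_cl, contract_apply, contract_apply, insert_union]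
  constructor <;> intro h <;> linarith

theorem cl_contract : (ρ.contract A).cl X = ρ.cl (X ∪ A) := by
  ext x
  exact ρ.mem_cl_contract

/-- The rank function of a family of vectors. -/
noncomputable def lin (K : Type*) {W : Type*} [Field K] [AddCommGroup W] [Module K W]
    [FiniteDimensional K W] (f : γ → W) : RankFn γ where
  r X := Module.finrank K (Submodule.span K (f '' X))
  empty' := by simp
  mono' X Y h := by
    exact_mod_cast Submodule.finrank_mono (Submodule.span_mono (image_mono h))
  unit' x X := by
    rw [image_insert_eq, Submodule.span_insert]
    have h1 := Submodule.finrank_add_le_finrank_add_finrank (K ∙ f x) (Submodule.span K (f '' X))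
    have h2 : Module.finrank K (K ∙ f x) ≤ 1 := by
      simpa using finrank_span_le_card (R := K) ({f x} : Set W)
    norm_cast
    omega
  loc' X Y h := by
    congr 1
    have : Submodule.span K (f '' (X ∪ Y)) = Submodule.span K (f '' X) := by
      refine le_antisymm (Submodule.span_le.2 ?_) (Submodule.span_mono (image_mono subset_union_left))
      rintro _ ⟨x, hx | hx, rfl⟩
      · exact Submodule.subset_span (mem_image_of_mem _ hx)
      · have h1 := h x hx
        have h2 : Submodule.span K (f '' X) ≤ Submodule.span K (f '' insert x X) :=
          Submodule.span_mono (image_mono (subset_insert _ _))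
        rw [Submodule.eq_of_le_of_finrank_eq h2 (by exact_mod_cast h1.symm)]
        exact Submodule.subset_span (mem_image_of_mem _ (mem_insert _ _))
    rw [this]

theorem lin_apply (K : Type*) {W : Type*} [Field K] [AddCommGroup W] [Module K W]
    [FiniteDimensional K W] (f : γ → W) (X : Set γ) :
    lin K f X = Module.finrank K (Submodule.span K (f '' X)) := rfl

theorem mem_cl_lin (K : Type*) {W : Type*} [Field K] [AddCommGroup W] [Module K W]
    [FiniteDimensional K W] (f : γ → W) {X : Set γ} {x : γ} :
    x ∈ (lin K f).cl X ↔ f x ∈ Submodule.span K (f '' X) := by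
  rw [mem_cl, lin_apply, lin_apply, image_insert_eq]
  constructor
  · intro h
    have h2 : Submodule.span K (f '' X) ≤ Submodule.span K (insert (f x) (f '' X)) :=
      Submodule.span_mono (subset_insert _ _)
    rw [Submodule.eq_of_le_of_finrank_eq h2 (by exact_mod_cast h.symm)]
    exact Submodule.subset_span (mem_insert _ _)
  · intro h
    rw [Submodule.span_insert_eq_span h]

/-- A circuit: a finite dependent set all of whose proper subsets are independent. -/
def Circ (C : Set γ) : Prop := C.Finite ∧ ρ C < C.ncard ∧ ∀ D, D ⊂ C → ρ.Ind D

theorem exists_circ_subset {X : Set γ} (hX : X.Finite) (h : ρ X < X.ncard) :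
    ∃ C ⊆ X, ρ.Circ C := by
  induction hn : X.ncard using Nat.strong_induction_on generalizing X with
  | _ n ih =>
    by_cases hmin : ∀ D, D ⊂ X → ρ.Ind D
    · exact ⟨X, subset_rfl, hX, h, hmin⟩
    · push Not at hmin
      obtain ⟨D, hD, hDi⟩ := hmin
      have hDf := hX.subset hD.subset
      have hlt : ρ D < D.ncard :=
        lt_of_le_of_ne (ρ.rank_le_ncard hDf) fun h' => hDi ⟨hDf, h'⟩
      obtain ⟨C, hC, hCc⟩ := ih _ (hn ▸ ncard_lt_ncard hD hX) hDf hlt rfl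
      exact ⟨C, hC.trans hD.subset, hCc⟩

theorem Circ.eq_of_subset {C X : Set γ} (hC : ρ.Circ C) (h : X ⊆ C) (hX : ρ X < X.ncard) :
    X = C := by
  by_contra hne
  have := (hC.2.2 X (h.ssubset_of_ne hne)).2
  omega

end RankFn

end FrameMatroids

namespace FrameMatroids

universe u v

/-! ### Paths and cycles -/

section Paths

variable {V : Type v} {α : Type u} {G : Graph V α} {x y z a b c d : V} {W W₁ W₂ U : Set V}
  {P P₁ P₂ C D X K : Set α} {e f : α}

namespace IsPath

theorem left_mem (h : IsPath G x y W P) : x ∈ W := by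
  cases h with
  | nil => rfl
  | cons => exact mem_insert _ _

theorem right_mem (h : IsPath G x y W P) : y ∈ W := by
  induction h with
  | nil => rfl
  | cons _ _ _ ih => exact mem_insert_of_mem _ ih

theorem left_vertex (h : IsPath G x y W P) : x ∈ G.vertexSet := by
  cases h with
  | nil h => exact h
  | cons h => exact h.left_mem

theorem finite (h : IsPath G x y W P) : W.Finite ∧ P.Finite := by
  induction h with
  | nil => simp
  | cons _ _ _ ih => exact ⟨ih.1.insert _, ih.2.insert _⟩

theorem edge (h : IsPath G x y W P) (he : e ∈ P) :
    ∃ a ∈ W, ∃ b ∈ W, G.IsLink e a b ∧ a ≠ b := by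
  induction h with
  | nil => exact absurd he (notMem_empty _)
  | cons hl hP hx ih =>
    rcases he with rfl | he
    · exact ⟨_, mem_insert _ _, _, mem_insert_of_mem _ hP.left_mem, hl,
        fun h => hx (h ▸ hP.left_mem)⟩
    · obtain ⟨a, ha, b, hb, h⟩ := ih he
      exact ⟨a, mem_insert_of_mem _ ha, b, mem_insert_of_mem _ hb, h⟩

theorem edge_mem (h : IsPath G x y W P) (he : e ∈ P) : e ∈ G.edgeSet := by
  obtain ⟨a, -, b, -, h, -⟩ := h.edge he
  exact h.edge_mem

theorem mem_of_inc (h : IsPath G x y W P) (he : e ∈ P) (hv : G.Inc e a) : a ∈ W := by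
  obtain ⟨b, hb, c, hc, hl, -⟩ := h.edge he
  rcases hv.eq_or_eq_of_isLink hl with rfl | rfl <;> assumption

/-- An edge of a path is not an edge all of whose ends are equal. -/
theorem notMem_of_inc (h : IsPath G x y W P) (hv : ∀ a ∈ W, G.Inc e a → a = c) : e ∉ P := by
  intro he
  obtain ⟨a, ha, b, hb, hl, hne⟩ := h.edge he
  exact hne ((hv a ha hl.inc_left).trans (hv b hb hl.inc_right).symm)

/-- An edge of a path has two distinct ends on the path, so it cannot be supported on a single
common vertex. -/
theorem disjoint_of_inter (h : IsPath G x y W P) (hX : ∀ e ∈ X, ∀ a, G.Inc e a → a ∈ U)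
    (hWU : W ∩ U ⊆ {c}) : Disjoint P X := by
  rw [Set.disjoint_left]
  intro e he heX
  exact h.notMem_of_inc (fun a ha hi => hWU ⟨ha, hX e heX a hi⟩) he

theorem ncard (h : IsPath G x y W P) : W.ncard = P.ncard + 1 := by
  induction h with
  | nil => simp
  | cons hl hP hx ih =>
    rw [ncard_insert_of_notMem hx hP.finite.1, ncard_insert_of_notMem _ hP.finite.2, ih]
    exact fun he => hx (hP.mem_of_inc he hl.inc_left)

theorem append (h₁ : IsPath G x y W₁ P₁) (h₂ : IsPath G y z W₂ P₂) (h : W₁ ∩ W₂ = {y}) :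
    IsPath G x z (W₁ ∪ W₂) (P₁ ∪ P₂) := by
  induction h₁ with
  | nil => rwa [singleton_union, insert_eq_of_mem h₂.left_mem, empty_union]
  | @cons a b c W e P hl hP hx ih =>
    have hx2 : a ∉ W₂ := by
      intro hx'
      have : a ∈ ({c} : Set V) := h ▸ ⟨mem_insert _ _, hx'⟩
      exact hx (this ▸ hP.right_mem)
    rw [insert_union, insert_union]
    refine IsPath.cons hl (ih h₂ ?_) (by simp [hx, hx2])
    rw [← h, insert_inter_of_notMem hx2]

theorem of_isLink (h : G.IsLink e x y) (hne : x ≠ y) : IsPath G x y {x, y} {e} := by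
  have := IsPath.cons h (IsPath.nil h.right_mem) hne
  simpa using this

theorem reverse (h : IsPath G x y W P) : IsPath G y x W P := by
  induction h with
  | nil h => exact IsPath.nil h
  | @cons a b c W e P hl hP hx ih =>
    have hne : b ≠ a := fun h => hx (h ▸ hP.left_mem)
    have := ih.append (of_isLink hl.symm hne) (by
      ext v
      simp only [mem_inter_iff, mem_insert_iff, mem_singleton_iff]
      constructor
      · rintro ⟨h1, rfl | rfl⟩
        · rfl
        · exact absurd h1 hx
      · rintro rfl
        exact ⟨hP.left_mem, Or.inl rfl⟩)
    convert this using 1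
    · ext v
      simp only [mem_insert_iff, mem_union, mem_singleton_iff]
      constructor
      · rintro (h | h)
        · exact Or.inr (Or.inr h)
        · exact Or.inl h
      · rintro (h | rfl | h)
        · exact Or.inr h
        · exact Or.inr hP.left_mem
        · exact Or.inl h
    · rw [union_singleton]

theorem join (h₁ : IsPath G x c W₁ P₁) (hf : G.IsLink f c d) (h₂ : IsPath G d y W₂ P₂)
    (h : Disjoint W₁ W₂) : IsPath G x y (W₁ ∪ W₂) (insert f (P₁ ∪ P₂)) := by
  have hc : c ∉ W₂ := fun h' => h.ne_of_mem h₁.right_mem h' rfl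
  have := h₁.append (IsPath.cons hf h₂ hc) (by
    rw [← union_singleton, inter_union_distrib_left, h.inter_eq, empty_union]
    simpa using h₁.right_mem)
  rwa [union_insert, union_insert, insert_eq_of_mem (mem_union_left _ h₁.right_mem)] at this

/-- The first vertex of a path in a set of vertices splits the path. -/
theorem first_hit (h : IsPath G x y W P) (hw : a ∈ W) (hU : a ∈ U) :
    ∃ c W₁ P₁ W₂ P₂, IsPath G x c W₁ P₁ ∧ IsPath G c y W₂ P₂ ∧ W₁ ∩ U = {c} ∧
      W₁ ∩ W₂ = {c} ∧ W₁ ∪ W₂ = W ∧ P₁ ∪ P₂ = P := by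
  induction h with
  | @nil b h =>
    obtain rfl : a = b := hw
    exact ⟨a, {a}, ∅, {a}, ∅, .nil h, .nil h, by simpa using hU, by simp, by simp, by simp⟩
  | @cons a b c W e P hl hP hx ih =>
    by_cases ha : a ∈ U
    · exact ⟨a, {a}, ∅, insert a W, insert e P, .nil hl.left_mem, .cons hl hP hx,
        by simpa using ha, by simp, by simp, by simp⟩
    · obtain ⟨w, W₁, P₁, W₂, P₂, h1, h2, h3, h4, rfl, rfl⟩ := ih (hw.resolve_left fun h => ha (h ▸ hU))
      refine ⟨w, insert a W₁, insert e P₁, W₂, P₂, .cons hl h1 fun h => hx (Or.inl h), h2, ?_, ?_,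
        insert_union, insert_union⟩
      · rw [insert_inter_of_notMem ha, h3]
      · rw [insert_inter_of_notMem fun h => hx (Or.inr h), h4]

theorem split (h : IsPath G x y W P) (hc : c ∈ W) :
    ∃ W₁ P₁ W₂ P₂, IsPath G x c W₁ P₁ ∧ IsPath G c y W₂ P₂ ∧
      W₁ ∩ W₂ = {c} ∧ W₁ ∪ W₂ = W ∧ P₁ ∪ P₂ = P := by
  induction h with
  | @nil a h =>
    obtain rfl : c = a := hc
    exact ⟨{c}, ∅, {c}, ∅, .nil h, .nil h, by simp, by simp, by simp⟩
  | @cons a b w W e P hl hP hx ih =>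
    by_cases ha : c = a
    · subst ha
      exact ⟨{c}, ∅, insert c W, insert e P, .nil hl.left_mem, .cons hl hP hx, by simp, by simp,
        by simp⟩
    · obtain ⟨W₁, P₁, W₂, P₂, h1, h2, h4, rfl, rfl⟩ := ih (hc.resolve_left ha)
      refine ⟨insert a W₁, insert e P₁, W₂, P₂, .cons hl h1 fun h => hx (Or.inl h), h2, ?_,
        insert_union, insert_union⟩
      rw [insert_inter_of_notMem fun h => hx (Or.inr h), h4]

theorem split_edge (h : IsPath G x y W P) (hf : f ∈ P) :
    ∃ c d W₁ P₁ W₂ P₂, IsPath G x c W₁ P₁ ∧ G.IsLink f c d ∧ IsPath G d y W₂ P₂ ∧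
      Disjoint W₁ W₂ ∧ W₁ ∪ W₂ = W ∧ insert f (P₁ ∪ P₂) = P ∧ f ∉ P₁ ∪ P₂ := by
  induction h with
  | nil h => exact absurd hf (notMem_empty _)
  | @cons a b w W e P hl hP hx ih =>
    by_cases hfe : f = e
    · subst hfe
      refine ⟨a, b, {a}, ∅, W, P, .nil hl.left_mem, hl, hP, by simpa using hx, by simp, by simp, ?_⟩
      rw [empty_union]
      exact fun h => hx (hP.mem_of_inc h hl.inc_left)
    · obtain ⟨c, d, W₁, P₁, W₂, P₂, h1, h2, h3, h4, rfl, rfl, h5⟩ := ih (hf.resolve_left hfe)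
      refine ⟨c, d, insert a W₁, insert e P₁, W₂, P₂, .cons hl h1 fun h => hx (Or.inl h), h2, h3,
        ?_, insert_union, ?_, ?_⟩
      · rw [disjoint_insert_left]
        exact ⟨fun h => hx (Or.inr h), h4⟩
      · rw [insert_union, insert_comm]
      · rw [insert_union, mem_insert_iff, not_or]
        exact ⟨hfe, h5⟩

end IsPath

/-! ### Reachability -/

/-- `b` can be reached from `a` along edges in `X`. -/
def Reach (G : Graph V α) (X : Set α) (a b : V) : Prop := ∃ W P, IsPath G a b W P ∧ P ⊆ X

namespace Reach

theorem refl (h : a ∈ G.vertexSet) : Reach G X a a := ⟨_, _, .nil h, empty_subset _⟩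

theorem symm (h : Reach G X a b) : Reach G X b a := by
  obtain ⟨W, P, h, hP⟩ := h
  exact ⟨W, P, h.reverse, hP⟩

theorem mono {X' : Set α} (hX : X ⊆ X') (h : Reach G X a b) : Reach G X' a b := by
  obtain ⟨W, P, h, hP⟩ := h
  exact ⟨W, P, h, hP.trans hX⟩

theorem cons (he : G.IsLink e a b) (heX : e ∈ X) (h : Reach G X b c) : Reach G X a c := by
  obtain ⟨W, P, h, hP⟩ := h
  by_cases ha : a ∈ W
  · obtain ⟨W₁, P₁, W₂, P₂, -, h2, -, -, rfl⟩ := h.split ha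
    exact ⟨W₂, P₂, h2, subset_union_right.trans hP⟩
  · exact ⟨_, _, .cons he h ha, insert_subset heX hP⟩

theorem trans (h : Reach G X a b) (h' : Reach G X b c) : Reach G X a c := by
  obtain ⟨W, P, h, hP⟩ := h
  induction h with
  | nil => exact h'
  | cons hl _ _ ih =>
    exact (ih h' ((subset_insert _ _).trans hP)).cons hl (hP (mem_insert _ _))

theorem of_isLink (he : G.IsLink e a b) (heX : e ∈ X) : Reach G X a b :=
  (refl he.right_mem).cons he heX

/-- A path that leaves a set of vertices uses an edge that leaves the set. -/
theorem exists_leaving (h : Reach G X a b) (ha : a ∈ U) (hb : b ∉ U) :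
    ∃ e ∈ X, ∃ c ∈ U, ∃ d ∉ U, G.IsLink e c d := by
  obtain ⟨W, P, h, hP⟩ := h
  induction h with
  | nil => exact absurd ha hb
  | @cons a b w W e P hl hP' hx ih =>
    by_cases hbU : b ∈ U
    · exact ih hbU hb ((subset_insert _ _).trans hP)
    · exact ⟨e, hP (mem_insert _ _), a, ha, b, hbU, hl⟩

end Reach

/-! ### Cycles -/

namespace IsCycleOn

theorem finite (h : IsCycleOn G W C) : W.Finite ∧ C.Finite := by
  obtain ⟨x, y, P, e, hP, -, -, rfl⟩ := h
  exact ⟨hP.finite.1, hP.finite.2.insert _⟩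

theorem ncard (h : IsCycleOn G W C) : W.ncard = C.ncard := by
  obtain ⟨x, y, P, e, hP, -, he, rfl⟩ := h
  rw [ncard_insert_of_notMem he hP.finite.2, hP.ncard]

theorem mem_of_inc (h : IsCycleOn G W C) (he : e ∈ C) (hv : G.Inc e a) : a ∈ W := by
  obtain ⟨x, y, P, f, hP, hf, -, rfl⟩ := h
  rcases he with rfl | he
  · rcases hv.eq_or_eq_of_isLink hf with rfl | rfl
    · exact hP.left_mem
    · exact hP.right_mem
  · exact hP.mem_of_inc he hv

theorem subset_edgeSet (h : IsCycleOn G W C) : C ⊆ G.edgeSet := by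
  obtain ⟨x, y, P, e, hP, he, -, rfl⟩ := h
  exact insert_subset he.edge_mem fun f hf => hP.edge_mem hf

theorem nonempty (h : IsCycleOn G W C) : C.Nonempty := by
  obtain ⟨x, y, P, e, -, -, -, rfl⟩ := h
  exact insert_nonempty _ _

theorem nonempty_vertices (h : IsCycleOn G W C) : W.Nonempty := by
  obtain ⟨x, y, P, e, hP, -, -, rfl⟩ := h
  exact ⟨x, hP.left_mem⟩

theorem subset_vertexSet (h : IsCycleOn G W C) : W ⊆ G.vertexSet := by
  obtain ⟨x, y, P, e, hP, -, -, rfl⟩ := h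
  intro w hw
  obtain ⟨_, _, _, _, -, h2, -⟩ := hP.split hw
  exact h2.left_vertex

theorem reach (h : IsCycleOn G W C) (ha : a ∈ W) (hb : b ∈ W) : Reach G C a b := by
  obtain ⟨x, y, P, e, hP, -, -, rfl⟩ := h
  have : ∀ a ∈ W, Reach G (insert e P) x a := by
    intro a ha
    obtain ⟨_, _, _, _, h1, -, -, -, rfl⟩ := hP.split ha
    exact ⟨_, _, h1, subset_union_left.trans (subset_insert _ _)⟩
  exact (this a ha).symm.trans (this b hb)

/-- A cycle can be opened at each of its edges. -/
theorem rotate (h : IsCycleOn G W C) (he : e ∈ C) :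
    ∃ x y P, IsPath G x y W P ∧ G.IsLink e x y ∧ e ∉ P ∧ C = insert e P := by
  obtain ⟨x, y, P, f, hP, hf, hfP, rfl⟩ := h
  by_cases hef : e = f
  · subst hef
    exact ⟨x, y, P, hP, hf, hfP, rfl⟩
  · obtain ⟨c, d, W₁, P₁, W₂, P₂, h1, h2, h3, h4, rfl, rfl, h5⟩ :=
      hP.split_edge (he.resolve_left hef)
    refine ⟨d, c, _, union_comm W₂ W₁ ▸ h3.join hf.symm h1 h4.symm, h2.symm, ?_, ?_⟩
    · rw [mem_insert_iff, not_or, union_comm]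
      exact ⟨hef, h5⟩
    · rw [insert_comm, union_comm]

/-- Two vertices divide a cycle into two paths. -/
theorem split (h : IsCycleOn G W C) (ha : a ∈ W) (hb : b ∈ W) (hab : a ≠ b) :
    ∃ W₁ P₁ W₂ P₂, IsPath G a b W₁ P₁ ∧ IsPath G a b W₂ P₂ ∧ W₁ ∩ W₂ = {a, b} ∧
      Disjoint P₁ P₂ ∧ P₁ ∪ P₂ = C ∧ W₁ ∪ W₂ = W := by
  obtain ⟨x, y, P, e, hP, he, heP, rfl⟩ := h
  -- The case in which `b` comes after `a` on the opened cycle. One path is the segment between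
  -- them; the other goes back from `a` to the start, over the closing edge `e`, and back from the
  -- far end to `b`.
  have main : ∀ a b, a ≠ b → ∀ W₁ P₁ W₂ P₂, IsPath G x a W₁ P₁ → IsPath G a y W₂ P₂ →
      W₁ ∩ W₂ = {a} → W₁ ∪ W₂ = W → P₁ ∪ P₂ = P → b ∈ W₂ →
      ∃ W₁ P₁ W₂ P₂, IsPath G a b W₁ P₁ ∧ IsPath G a b W₂ P₂ ∧ W₁ ∩ W₂ = {a, b} ∧
      Disjoint P₁ P₂ ∧ P₁ ∪ P₂ = insert e P ∧ W₁ ∪ W₂ = W := by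
    intro a b hab W₁ P₁ W₂ P₂ h1 h2 h3 h4 h5 hb
    obtain ⟨W₃, P₃, W₄, P₄, h6, h7, h8, rfl, rfl⟩ := h2.split hb
    have haW4 : a ∉ W₄ := fun h => hab (by
      have : a ∈ W₃ ∩ W₄ := ⟨h6.left_mem, h⟩
      rwa [h8] at this)
    have h14 : Disjoint W₁ W₄ := by
      rw [Set.disjoint_left]
      intro v hv1 hv4
      have : v ∈ W₁ ∩ (W₃ ∪ W₄) := ⟨hv1, Or.inr hv4⟩
      rw [h3] at this
      exact haW4 (this ▸ hv4)
    have h13 : W₁ ∩ W₃ ⊆ {a} := fun v hv => by rw [← h3]; exact ⟨hv.1, Or.inl hv.2⟩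
    refine ⟨W₃, P₃, W₁ ∪ W₄, insert e (P₁ ∪ P₄), h6, h1.reverse.join he h7.reverse h14, ?_, ?_,
      ?_, ?_⟩
    · ext v
      constructor
      · rintro ⟨hv3, hv | hv⟩
        · exact Or.inl (h13 ⟨hv, hv3⟩)
        · exact Or.inr (h8 ▸ ⟨hv3, hv⟩)
      · rintro (rfl | rfl)
        · exact ⟨h6.left_mem, Or.inl h1.right_mem⟩
        · exact ⟨h6.right_mem, Or.inr h7.left_mem⟩
    · rw [disjoint_insert_right, disjoint_union_right]
      refine ⟨fun h => heP (h5 ▸ Or.inr (Or.inl h)), ?_, ?_⟩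
      · exact h6.disjoint_of_inter (fun e he v hv => h1.mem_of_inc he hv) (inter_comm _ _ ▸ h13)
      · exact h6.disjoint_of_inter (fun e he v hv => h7.mem_of_inc he hv) h8.subset
    · rw [← h5]
      ext v
      simp only [mem_union, mem_insert_iff]
      tauto
    · rw [← h4]
      ext v
      simp only [mem_union]
      tauto
  obtain ⟨W₁, P₁, W₂, P₂, h1, h2, h3, h4, h5⟩ := hP.split ha
  by_cases hb2 : b ∈ W₂
  · exact main a b hab W₁ P₁ W₂ P₂ h1 h2 h3 h4 h5 hb2
  · have hb1 : b ∈ W₁ := (h4 ▸ hb : b ∈ W₁ ∪ W₂).resolve_right hb2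
    obtain ⟨W₃, P₃, W₄, P₄, h6, h7, h8, rfl, rfl⟩ := h1.split hb1
    obtain ⟨A₁, Q₁, A₂, Q₂, g1, g2, g3, g4, g5, g6⟩ := main b a hab.symm W₃ P₃ (W₄ ∪ W₂) (P₄ ∪ P₂)
      h6 (h7.append h2 (by
        ext v
        constructor
        · rintro ⟨hv4, hv2⟩
          rw [← h3]
          exact ⟨Or.inr hv4, hv2⟩
        · rintro rfl
          exact ⟨h7.right_mem, h2.left_mem⟩)) (by
        ext v
        constructor
        · rintro ⟨hv3, hv4 | hv2⟩
          · rw [← h8]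
            exact ⟨hv3, hv4⟩
          · have : v ∈ (W₃ ∪ W₄) ∩ W₂ := ⟨Or.inl hv3, hv2⟩
            rw [h3] at this
            have hva : v = a := this
            have : v ∈ W₃ ∩ W₄ := ⟨hv3, hva ▸ h7.right_mem⟩
            rw [h8] at this
            exact this
        · rintro rfl
          exact ⟨h6.right_mem, Or.inl h7.left_mem⟩) (by rw [← h4, union_assoc])
      (by rw [← h5, union_assoc]) (Or.inl h7.right_mem)
    exact ⟨A₁, Q₁, A₂, Q₂, g1.reverse, g2.reverse, by rw [g3, pair_comm], g4, g5, g6⟩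

end IsCycleOn

/-- Two internally disjoint paths form a cycle. -/
theorem IsPath.isCycleOn (h₁ : IsPath G a b W₁ P₁) (h₂ : IsPath G a b W₂ P₂) (hab : a ≠ b)
    (hW : W₁ ∩ W₂ = {a, b}) (hP : Disjoint P₁ P₂) : IsCycleOn G (W₁ ∪ W₂) (P₁ ∪ P₂) := by
  cases h₂ with
  | nil => exact absurd rfl hab
  | @cons _ c _ W e P hl hP' hx =>
    refine ⟨c, a, P ∪ P₁, e, ?_, hl.symm, ?_, ?_⟩
    · have : W ∩ W₁ = {b} := by
        ext v
        constructor
        · rintro ⟨h1, h2⟩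
          have : v ∈ W₁ ∩ insert a W := ⟨h2, Or.inr h1⟩
          rw [hW] at this
          exact this.resolve_left fun h => hx (h ▸ h1)
        · rintro rfl
          exact ⟨hP'.right_mem, h₁.right_mem⟩
      have := hP'.append h₁.reverse this
      rwa [union_insert, insert_eq_of_mem (mem_union_left _ h₁.left_mem), union_comm]
    · rintro (h | h)
      · exact hx (hP'.mem_of_inc h hl.inc_left)
      · exact hP.ne_of_mem h (mem_insert _ _) rfl
    · rw [union_insert, union_comm]

/-! ### Growing connected sets of edges -/

/-- The set of ends of the edges in a set. -/
def ends (G : Graph V α) (X : Set α) : Set V := {v | ∃ e ∈ X, G.Inc e v}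

/-- A connected set of edges is grown along edges that leave the set of vertices reached so far.
Each new edge brings exactly one new vertex, so the difference between the numbers of edges and of
vertices stays constant. Starting from a single vertex this gives a spanning tree, starting from a
cycle a spanning unicyclic subgraph. -/
theorem exists_spanning (hX : X.Finite) {U₀ : Set V} (hU₀ : U₀.Finite) (ha : a ∈ U₀)
    (hreach : ∀ v ∈ U₀ ∪ ends G X, Reach G X a v) {K₀ : Set α} (hK₀ : K₀ ⊆ X)
    (hK₀U : ∀ e ∈ K₀, ∀ v, G.Inc e v → v ∈ U₀) (hr : ∀ v ∈ U₀, Reach G K₀ a v) :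
    ∃ K, K₀ ⊆ K ∧ K ⊆ X ∧ (∀ v ∈ U₀ ∪ ends G X, Reach G K a v) ∧
      K.ncard + U₀.ncard = K₀.ncard + (U₀ ∪ ends G X).ncard := by
  have hfin : (U₀ ∪ ends G X).Finite := by
    refine hU₀.union ?_
    have : ends G X = ⋃ e ∈ X, {v | G.Inc e v} := by
      ext v
      simp [ends]
    rw [this]
    refine hX.biUnion fun e he => ?_
    by_cases h : ∃ v, G.Inc e v
    · obtain ⟨v, w, hvw⟩ := h
      exact (toFinite {v, w}).subset fun x hx => hx.eq_or_eq_of_isLink hvw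
    · push Not at h
      simp [h]
  induction hn : ((U₀ ∪ ends G X) \ U₀).ncard generalizing U₀ K₀ with
  | zero =>
    have h0 : (U₀ ∪ ends G X) \ U₀ = ∅ := (ncard_eq_zero hfin.sdiff).1 hn
    have h1 : U₀ ∪ ends G X = U₀ := (sdiff_eq_empty.1 h0).antisymm subset_union_left
    refine ⟨K₀, subset_rfl, hK₀, ?_, ?_⟩
    · rwa [h1]
    · rw [h1]
  | succ n ih =>
    have hne : ((U₀ ∪ ends G X) \ U₀).Nonempty := by
      rw [nonempty_iff_ne_empty]
      intro h
      rw [h, ncard_empty] at hn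
      omega
    obtain ⟨w, hw, hwU⟩ := hne
    obtain ⟨e, heX, c, hc, d, hd, hl⟩ := (hreach w hw).exists_leaving ha hwU
    have hdX : d ∈ ends G X := ⟨e, heX, hl.inc_right⟩
    have hUeq : insert d U₀ ∪ ends G X = U₀ ∪ ends G X := by
      rw [insert_union, insert_eq_of_mem (mem_union_right _ hdX)]
    have heK : e ∉ K₀ := fun h => hd (hK₀U e h d hl.inc_right)
    obtain ⟨K, h1, h2, h3, h4⟩ := ih (U₀ := insert d U₀) (K₀ := insert e K₀) (hU₀.insert _)
      (mem_insert_of_mem _ ha) (by rwa [hUeq]) (insert_subset heX hK₀) (by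
        rintro f (rfl | hf) v hv
        · rcases hv.eq_or_eq_of_isLink hl with rfl | rfl
          · exact mem_insert_of_mem _ hc
          · exact mem_insert _ _
        · exact mem_insert_of_mem _ (hK₀U f hf v hv)) (by
        rintro v (rfl | hv)
        · exact ((hr c hc).mono (subset_insert _ _)).trans
            (Reach.of_isLink hl (mem_insert _ _))
        · exact (hr v hv).mono (subset_insert _ _)) (by rwa [hUeq]) (by
        rw [hUeq]
        have : (U₀ ∪ ends G X) \ insert d U₀ = ((U₀ ∪ ends G X) \ U₀) \ {d} := by
          ext v
          simp only [mem_sdiff, mem_insert_iff, mem_singleton_iff]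
          tauto
        have h1 : d ∈ (U₀ ∪ ends G X) \ U₀ := ⟨Or.inr hdX, hd⟩
        have h2 := ncard_sdiff_singleton_add_one h1 hfin.sdiff
        rw [this]
        omega)
    refine ⟨K, (subset_insert _ _).trans h1, h2, by rwa [hUeq] at h3, ?_⟩
    rw [hUeq, ncard_insert_of_notMem hd hU₀, ncard_insert_of_notMem heK (hX.subset hK₀)] at h4
    omega

/-- A connected graph with at least as many edges as vertices contains a cycle. -/
theorem exists_isCycleOn_subset (hX : X.Finite) (hXE : X ⊆ G.edgeSet) (ha : a ∈ G.vertexSet)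
    (hreach : ∀ v ∈ insert a (ends G X), Reach G X a v)
    (hcard : (insert a (ends G X)).ncard ≤ X.ncard) :
    ∃ W C, IsCycleOn G W C ∧ C ⊆ X := by
  obtain ⟨K, -, hKX, hK, hcK⟩ := exists_spanning (U₀ := {a}) (K₀ := ∅) hX (finite_singleton _) rfl
    (by rwa [singleton_union]) (empty_subset _) (by simp) (by
      rintro v rfl
      exact Reach.refl ha)
  rw [singleton_union] at hcK hK
  have : ∃ g ∈ X, g ∉ K := by
    by_contra! hcon
    have := ncard_le_ncard hcon (hX.subset hKX)
    simp at hcK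
    omega
  obtain ⟨g, hgX, hgK⟩ := this
  obtain ⟨x, y, hg⟩ := Graph.exists_isLink_of_mem_edgeSet (hXE hgX)
  obtain ⟨W, P, hP, hPK⟩ := (hK x (Or.inr ⟨g, hgX, hg.inc_left⟩)).symm.trans
    (hK y (Or.inr ⟨g, hgX, hg.inc_right⟩))
  exact ⟨W, _, ⟨x, y, P, g, hP, hg, fun h => hgK (hPK h), rfl⟩,
    insert_subset hgX (hPK.trans hKX)⟩

/-- A connected graph with a cycle and with more edges than vertices contains a theta or a pair
of handcuffs. -/
theorem exists_theta_or_handcuffs (hX : X.Finite) (hXE : X ⊆ G.edgeSet)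
    (hreach : ∀ v ∈ ends G X, ∀ w ∈ ends G X, Reach G X v w)
    (hcard : (ends G X).ncard < X.ncard) (hD : IsCycleOn G W D) (hDX : D ⊆ X) :
    (∃ P₁ P₂ P₃, IsTheta G P₁ P₂ P₃ ∧ P₁ ∪ P₂ ∪ P₃ ⊆ X) ∨
    (∃ W₁ W₂ C₁ C₂ x, IsCycleOn G W₁ C₁ ∧ IsCycleOn G W₂ C₂ ∧ Disjoint C₁ C₂ ∧ W₁ ∩ W₂ = {x} ∧
      C₁ ∪ C₂ ⊆ X) ∨
    (∃ W₁ W₂ W C₁ C₂ P x y, IsCycleOn G W₁ C₁ ∧ IsCycleOn G W₂ C₂ ∧ Disjoint W₁ W₂ ∧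
      IsPath G x y W P ∧ W ∩ W₁ = {x} ∧ W ∩ W₂ = {y} ∧ C₁ ∪ C₂ ∪ P ⊆ X) := by
  obtain ⟨a, ha⟩ := hD.nonempty_vertices
  have hWX : W ⊆ ends G X := by
    intro w hw
    obtain ⟨x, y, P, e, hP, he, -, rfl⟩ := hD
    obtain ⟨W₁, P₁, W₂, P₂, h1, h2, -, -, rfl⟩ := hP.split hw
    cases h2 with
    | nil => exact ⟨e, hDX (mem_insert _ _), he.inc_right⟩
    | @cons _ _ _ _ f _ hl =>
      exact ⟨f, hDX (Or.inr (Or.inr (mem_insert _ _))), hl.inc_left⟩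
  have hun : W ∪ ends G X = ends G X := union_eq_self_of_subset_left hWX
  obtain ⟨K, hDK, hKX, hK, hcK⟩ := exists_spanning hX hD.finite.1 ha
    (by rw [hun]; exact fun v hv => hreach a (hWX ha) v hv) hDX
    (fun e he v hv => hD.mem_of_inc he hv) (fun v hv => hD.reach ha hv)
  rw [hun] at hcK hK
  -- As a cycle has as many edges as vertices, `K` has exactly as many edges as `X` has ends, which
  -- is fewer than the edges of `X`.
  have : ∃ g ∈ X, g ∉ K := by
    by_contra! hcon
    have := ncard_le_ncard hcon (hX.subset hKX)
    rw [hD.ncard] at hcK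
    omega
  obtain ⟨g, hgX, hgK⟩ := this
  obtain ⟨x, y, hg⟩ := Graph.exists_isLink_of_mem_edgeSet (hXE hgX)
  -- From each end of `g` a path in `K` leads to the cycle `D`; it is cut off at its first vertex on
  -- `D`.
  have tail : ∀ x, x ∈ ends G X → ∃ x' W₁ P₁, IsPath G x x' W₁ P₁ ∧ W₁ ∩ W = {x'} ∧ P₁ ⊆ K := by
    intro x hx
    obtain ⟨A, P, hP, hPK⟩ := (hK x hx).symm
    obtain ⟨c, W₁, P₁, W₂, P₂, h1, -, h3, -, -, rfl⟩ := hP.first_hit hP.right_mem ha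
    exact ⟨c, W₁, P₁, h1, h3, subset_union_left.trans hPK⟩
  obtain ⟨x', W₁, P₁, h1, h1W, h1K⟩ := tail x ⟨g, hgX, hg.inc_left⟩
  obtain ⟨y', W₂, P₂, h2, h2W, h2K⟩ := tail y ⟨g, hgX, hg.inc_right⟩
  have hDends : ∀ e ∈ D, ∀ v, G.Inc e v → v ∈ W := fun e he v hv => hD.mem_of_inc he hv
  have d1 : Disjoint P₁ D := h1.disjoint_of_inter hDends h1W.subset
  have d2 : Disjoint P₂ D := h2.disjoint_of_inter hDends h2W.subset
  have hx' : x' ∈ W := (h1W.symm.subset rfl).2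
  have hy' : y' ∈ W := (h2W.symm.subset rfl).2
  -- If the two tails are disjoint, they form with `g` an ear of `D`, hence a theta. Otherwise `g`
  -- and the tails up to their first meeting point `c` close a second cycle.
  by_cases h12 : Disjoint W₁ W₂
  · left
    have hne : x' ≠ y' := fun h => h12.ne_of_mem h1.right_mem h2.right_mem h
    obtain ⟨A₁, Q₁, A₂, Q₂, q1, q2, hA, hQ, rfl, rfl⟩ := hD.split hx' hy' hne
    have h3 := h1.reverse.join hg h2 h12
    have hint : (W₁ ∪ W₂) ∩ (A₁ ∪ A₂) = {x', y'} := by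
      rw [union_inter_distrib_right, h1W, h2W]
      rfl
    have hi : ∀ A ⊆ A₁ ∪ A₂, x' ∈ A → y' ∈ A → A ∩ (W₁ ∪ W₂) = {x', y'} := by
      intro A hA hx hy
      ext v
      constructor
      · rintro ⟨hv1, hv2⟩
        rw [← hint]
        exact ⟨hv2, hA hv1⟩
      · rintro (rfl | rfl)
        · exact ⟨hx, Or.inl h1.right_mem⟩
        · exact ⟨hy, Or.inr h2.right_mem⟩
    have hd : ∀ Q ⊆ Q₁ ∪ Q₂, Disjoint Q (insert g (P₁ ∪ P₂)) := by
      intro Q hQ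
      rw [disjoint_insert_right, disjoint_union_right]
      exact ⟨fun h => hgK (hDK (hQ h)), (d1.mono_right hQ).symm, (d2.mono_right hQ).symm⟩
    refine ⟨Q₁, Q₂, _, ⟨x', y', A₁, A₂, _, hne, q1, q2, h3, hA,
      hi _ subset_union_left q1.left_mem q1.right_mem,
      hi _ subset_union_right q2.left_mem q2.right_mem, hQ, hd _ subset_union_left,
      hd _ subset_union_right⟩, ?_⟩
    exact union_subset hDX (insert_subset hgX ((union_subset h1K h2K).trans hKX))
  · right
    rw [not_disjoint_iff] at h12
    obtain ⟨w, hw1, hw2⟩ := h12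
    obtain ⟨c, A₁, Q₁, A₂, Q₂, q1, q2, hcW, hA, hAS, hQR⟩ := h1.first_hit hw1 hw2
    have hA₁W₁ : A₁ ⊆ W₁ := subset_union_left.trans hAS.subset
    have hQ₁P₁ : Q₁ ⊆ P₁ := subset_union_left.trans hQR.subset
    have hcW₂ : c ∈ W₂ := (hcW.symm.subset rfl).2
    obtain ⟨B₁, T₁, B₂, T₂, t1, t2, hB, rfl, rfl⟩ := h2.split hcW₂
    have hAB : A₁ ∩ B₁ = {c} := by
      ext v
      constructor
      · rintro ⟨hv1, hv2⟩
        rw [← hcW]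
        exact ⟨hv1, Or.inl hv2⟩
      · rintro rfl
        exact ⟨q1.right_mem, t1.right_mem⟩
    have hcyc : IsCycleOn G (A₁ ∪ B₁) (insert g (Q₁ ∪ T₁)) :=
      ⟨x, y, _, g, q1.append t1.reverse hAB, hg,
        fun h => hgK (union_subset (hQ₁P₁.trans h1K) (subset_union_left.trans h2K) h), rfl⟩
    have hcycX : insert g (Q₁ ∪ T₁) ⊆ X := insert_subset hgX
      ((union_subset (hQ₁P₁.trans h1K) (subset_union_left.trans h2K)).trans hKX)
    have hyc : y' ∈ B₁ → y' = c := fun h => by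
      have : y' ∈ B₁ ∩ B₂ := ⟨h, t2.right_mem⟩
      rwa [hB] at this
    -- If `c` is on `D`, the two cycles meet just there. If not, the rest of the second tail
    -- connects them.
    by_cases hcD : c ∈ W
    · left
      have hcx : c = x' := by
        have : c ∈ W₁ ∩ W := ⟨hA₁W₁ q1.right_mem, hcD⟩
        rwa [h1W] at this
      have hcy : c = y' := by
        have : c ∈ (B₁ ∪ B₂) ∩ W := ⟨hcW₂, hcD⟩
        rwa [h2W] at this
      refine ⟨A₁ ∪ B₁, W, _, D, c, hcyc, hD, ?_, ?_, union_subset hcycX hDX⟩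
      · rw [disjoint_insert_left, disjoint_union_left]
        exact ⟨fun h => hgK (hDK h), d1.mono_left hQ₁P₁, d2.mono_left subset_union_left⟩
      · ext v
        constructor
        · rintro ⟨hv | hv, hvW⟩
          · rw [hcx, ← h1W]
            exact ⟨hA₁W₁ hv, hvW⟩
          · rw [hcy, ← h2W]
            exact ⟨Or.inl hv, hvW⟩
        · rintro rfl
          exact ⟨Or.inl q1.right_mem, hcD⟩
    · right
      have hAW : Disjoint A₁ W := by
        rw [Set.disjoint_left]
        intro v hvA hvW
        obtain rfl : v = x' := by
          have : v ∈ W₁ ∩ W := ⟨hA₁W₁ hvA, hvW⟩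
          rwa [h1W] at this
        have : v ∈ A₁ ∩ A₂ := ⟨hvA, q2.right_mem⟩
        rw [hA] at this
        exact hcD (this ▸ hvW)
      refine ⟨A₁ ∪ B₁, W, B₂, _, D, T₂, c, y', hcyc, hD, ?_, t2, ?_, ?_,
        union_subset (union_subset hcycX hDX) ((subset_union_right.trans h2K).trans hKX)⟩
      · rw [disjoint_union_left]
        refine ⟨hAW, ?_⟩
        rw [Set.disjoint_left]
        intro v hvB hvW
        obtain rfl : v = y' := by
          have : v ∈ (B₁ ∪ B₂) ∩ W := ⟨Or.inl hvB, hvW⟩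
          rwa [h2W] at this
        exact hcD (hyc hvB ▸ hvW)
      · ext v
        constructor
        · rintro ⟨hv2, hv | hv⟩
          · rw [← hcW]
            exact ⟨hv, Or.inr hv2⟩
          · rw [← hB]
            exact ⟨hv, hv2⟩
        · rintro rfl
          exact ⟨t2.left_mem, Or.inl q1.right_mem⟩
      · ext v
        constructor
        · rintro ⟨hv2, hv⟩
          rw [← h2W]
          exact ⟨Or.inr hv2, hv⟩
        · rintro rfl
          exact ⟨t2.right_mem, hy'⟩

end Paths

end FrameMatroids

namespace FrameMatroids

universe u v

/-! ### Rank functions framed by a graph -/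

section Framing

variable {V : Type v} {α : Type u}

/-- The rank function `ρ` on `α ⊕ V` is framed by the graph `G` if the vertices are independent,
each link is on the line spanned by its ends but parallel to neither of them, and each loop
is parallel to its end. -/
structure Framing (ρ : RankFn (α ⊕ V)) (G : Graph V α) : Prop where
  joints : ∀ S ⊆ G.vertexSet, ρ (Sum.inr '' S) = S.ncard
  mem_cl : ∀ {e x y}, G.IsLink e x y → Sum.inl e ∈ ρ.cl {Sum.inr x, Sum.inr y}
  swap : ∀ {e x y}, G.IsLink e x y → Sum.inr y ∈ ρ.cl {Sum.inl e, Sum.inr x}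
  loop : ∀ {e x}, G.IsLink e x x → Sum.inr x ∈ ρ.cl {Sum.inl e}

/-- The restriction of a rank function on `α ⊕ V` to `α`. -/
def RankFn.edge (ρ : RankFn (α ⊕ V)) : RankFn α := ρ.comap Sum.inl

theorem RankFn.edge_apply (ρ : RankFn (α ⊕ V)) (X : Set α) : ρ.edge X = ρ (Sum.inl '' X) := rfl

variable {ρ : RankFn (α ⊕ V)} {G : Graph V α} {x y z a b c d : V} {W W₁ W₂ U : Set V}
  {P P₁ P₂ P₃ C D X K : Set α} {e f : α}

theorem IsCycleOn.reach_sdiff (h : IsCycleOn G W C) (he : e ∈ C) (ha : a ∈ W) (hb : b ∈ W) :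
    Reach G (C \ {e}) a b := by
  obtain ⟨x, y, P, hP, -, heP, rfl⟩ := h.rotate he
  rw [insert_sdiff_self_of_notMem heP]
  have : ∀ a ∈ W, Reach G P x a := by
    intro a ha
    obtain ⟨_, _, _, _, h1, -, -, -, rfl⟩ := hP.split ha
    exact ⟨_, _, h1, subset_union_left⟩
  exact (this a ha).symm.trans (this b hb)

theorem IsPath.reach_sdiff (h : IsPath G x y W P) (he : e ∈ P) (ha : a ∈ W) :
    Reach G (P \ {e}) x a ∨ Reach G (P \ {e}) y a := by
  obtain ⟨c, d, W₁, P₁, W₂, P₂, h1, h2, h3, -, rfl, rfl, hne⟩ := h.split_edge he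
  rw [insert_sdiff_self_of_notMem hne]
  rcases ha with ha | ha
  · obtain ⟨_, _, _, _, h4, -, -, -, rfl⟩ := h1.split ha
    exact Or.inl ⟨_, _, h4, subset_union_left.trans subset_union_left⟩
  · obtain ⟨_, _, _, _, -, h4, -, -, rfl⟩ := h3.split ha
    exact Or.inr ⟨_, _, h4.reverse, subset_union_right.trans subset_union_right⟩

theorem IsPath.reach (h : IsPath G x y W P) (ha : a ∈ W) : Reach G P x a := by
  obtain ⟨_, _, _, _, h4, -, -, -, rfl⟩ := h.split ha
  exact ⟨_, _, h4, subset_union_left⟩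

theorem IsPath.subset_vertexSet (h : IsPath G x y W P) : W ⊆ G.vertexSet := fun _ hv => by
  obtain ⟨_, _, h', -⟩ := (h.reach hv).symm
  exact h'.left_vertex

namespace Framing

theorem subset_cl (hF : Framing ρ G) (hX : X ⊆ G.edgeSet)
    (hU : ∀ e ∈ X, ∀ v, G.Inc e v → v ∈ U) :
    Sum.inl '' X ⊆ ρ.cl (Sum.inr '' U) := by
  rintro _ ⟨e, he, rfl⟩
  obtain ⟨x, y, h⟩ := Graph.exists_isLink_of_mem_edgeSet (hX he)
  refine ρ.cl_mono ?_ (hF.mem_cl h)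
  rintro _ (rfl | rfl)
  · exact mem_image_of_mem _ (hU e he _ h.inc_left)
  · exact mem_image_of_mem _ (hU e he _ h.inc_right)

theorem rank_le (hF : Framing ρ G) (hX : X ⊆ G.edgeSet)
    (hU : ∀ e ∈ X, ∀ v, G.Inc e v → v ∈ U) (hUV : U ⊆ G.vertexSet) : ρ.edge X ≤ U.ncard := by
  rw [← hF.joints U hUV]
  exact ρ.rank_le_of_subset_cl (hF.subset_cl hX hU)

theorem reach (hF : Framing ρ G) (h : Reach G X a b) :
    Sum.inr b ∈ ρ.cl (insert (Sum.inr a) (Sum.inl '' X)) := by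
  obtain ⟨W, P, h, hP⟩ := h
  induction h with
  | nil => exact ρ.mem_cl_of_mem (mem_insert _ _)
  | @cons x y z W e P hl hP' hx ih =>
    refine ρ.cl_subset_cl ?_ (ih ((subset_insert _ _).trans hP))
    refine insert_subset ?_ ((subset_insert _ _).trans (ρ.subset_cl _))
    refine ρ.cl_mono ?_ (hF.swap hl)
    rintro _ (rfl | rfl)
    · exact Or.inr (mem_image_of_mem _ (hP (mem_insert _ _)))
    · exact mem_insert _ _

theorem reach' (hF : Framing ρ G) (h : Reach G X a b) {Z : Set (α ⊕ V)}
    (hX : Sum.inl '' X ⊆ ρ.cl Z) (ha : Sum.inr a ∈ ρ.cl Z) : Sum.inr b ∈ ρ.cl Z :=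
  ρ.cl_subset_cl (insert_subset ha hX) (hF.reach h)

theorem le_rank (hF : Framing ρ G) (hUV : U ⊆ G.vertexSet)
    (h : ∀ v ∈ U, Sum.inr v ∈ ρ.cl (Sum.inl '' X)) : U.ncard ≤ ρ.edge X := by
  rw [← hF.joints U hUV]
  refine ρ.rank_le_of_subset_cl ?_
  rintro _ ⟨v, hv, rfl⟩
  exact h v hv

theorem le_rank_add_one (hF : Framing ρ G) (h : ∀ v ∈ U, Reach G X a v) :
    U.ncard ≤ ρ.edge X + 1 := by
  rw [← hF.joints U fun v hv => by
    obtain ⟨_, _, h', -⟩ := (h v hv).symm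
    exact h'.left_vertex]
  refine le_trans (ρ.rank_le_of_subset_cl (X := insert (Sum.inr a) (Sum.inl '' X)) ?_)
    (ρ.insert_le _ _)
  rintro _ ⟨v, hv, rfl⟩
  exact hF.reach (h v hv)

theorem ind_path (hF : Framing ρ G) (h : IsPath G x y W P) : ρ.edge.Ind P := by
  refine ⟨h.finite.2, le_antisymm (ρ.edge.rank_le_ncard h.finite.2) ?_⟩
  have h1 := hF.le_rank_add_one (U := W) fun v hv => h.reach hv
  rw [h.ncard] at h1
  push_cast at h1
  linarith

theorem ind_of_ssubset (hF : Framing ρ G) (h : IsCycleOn G W C) (hD : D ⊂ C) : ρ.edge.Ind D := by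
  obtain ⟨e, he, heD⟩ := exists_of_ssubset hD
  obtain ⟨x, y, P, hP, -, -, rfl⟩ := h.rotate he
  refine (hF.ind_path hP).subset fun f hf => (hD.subset hf).resolve_left ?_
  rintro rfl
  exact heD hf

theorem circ_of_cycle (hF : Framing ρ G) (h : IsCycleOn G W C) (hd : ρ.edge C < C.ncard) :
    ρ.edge.Circ C :=
  ⟨h.finite.2, hd, fun _ hD => hF.ind_of_ssubset h hD⟩

/-- An independent cycle spans its vertices. -/
theorem mem_cl_of_cycle (hF : Framing ρ G) (h : IsCycleOn G W C) (hd : ¬ ρ.edge C < C.ncard)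
    (ha : a ∈ W) : Sum.inr a ∈ ρ.cl (Sum.inl '' C) := by
  have h1 := hF.subset_cl h.subset_edgeSet fun e he v hv => h.mem_of_inc he hv
  have h2 := ρ.subset_cl_of_rank_le (X := Sum.inl '' C) (Y := Sum.inr '' W ∪ Sum.inl '' C)
    subset_union_right (by
      rw [ρ.rank_union_of_subset_cl h1, hF.joints W h.subset_vertexSet, h.ncard]
      exact not_lt.1 hd)
  exact h2 (Or.inl (mem_image_of_mem _ ha))

/-- Common to handcuffs and thetas. There is one edge more than vertices, so the set is dependent;
after the deletion of an edge the remaining edges still span all the vertices and are as many as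
these, hence independent. -/
theorem circ_of_spanning (hF : Framing ρ G) (hX : X ⊆ G.edgeSet) (hfin : X.Finite)
    (hUV : U ⊆ G.vertexSet) (hU : ∀ e ∈ X, ∀ v, G.Inc e v → v ∈ U) (hcard : X.ncard = U.ncard + 1)
    (h : ∀ e ∈ X, ∀ v ∈ U, Sum.inr v ∈ ρ.cl (Sum.inl '' (X \ {e}))) : ρ.edge.Circ X := by
  refine ⟨hfin, ?_, ?_⟩
  · have := hF.rank_le hX hU hUV
    rw [hcard]
    push_cast
    linarith
  · intro D hD
    obtain ⟨e, he, heD⟩ := exists_of_ssubset hD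
    have h1 := hF.le_rank hUV (h e he)
    have h2 := ncard_sdiff_singleton_add_one he hfin
    have h3 : ρ.edge.Ind (X \ {e}) := by
      refine ⟨hfin.sdiff, le_antisymm (ρ.edge.rank_le_ncard hfin.sdiff) ?_⟩
      omega
    exact h3.subset fun f hf => ⟨hD.subset hf, fun h => heD (h ▸ hf)⟩

/-- When an edge of one cycle is deleted, the other cycle still spans its vertices because it is
independent, and the rest of the broken cycle carries this to its own vertices along a path. The
same argument serves for loose handcuffs and thetas. -/
theorem circ_tight (hF : Framing ρ G) (h₁ : IsCycleOn G W₁ P₁) (h₂ : IsCycleOn G W₂ P₂)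
    (hd : Disjoint P₁ P₂) (hW : W₁ ∩ W₂ = {x}) (hi₁ : ¬ ρ.edge P₁ < P₁.ncard)
    (hi₂ : ¬ ρ.edge P₂ < P₂.ncard) : ρ.edge.Circ (P₁ ∪ P₂) := by
  have key : ∀ {W₁ W₂ : Set V} {P₁ P₂ : Set α}, IsCycleOn G W₁ P₁ → IsCycleOn G W₂ P₂ →
      Disjoint P₁ P₂ → W₁ ∩ W₂ = {x} → ¬ ρ.edge P₂ < P₂.ncard →
      ∀ e ∈ P₁, ∀ v ∈ W₁ ∪ W₂, Sum.inr v ∈ ρ.cl (Sum.inl '' ((P₁ ∪ P₂) \ {e})) := by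
    intro W₁ W₂ P₁ P₂ h₁ h₂ hd hW hi e he
    have hx : x ∈ W₁ ∩ W₂ := hW.symm.subset rfl
    have s2 : P₂ ⊆ (P₁ ∪ P₂) \ {e} := fun f hf =>
      ⟨Or.inr hf, fun h => hd.ne_of_mem he hf (by rw [h])⟩
    have m2 : ∀ v ∈ W₂, Sum.inr v ∈ ρ.cl (Sum.inl '' ((P₁ ∪ P₂) \ {e})) := fun v hv =>
      ρ.cl_mono (image_mono s2) (hF.mem_cl_of_cycle h₂ hi hv)
    rintro v (hv | hv)
    · exact hF.reach' ((h₁.reach_sdiff he hx.1 hv).mono (sdiff_subset_sdiff_left subset_union_left))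
        (ρ.subset_cl _) (m2 x hx.2)
    · exact m2 v hv
  refine hF.circ_of_spanning (U := W₁ ∪ W₂) (union_subset h₁.subset_edgeSet h₂.subset_edgeSet)
    (h₁.finite.2.union h₂.finite.2) (union_subset h₁.subset_vertexSet h₂.subset_vertexSet) ?_ ?_ ?_
  · rintro e (he | he) v hv
    · exact Or.inl (h₁.mem_of_inc he hv)
    · exact Or.inr (h₂.mem_of_inc he hv)
  · rw [ncard_union_eq hd h₁.finite.2 h₂.finite.2, ← h₁.ncard, ← h₂.ncard,
      ← ncard_union_add_ncard_inter _ _ h₁.finite.1 h₂.finite.1, hW, ncard_singleton]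
  · rintro e (he | he)
    · exact key h₁ h₂ hd hW hi₂ e he
    · rw [union_comm P₁, union_comm W₁]
      exact key h₂ h₁ hd.symm (inter_comm W₁ W₂ ▸ hW) hi₁ e he

theorem circ_loose (hF : Framing ρ G) (h₁ : IsCycleOn G W₁ P₁) (h₂ : IsCycleOn G W₂ P₂)
    (hd : Disjoint W₁ W₂) (hP : IsPath G x y W P) (hW₁ : W ∩ W₁ = {x}) (hW₂ : W ∩ W₂ = {y})
    (hi₁ : ¬ ρ.edge P₁ < P₁.ncard) (hi₂ : ¬ ρ.edge P₂ < P₂.ncard) :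
    ρ.edge.Circ (P₁ ∪ P₂ ∪ P) := by
  have dP₁ : Disjoint P P₁ := hP.disjoint_of_inter (fun e he v hv => h₁.mem_of_inc he hv) hW₁.subset
  have dP₂ : Disjoint P P₂ := hP.disjoint_of_inter (fun e he v hv => h₂.mem_of_inc he hv) hW₂.subset
  have d12 : Disjoint P₁ P₂ := by
    rw [Set.disjoint_left]
    intro e he he'
    obtain ⟨u, w, hl⟩ := Graph.exists_isLink_of_mem_edgeSet (h₁.subset_edgeSet he)
    exact hd.ne_of_mem (h₁.mem_of_inc he hl.inc_left) (h₂.mem_of_inc he' hl.inc_left) rfl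
  have key : ∀ {W₁ W₂ : Set V} {P₁ P₂ : Set α} {x y : V}, IsCycleOn G W₁ P₁ → IsCycleOn G W₂ P₂ →
      IsPath G x y W P → W ∩ W₁ = {x} → W ∩ W₂ = {y} → Disjoint P₁ P₂ → Disjoint P P₁ →
      ¬ ρ.edge P₂ < P₂.ncard →
      ∀ e ∈ P₁, ∀ v ∈ W₁ ∪ W₂ ∪ W, Sum.inr v ∈ ρ.cl (Sum.inl '' ((P₁ ∪ P₂ ∪ P) \ {e})) := by
    intro W₁ W₂ P₁ P₂ x y h₁ h₂ hP hW₁ hW₂ d12 dP₁ hi e he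
    have hx : x ∈ W ∩ W₁ := hW₁.symm.subset rfl
    have hy : y ∈ W ∩ W₂ := hW₂.symm.subset rfl
    have s2 : P₂ ⊆ (P₁ ∪ P₂ ∪ P) \ {e} := fun f hf =>
      ⟨Or.inl (Or.inr hf), fun h => d12.ne_of_mem he hf (by rw [h])⟩
    have s3 : P ⊆ (P₁ ∪ P₂ ∪ P) \ {e} := fun f hf =>
      ⟨Or.inr hf, fun h => dP₁.ne_of_mem hf he (by rw [h])⟩
    have m2 : ∀ v ∈ W₂, Sum.inr v ∈ ρ.cl (Sum.inl '' ((P₁ ∪ P₂ ∪ P) \ {e})) := fun v hv =>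
      ρ.cl_mono (image_mono s2) (hF.mem_cl_of_cycle h₂ hi hv)
    have m3 : ∀ v ∈ W, Sum.inr v ∈ ρ.cl (Sum.inl '' ((P₁ ∪ P₂ ∪ P) \ {e})) := fun v hv =>
      hF.reach' ((hP.reverse.reach hv).mono s3) (ρ.subset_cl _) (m2 y hy.2)
    rintro v ((hv | hv) | hv)
    · exact hF.reach' ((h₁.reach_sdiff he hx.2 hv).mono (sdiff_subset_sdiff_left
        (subset_union_left.trans subset_union_left))) (ρ.subset_cl _) (m3 x hx.1)
    · exact m2 v hv
    · exact m3 v hv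
  refine hF.circ_of_spanning (U := W₁ ∪ W₂ ∪ W)
    (union_subset (union_subset h₁.subset_edgeSet h₂.subset_edgeSet) fun e he => hP.edge_mem he)
    ((h₁.finite.2.union h₂.finite.2).union hP.finite.2)
    (union_subset (union_subset h₁.subset_vertexSet h₂.subset_vertexSet) hP.subset_vertexSet)
    ?_ ?_ ?_
  · rintro e ((he | he) | he) v hv
    · exact Or.inl (Or.inl (h₁.mem_of_inc he hv))
    · exact Or.inl (Or.inr (h₂.mem_of_inc he hv))
    · exact Or.inr (hP.mem_of_inc he hv)
  · have c1 := ncard_union_add_ncard_inter (W₁ ∪ W₂) W (h₁.finite.1.union h₂.finite.1) hP.finite.1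
    have c2 : (W₁ ∪ W₂) ∩ W = {x, y} := by
      rw [inter_comm, inter_union_distrib_left, hW₁, hW₂]
      rfl
    have hxy : x ≠ y := hd.ne_of_mem (hW₁.symm.subset rfl).2 (hW₂.symm.subset rfl).2
    have c3 : ({x, y} : Set V).ncard = 2 := ncard_pair hxy
    have c4 := ncard_union_eq hd h₁.finite.1 h₂.finite.1
    have c5 := ncard_union_eq (disjoint_union_left.2 ⟨dP₁.symm, dP₂.symm⟩)
      (h₁.finite.2.union h₂.finite.2) hP.finite.2
    have c6 := ncard_union_eq d12 h₁.finite.2 h₂.finite.2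
    have c7 := hP.ncard
    have c8 := h₁.ncard
    have c9 := h₂.ncard
    rw [c2, c3] at c1
    omega
  · rintro e ((he | he) | he)
    · exact key h₁ h₂ hP hW₁ hW₂ d12 dP₁ hi₂ e he
    · rw [union_comm P₁, union_comm W₁]
      exact key h₂ h₁ hP.reverse hW₂ hW₁ d12.symm dP₂ hi₁ e he
    · have s1 : P₁ ⊆ (P₁ ∪ P₂ ∪ P) \ {e} := fun f hf =>
        ⟨Or.inl (Or.inl hf), fun h => dP₁.ne_of_mem he hf (by rw [h])⟩
      have s2 : P₂ ⊆ (P₁ ∪ P₂ ∪ P) \ {e} := fun f hf =>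
        ⟨Or.inl (Or.inr hf), fun h => dP₂.ne_of_mem he hf (by rw [h])⟩
      have s3 : P \ {e} ⊆ (P₁ ∪ P₂ ∪ P) \ {e} := sdiff_subset_sdiff_left subset_union_right
      have m1 : ∀ v ∈ W₁, Sum.inr v ∈ ρ.cl (Sum.inl '' ((P₁ ∪ P₂ ∪ P) \ {e})) := fun v hv =>
        ρ.cl_mono (image_mono s1) (hF.mem_cl_of_cycle h₁ hi₁ hv)
      have m2 : ∀ v ∈ W₂, Sum.inr v ∈ ρ.cl (Sum.inl '' ((P₁ ∪ P₂ ∪ P) \ {e})) := fun v hv =>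
        ρ.cl_mono (image_mono s2) (hF.mem_cl_of_cycle h₂ hi₂ hv)
      rintro v ((hv | hv) | hv)
      · exact m1 v hv
      · exact m2 v hv
      · rcases hP.reach_sdiff he hv with h | h
        · exact hF.reach' (h.mono s3) (ρ.subset_cl _) (m1 x (hW₁.symm.subset rfl).2)
        · exact hF.reach' (h.mono s3) (ρ.subset_cl _) (m2 y (hW₂.symm.subset rfl).2)

theorem ncard_theta {W₃ : Set V} (hxy : x ≠ y) (h₁ : IsPath G x y W₁ P₁)
    (h₂ : IsPath G x y W₂ P₂) (h₃ : IsPath G x y W₃ P₃) (h12 : W₁ ∩ W₂ = {x, y})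
    (h13 : W₁ ∩ W₃ = {x, y}) (h23 : W₂ ∩ W₃ = {x, y}) (d12 : Disjoint P₁ P₂)
    (d13 : Disjoint P₁ P₃) (d23 : Disjoint P₂ P₃) :
    (P₁ ∪ P₂ ∪ P₃).ncard = (W₁ ∪ W₂ ∪ W₃).ncard + 1 ∧
      (P₁ ∪ P₂ ∪ P₃).ncard = P₁.ncard + P₂.ncard + P₃.ncard := by
  have c1 := ncard_union_add_ncard_inter (W₁ ∪ W₂) W₃ (h₁.finite.1.union h₂.finite.1) h₃.finite.1
  have c2 : (W₁ ∪ W₂) ∩ W₃ = {x, y} := by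
    rw [union_inter_distrib_right, h13, h23, union_self]
  have c3 : ({x, y} : Set V).ncard = 2 := ncard_pair hxy
  have c4 := ncard_union_add_ncard_inter W₁ W₂ h₁.finite.1 h₂.finite.1
  have c5 := ncard_union_eq (disjoint_union_left.2 ⟨d13, d23⟩)
    (h₁.finite.2.union h₂.finite.2) h₃.finite.2
  have c6 := ncard_union_eq d12 h₁.finite.2 h₂.finite.2
  have c7 := h₁.ncard
  have c8 := h₂.ncard
  have c9 := h₃.ncard
  rw [c2, c3] at c1
  rw [h12, c3] at c4
  omega

theorem circ_theta (hF : Framing ρ G) (h : IsTheta G P₁ P₂ P₃)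
    (i12 : ¬ ρ.edge (P₁ ∪ P₂) < (P₁ ∪ P₂).ncard) (i13 : ¬ ρ.edge (P₁ ∪ P₃) < (P₁ ∪ P₃).ncard)
    (i23 : ¬ ρ.edge (P₂ ∪ P₃) < (P₂ ∪ P₃).ncard) : ρ.edge.Circ (P₁ ∪ P₂ ∪ P₃) := by
  obtain ⟨x, y, W₁, W₂, W₃, hxy, h₁, h₂, h₃, h12, h13, h23, d12, d13, d23⟩ := h
  have key : ∀ {W₁ W₂ W₃ : Set V} {P₁ P₂ P₃ : Set α}, IsPath G x y W₁ P₁ → IsPath G x y W₂ P₂ →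
      IsPath G x y W₃ P₃ → W₂ ∩ W₃ = {x, y} → Disjoint P₁ P₂ → Disjoint P₁ P₃ → Disjoint P₂ P₃ →
      ¬ ρ.edge (P₂ ∪ P₃) < (P₂ ∪ P₃).ncard → ∀ X, X = P₁ ∪ P₂ ∪ P₃ →
      ∀ e ∈ P₁, ∀ v, v ∈ W₁ ∨ v ∈ W₂ ∨ v ∈ W₃ → Sum.inr v ∈ ρ.cl (Sum.inl '' (X \ {e})) := by
    rintro W₁ W₂ W₃ P₁ P₂ P₃ h₁ h₂ h₃ h23 d12 d13 d23 hi X rfl e he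
    have s2 : P₂ ∪ P₃ ⊆ (P₁ ∪ P₂ ∪ P₃) \ {e} := by
      rintro f (hf | hf)
      · exact ⟨Or.inl (Or.inr hf), fun h => d12.ne_of_mem he hf (by rw [h])⟩
      · exact ⟨Or.inr hf, fun h => d13.ne_of_mem he hf (by rw [h])⟩
    have s3 : P₁ \ {e} ⊆ (P₁ ∪ P₂ ∪ P₃) \ {e} :=
      sdiff_subset_sdiff_left (subset_union_left.trans subset_union_left)
    have m2 : ∀ v ∈ W₂ ∪ W₃, Sum.inr v ∈ ρ.cl (Sum.inl '' ((P₁ ∪ P₂ ∪ P₃) \ {e})) := fun v hv =>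
      ρ.cl_mono (image_mono s2) (hF.mem_cl_of_cycle (h₂.isCycleOn h₃ hxy h23 d23) hi hv)
    rintro v (hv | hv)
    · rcases h₁.reach_sdiff he hv with h | h
      · exact hF.reach' (h.mono s3) (ρ.subset_cl _) (m2 x (Or.inl h₂.left_mem))
      · exact hF.reach' (h.mono s3) (ρ.subset_cl _) (m2 y (Or.inl h₂.right_mem))
    · exact m2 v hv
  refine hF.circ_of_spanning (U := W₁ ∪ W₂ ∪ W₃) ?_
    ((h₁.finite.2.union h₂.finite.2).union h₃.finite.2)
    (union_subset (union_subset h₁.subset_vertexSet h₂.subset_vertexSet) h₃.subset_vertexSet) ?_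
    (ncard_theta hxy h₁ h₂ h₃ h12 h13 h23 d12 d13 d23).1 ?_
  · rintro e ((he | he) | he)
    · exact h₁.edge_mem he
    · exact h₂.edge_mem he
    · exact h₃.edge_mem he
  · rintro e ((he | he) | he) v hv
    · exact Or.inl (Or.inl (h₁.mem_of_inc he hv))
    · exact Or.inl (Or.inr (h₂.mem_of_inc he hv))
    · exact Or.inr (h₃.mem_of_inc he hv)
  · rintro e ((he | he) | he) v hv
    · exact key h₁ h₂ h₃ h23 d12 d13 d23 i23 _ rfl e he v (by rwa [← or_assoc])
    · exact key h₂ h₁ h₃ h13 d12.symm d23 d13 i13 _ (by rw [union_comm P₁]) e he v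
        (by rcases hv with (h | h) | h <;> simp [h])
    · exact key h₃ h₁ h₂ h12 d13.symm d23.symm d12 i12 _ (by rw [union_assoc P₃, union_comm]) e he v
        (by rcases hv with (h | h) | h <;> simp [h])

/-- If the third cycle were independent, it would span its vertices and hence all vertices of the
theta, so the theta would have rank at least its number of edges minus one. But the two dependent
cycles meet in the independent path `P₂`, so submodularity bounds the rank by the number of edges
minus two. -/
theorem theta_property (hF : Framing ρ G) (h : IsTheta G P₁ P₂ P₃)
    (h12 : ρ.edge (P₁ ∪ P₂) < (P₁ ∪ P₂).ncard) (h23 : ρ.edge (P₂ ∪ P₃) < (P₂ ∪ P₃).ncard) :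
    ρ.edge (P₁ ∪ P₃) < (P₁ ∪ P₃).ncard := by
  obtain ⟨x, y, W₁, W₂, W₃, hxy, h₁, h₂, h₃, w12, w13, w23, d12, d13, d23⟩ := h
  by_contra hcon
  have hc := h₁.isCycleOn h₃ hxy w13 d13
  obtain ⟨c1, c2⟩ := ncard_theta hxy h₁ h₂ h₃ w12 w13 w23 d12 d13 d23
  have s1 : P₁ ∪ P₃ ⊆ P₁ ∪ P₂ ∪ P₃ := union_subset_union_left _ subset_union_left
  have s2 : P₂ ⊆ P₁ ∪ P₂ ∪ P₃ := subset_union_right.trans subset_union_left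
  have m1 : ∀ v ∈ W₁ ∪ W₃, Sum.inr v ∈ ρ.cl (Sum.inl '' (P₁ ∪ P₂ ∪ P₃)) := fun v hv =>
    ρ.cl_mono (image_mono s1) (hF.mem_cl_of_cycle hc hcon hv)
  have h4 := hF.le_rank (U := W₁ ∪ W₂ ∪ W₃) (X := P₁ ∪ P₂ ∪ P₃)
    (union_subset (union_subset h₁.subset_vertexSet h₂.subset_vertexSet) h₃.subset_vertexSet) (by
    rintro v ((hv | hv) | hv)
    · exact m1 v (Or.inl hv)
    · exact hF.reach' ((h₂.reach hv).mono s2) (ρ.subset_cl _) (m1 x (Or.inl h₁.left_mem))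
    · exact m1 v (Or.inr hv))
  have h5 := ρ.edge.submod_of_subset (X := P₁ ∪ P₂) (Y := P₂ ∪ P₃) (Z := P₂) (W := P₁ ∪ P₂ ∪ P₃)
    subset_union_right subset_union_left (by
      intro e he
      rcases he with he | he
      · exact Or.inl he
      · exact Or.inr (Or.inr he))
  have h6 := (hF.ind_path h₂).2
  have c3 := ncard_union_eq d12 h₁.finite.2 h₂.finite.2
  have c4 := ncard_union_eq d23 h₂.finite.2 h₃.finite.2
  omega

/-- The biased graph whose balanced cycles are the dependent ones. -/
def biasedGraph (hF : Framing ρ G) (hV : G.vertexSet.Finite) (hE : G.edgeSet.Finite) :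
    BiasedGraph V α where
  graph := G
  finite_vertexSet := hV
  finite_edgeSet := hE
  balanced := {C | IsCycle G C ∧ ρ.edge C < C.ncard}
  isCycle_of_balanced C hC := hC.1
  theta_property := by
    intro P₁ P₂ P₃ h h12 h23
    refine ⟨?_, hF.theta_property h h12.2 h23.2⟩
    obtain ⟨x, y, W₁, W₂, W₃, hxy, h₁, h₂, h₃, w12, w13, w23, d12, d13, d23⟩ := h
    exact ⟨_, h₁.isCycleOn h₃ hxy w13 d13⟩

theorem circ_of_isFrameCircuit (hF : Framing ρ G) (hV : G.vertexSet.Finite)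
    (hE : G.edgeSet.Finite) (hC : (hF.biasedGraph hV hE).IsFrameCircuit C) :
    ρ.edge.Circ C ∧ C ⊆ G.edgeSet := by
  have hi : ∀ {W D}, (hF.biasedGraph hV hE).IsUnbalancedCycleOn W D → ¬ ρ.edge D < D.ncard :=
    fun h h' => h.2 ⟨⟨_, h.1⟩, h'⟩
  rcases hC with ⟨⟨W, hC⟩, hd⟩ | ⟨W₁, W₂, C₁, C₂, x, h1, h2, h3, h4, rfl⟩ |
    ⟨W₁, W₂, W, C₁, C₂, P, x, y, h1, h2, h3, h4, h5, h6, rfl⟩ |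
    ⟨P₁, P₂, P₃, hth, h1, h2, h3, rfl⟩
  · exact ⟨hF.circ_of_cycle hC hd, hC.subset_edgeSet⟩
  · exact ⟨hF.circ_tight h1.1 h2.1 h3 h4 (hi h1) (hi h2),
      union_subset h1.1.subset_edgeSet h2.1.subset_edgeSet⟩
  · exact ⟨hF.circ_loose h1.1 h2.1 h3 h4 h5 h6 (hi h1) (hi h2),
      union_subset (union_subset h1.1.subset_edgeSet h2.1.subset_edgeSet)
      fun e he => h4.edge_mem he⟩
  · have hth' := hth
    obtain ⟨x, y, W₁, W₂, W₃, hxy, h₁, h₂, h₃, w12, w13, w23, d12, d13, d23⟩ := hth'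
    refine ⟨hF.circ_theta hth (hi ⟨h₁.isCycleOn h₂ hxy w12 d12, h1⟩)
      (hi ⟨h₁.isCycleOn h₃ hxy w13 d13, h2⟩) (hi ⟨h₂.isCycleOn h₃ hxy w23 d23, h3⟩), ?_⟩
    rintro e ((he | he) | he)
    · exact h₁.edge_mem he
    · exact h₂.edge_mem he
    · exact h₃.edge_mem he

theorem skew (hF : Framing ρ G) (hV : G.vertexSet.Finite) {K : Set V} (hK : K ⊆ G.vertexSet) :
    ρ (Sum.inr '' K ∪ Sum.inr '' (G.vertexSet \ K)) =
      ρ (Sum.inr '' K) + ρ (Sum.inr '' (G.vertexSet \ K)) := by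
  rw [← image_union, union_sdiff_cancel hK, hF.joints _ subset_rfl, hF.joints _ hK,
    hF.joints _ sdiff_subset, ← ncard_sdiff_add_ncard_of_subset hK hV]
  push_cast
  ring

/-- The edges in different components are spanned by disjoint sets of joints and are therefore skew,
whereas a circuit is not the union of two skew proper nonempty parts. -/
theorem reach_of_circ (hF : Framing ρ G) (hV : G.vertexSet.Finite) (hCE : C ⊆ G.edgeSet) (hC : ρ.edge.Circ C) :
    ∀ v ∈ ends G C, ∀ w ∈ ends G C, Reach G C v w := by
  intro a ha w hw
  set K : Set V := {v | Reach G C a v} with hK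
  have hKV : K ⊆ G.vertexSet := fun v hv => by
    obtain ⟨_, _, h', -⟩ := hv.symm
    exact h'.left_vertex
  set C₁ : Set α := {e ∈ C | ∀ v, G.Inc e v → v ∈ K} with hC₁
  have hends : ∀ e ∈ C, ∀ u ∈ K, G.Inc e u → e ∈ C₁ := by
    intro e he u hu hinc
    refine ⟨he, fun v hv => ?_⟩
    obtain ⟨u', hl⟩ := hinc
    rcases hv.eq_or_eq_of_isLink hl with rfl | rfl
    · exact hu
    · exact Reach.trans hu (Reach.of_isLink hl he)
  by_cases h1 : C₁ = C
  · obtain ⟨e, he, hew⟩ := hw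
    rw [← h1] at he
    exact he.2 w hew
  · exfalso
    have s1 : C₁ ⊂ C := (sep_subset _ _).ssubset_of_ne h1
    obtain ⟨e, he, hea⟩ := ha
    have he1 : e ∈ C₁ := by
      obtain ⟨u', hl⟩ := hea
      exact hends e he a (Reach.refl hl.left_mem) ⟨u', hl⟩
    have s2 : C \ C₁ ⊂ C := by
      refine sdiff_subset.ssubset_of_ne fun h => ?_
      rw [← h] at he
      exact he.2 he1
    have i1 := hC.2.2 _ s1
    have i2 := hC.2.2 _ s2
    have hsk := ρ.skew_mono (hF.skew hV hKV) (hF.subset_cl (s1.subset.trans hCE) fun e he v hv => he.2 v hv)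
      (hF.subset_cl (U := G.vertexSet \ K) (s2.subset.trans hCE) fun e he v hv =>
        ⟨hv.vertex_mem, fun hvK => he.2 (hends e he.1 v hvK hv)⟩)
    rw [← image_union, union_sdiff_cancel s1.subset, ← RankFn.edge_apply, ← RankFn.edge_apply,
      ← RankFn.edge_apply, i1.2, i2.2] at hsk
    have h3 := ncard_sdiff_add_ncard_of_subset s1.subset hC.1
    have := hC.2.1
    omega

/-- A circuit containing a dependent cycle equals it. In all other cases every cycle inside is
unbalanced, and counting edges against ends produces a theta or handcuffs inside, which are
dependent and so are the whole circuit. -/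
theorem isFrameCircuit_of_circ (hF : Framing ρ G) (hV : G.vertexSet.Finite) (hE : G.edgeSet.Finite) (hCE : C ⊆ G.edgeSet)
    (hC : ρ.edge.Circ C) : (hF.biasedGraph hV hE).IsFrameCircuit C := by
  by_cases hbal : ∃ W D, IsCycleOn G W D ∧ D ⊆ C ∧ ρ.edge D < D.ncard
  · obtain ⟨W, D, hD, hDC, hd⟩ := hbal
    rw [← hC.eq_of_subset _ hDC hd]
    exact Or.inl ⟨⟨W, hD⟩, hd⟩
  push Not at hbal
  have hunb : ∀ {W D}, IsCycleOn G W D → D ⊆ C → ¬ ρ.edge D < D.ncard := fun h1 h2 =>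
    not_lt.2 (hbal _ _ h1 h2)
  have hnb : ∀ {D}, D ⊆ C → D ∉ (hF.biasedGraph hV hE).balanced := by
    rintro D hDC ⟨⟨W, hD⟩, hd⟩
    exact hunb hD hDC hd
  have hreach := hF.reach_of_circ hV hCE hC
  obtain ⟨e, he⟩ : C.Nonempty := by
    rw [nonempty_iff_ne_empty]
    rintro rfl
    have := hC.2.1
    simp at this
  obtain ⟨a, b, hl⟩ := Graph.exists_isLink_of_mem_edgeSet (hCE he)
  have ha : a ∈ ends G C := ⟨e, he, hl.inc_left⟩
  -- Connectedness gives at most rank plus one ends, and the rank is less than the number of edges.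
  -- This is enough for a cycle to exist.
  have hcard : (ends G C).ncard ≤ C.ncard := by
    have := hF.le_rank_add_one (hreach a ha)
    have := hC.2.1
    omega
  obtain ⟨W, D, hD, hDC⟩ := exists_isCycleOn_subset hC.1 hCE hl.left_mem
    (by rw [insert_eq_of_mem ha]; exact hreach a ha) (by rwa [insert_eq_of_mem ha])
  obtain ⟨w, hw⟩ := hD.nonempty_vertices
  have hwC : w ∈ ends G C := by
    obtain ⟨f, hf⟩ := hD.nonempty
    obtain ⟨x, y, P, hP, hl, -, rfl⟩ := hD.rotate hf
    have h1 := hP.reach hw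
    obtain ⟨W₁, P₁, h1, h2⟩ := h1.symm
    cases h1 with
    | nil => exact ⟨f, hDC hf, hl.inc_left⟩
    | @cons _ _ _ _ g _ hg => exact ⟨g, hDC (Or.inr (h2 (mem_insert _ _))), hg.inc_left⟩
  have hwcl := ρ.cl_mono (image_mono hDC) (hF.mem_cl_of_cycle hD (hunb hD hDC) hw)
  -- The cycle found is independent, so one of its vertices, and by connectedness every end of `C`,
  -- is spanned. This improves the count by one.
  have hlt : (ends G C).ncard < C.ncard := by
    have := hF.le_rank (U := ends G C) (X := C) (fun v ⟨_, _, h⟩ => h.vertex_mem) fun v hv =>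
      hF.reach' (hreach w hwC v hv) (ρ.subset_cl _) hwcl
    have := hC.2.1
    omega
  rcases exists_theta_or_handcuffs hC.1 hCE hreach hlt hD hDC with
    ⟨P₁, P₂, P₃, hth, hs⟩ | ⟨W₁, W₂, C₁, C₂, x, h1, h2, h3, h4, hs⟩ |
    ⟨W₁, W₂, W, C₁, C₂, P, x, y, h1, h2, h3, h4, h5, h6, hs⟩
  · have s1 : P₁ ∪ P₂ ⊆ C := subset_union_left.trans hs
    have s2 : P₁ ∪ P₃ ⊆ C := (union_subset_union_left _ subset_union_left).trans hs
    have s3 : P₂ ∪ P₃ ⊆ C := (union_subset_union_left _ subset_union_right).trans hs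
    have hth' := hth
    obtain ⟨x, y, W₁, W₂, W₃, hxy, h₁, h₂, h₃, w12, w13, w23, d12, d13, d23⟩ := hth'
    have hc := hF.circ_theta hth (hunb (h₁.isCycleOn h₂ hxy w12 d12) s1)
      (hunb (h₁.isCycleOn h₃ hxy w13 d13) s2) (hunb (h₂.isCycleOn h₃ hxy w23 d23) s3)
    rw [← hC.eq_of_subset _ hs hc.2.1]
    exact Or.inr (Or.inr (Or.inr ⟨P₁, P₂, P₃, hth, hnb s1, hnb s2, hnb s3, rfl⟩))
  · have s1 : C₁ ⊆ C := subset_union_left.trans hs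
    have s2 : C₂ ⊆ C := subset_union_right.trans hs
    have hc := hF.circ_tight h1 h2 h3 h4 (hunb h1 s1) (hunb h2 s2)
    rw [← hC.eq_of_subset _ hs hc.2.1]
    exact Or.inr (Or.inl ⟨W₁, W₂, C₁, C₂, x, ⟨h1, hnb s1⟩, ⟨h2, hnb s2⟩, h3, h4, rfl⟩)
  · have s1 : C₁ ⊆ C := (subset_union_left.trans subset_union_left).trans hs
    have s2 : C₂ ⊆ C := (subset_union_right.trans subset_union_left).trans hs
    have hc := hF.circ_loose h1 h2 h3 h4 h5 h6 (hunb h1 s1) (hunb h2 s2)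
    rw [← hC.eq_of_subset _ hs hc.2.1]
    exact Or.inr (Or.inr (Or.inl ⟨W₁, W₂, W, C₁, C₂, P, x, y, ⟨h1, hnb s1⟩, ⟨h2, hnb s2⟩, h3, h4,
      h5, h6, rfl⟩))

end Framing

end Framing

end FrameMatroids

namespace FrameMatroids

universe u v

/-! ### Matroids and rank functions -/

namespace RankFn

variable {γ : Type*} {ρ σ : RankFn γ} {X E : Set γ}

theorem ind_iff_forall_not_circ (hX : X.Finite) : ρ.Ind X ↔ ∀ C ⊆ X, ¬ ρ.Circ C := by
  constructor
  · intro h C hC hc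
    have := (h.subset hC).2
    have := hc.2.1
    omega
  · intro h
    refine ⟨hX, le_antisymm (ρ.rank_le_ncard hX) (not_lt.1 fun hlt => ?_)⟩
    obtain ⟨C, hC, hc⟩ := ρ.exists_circ_subset hX hlt
    exact h C hC hc

theorem rank_le_of_forall_ind (h : ∀ I ⊆ X, ρ.Ind I → σ.Ind I) : ρ X ≤ σ X := by
  obtain ⟨J, hJX, hJ, hr⟩ := ρ.exists_basis X
  rw [← hr, hJ.2, ← (h J hJX hJ).2]
  exact σ.mono hJX

/-- Rank functions with the same circuits agree. -/
theorem eq_of_forall_circ (hE : E.Finite) (h : ∀ C ⊆ E, ρ.Circ C ↔ σ.Circ C) (hX : X ⊆ E) :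
    ρ X = σ X := by
  have key : ∀ I ⊆ X, (ρ.Ind I ↔ σ.Ind I) := fun I hI => by
    rw [ind_iff_forall_not_circ (hE.subset (hI.trans hX)),
      ind_iff_forall_not_circ (hE.subset (hI.trans hX))]
    exact forall₂_congr fun C hC => not_congr (h C (hC.trans (hI.trans hX)))
  exact le_antisymm (rank_le_of_forall_ind fun I hI => (key I hI).1)
    (rank_le_of_forall_ind fun I hI => (key I hI).2)

theorem ind_congr (h : ∀ X ⊆ E, ρ X = σ X) (hX : X ⊆ E) : ρ.Ind X ↔ σ.Ind X := by
  rw [Ind, Ind, h X hX]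

theorem circ_congr (h : ∀ X ⊆ E, ρ X = σ X) (hX : X ⊆ E) : ρ.Circ X ↔ σ.Circ X := by
  rw [Circ, Circ, h X hX]
  exact and_congr_right fun _ => and_congr_right fun _ =>
    forall₂_congr fun D hD => ind_congr h (hD.subset.trans hX)

end RankFn

section Matroid

variable {α : Type u}

/-- The rank function of a finite matroid. -/
noncomputable def rankFn (M : Matroid α) [M.Finite] : RankFn α where
  r X := (M.eRk X).toNat
  empty' := by simp
  mono' X Y h := by
    exact_mod_cast ENat.toNat_le_toNat (M.eRk_mono h)
      (Matroid.eRk_ne_top_iff.2 (M.isRkFinite_set Y))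
  unit' x X := by
    have h1 := ENat.natCast_toNat (Matroid.eRk_ne_top_iff.2 (M.isRkFinite_set X))
    have h2 := ENat.natCast_toNat (Matroid.eRk_ne_top_iff.2 (M.isRkFinite_set (insert x X)))
    have h3 := M.eRk_insert_le_add_one x X
    rw [← h1, ← h2] at h3
    exact_mod_cast h3
  loc' X Y h := by
    have h1 : ∀ Z, ((M.eRk Z).toNat : ℕ∞) = M.eRk Z := fun Z =>
      ENat.natCast_toNat (Matroid.eRk_ne_top_iff.2 (M.isRkFinite_set Z))
    have h2 : M.eRk X = M.eRk (X ∪ Y) := by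
      refine Matroid.eRk_eq_of_eRk_insert_le_forall subset_union_left ?_
      rintro y ⟨hy | hy, hn⟩
      · exact absurd hy hn
      · rw [← h1 X, ← h1]
        exact_mod_cast (h y hy).le
    rw [h2]

variable {M : Matroid α} [M.Finite] {X C : Set α} {e : α}

theorem coe_rankFn (M : Matroid α) [M.Finite] (X : Set α) : ((M.eRk X).toNat : ℕ∞) = M.eRk X :=
  ENat.natCast_toNat (Matroid.eRk_ne_top_iff.2 (M.isRkFinite_set X))

theorem rankFn_apply (M : Matroid α) [M.Finite] (X : Set α) :
    rankFn M X = (M.eRk X).toNat := rfl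

theorem rankFn_eq_iff {N : ℕ} : rankFn M X = N ↔ M.eRk X = N := by
  rw [rankFn_apply, ← coe_rankFn M X]
  norm_cast

theorem ind_rankFn : (rankFn M).Ind X ↔ M.Indep X := by
  constructor
  · rintro ⟨h1, h2⟩
    rw [Matroid.indep_iff_eRk_eq_encard, ← h1.cast_ncard_eq]
    exact rankFn_eq_iff.1 h2
  · intro h
    refine ⟨h.finite, rankFn_eq_iff.2 ?_⟩
    rw [h.eRk_eq_encard, h.finite.cast_ncard_eq]

theorem circ_rankFn : (rankFn M).Circ C ∧ C ⊆ M.E ↔ M.IsCircuit C := by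
  rw [Matroid.isCircuit_iff_forall_ssubset]
  constructor
  · rintro ⟨⟨h1, h2, h3⟩, h4⟩
    refine ⟨⟨fun h => ?_, h4⟩, fun D hD => ind_rankFn.1 (h3 D hD)⟩
    have := (ind_rankFn.2 h).2
    omega
  · rintro ⟨h1, h2⟩
    refine ⟨⟨M.ground_finite.subset h1.subset_ground, ?_, fun D hD => ind_rankFn.2 (h2 hD)⟩,
      h1.subset_ground⟩
    refine lt_of_le_of_ne (RankFn.rank_le_ncard _ (M.ground_finite.subset h1.subset_ground)) ?_
    intro h
    exact h1.not_indep (ind_rankFn.1 ⟨M.ground_finite.subset h1.subset_ground, h⟩)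

theorem rankFn_eq {r : RankFn α} (h : ∀ C, M.IsCircuit C ↔ r.Circ C ∧ C ⊆ M.E) (hX : X ⊆ M.E) :
    rankFn M X = r X := by
  refine RankFn.eq_of_forall_circ M.ground_finite (fun C hC => ?_) hX
  have := h C
  rw [← circ_rankFn] at this
  tauto

theorem isCircuit_iff_of_rankFn_eq {r : RankFn α} (h : ∀ X ⊆ M.E, rankFn M X = r X) :
    M.IsCircuit C ↔ r.Circ C ∧ C ⊆ M.E := by
  rw [← circ_rankFn]
  exact and_congr_left fun hC => RankFn.circ_congr h hC

/-- The matroid with a given rank function on a finite ground set. -/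
def RankFn.matroid {γ : Type*} (ρ : RankFn γ) {E : Set γ} (hE : E.Finite) : Matroid γ :=
  (IndepMatroid.ofFinite hE (fun I => ρ.Ind I ∧ I ⊆ E) ⟨ρ.ind_empty, empty_subset _⟩
    (fun _ _ hJ hIJ => ⟨hJ.1.subset hIJ, hIJ.trans hJ.2⟩)
    (by
      rintro I J ⟨hI, hIE⟩ ⟨hJ, hJE⟩ hlt
      by_contra! hcon
      have hcl : J ⊆ ρ.cl I := fun x hx => by
        by_contra hxI
        exact hcon x hx (fun h => hxI (ρ.subset_cl _ h)) (hI.insert hxI)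
          (insert_subset (hJE hx) hIE)
      have := ρ.rank_le_of_subset_cl hcl
      rw [hI.2, hJ.2] at this
      omega)
    (fun _ hI => hI.2)).matroid

theorem RankFn.matroid_indep {γ : Type*} (ρ : RankFn γ) {E I : Set γ} (hE : E.Finite) :
    (ρ.matroid hE).Indep I ↔ ρ.Ind I ∧ I ⊆ E := Iff.rfl

theorem RankFn.matroid_E {γ : Type*} (ρ : RankFn γ) {E : Set γ} (hE : E.Finite) :
    (ρ.matroid hE).E = E := rfl

instance {γ : Type*} (ρ : RankFn γ) {E : Set γ} (hE : E.Finite) : (ρ.matroid hE).Finite := ⟨hE⟩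

theorem RankFn.rankFn_matroid {γ : Type*} (ρ : RankFn γ) {E X : Set γ} (hE : E.Finite)
    (hX : X ⊆ E) : rankFn (ρ.matroid hE) X = ρ X := by
  have : ∀ I ⊆ X, ((rankFn (ρ.matroid hE)).Ind I ↔ ρ.Ind I) := fun I hI => by
    rw [ind_rankFn, matroid_indep]
    exact and_iff_left (hI.trans hX)
  exact le_antisymm (RankFn.rank_le_of_forall_ind fun I hI => (this I hI).1)
    (RankFn.rank_le_of_forall_ind fun I hI => (this I hI).2)

end Matroid

/-! ### Frame representations -/

section FrameRep

variable {α : Type u}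

/-- The matroid on `E` with rank function `r` has an extension in which every element is spanned
by two elements of an independent set of joints; the elements of `L` are parallel to joints. -/
def FrameRep (E : Set α) (r : RankFn α) (L : Set α) : Prop :=
  ∃ (V : Type u) (_ : Finite V) (ρ : RankFn (α ⊕ V)), (∀ S : Set V, ρ (Sum.inr '' S) = S.ncard) ∧
    (∀ X ⊆ E, r X = ρ (Sum.inl '' X)) ∧
    (∀ e ∈ E, ∃ v w, Sum.inl e ∈ ρ.cl {Sum.inr v, Sum.inr w}) ∧
    ∀ e ∈ L, ∃ v, Sum.inl e ∈ ρ.cl {Sum.inr v}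

variable {E E' L L' : Set α} {r r' : RankFn α}

/-- Elements and joints may be placed in any rank function that is at hand; pulling it back along
`Sum.elim ι j` gives one of the required shape. -/
theorem FrameRep.of {γ : Type*} {V : Type u} [Finite V] {ρ : RankFn γ} {ι : α → γ} {j : V → γ}
    (hj : ∀ S : Set V, ρ (j '' S) = S.ncard) (hr : ∀ X ⊆ E, r X = ρ (ι '' X))
    (hE : ∀ e ∈ E, ∃ v w, ι e ∈ ρ.cl {j v, j w}) (hL : ∀ e ∈ L, ∃ v, ι e ∈ ρ.cl {j v}) :
    FrameRep E r L := by
  refine ⟨V, inferInstance, ρ.comap (Sum.elim ι j), fun S => ?_, fun X hX => ?_, fun e he => ?_,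
    fun e he => ?_⟩
  · rw [RankFn.comap_apply, image_image]
    exact hj S
  · rw [RankFn.comap_apply, image_image]
    exact hr X hX
  · obtain ⟨v, w, h⟩ := hE e he
    refine ⟨v, w, (ρ.mem_cl_comap _).2 ?_⟩
    rwa [image_pair]
  · obtain ⟨v, h⟩ := hL e he
    refine ⟨v, (ρ.mem_cl_comap _).2 ?_⟩
    rwa [image_singleton]

theorem FrameRep.congr (h : FrameRep E r L) (hE : E' ⊆ E) (hr : ∀ X ⊆ E', r' X = r X)
    (hL : L' ⊆ L) : FrameRep E' r' L' := by
  obtain ⟨V, hV, ρ, h1, h2, h3, h4⟩ := h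
  exact ⟨V, hV, ρ, h1, fun X hX => (hr X hX).trans (h2 X (hX.trans hE)), fun e he => h3 e (hE he),
    fun e he => h4 e (hL he)⟩

/-- The joints in `J` are independent, and every element of `E` is a nonloop spanned by at most two
joints in `J`. -/
structure Frame {V : Type v} (ρ : RankFn (α ⊕ V)) (J : Set V) (E : Set α) : Prop where
  finite : J.Finite
  joints : ∀ S ⊆ J, ρ (Sum.inr '' S) = S.ncard
  line : ∀ e ∈ E, ∃ v ∈ J, ∃ w ∈ J, Sum.inl e ∈ ρ.cl {Sum.inr v, Sum.inr w}
  nonloop : ∀ e ∈ E, ρ {Sum.inl e} = 1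

namespace Frame

variable {V : Type v} {ρ : RankFn (α ⊕ V)} {J S T : Set V} {x y v w : V} {e f : α}

theorem subset (h : Frame ρ J E) (hE : E' ⊆ E) : Frame ρ J E' :=
  ⟨h.finite, h.joints, fun e he => h.line e (hE he), fun e he => h.nonloop e (hE he)⟩

theorem joint_nonloop (h : Frame ρ J E) (hv : v ∈ J) : ρ {Sum.inr v} = 1 := by
  simpa using h.joints {v} (by simpa using hv)

theorem mem_of_mem_cl (h : Frame ρ J E) (hS : S ⊆ J) (hv : v ∈ J)
    (hvS : Sum.inr v ∈ ρ.cl (Sum.inr '' S)) : v ∈ S := by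
  by_contra hn
  rw [ρ.mem_cl, ← image_insert_eq, h.joints _ (insert_subset hv hS), h.joints _ hS,
    ncard_insert_of_notMem hn (h.finite.subset hS)] at hvS
  push_cast at hvS
  linarith

theorem skew (h : Frame ρ J E) (hS : S ⊆ J) (hT : T ⊆ J) (hST : Disjoint S T) :
    ρ (Sum.inr '' S ∪ Sum.inr '' T) = ρ (Sum.inr '' S) + ρ (Sum.inr '' T) := by
  rw [← image_union, h.joints _ (union_subset hS hT), h.joints _ hS, h.joints _ hT,
    ncard_union_eq hST (h.finite.subset hS) (h.finite.subset hT)]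
  push_cast
  ring

theorem swap_of_nonloop (h1 : ρ {Sum.inl e} = 1) (he : Sum.inl e ∈ ρ.cl {Sum.inr v}) :
    Sum.inr v ∈ ρ.cl {Sum.inl e} := ρ.parallel_symm he h1

/-- An element is parallel to at most one joint. -/
theorem eq_of_parallel (h : Frame ρ J E) (hv : v ∈ J) (hw : w ∈ J) (h1 : ρ {Sum.inl e} = 1)
    (hev : Sum.inl e ∈ ρ.cl {Sum.inr v}) (hew : Sum.inl e ∈ ρ.cl {Sum.inr w}) : v = w := by
  have h2 := h.mem_of_mem_cl (S := {w}) (by simpa using hw) hv (by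
    rw [image_singleton]
    exact ρ.cl_subset_cl (singleton_subset_iff.2 hew) (swap_of_nonloop h1 hev))
  exact h2

/-- A frame is framed by a graph on the joints. -/
theorem exists_graph (h : Frame ρ J E) :
    ∃ G : Graph V α, G.vertexSet = J ∧ G.edgeSet = E ∧ Framing ρ G ∧
      ∀ e ∈ E, ∀ v ∈ J, Sum.inl e ∈ ρ.cl {Sum.inr v} → G.IsLink e v v := by
  classical
  -- An element parallel to a joint has to become a loop there: as a link from this joint to another
  -- one, it would not span the second end together with the first.
  have key : ∀ e : α, e ∈ E → ∃ v ∈ J, ∃ w ∈ J, Sum.inl e ∈ ρ.cl {Sum.inr v, Sum.inr w} ∧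
      ((∃ u ∈ J, Sum.inl e ∈ ρ.cl {Sum.inr u}) → v = w) := by
    intro e he
    by_cases h' : ∃ u ∈ J, Sum.inl e ∈ ρ.cl {Sum.inr u}
    · obtain ⟨u, huJ, hu⟩ := h'
      exact ⟨u, huJ, u, huJ, by simpa using hu, fun _ => rfl⟩
    · obtain ⟨v, hv, w, hw, hvw⟩ := h.line e he
      exact ⟨v, hv, w, hw, hvw, fun h'' => absurd h'' h'⟩
  have key' : ∃ p q : E → V, ∀ e : E, p e ∈ J ∧ q e ∈ J ∧
      Sum.inl e.1 ∈ ρ.cl {Sum.inr (p e), Sum.inr (q e)} ∧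
      ((∃ u ∈ J, Sum.inl e.1 ∈ ρ.cl {Sum.inr u}) → p e = q e) := by
    choose p hp q hq h using key
    exact ⟨fun e => p e.1 e.2, fun e => q e.1 e.2,
      fun e => ⟨hp e.1 e.2, hq e.1 e.2, h e.1 e.2⟩⟩
  obtain ⟨p, q, hpq⟩ := key'
  let G : Graph V α :=
    { vertexSet := J
      IsLink := fun e x y => ∃ h : e ∈ E, (p ⟨e, h⟩ = x ∧ q ⟨e, h⟩ = y) ∨
        (p ⟨e, h⟩ = y ∧ q ⟨e, h⟩ = x)
      isLink_symm := fun e he => ⟨fun x y ⟨h, h'⟩ => ⟨h, h'.symm⟩⟩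
      eq_or_eq_of_isLink_of_isLink := by
        rintro e x y v w ⟨h, ⟨rfl, rfl⟩ | ⟨rfl, rfl⟩⟩ ⟨-, ⟨rfl, rfl⟩ | ⟨rfl, rfl⟩⟩ <;> simp
      left_mem_of_isLink := by
        rintro e x y ⟨h, ⟨rfl, rfl⟩ | ⟨rfl, rfl⟩⟩
        · exact (hpq ⟨e, h⟩).1
        · exact (hpq ⟨e, h⟩).2.1 }
  have hmem : ∀ {e x y}, G.IsLink e x y → Sum.inl e ∈ ρ.cl {Sum.inr x, Sum.inr y} := by
    rintro e x y ⟨h, ⟨rfl, rfl⟩ | ⟨rfl, rfl⟩⟩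
    · exact (hpq ⟨e, h⟩).2.2.1
    · rw [pair_comm]
      exact (hpq ⟨e, h⟩).2.2.1
  have hloop : ∀ {e x y}, G.IsLink e x y → (∃ u ∈ J, Sum.inl e ∈ ρ.cl {Sum.inr u}) → x = y := by
    rintro e x y ⟨h, ⟨rfl, rfl⟩ | ⟨rfl, rfl⟩⟩ hu
    · exact (hpq ⟨e, h⟩).2.2.2 hu
    · exact ((hpq ⟨e, h⟩).2.2.2 hu).symm
  have hedge : G.edgeSet = E := by
    ext e
    exact ⟨fun ⟨x, y, h, _⟩ => h, fun h => ⟨_, _, h, Or.inl ⟨rfl, rfl⟩⟩⟩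
  refine ⟨G, rfl, hedge, ⟨h.joints, hmem, ?_, ?_⟩, ?_⟩
  · intro e x y hl
    by_cases hx : Sum.inl e ∈ ρ.cl {Sum.inr x}
    · have := hloop hl ⟨x, hl.left_mem, hx⟩
      subst this
      exact ρ.mem_cl_of_mem (by simp)
    · refine ρ.exchange ?_ hx
      rw [pair_comm]
      exact hmem hl
  · intro e x hl
    refine swap_of_nonloop (h.nonloop e hl.1) ?_
    simpa using hmem hl
  · intro e he v hv hev
    have hl : G.IsLink e (p ⟨e, he⟩) (q ⟨e, he⟩) := ⟨he, Or.inl ⟨rfl, rfl⟩⟩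
    have heq := hloop hl ⟨v, hv, hev⟩
    rw [← heq] at hl
    rw [h.eq_of_parallel hv hl.left_mem (h.nonloop e he) hev (by simpa using hmem hl)]
    exact hl

end Frame

variable {M : Matroid α} [M.Finite]

theorem rankFn_singleton [M.Loopless] {e : α} (he : e ∈ M.E) : rankFn M {e} = 1 := by
  have : rankFn M {e} = (1 : ℕ) := rankFn_eq_iff.2 (by simpa using M.eRk_singleton_eq he)
  exact_mod_cast this

theorem FrameRep.isFrameMatroidal [M.Loopless] (hL : L ⊆ M.E) (h : FrameRep M.E (rankFn M) L) :
    IsFrameMatroidal M L := by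
  obtain ⟨V, hV, ρ, hj, hr, hE, hLj⟩ := h
  have h1 : ∀ e ∈ M.E, ρ {Sum.inl e} = 1 := fun e he => by
    rw [← image_singleton, ← hr {e} (by simpa using he), rankFn_singleton he]
  obtain ⟨G, -, hGE, hF, hloop⟩ := (Frame.mk (J := univ) finite_univ (fun S _ => hj S)
    (fun e he => (hE e he).imp fun v ⟨w, h⟩ => ⟨mem_univ _, w, mem_univ _, h⟩) h1).exists_graph
  have hfin : G.edgeSet.Finite := hGE ▸ M.ground_finite
  refine ⟨V, hF.biasedGraph (toFinite _) hfin, ⟨hGE, fun C => ?_⟩, fun e he => ?_⟩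
  · rw [isCircuit_iff_of_rankFn_eq (r := ρ.edge) fun X hX => hr X hX]
    constructor
    · rintro ⟨h1, h2⟩
      exact hF.isFrameCircuit_of_circ (toFinite _) hfin (hGE ▸ h2) h1
    · intro h
      rw [← hGE]
      exact hF.circ_of_isFrameCircuit _ _ h
  · obtain ⟨v, hv⟩ := hLj e he
    refine ⟨⟨v, hloop e (hL he) v (mem_univ _) hv⟩, fun h => ?_⟩
    have := h.2
    rw [RankFn.edge_apply, image_singleton, h1 e (hL he)] at this
    simp at this

theorem FrameRep.isFrame (h : FrameRep M.E (rankFn M) ∅) : IsFrame M := by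
  obtain ⟨V, hV, ρ, hj, hr, hE, -⟩ := h
  have hfin : (Sum.inl '' M.E ∪ range Sum.inr : Set (α ⊕ V)).Finite :=
    (M.ground_finite.image _).union (finite_range _)
  have hind : ρ.Ind (range Sum.inr) := by
    refine ⟨finite_range _, ?_⟩
    rw [← image_univ, hj, ncard_image_of_injective _ Sum.inr_injective]
  have hcl : ∀ e, e ∈ (ρ.matroid hfin).E → ∀ X ⊆ (ρ.matroid hfin).E, e ∈ ρ.cl X →
      e ∈ (ρ.matroid hfin).closure X := by
    intro e he X hX h
    by_contra hn
    have h1 := (ρ.matroid hfin).eRk_insert_eq_add_one ⟨he, hn⟩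
    have h2 := ρ.rankFn_matroid hfin hX
    have h3 := ρ.rankFn_matroid hfin (insert_subset he hX)
    rw [ρ.mem_cl.1 h, ← h2, rankFn_apply] at h3
    have h4 := rankFn_eq_iff.1 h3
    rw [h1, coe_rankFn] at h4
    exact absurd h4 (by
      rw [← coe_rankFn]
      norm_cast
      omega)
  refine ⟨V, ρ.matroid hfin, range Sum.inr, inferInstance, ?_, ?_, ?_⟩
  · refine Matroid.ext_indep ?_ ?_
    · ext e
      simp [RankFn.matroid_E]
    · intro I hI
      have hIE : I ⊆ M.E := by
        intro e he
        have := hI he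
        simpa [RankFn.matroid_E] using this
      rw [Matroid.comap_indep_iff, RankFn.matroid_indep, ← ind_rankFn, RankFn.Ind, RankFn.Ind,
        hr I hIE, ncard_image_of_injective _ Sum.inl_injective]
      constructor
      · rintro ⟨⟨⟨h1, h2⟩, -⟩, -⟩
        exact ⟨M.ground_finite.subset hIE, h2⟩
      · rintro ⟨h1, h2⟩
        exact ⟨⟨⟨h1.image _, h2⟩, (image_mono hIE).trans subset_union_left⟩,
          Sum.inl_injective.injOn⟩
  · refine Matroid.Indep.isBase_of_ground_subset_closure
      (((ρ.matroid_indep hfin).2 ⟨hind, subset_union_right⟩)) ?_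
    intro e he
    refine hcl e he _ subset_union_right ?_
    rcases he with ⟨e, he, rfl⟩ | he
    · obtain ⟨v, w, h⟩ := hE e he
      refine ρ.cl_mono ?_ h
      rintro _ (rfl | rfl) <;> simp
    · exact ρ.subset_cl _ he
  · intro e he
    rcases id he with ⟨e, he', rfl⟩ | ⟨v, rfl⟩
    · obtain ⟨v, w, h⟩ := hE e he'
      refine ⟨_, ⟨v, rfl⟩, _, ⟨w, rfl⟩, hcl _ he _ ?_ h⟩
      rintro _ (rfl | rfl) <;> exact Or.inr ⟨_, rfl⟩
    · refine ⟨_, ⟨v, rfl⟩, _, ⟨v, rfl⟩, hcl _ he _ ?_ (ρ.subset_cl _ (by simp))⟩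
      rintro _ (rfl | rfl) <;> exact Or.inr ⟨_, rfl⟩

theorem IsFrame.frameRep (h : IsFrame M) : FrameRep M.E (rankFn M) ∅ := by
  obtain ⟨β, N, B, hN, hNM, hB, hE⟩ := h
  have hj : ∀ I : Set (α ⊕ β), N.Indep I → rankFn N I = I.ncard := fun I hI =>
    (ind_rankFn.2 hI).2
  have hcl : ∀ e X, e ∈ N.closure X → e ∈ (rankFn N).cl X := by
    intro e X h
    rw [RankFn.mem_cl, rankFn_apply, rankFn_apply, ← N.eRk_insert_closure_eq,
      insert_eq_of_mem h, N.eRk_closure_eq]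
  have hBf : Finite B := N.ground_finite.subset hB.subset_ground
  refine FrameRep.of (V := B) (ρ := rankFn N) (ι := Sum.inl) (j := Subtype.val) (fun S => ?_)
    (fun X hX => ?_) (fun e he => ?_) (by simp)
  · rw [hj _ (hB.indep.subset (by simp)), ncard_image_of_injective _ Subtype.val_injective]
  · rw [rankFn_apply, rankFn_apply]
    congr 2
    rw [← hNM, Matroid.eRk_comap]
  · have : Sum.inl e ∈ N.E := by
      rw [← hNM] at he
      exact he
    obtain ⟨x, hx, y, hy, h⟩ := hE _ this
    exact ⟨⟨x, hx⟩, ⟨y, hy⟩, hcl _ _ h⟩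

end FrameRep

end FrameMatroids

namespace FrameMatroids

universe u v

/-! ### Frame representations of biased graphs -/

section

variable {V : Type v} {α : Type u} {G : Graph V α} {W : Set V} {C D P X Z : Set α} {a b c d x y : V}
  {e f : α}

theorem IsPath.not_isCycleOn_subset (h : IsPath G x y W P) {U : Set V} (hD : IsCycleOn G U D) :
    ¬ D ⊆ P := by
  induction h with
  | nil => exact fun h => hD.nonempty.ne_empty (subset_empty_iff.1 h)
  | @cons a b z W e P hl hP ha ih =>
    intro hDP
    by_cases he : e ∈ D
    · obtain ⟨s, t, Q, hQ, hst, heQ, rfl⟩ := hD.rotate he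
      have hQP : Q ⊆ P := fun g hg => (hDP (Or.inr hg)).resolve_left fun h => heQ (h ▸ hg)
      -- If the first edge of the path were on the cycle, the rest of the cycle would lie in `P` and
      -- have an end at `a`; but no edge of `P` meets `a`.
      have main : ∀ {s t U}, IsPath G s t U Q → s = a → t = b → False := by
        intro s t U hQ hs ht
        subst hs ht
        cases hQ with
        | nil => exact ha hP.left_mem
        | cons hg => exact ha (hP.mem_of_inc (hQP (mem_insert _ _)) hg.inc_left)
      rcases hst.eq_and_eq_or_eq_and_eq hl with ⟨h1, h2⟩ | ⟨h1, h2⟩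
      · exact main hQ h1 h2
      · exact main hQ.reverse h2 h1
    · exact ih fun g hg => (hDP hg).resolve_left fun h => he (h ▸ hg)

/-- Cycles are minimal. -/
theorem IsCycleOn.eq_of_subset {U : Set V} (hC : IsCycleOn G W C) (hD : IsCycleOn G U D)
    (h : D ⊆ C) : D = C := by
  by_contra hne
  obtain ⟨e, he, heD⟩ := exists_of_ssubset (h.ssubset_of_ne hne)
  obtain ⟨x, y, P, hP, -, -, rfl⟩ := hC.rotate he
  exact hP.not_isCycleOn_subset hD fun g hg => (h hg).resolve_left fun h => heD (h ▸ hg)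

theorem IsCycleOn.vertices_eq_of_singleton (h : IsCycleOn G W {e}) (hl : G.IsLink e a b)
    (hx : x ∈ W) : x = a := by
  obtain ⟨s, t, P, hP, hst, heP, hD⟩ := h.rotate rfl
  have : P = ∅ := by
    rw [eq_empty_iff_forall_notMem]
    intro g hg
    have : g ∈ ({e} : Set α) := by
      rw [hD]
      exact Or.inr hg
    exact heP (this ▸ hg)
  subst this
  have h1 := hP.ncard
  rw [ncard_empty, zero_add, ncard_eq_one] at h1
  obtain ⟨v, rfl⟩ := h1
  have h2 : s = v := hP.left_mem
  have h3 : t = v := hP.right_mem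
  have h4 : x = v := hx
  subst h2
  subst h3
  rcases hst.eq_and_eq_or_eq_and_eq hl with ⟨h1, h2⟩ | ⟨h1, h2⟩
  · rw [h4, h1]
  · rw [h4, h2]

/-- Two edges of a cycle whose vertices are connected by further edges lie on different paths
of a theta. -/
theorem IsCycleOn.exists_theta (h : IsCycleOn G W D) (he : e ∈ D) (hf : f ∈ D) (hef : e ≠ f)
    (heX : e ∉ X) (hfX : f ∉ X) (hr : ∀ a ∈ W, ∀ b ∈ W, Reach G X a b) :
    ∃ (a b : V) (W₁ W₂ U : Set V) (P₁ P₂ R : Set α), a ∈ W ∧ a ≠ b ∧ IsPath G a b W₁ P₁ ∧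
      IsPath G a b W₂ P₂ ∧ IsPath G a b U R ∧ W₁ ∩ W₂ = {a, b} ∧ W₁ ∩ U = {a, b} ∧
      W₂ ∩ U = {a, b} ∧ Disjoint P₁ P₂ ∧ Disjoint P₁ R ∧ Disjoint P₂ R ∧ P₁ ∪ P₂ = D ∧
      f ∉ P₁ ∧ e ∉ P₂ ∧ R ⊆ X := by
  obtain ⟨x, y, P, hP, hl, heP, rfl⟩ := h.rotate he
  obtain ⟨c, d, W₁, Q₁, W₂, Q₂, h1, h2, h3, hd, rfl, rfl, hfQ⟩ :=
    hP.split_edge (hf.resolve_left hef.symm)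
  -- Without `e` and `f` the cycle consists of two disjoint paths on `W₁` and `W₂`. A path in `X`
  -- from one to the other is cut at its first vertex in `W₂` and then, read backwards, at the first
  -- vertex in `W₁`; the remaining piece `R` is the third path of the theta.
  obtain ⟨U₀, R₀, hR₀, hR₀X⟩ := hr c (Or.inl h1.right_mem) d (Or.inr h3.left_mem)
  obtain ⟨b, U₁, R₁, U₁', R₁', hR₁, -, hU₁, -, -, rfl⟩ := hR₀.first_hit hR₀.right_mem h3.left_mem
  obtain ⟨a, U, R, U', R', hR, -, hU, -, rfl, rfl⟩ :=
    hR₁.reverse.first_hit hR₁.left_mem h1.right_mem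
  have hRX : R ⊆ X := (subset_union_left.trans subset_union_left).trans hR₀X
  have ha : a ∈ W₁ := (hU.symm.subset rfl).2
  have hb : b ∈ W₂ := (hU₁.symm.subset rfl).2
  have hUb : U ∩ W₂ = {b} := by
    refine subset_antisymm (fun v hv => ?_) (singleton_subset_iff.2 ⟨hR.left_mem, hb⟩)
    rw [← hU₁]
    exact ⟨Or.inl hv.1, hv.2⟩
  obtain ⟨A₁, S₁, A₂, S₂, a1, a2, a3, rfl, rfl⟩ := h1.split ha
  obtain ⟨B₁, T₁, B₂, T₂, b1, b2, b3, rfl, rfl⟩ := h3.split hb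
  have hne : a ≠ b := hd.ne_of_mem ha hb
  have hAB : ∀ v, v ∈ A₁ ∪ A₂ → v ∈ B₁ ∪ B₂ → False := fun v h h' => hd.ne_of_mem h h' rfl
  have dAB : ∀ {A B : Set V} {S T : Set α} {p q p' q' : V}, A ⊆ A₁ ∪ A₂ → B ⊆ B₁ ∪ B₂ →
      IsPath G p q A S → IsPath G p' q' B T → Disjoint S T := by
    intro A B S T p q p' q' hA hB hS hT
    rw [Set.disjoint_left]
    intro g hg hg'
    obtain ⟨u, hu, _, _, hl', _⟩ := hS.edge hg
    exact hAB u (hA hu) (hB (hT.mem_of_inc hg' hl'.inc_left))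
  have dA : Disjoint S₁ S₂ :=
    a1.disjoint_of_inter (fun g hg v hv => a2.mem_of_inc hg hv) a3.subset
  have dB : Disjoint T₁ T₂ :=
    b1.disjoint_of_inter (fun g hg v hv => b2.mem_of_inc hg hv) b3.subset
  have dRA : Disjoint R (S₁ ∪ S₂) :=
    hR.disjoint_of_inter (fun g hg v hv => h1.mem_of_inc hg hv) hU.subset
  have dRB : Disjoint R (T₁ ∪ T₂) :=
    hR.disjoint_of_inter (fun g hg v hv => h3.mem_of_inc hg hv) hUb.subset
  have heR : e ∉ R := fun h => heX (hRX h)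
  have hfR : f ∉ R := fun h => hfX (hRX h)
  have p1 : IsPath G a b (A₁ ∪ B₂) (insert e (S₁ ∪ T₂)) :=
    a1.reverse.join hl b2.reverse (hd.mono subset_union_left subset_union_right)
  have p2 : IsPath G a b (A₂ ∪ B₁) (insert f (S₂ ∪ T₁)) :=
    a2.join h2 b1 (hd.mono subset_union_right subset_union_left)
  simp only [mem_insert_iff, mem_union, not_or] at heP hfQ
  refine ⟨a, b, _, _, U, _, _, R, Or.inl ha, hne, p1, p2, hR.reverse, ?_, ?_, ?_, ?_, ?_, ?_, ?_,
    ?_, ?_, hRX⟩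
  · refine subset_antisymm ?_ (pair_subset ⟨p1.left_mem, p2.left_mem⟩ ⟨p1.right_mem, p2.right_mem⟩)
    rintro v ⟨hv | hv, hv' | hv'⟩
    · exact Or.inl (a3.subset ⟨hv, hv'⟩)
    · exact (hAB v (Or.inl hv) (Or.inl hv')).elim
    · exact (hAB v (Or.inr hv') (Or.inr hv)).elim
    · exact Or.inr (b3.subset ⟨hv', hv⟩)
  · refine subset_antisymm ?_ (pair_subset ⟨p1.left_mem, hR.right_mem⟩ ⟨p1.right_mem, hR.left_mem⟩)
    rintro v ⟨hv | hv, hv'⟩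
    · exact Or.inl (hU.subset ⟨hv', Or.inl hv⟩)
    · exact Or.inr (hUb.subset ⟨hv', Or.inr hv⟩)
  · refine subset_antisymm ?_ (pair_subset ⟨p2.left_mem, hR.right_mem⟩ ⟨p2.right_mem, hR.left_mem⟩)
    rintro v ⟨hv | hv, hv'⟩
    · exact Or.inl (hU.subset ⟨hv', Or.inr hv⟩)
    · exact Or.inr (hUb.subset ⟨hv', Or.inl hv⟩)
  · rw [disjoint_insert_left, disjoint_insert_right]
    refine ⟨?_, ?_, ?_⟩
    · simp only [mem_insert_iff, mem_union, not_or]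
      exact ⟨hef, heP.2.1.2, heP.2.2.1⟩
    · simp only [mem_union, not_or]
      exact ⟨hfQ.1.1, hfQ.2.2⟩
    · rw [disjoint_union_left, disjoint_union_right, disjoint_union_right]
      exact ⟨⟨dA, dAB subset_union_left subset_union_left a1 b1⟩,
        (dAB subset_union_right subset_union_right a2 b2).symm, dB.symm⟩
  · rw [disjoint_insert_left]
    exact ⟨heR, ((dRA.mono_right subset_union_left).union_right
      (dRB.mono_right subset_union_right)).symm⟩
  · rw [disjoint_insert_left]
    exact ⟨hfR, ((dRA.mono_right subset_union_right).union_right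
      (dRB.mono_right subset_union_left)).symm⟩
  · ext g
    simp only [mem_insert_iff, mem_union]
    tauto
  · simp only [mem_insert_iff, mem_union, not_or]
    exact ⟨hef.symm, hfQ.1.1, hfQ.2.2⟩
  · simp only [mem_insert_iff, mem_union, not_or]
    exact ⟨hef, heP.2.1.2, heP.2.2.1⟩

end

/-! #### Incidence vectors over the field with two elements -/

section Incidence

variable {V : Type v} {α : Type u} (G : Graph V α)

open Classical in
/-- The unit vector of a vertex. -/
noncomputable def unitVec (v : V) : G.vertexSet → ZMod 2 := fun u => if u.1 = v then 1 else 0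

/-- The incidence vectors of the edges in a set. -/
def linkVecs (X : Set α) : Set (G.vertexSet → ZMod 2) :=
  {w | ∃ e ∈ X, ∃ x y, G.IsLink e x y ∧ w = unitVec G x + unitVec G y}

variable {G} {X : Set α} {J : Set V} {a b : V} {e : α}

theorem zmod2_add_self {M : Type*} [AddCommGroup M] [Module (ZMod 2) M] (m : M) : m + m = 0 := by
  have : (1 + 1 : ZMod 2) • m = m + m := by rw [add_smul, one_smul]
  rw [← this]
  have : (1 + 1 : ZMod 2) = 0 := by decide
  rw [this, zero_smul]

theorem linkVecs_mono {Y : Set α} (h : X ⊆ Y) : linkVecs G X ⊆ linkVecs G Y :=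
  fun _ ⟨e, he, h'⟩ => ⟨e, h he, h'⟩

theorem Reach.unitVec_add_mem (h : Reach G X a b)
    {S : Submodule (ZMod 2) (G.vertexSet → ZMod 2)} (hS : linkVecs G X ⊆ (S : Set _)) :
    unitVec G a + unitVec G b ∈ S := by
  obtain ⟨W, P, h, hP⟩ := h
  induction h with
  | nil => rw [zmod2_add_self]; exact S.zero_mem
  | @cons x y z W e P hl _ _ ih =>
    have h1 := ih ((subset_insert _ _).trans hP)
    have h2 := hS ⟨e, hP (mem_insert _ _), x, y, hl, rfl⟩
    have h3 := S.add_mem h2 h1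
    have : unitVec G x + unitVec G y + (unitVec G y + unitVec G z) =
        unitVec G x + unitVec G z + (unitVec G y + unitVec G y) := by abel
    rwa [this, zmod2_add_self, add_zero] at h3

theorem mem_of_add_mem {M : Type*} [AddCommGroup M] [Module (ZMod 2) M]
    {S : Submodule (ZMod 2) M} {m n : M} (h : m + n ∈ S) (hm : m ∈ S) : n ∈ S := by
  have := S.add_mem h hm
  rwa [add_right_comm, zmod2_add_self, zero_add] at this

open Classical in
theorem exists_indicator [Finite G.vertexSet] (K : Set V) :
    ∃ φ : (G.vertexSet → ZMod 2) →ₗ[ZMod 2] ZMod 2,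
      ∀ v ∈ G.vertexSet, φ (unitVec G v) = if v ∈ K then 1 else 0 := by
  have := Fintype.ofFinite G.vertexSet
  refine ⟨∑ u : G.vertexSet, if u.1 ∈ K then LinearMap.proj u else 0, fun v hv => ?_⟩
  rw [LinearMap.sum_apply, Finset.sum_eq_single ⟨v, hv⟩]
  · by_cases h : v ∈ K
    · simp [h, unitVec]
    · simp [h]
  · intro u _ hu
    have : u.1 ≠ v := fun h => hu (Subtype.ext h)
    by_cases h : u.1 ∈ K
    · simp [h, unitVec, this]
    · simp [h]
  · simp

/-- The functional that sums the coordinates over the component of `a` vanishes on all links. It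
also vanishes on the unit vectors from `J`, since none of these belongs to the component, `a` itself
not being spanned. So it vanishes on the sum for `a` and `b`, which forces `b` into the component.
-/
theorem reach_of_unitVec_add_mem [Finite G.vertexSet] (hJ : J ⊆ G.vertexSet)
    (ha : a ∈ G.vertexSet) (hb : b ∈ G.vertexSet)
    (hab : unitVec G a + unitVec G b ∈
      Submodule.span (ZMod 2) (linkVecs G X ∪ unitVec G '' J))
    (hn : unitVec G a ∉ Submodule.span (ZMod 2) (linkVecs G X ∪ unitVec G '' J)) :
    Reach G X a b := by
  classical
  obtain ⟨φ, hφ⟩ := exists_indicator (G := G) {v | Reach G X a v}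
  have h0 : Submodule.span (ZMod 2) (linkVecs G X ∪ unitVec G '' J) ≤ LinearMap.ker φ := by
    rw [Submodule.span_le]
    rintro _ (⟨e, he, x, y, hl, rfl⟩ | ⟨v, hv, rfl⟩)
    · rw [SetLike.mem_coe, LinearMap.mem_ker, map_add, hφ _ hl.left_mem, hφ _ hl.right_mem]
      have : Reach G X a x ↔ Reach G X a y :=
        ⟨fun h => h.trans (.of_isLink hl he), fun h => h.trans (.of_isLink hl.symm he)⟩
      simp only [mem_ofPred_eq, this]
      exact zmod2_add_self _
    · rw [SetLike.mem_coe, LinearMap.mem_ker, hφ _ (hJ hv)]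
      refine if_neg fun h => hn ?_
      refine mem_of_add_mem (h.symm.unitVec_add_mem ?_)
        (Submodule.subset_span (Or.inr (mem_image_of_mem _ hv)))
      exact subset_union_left.trans Submodule.subset_span
  have h1 := h0 hab
  rw [LinearMap.mem_ker, map_add, hφ _ ha, hφ _ hb] at h1
  by_contra hr
  rw [if_pos (show a ∈ {v | Reach G X a v} from Reach.refl ha), 
    if_neg (show b ∉ {v | Reach G X a v} from hr), add_zero] at h1
  exact one_ne_zero h1

theorem RankFn.ind_of_forall_notMem {γ : Type*} (ρ : RankFn γ) {S : Set γ}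
    (h : ∀ v ∈ S, v ∉ ρ.cl (S \ {v})) : ρ.Ind S := by
  obtain ⟨J, hJS, hJ, hr⟩ := ρ.exists_basis S
  have : J = S := by
    refine subset_antisymm hJS fun v hv => ?_
    by_contra hvJ
    refine h v hv (ρ.cl_mono ?_ (ρ.subset_cl_of_rank_le hJS hr.ge hv))
    exact fun w hw => ⟨hJS hw, fun h => hvJ (h ▸ hw)⟩
  rwa [this] at hJ

theorem RankFn.lin_map {γ K W W' : Type*} [Field K] [AddCommGroup W] [Module K W]
    [FiniteDimensional K W] [AddCommGroup W'] [Module K W'] [FiniteDimensional K W'] {f : γ → W}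
    {g : γ → W'} {φ : W →ₗ[K] W'} {S : Submodule K W} {X : Set γ} (hf : ∀ x ∈ X, f x ∈ S)
    (hφ : ∀ w ∈ S, φ w = 0 → w = 0) (hg : ∀ x ∈ X, g x = φ (f x)) : lin K f X = lin K g X := by
  have h1 : g '' X = φ '' (f '' X) := by
    rw [image_image]
    exact image_congr hg
  have h2 : Submodule.span K (f '' X) ≤ S := by
    rw [Submodule.span_le]
    rintro _ ⟨x, hx, rfl⟩
    exact hf x hx
  have h3 : Function.Injective (φ.domRestrict (Submodule.span K (f '' X))) := by
    rw [← LinearMap.ker_eq_bot, LinearMap.ker_eq_bot']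
    rintro ⟨w, hw⟩ h
    exact Subtype.ext (hφ w (h2 hw) h)
  rw [lin_apply, lin_apply, h1, Submodule.span_image, ← LinearMap.finrank_range_of_inj h3,
    LinearMap.range_domRestrict]

theorem finrank_span_unitVec [Finite G.vertexSet] (hJ : J ⊆ G.vertexSet) :
    Module.finrank (ZMod 2) (Submodule.span (ZMod 2) (unitVec G '' J)) = J.ncard := by
  classical
  have h := RankFn.ind_of_forall_notMem (RankFn.lin (ZMod 2) (unitVec G)) (S := J)
    (fun v hv hcl => by
      rw [RankFn.mem_cl_lin] at hcl
      have : Submodule.span (ZMod 2) (unitVec G '' (J \ {v})) ≤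
          LinearMap.ker (LinearMap.proj (R := ZMod 2) (φ := fun _ => ZMod 2) ⟨v, hJ hv⟩) := by
        rw [Submodule.span_le]
        rintro _ ⟨w, hw, rfl⟩
        have : v ≠ w := fun h => hw.2 h.symm
        simp [unitVec, this]
      have := this hcl
      simp [unitVec] at this)
  have h2 := h.2
  rw [RankFn.lin_apply] at h2
  exact_mod_cast h2

end Incidence

namespace BiasedGraph

variable {V : Type v} {α : Type u} (Ω : BiasedGraph V α)

instance : Finite Ω.graph.vertexSet := Ω.finite_vertexSet

/-- The vertices on unbalanced cycles in a set, and the joints in the set. -/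
def rootSet (Z : Set (α ⊕ V)) : Set V :=
  {v | v ∈ Ω.graph.vertexSet ∧ (Sum.inr v ∈ Z ∨
    ∃ W D, Ω.IsUnbalancedCycleOn W D ∧ Sum.inl '' D ⊆ Z ∧ v ∈ W)}

/-- A subspace that records the connected components spanned by a set of edges and joints, and
which of these are unbalanced. -/
def flat (Z : Set (α ⊕ V)) : Submodule (ZMod 2) (Ω.graph.vertexSet → ZMod 2) :=
  Submodule.span (ZMod 2) (linkVecs Ω.graph (Sum.inl ⁻¹' Z) ∪ unitVec Ω.graph '' Ω.rootSet Z)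

variable {Ω} {Z Z' Y : Set (α ⊕ V)} {W : Set V} {D : Set α} {x y v : V} {e : α}

theorem rootSet_mono (h : Z ⊆ Z') : Ω.rootSet Z ⊆ Ω.rootSet Z' := by
  rintro v ⟨hv, h' | ⟨W, D, h1, h2, h3⟩⟩
  · exact ⟨hv, Or.inl (h h')⟩
  · exact ⟨hv, Or.inr ⟨W, D, h1, h2.trans h, h3⟩⟩

theorem flat_mono (h : Z ⊆ Z') : Ω.flat Z ≤ Ω.flat Z' :=
  Submodule.span_mono (union_subset_union (linkVecs_mono (preimage_mono h))
    (image_mono (rootSet_mono h)))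

theorem linkVecs_subset_flat : linkVecs Ω.graph (Sum.inl ⁻¹' Z) ⊆ Ω.flat Z :=
  subset_union_left.trans Submodule.subset_span

theorem isLink_mem_flat (hl : Ω.graph.IsLink e x y) (he : Sum.inl e ∈ Z) :
    unitVec Ω.graph x + unitVec Ω.graph y ∈ Ω.flat Z :=
  linkVecs_subset_flat ⟨e, he, x, y, hl, rfl⟩

theorem unitVec_mem_flat (hv : v ∈ Ω.rootSet Z) : unitVec Ω.graph v ∈ Ω.flat Z :=
  Submodule.subset_span (Or.inr (mem_image_of_mem _ hv))

/-- This gives the unit increase of the rank. If `e` closes an unbalanced cycle with edges in `Z`,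
the unit vector of one end yields all new root vertices, since the rest of the cycle connects them
to this end. If `e` closes no such cycle, only its own incidence vector is new. -/
theorem flat_insert_le_of_cycle (hl : Ω.graph.IsLink e x y) :
    Ω.flat (insert (Sum.inl e) Z) ≤ Submodule.span (ZMod 2) {unitVec Ω.graph x} ⊔ Ω.flat Z ∨
    Ω.flat (insert (Sum.inl e) Z) ≤
      Submodule.span (ZMod 2) {unitVec Ω.graph x + unitVec Ω.graph y} ⊔ Ω.flat Z := by
  have hpre : ∀ {g : α}, Sum.inl g ∈ insert (Sum.inl e) Z → g ≠ e → Sum.inl g ∈ Z := by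
    intro g hg hne
    exact hg.resolve_left fun h => hne (Sum.inl_injective h)
  by_cases hcyc : ∃ W D, Ω.IsUnbalancedCycleOn W D ∧ Sum.inl '' D ⊆ insert (Sum.inl e) Z ∧ e ∈ D
  · left
    set S := Submodule.span (ZMod 2) {unitVec Ω.graph x} ⊔ Ω.flat Z with hS
    have hx : unitVec Ω.graph x ∈ S := (le_sup_left : _ ≤ S) (Submodule.mem_span_singleton_self _)
    have hflat : Ω.flat Z ≤ S := le_sup_right
    have hcyc' : ∀ W D, Ω.IsUnbalancedCycleOn W D → Sum.inl '' D ⊆ insert (Sum.inl e) Z → e ∈ D →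
        ∀ v ∈ W, unitVec Ω.graph v ∈ S := by
      intro W D hD hDZ he v hv
      have hr : Reach Ω.graph (D \ {e}) x v :=
        hD.1.reach_sdiff he (hD.1.mem_of_inc he hl.inc_left) hv
      refine mem_of_add_mem (hr.unitVec_add_mem (S := S) ?_) hx
      refine (linkVecs_mono ?_).trans (linkVecs_subset_flat.trans hflat)
      exact fun g hg => hpre (hDZ (mem_image_of_mem _ hg.1)) hg.2
    have hy : unitVec Ω.graph y ∈ S := by
      obtain ⟨W, D, hD, hDZ, he⟩ := hcyc
      exact hcyc' W D hD hDZ he y (hD.1.mem_of_inc he hl.inc_right)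
    refine Submodule.span_le.2 ?_
    rintro _ (⟨g, hg, a, b, hab, rfl⟩ | ⟨v, ⟨hv, h | ⟨W, D, h1, h2, h3⟩⟩, rfl⟩)
    · by_cases hge : g = e
      · subst hge
        rcases hab.eq_and_eq_or_eq_and_eq hl with ⟨rfl, rfl⟩ | ⟨rfl, rfl⟩
        · exact S.add_mem hx hy
        · exact S.add_mem hy hx
      · exact hflat (isLink_mem_flat hab (hpre hg hge))
    · exact hflat (unitVec_mem_flat ⟨hv, Or.inl (h.resolve_left (by simp))⟩)
    · by_cases heD : e ∈ D
      · exact hcyc' W D h1 h2 heD v h3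
      · refine hflat (unitVec_mem_flat ⟨hv, Or.inr ⟨W, D, h1, ?_, h3⟩⟩)
        rintro _ ⟨g, hg, rfl⟩
        exact hpre (h2 (mem_image_of_mem _ hg)) fun h => heD (h ▸ hg)
  · right
    refine Submodule.span_le.2 ?_
    rintro _ (⟨g, hg, a, b, hab, rfl⟩ | ⟨v, ⟨hv, h | ⟨W, D, h1, h2, h3⟩⟩, rfl⟩)
    · by_cases hge : g = e
      · subst hge
        refine (le_sup_left : _ ≤ _ ⊔ Ω.flat Z) ?_
        rcases hab.eq_and_eq_or_eq_and_eq hl with ⟨rfl, rfl⟩ | ⟨rfl, rfl⟩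
        · exact Submodule.mem_span_singleton_self _
        · rw [add_comm]
          exact Submodule.mem_span_singleton_self _
      · exact (le_sup_right : Ω.flat Z ≤ _) (isLink_mem_flat hab (hpre hg hge))
    · exact (le_sup_right : Ω.flat Z ≤ _)
        (unitVec_mem_flat ⟨hv, Or.inl (h.resolve_left (by simp))⟩)
    · refine (le_sup_right : Ω.flat Z ≤ _) (unitVec_mem_flat ⟨hv, Or.inr ⟨W, D, h1, ?_, h3⟩⟩)
      rintro _ ⟨g, hg, rfl⟩
      refine hpre (h2 (mem_image_of_mem _ hg)) ?_
      rintro rfl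
      exact hcyc ⟨W, D, h1, h2, hg⟩

theorem exists_flat_insert_le (z : α ⊕ V) (Z : Set (α ⊕ V)) :
    ∃ w, Ω.flat (insert z Z) ≤ Submodule.span (ZMod 2) {w} ⊔ Ω.flat Z := by
  rcases z with e | v
  · by_cases he : e ∈ Ω.graph.edgeSet
    · obtain ⟨x, y, hl⟩ := Graph.exists_isLink_of_mem_edgeSet he
      rcases flat_insert_le_of_cycle (Z := Z) hl with h | h
      exacts [⟨_, h⟩, ⟨_, h⟩]
    · refine ⟨0, le_trans (Submodule.span_le.2 ?_) le_sup_right⟩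
      rintro _ (⟨g, hg, a, b, hab, rfl⟩ | ⟨v, ⟨hv, h | ⟨W, D, h1, h2, h3⟩⟩, rfl⟩)
      · refine isLink_mem_flat hab (hg.resolve_left fun h => he ?_)
        rw [← Sum.inl_injective h]
        exact hab.edge_mem
      · exact unitVec_mem_flat ⟨hv, Or.inl (h.resolve_left (by simp))⟩
      · refine unitVec_mem_flat ⟨hv, Or.inr ⟨W, D, h1, ?_, h3⟩⟩
        rintro _ ⟨g, hg, rfl⟩
        refine (h2 (mem_image_of_mem _ hg)).resolve_left fun h => he ?_
        rw [← Sum.inl_injective h]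
        exact h1.1.subset_edgeSet hg
  · refine ⟨unitVec Ω.graph v, Submodule.span_le.2 ?_⟩
    rintro _ (⟨g, hg, a, b, hab, rfl⟩ | ⟨w, ⟨hw, h | ⟨W, D, h1, h2, h3⟩⟩, rfl⟩)
    · exact (le_sup_right : Ω.flat Z ≤ _) (isLink_mem_flat hab (hg.resolve_left (by simp)))
    · rcases h with h | h
      · rw [Sum.inr_injective h]
        exact (le_sup_left : _ ≤ _ ⊔ Ω.flat Z) (Submodule.mem_span_singleton_self _)
      · exact (le_sup_right : Ω.flat Z ≤ _) (unitVec_mem_flat ⟨hw, Or.inl h⟩)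
    · refine (le_sup_right : Ω.flat Z ≤ _) (unitVec_mem_flat ⟨hw, Or.inr ⟨W, D, h1, ?_, h3⟩⟩)
      rintro _ ⟨g, hg, rfl⟩
      exact (h2 (mem_image_of_mem _ hg)).resolve_left (by simp)

/-- This is where locality of the rank function rests on the theta property. If each element of `Y`
alone adds nothing to the flat of `Z`, neither may an unbalanced cycle that uses several of them.
The induction is on the number of edges of the cycle outside `Z`. -/
theorem mem_flat_of_cycle (hY : ∀ y ∈ Y, Ω.flat (insert y Z) ≤ Ω.flat Z)
    (hD : Ω.IsUnbalancedCycleOn W D) (hDZ : Sum.inl '' D ⊆ Z ∪ Y) (hv : v ∈ W) :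
    unitVec Ω.graph v ∈ Ω.flat Z := by
  induction hn : (D \ Sum.inl ⁻¹' Z).ncard using Nat.strong_induction_on generalizing W D v with
  | _ n ih =>
  set X : Set α := Sum.inl ⁻¹' Z with hX
  have hlink : ∀ e ∈ D, ∀ {x y}, Ω.graph.IsLink e x y →
      unitVec Ω.graph x + unitVec Ω.graph y ∈ Ω.flat Z := by
    intro e he x y hl
    rcases hDZ (mem_image_of_mem _ he) with h | h
    · exact isLink_mem_flat hl h
    · exact hY _ h (isLink_mem_flat hl (mem_insert _ _))
  have hlinks : linkVecs Ω.graph D ⊆ Ω.flat Z := by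
    rintro _ ⟨e, he, x, y, hl, rfl⟩
    exact hlink e he hl
  by_contra hvn
  have hone : ∀ w ∈ W, unitVec Ω.graph w ∉ Ω.flat Z := fun w hw h =>
    hvn (mem_of_add_mem ((hD.1.reach hw hv).unitVec_add_mem hlinks) h)
  have hroot : Ω.rootSet Z ⊆ Ω.graph.vertexSet := fun _ h => h.1
  -- If one vertex of the cycle is outside the flat, all are, and then membership of their sums in
  -- the flat can only come from paths inside `Z`.
  have hreach : ∀ a ∈ W, ∀ b ∈ W, Reach Ω.graph X a b := fun a ha b hb =>
    reach_of_unitVec_add_mem hroot (hD.1.subset_vertexSet ha) (hD.1.subset_vertexSet hb)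
      ((hD.1.reach ha hb).unitVec_add_mem hlinks) (hone a ha)
  by_cases h2 : ∃ e ∈ D \ X, ∃ f ∈ D \ X, e ≠ f
  · obtain ⟨e, he, f, hf, hef⟩ := h2
    obtain ⟨a, b, W₁, W₂, U, P₁, P₂, R, ha, hab, p1, p2, p3, w12, w13, w23, d12, d13, d23, rfl,
      hf1, he2, hRX⟩ := hD.1.exists_theta he.1 hf.1 hef he.2 hf.2 hreach
    have hfin := hD.1.finite.2.subset (sdiff_subset (t := X))
    -- Each of the two shorter cycles through the connecting path `R` misses one of `e`, `f` and has
    -- fewer edges outside `Z`. By induction it is balanced, since otherwise its vertices, among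
    -- them `a`, would be in the flat. The theta property then makes the original cycle balanced.
    have step : ∀ {W' Q} {g : α}, IsPath Ω.graph a b W' Q → W' ∩ U = {a, b} → Disjoint Q R →
        Q ⊆ P₁ ∪ P₂ → g ∈ (P₁ ∪ P₂) \ X → g ∉ Q → Q ∪ R ∈ Ω.balanced := by
      intro W' Q g p w d hQ hg hgQ
      by_contra hb
      refine hone a ha (ih ((Q ∪ R) \ X).ncard ?_ ⟨p.isCycleOn p3 hab w d, hb⟩ ?_
        (Or.inl p.left_mem) rfl)
      · rw [← hn]
        refine ncard_lt_ncard ⟨?_, fun h => ?_⟩ hfin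
        · rintro k ⟨hk | hk, hkX⟩
          · exact ⟨hQ hk, hkX⟩
          · exact absurd (hRX hk) hkX
        · obtain ⟨hgQ' | hgR, -⟩ := h hg
          · exact hgQ hgQ'
          · exact hg.2 (hRX hgR)
      · rintro _ ⟨k, hk | hk, rfl⟩
        · exact hDZ (mem_image_of_mem _ (hQ hk))
        · exact Or.inl (hRX hk)
    refine hD.2 (Ω.theta_property P₁ R P₂ ⟨a, b, W₁, U, W₂, hab, p1, p3, p2, w13, w12,
      by rw [inter_comm, w23], d13, d12, d23.symm⟩ (step p1 w13 d13 subset_union_left hf hf1) ?_)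
    rw [union_comm]
    exact step p2 w23 d23 subset_union_right he he2
  · push Not at h2
    rcases (D \ X).eq_empty_or_nonempty with h0 | ⟨e, he⟩
    · refine hvn (unitVec_mem_flat ⟨hD.1.subset_vertexSet hv, Or.inr ⟨W, D, hD, ?_, hv⟩⟩)
      rintro _ ⟨g, hg, rfl⟩
      exact (sdiff_eq_empty.1 h0) hg
    · refine hvn (hY (Sum.inl e) ?_ (unitVec_mem_flat ⟨hD.1.subset_vertexSet hv,
        Or.inr ⟨W, D, hD, ?_, hv⟩⟩))
      · exact (hDZ (mem_image_of_mem _ he.1)).resolve_left he.2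
      · rintro _ ⟨g, hg, rfl⟩
        by_cases hgX : g ∈ X
        · exact Or.inr hgX
        · rw [h2 e he g ⟨hg, hgX⟩]
          exact mem_insert _ _

variable (Ω) in
/-- The rank function of the frame matroid of a biased graph, with joints at all vertices. -/
noncomputable def rankFn : RankFn (α ⊕ V) where
  r Z := Module.finrank (ZMod 2) (Ω.flat Z)
  empty' := by
    have : Ω.flat ∅ = ⊥ := by
      refine (Submodule.span_eq_bot).2 ?_
      rintro _ (⟨g, hg, a, b, hab, rfl⟩ | ⟨w, ⟨hw, h | ⟨W, D, h1, h2, h3⟩⟩, rfl⟩)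
      · exact hg.elim
      · exact h.elim
      · obtain ⟨g, hg⟩ := h1.1.nonempty
        exact (h2 (mem_image_of_mem _ hg)).elim
    rw [this]
    simp
  mono' X Y h := by exact_mod_cast Submodule.finrank_mono (flat_mono h)
  unit' z Z := by
    obtain ⟨w, hw⟩ := exists_flat_insert_le (Ω := Ω) z Z
    have h1 := Submodule.finrank_mono hw
    have h2 := Submodule.finrank_add_le_finrank_add_finrank (Submodule.span (ZMod 2) {w}) (Ω.flat Z)
    have h3 : Module.finrank (ZMod 2) (Submodule.span (ZMod 2) {w}) ≤ 1 := by
      simpa using finrank_span_le_card (R := ZMod 2) ({w} : Set (Ω.graph.vertexSet → ZMod 2))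
    norm_cast
    omega
  loc' Z Y h := by
    have hY : ∀ y ∈ Y, Ω.flat (insert y Z) ≤ Ω.flat Z := fun y hy =>
      (Submodule.eq_of_le_of_finrank_eq (flat_mono (subset_insert _ _))
        (by exact_mod_cast (h y hy).symm)).ge
    have : Ω.flat (Z ∪ Y) = Ω.flat Z := by
      refine le_antisymm (Submodule.span_le.2 ?_) (flat_mono subset_union_left)
      rintro _ (⟨g, hg | hg, a, b, hab, rfl⟩ | ⟨w, ⟨hw, (h | h) | ⟨W, D, h1, h2, h3⟩⟩, rfl⟩)
      · exact isLink_mem_flat hab hg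
      · exact hY _ hg (isLink_mem_flat hab (mem_insert _ _))
      · exact unitVec_mem_flat ⟨hw, Or.inl h⟩
      · exact hY _ h (unitVec_mem_flat ⟨hw, Or.inl (mem_insert _ _)⟩)
      · exact mem_flat_of_cycle hY h1 h2 h3
    rw [this]

theorem rankFn_apply : Ω.rankFn Z = Module.finrank (ZMod 2) (Ω.flat Z) := rfl

theorem mem_cl_rankFn {z : α ⊕ V} : z ∈ Ω.rankFn.cl Z ↔ Ω.flat (insert z Z) ≤ Ω.flat Z := by
  rw [RankFn.mem_cl, rankFn_apply, rankFn_apply]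
  constructor
  · intro h
    exact (Submodule.eq_of_le_of_finrank_eq (flat_mono (subset_insert _ _))
        (by exact_mod_cast h.symm)).ge
  · intro h
    rw [le_antisymm h (flat_mono (subset_insert _ _))]

theorem inr_mem_cl (h : unitVec Ω.graph v ∈ Ω.flat Z) : Sum.inr v ∈ Ω.rankFn.cl Z := by
  rw [mem_cl_rankFn]
  refine Submodule.span_le.2 ?_
  rintro _ (⟨g, hg, a, b, hab, rfl⟩ | ⟨w, ⟨hw, h' | ⟨W, D, h1, h2, h3⟩⟩, rfl⟩)
  · exact isLink_mem_flat hab (hg.resolve_left (by simp))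
  · rcases h' with h' | h'
    · rw [Sum.inr_injective h']
      exact h
    · exact unitVec_mem_flat ⟨hw, Or.inl h'⟩
  · refine unitVec_mem_flat ⟨hw, Or.inr ⟨W, D, h1, ?_, h3⟩⟩
    rintro _ ⟨g, hg, rfl⟩
    exact (h2 (mem_image_of_mem _ hg)).resolve_left (by simp)

theorem unitVec_mem_flat_of_mem (hv : v ∈ Ω.graph.vertexSet) (h : Sum.inr v ∈ Z) :
    unitVec Ω.graph v ∈ Ω.flat Z :=
  unitVec_mem_flat ⟨hv, Or.inl h⟩

/-- The frame matroid of a biased graph without balanced loops is framed by the graph. -/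
theorem framing (hΩ : ∀ e x, Ω.graph.IsLink e x x → {e} ∉ Ω.balanced) :
    Framing Ω.rankFn Ω.graph where
  joints S hS := by
    have : Ω.flat (Sum.inr '' S) = Submodule.span (ZMod 2) (unitVec Ω.graph '' S) := by
      refine le_antisymm (Submodule.span_le.2 ?_) (Submodule.span_le.2 ?_)
      · rintro _ (⟨g, hg, a, b, hab, rfl⟩ | ⟨w, ⟨hw, h' | ⟨W, D, h1, h2, h3⟩⟩, rfl⟩)
        · simp at hg
        · refine Submodule.subset_span (mem_image_of_mem _ ?_)
          simpa using h'
        · obtain ⟨g, hg⟩ := h1.1.nonempty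
          have := h2 (mem_image_of_mem _ hg)
          simp at this
      · rintro _ ⟨v, hv, rfl⟩
        exact unitVec_mem_flat_of_mem (hS hv) (mem_image_of_mem _ hv)
    rw [rankFn_apply, this, finrank_span_unitVec hS]
  mem_cl {e x y} hl := by
    rw [mem_cl_rankFn]
    have hx : unitVec Ω.graph x ∈ Ω.flat {Sum.inr x, Sum.inr y} :=
      unitVec_mem_flat_of_mem hl.left_mem (by simp)
    have hy : unitVec Ω.graph y ∈ Ω.flat {Sum.inr x, Sum.inr y} :=
      unitVec_mem_flat_of_mem hl.right_mem (by simp)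
    refine Submodule.span_le.2 ?_
    rintro _ (⟨g, hg, a, b, hab, rfl⟩ | ⟨w, ⟨hw, h' | ⟨W, D, h1, h2, h3⟩⟩, rfl⟩)
    · obtain rfl : g = e := by simpa using hg
      rcases hab.eq_and_eq_or_eq_and_eq hl with ⟨rfl, rfl⟩ | ⟨rfl, rfl⟩
      · exact Submodule.add_mem _ hx hy
      · exact Submodule.add_mem _ hy hx
    · refine unitVec_mem_flat_of_mem hw ?_
      simpa using h'
    · have hD : D = {e} := by
        refine h1.1.nonempty.subset_singleton_iff.1 fun g hg => ?_
        simpa using h2 (mem_image_of_mem _ hg)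
      subst hD
      rw [h1.1.vertices_eq_of_singleton hl h3]
      exact hx
  swap {e x y} hl := by
    refine inr_mem_cl (mem_of_add_mem (isLink_mem_flat hl (mem_insert _ _)) ?_)
    exact unitVec_mem_flat_of_mem hl.left_mem (by simp)
  loop {e x} hl := by
    refine inr_mem_cl (unitVec_mem_flat ⟨hl.left_mem, Or.inr ⟨{x}, {e}, ⟨?_, hΩ e x hl⟩, ?_, rfl⟩⟩)
    · exact ⟨x, x, ∅, e, .nil hl.left_mem, hl, by simp, by simp⟩
    · simp

theorem flat_of_forall_balanced (h : ∀ C ⊆ D, IsCycle Ω.graph C → C ∈ Ω.balanced) :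
    Ω.flat (Sum.inl '' D) = Submodule.span (ZMod 2) (linkVecs Ω.graph D) := by
  refine le_antisymm (Submodule.span_le.2 ?_) (Submodule.span_le.2 ?_)
  · rintro _ (⟨g, hg, a, b, hab, rfl⟩ | ⟨w, ⟨hw, h' | ⟨W, C, h1, h2, h3⟩⟩, rfl⟩)
    · exact Submodule.subset_span ⟨g, by simpa using hg, a, b, hab, rfl⟩
    · simp at h'
    · refine absurd (h C (fun e he => ?_) ⟨_, h1.1⟩) h1.2
      simpa using h2 (mem_image_of_mem _ he)
  · refine subset_trans ?_ linkVecs_subset_flat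
    rw [preimage_image_eq _ Sum.inl_injective]

/-- By minimality of cycles, a balanced cycle contains no unbalanced one, so its flat is spanned by
links, and the closing edge adds nothing to those of the path. The flat of an unbalanced cycle
contains the unit vectors of all its vertices, which are as many as its edges. -/
theorem mem_balanced_iff (hD : IsCycleOn Ω.graph W D) :
    D ∈ Ω.balanced ↔ Ω.rankFn.edge D < D.ncard := by
  constructor
  · intro hb
    obtain ⟨x, y, P, e, hP, hl, heP, rfl⟩ := id hD
    have h1 : Ω.flat (Sum.inl '' insert e P) ≤ Ω.flat (Sum.inl '' P) := by
      rw [flat_of_forall_balanced fun C hC hcyc => by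
        obtain ⟨U, hcyc⟩ := hcyc
        rwa [hD.eq_of_subset hcyc hC]]
      refine Submodule.span_le.2 ?_
      have hs : linkVecs Ω.graph P ⊆ Ω.flat (Sum.inl '' P) := by
        refine subset_trans ?_ linkVecs_subset_flat
        rw [preimage_image_eq _ Sum.inl_injective]
      rintro _ ⟨g, rfl | hg, a, b, hab, rfl⟩
      · have hr : Reach Ω.graph P x y := ⟨_, _, hP, subset_rfl⟩
        rcases hab.eq_and_eq_or_eq_and_eq hl with ⟨rfl, rfl⟩ | ⟨rfl, rfl⟩
        · exact hr.unitVec_add_mem hs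
        · exact hr.symm.unitVec_add_mem hs
      · exact hs ⟨g, hg, a, b, hab, rfl⟩
    have h2 : Ω.rankFn.edge (insert e P) ≤ Ω.rankFn.edge P := by
      rw [RankFn.edge_apply, RankFn.edge_apply, rankFn_apply, rankFn_apply]
      exact_mod_cast Submodule.finrank_mono h1
    have h3 := Ω.rankFn.edge.rank_le_ncard hP.finite.2
    rw [ncard_insert_of_notMem heP hP.finite.2]
    push_cast
    linarith
  · intro h
    by_contra hb
    have h1 : Submodule.span (ZMod 2) (unitVec Ω.graph '' W) ≤ Ω.flat (Sum.inl '' D) := by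
      refine Submodule.span_le.2 ?_
      rintro _ ⟨v, hv, rfl⟩
      exact unitVec_mem_flat ⟨hD.subset_vertexSet hv, Or.inr ⟨W, D, ⟨hD, hb⟩, subset_rfl, hv⟩⟩
    have h2 := Submodule.finrank_mono h1
    rw [finrank_span_unitVec hD.subset_vertexSet, hD.ncard] at h2
    rw [RankFn.edge_apply, rankFn_apply] at h
    omega

/-- The circuits of the frame matroid of a biased graph. -/
theorem circ_rankFn_iff (hΩ : ∀ e x, Ω.graph.IsLink e x x → {e} ∉ Ω.balanced) {C : Set α} :
    Ω.rankFn.edge.Circ C ∧ C ⊆ Ω.graph.edgeSet ↔ Ω.IsFrameCircuit C := by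
  -- The biased graph is recovered from its own rank function, so the general description of the
  -- circuits of a framed rank function applies to it.
  have h : (framing hΩ).biasedGraph Ω.finite_vertexSet Ω.finite_edgeSet = Ω := by
    have hb : {C | IsCycle Ω.graph C ∧ Ω.rankFn.edge C < C.ncard} = Ω.balanced := by
      ext D
      constructor
      · rintro ⟨⟨W, hD⟩, h⟩
        exact (mem_balanced_iff hD).2 h
      · intro h
        obtain ⟨W, hD⟩ := Ω.isCycle_of_balanced D h
        exact ⟨⟨W, hD⟩, (mem_balanced_iff hD).1 h⟩
    obtain ⟨G, h1, h2, B, h3, h4⟩ := Ω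
    simp only [Framing.biasedGraph, BiasedGraph.mk.injEq, true_and]
    exact hb
  conv_rhs => rw [← h]
  exact ⟨fun ⟨h1, h2⟩ => (framing hΩ).isFrameCircuit_of_circ Ω.finite_vertexSet Ω.finite_edgeSet
    h2 h1, fun h => (framing hΩ).circ_of_isFrameCircuit _ _ h⟩

/-- The biased graph in which all cycles are balanced. -/
def ofGraph (G : Graph V α) (hV : G.vertexSet.Finite) (hE : G.edgeSet.Finite) :
    BiasedGraph V α where
  graph := G
  finite_vertexSet := hV
  finite_edgeSet := hE
  balanced := {C | IsCycle G C}
  isCycle_of_balanced C hC := hC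
  theta_property := by
    rintro P₁ P₂ P₃ ⟨x, y, W₁, W₂, W₃, hxy, h₁, h₂, h₃, w12, w13, w23, d12, d13, d23⟩ - -
    exact ⟨_, h₁.isCycleOn h₃ hxy w13 d13⟩

theorem isFrameCircuit_ofGraph {G : Graph V α} {hV : G.vertexSet.Finite} {hE : G.edgeSet.Finite}
    {C : Set α} : (ofGraph G hV hE).IsFrameCircuit C ↔ IsCycle G C := by
  refine ⟨?_, Or.inl⟩
  have hb : ∀ {W D}, ¬ (ofGraph G hV hE).IsUnbalancedCycleOn W D := fun h => h.2 ⟨_, h.1⟩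
  rintro (h | ⟨_, _, _, _, _, h, -⟩ | ⟨_, _, _, _, _, _, _, _, h, -⟩ | ⟨P₁, P₂, P₃, hth, h, -⟩)
  · exact h
  · exact (hb h).elim
  · exact (hb h).elim
  · obtain ⟨x, y, W₁, W₂, W₃, hxy, h₁, h₂, h₃, w12, w13, w23, d12, d13, d23⟩ := hth
    exact absurd ⟨_, h₁.isCycleOn h₂ hxy w12 d12⟩ h

end BiasedGraph

section Matroid

variable {α : Type u} {M : Matroid α} [M.Finite] {L E : Set α} {r r' : RankFn α}

theorem IsFrameMatroidal.frameRep [M.Loopless] (h : IsFrameMatroidal M L) :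
    FrameRep M.E (rankFn M) L := by
  obtain ⟨V, Ω, ⟨hE, hC⟩, hL⟩ := h
  have hΩ : ∀ e x, Ω.graph.IsLink e x x → {e} ∉ Ω.balanced := by
    intro e x hl hb
    have h1 := (hC {e}).2 (Or.inl hb)
    exact M.not_isLoop e (Matroid.singleton_isCircuit.1 h1)
  have hF := Ω.framing hΩ
  have hr : ∀ X ⊆ M.E, rankFn M X = Ω.rankFn.edge X := fun X hX =>
    rankFn_eq (fun C => by rw [hC, ← Ω.circ_rankFn_iff hΩ, hE]) hX
  refine FrameRep.of (V := Ω.graph.vertexSet) (ρ := Ω.rankFn) (ι := Sum.inl)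
    (j := fun v => Sum.inr v.1) (fun S => ?_) hr (fun e he => ?_) (fun e he => ?_)
  · rw [← image_image Sum.inr Subtype.val, hF.joints _ (by simp),
      ncard_image_of_injective _ Subtype.val_injective]
  · rw [← hE] at he
    obtain ⟨x, y, hl⟩ := Graph.exists_isLink_of_mem_edgeSet he
    exact ⟨⟨x, hl.left_mem⟩, ⟨y, hl.right_mem⟩, hF.mem_cl hl⟩
  · obtain ⟨⟨x, hl⟩, -⟩ := hL e he
    refine ⟨⟨x, Graph.IsLink.left_mem hl⟩, ?_⟩
    simpa using hF.mem_cl hl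

/-- The incidence vector of an edge with given ends. -/
noncomputable def edgeVec {V : Type*} (p q : V) : V → ZMod 2 :=
  open Classical in fun u => (if u = p then 1 else 0) + (if u = q then 1 else 0)

/-- The matroid on `E` with rank function `r` is represented by incidence vectors of a graph. -/
def GraphicRep (E : Set α) (r : RankFn α) : Prop :=
  ∃ (V : Type u) (_ : Finite V) (p q : α → V),
    ∀ X ⊆ E, r X = RankFn.lin (ZMod 2) (fun e => edgeVec (p e) (q e)) X

theorem ite_congr_iff {p q : Prop} {_ : Decidable p} {_ : Decidable q} (h : p ↔ q) :
    (if p then (1 : ZMod 2) else 0) = if q then 1 else 0 := by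
  simp only [h]

theorem unitVec_add_unitVec {V : Type*} {G : Graph V α} (x y : G.vertexSet) :
    unitVec G x.1 + unitVec G y.1 = edgeVec x y := by
  ext u
  simp only [unitVec, edgeVec, Pi.add_apply]
  congr 1 <;> exact ite_congr_iff Subtype.coe_inj

theorem image_edgeVec {V : Type*} {G : Graph V α} {p q : α → G.vertexSet} {X : Set α}
    (h : ∀ e ∈ X, G.IsLink e (p e) (q e)) :
    (fun e => edgeVec (p e) (q e)) '' X = linkVecs G X := by
  classical
  have : ∀ e, edgeVec (p e) (q e) = unitVec G (p e).1 + unitVec G (q e).1 := fun e =>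
    (unitVec_add_unitVec _ _).symm
  ext w
  constructor
  · rintro ⟨e, he, rfl⟩
    exact ⟨e, he, p e, q e, h e he, this e⟩
  · rintro ⟨e, he, x, y, hl, rfl⟩
    refine ⟨e, he, ?_⟩
    dsimp only
    rw [this]
    rcases hl.eq_and_eq_or_eq_and_eq (h e he) with ⟨h1, h2⟩ | ⟨h1, h2⟩
    · rw [h1, h2]
    · rw [h1, h2, add_comm]

/-- With all cycles balanced, edges contribute no root vertices, and the flat is just the span of
the incidence vectors: the cycle matroid is binary. -/
theorem ofGraph_rankFn {V : Type v} {G : Graph V α} (hV : G.vertexSet.Finite)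
    (hE : G.edgeSet.Finite) [Finite G.vertexSet] {p q : α → G.vertexSet}
    (h : ∀ e ∈ G.edgeSet, G.IsLink e (p e) (q e)) {X : Set α} (hX : X ⊆ G.edgeSet) :
    (BiasedGraph.ofGraph G hV hE).rankFn.edge X =
      RankFn.lin (ZMod 2) (fun e => edgeVec (p e) (q e)) X := by
  rw [RankFn.lin_apply, image_edgeVec fun e he => h e (hX he), RankFn.edge_apply,
    BiasedGraph.rankFn_apply, BiasedGraph.flat_of_forall_balanced (by exact fun C _ hC => hC)]
  rfl

theorem IsGraphic.graphicRep [M.Loopless] (h : IsGraphic M) : GraphicRep M.E (rankFn M) := by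
  obtain ⟨V, G, hV, hE, hC⟩ := h
  have hEf : G.edgeSet.Finite := hE ▸ M.ground_finite
  have : Finite G.vertexSet := hV
  have hloop : ∀ e x, ¬ G.IsLink e x x := by
    intro e x hl
    have h1 := (hC {e}).2 ⟨{x}, x, x, ∅, e, .nil hl.left_mem, hl, by simp, by simp⟩
    exact M.not_isLoop e (Matroid.singleton_isCircuit.1 h1)
  rcases M.E.eq_empty_or_nonempty with h0 | ⟨e₀, he₀⟩
  · refine ⟨PUnit, inferInstance, fun _ => ⟨⟩, fun _ => ⟨⟩, fun X hX => ?_⟩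
    rw [h0, subset_empty_iff] at hX
    simp [hX]
  have hends : ∀ e, ∃ x y : G.vertexSet, e ∈ G.edgeSet → G.IsLink e x y := by
    intro e
    by_cases he : e ∈ G.edgeSet
    · obtain ⟨x, y, hl⟩ := Graph.exists_isLink_of_mem_edgeSet he
      exact ⟨⟨x, hl.left_mem⟩, ⟨y, hl.right_mem⟩, fun _ => hl⟩
    · rw [← hE] at he₀
      obtain ⟨x, y, hl⟩ := Graph.exists_isLink_of_mem_edgeSet he₀
      exact ⟨⟨x, hl.left_mem⟩, ⟨y, hl.right_mem⟩, fun h => absurd h he⟩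
  choose p q hpq using hends
  refine ⟨G.vertexSet, hV, p, q, fun X hX => ?_⟩
  rw [← ofGraph_rankFn hV hEf hpq (hE ▸ hX)]
  refine rankFn_eq (fun C => ?_) hX
  have := (BiasedGraph.ofGraph G hV hEf).circ_rankFn_iff
    (fun e x hl => absurd hl (hloop e x)) (C := C)
  rw [hC, ← BiasedGraph.isFrameCircuit_ofGraph (hV := hV) (hE := hEf), ← this, ← hE]
  rfl

theorem edgeVec_self {V : Type*} (p : V) : edgeVec p p = 0 := by
  ext u
  exact zmod2_add_self _

theorem GraphicRep.isGraphic [M.Loopless] (h : GraphicRep M.E (rankFn M)) : IsGraphic M := by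
  obtain ⟨V, hV, p, q, hr⟩ := h
  let G : Graph V α :=
    { vertexSet := univ
      IsLink := fun e x y => e ∈ M.E ∧ ((p e = x ∧ q e = y) ∨ (p e = y ∧ q e = x))
      isLink_symm := fun e he => ⟨fun x y h => ⟨h.1, h.2.symm⟩⟩
      eq_or_eq_of_isLink_of_isLink := by
        rintro e x y v w ⟨-, ⟨rfl, rfl⟩ | ⟨rfl, rfl⟩⟩ ⟨-, ⟨rfl, rfl⟩ | ⟨rfl, rfl⟩⟩ <;> simp
      left_mem_of_isLink := fun _ _ _ _ => mem_univ _ }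
  have hE : G.edgeSet = M.E := by
    ext e
    exact ⟨fun ⟨x, y, h, _⟩ => h, fun h => ⟨_, _, h, Or.inl ⟨rfl, rfl⟩⟩⟩
  have hVf : G.vertexSet.Finite := toFinite _
  have hEf : G.edgeSet.Finite := hE ▸ M.ground_finite
  have hloop : ∀ e x, ¬ G.IsLink e x x := by
    rintro e x ⟨he, h⟩
    have h1 := hr {e} (by simpa using he)
    obtain ⟨rfl, h2⟩ : p e = x ∧ q e = p e := by
      rcases h with ⟨rfl, h⟩ | ⟨rfl, h⟩
      exacts [⟨rfl, h⟩, ⟨rfl, h⟩]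
    rw [rankFn_singleton he, RankFn.lin_apply, image_singleton, h2, edgeVec_self] at h1
    rw [Submodule.span_zero_singleton, finrank_bot] at h1
    norm_num at h1
  have hr' : ∀ X ⊆ M.E, rankFn M X = (BiasedGraph.ofGraph G hVf hEf).rankFn.edge X := by
    intro X hX
    rw [hr X hX]
    have := ofGraph_rankFn hVf hEf (p := fun e => ⟨p e, mem_univ _⟩)
      (q := fun e => ⟨q e, mem_univ _⟩)
      (fun e he => ⟨hE ▸ he, Or.inl ⟨rfl, rfl⟩⟩) (hE ▸ hX)
    rw [this]
    refine RankFn.lin_map (f := fun e => edgeVec (p e) (q e)) (S := ⊤)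
      (φ := LinearMap.funLeft (ZMod 2) (ZMod 2) Subtype.val) (fun _ _ => trivial) (fun w _ hw => ?_) ?_
    · ext u
      exact congrFun hw ⟨u, mem_univ _⟩
    · intro e _
      ext u
      simp only [edgeVec, LinearMap.funLeft_apply]
      congr 1 <;> exact ite_congr_iff Subtype.ext_iff
  refine ⟨V, G, hVf, hE, fun C => ?_⟩
  have := (BiasedGraph.ofGraph G hVf hEf).circ_rankFn_iff
    (fun e x hl => absurd hl (hloop e x)) (C := C)
  rw [isCircuit_iff_of_rankFn_eq hr', ← BiasedGraph.isFrameCircuit_ofGraph (hV := hVf) (hE := hEf),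
    ← this, ← hE]
  rfl

end Matroid

end FrameMatroids

namespace FrameMatroids

universe u v

/-! ### Gluing rank functions along a modular flat -/

namespace RankFn

section Glue

variable {γ₁ γ₂ T : Type*} (ρ₁ : RankFn γ₁) (ρ₂ : RankFn γ₂) (t₁ : T → γ₁) (t₂ : T → γ₂)

/-- The elements of the common restriction spanned by a set. -/
def trace (Z : Set γ₁) : Set T := {t | t₁ t ∈ ρ₁.cl Z}

variable {ρ₁ ρ₂ t₁ t₂} {Z Z' : Set γ₁} {X : Set (γ₁ ⊕ γ₂)} {Y : Set γ₂}

theorem trace_mono (h : Z ⊆ Z') : ρ₁.trace t₁ Z ⊆ ρ₁.trace t₁ Z' := fun _ ht => ρ₁.cl_mono h ht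

/-- Enlarging `Z` raises the rank in the second part by at most the growth of the trace, by
submodularity. Modularity says that this growth is what the first summand loses, so the glued rank
grows no faster than `ρ₁`. -/
theorem trace_increment (hm : ∀ Z, ρ₁ Z + ρ₁ (range t₁) = ρ₁ (Z ∪ range t₁) + ρ₁ (t₁ '' ρ₁.trace t₁ Z))
    (h12 : ∀ S, ρ₁ (t₁ '' S) = ρ₂ (t₂ '' S)) (h : Z ⊆ Z') (Y : Set γ₂) :
    ρ₁ (Z' ∪ range t₁) + ρ₂ (Y ∪ t₂ '' ρ₁.trace t₁ Z') + ρ₁ Z ≤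
      ρ₁ (Z ∪ range t₁) + ρ₂ (Y ∪ t₂ '' ρ₁.trace t₁ Z) + ρ₁ Z' := by
  have h1 := hm Z
  have h2 := hm Z'
  have h3 := ρ₂.submod_of_subset (X := Y ∪ t₂ '' ρ₁.trace t₁ Z) (Y := t₂ '' ρ₁.trace t₁ Z')
    (Z := t₂ '' ρ₁.trace t₁ Z) (W := Y ∪ t₂ '' ρ₁.trace t₁ Z') subset_union_right
    (image_mono (trace_mono h)) (union_subset (subset_union_left.trans subset_union_left)
      subset_union_right)
  rw [← h12, ← h12] at h3
  linarith

variable (ρ₁ ρ₂ t₁ t₂) in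
/-- The generalized parallel connection of two rank functions that agree on a common restriction,
which is modular in the first one. -/
def glue (hm : ∀ Z, ρ₁ Z + ρ₁ (range t₁) = ρ₁ (Z ∪ range t₁) + ρ₁ (t₁ '' ρ₁.trace t₁ Z))
    (h12 : ∀ S, ρ₁ (t₁ '' S) = ρ₂ (t₂ '' S)) : RankFn (γ₁ ⊕ γ₂) where
  r X := ρ₁ (Sum.inl ⁻¹' X ∪ range t₁) - ρ₁ (range t₁) +
    ρ₂ (Sum.inr ⁻¹' X ∪ t₂ '' ρ₁.trace t₁ (Sum.inl ⁻¹' X))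
  empty' := by
    have h0 : ρ₁ (t₁ '' ρ₁.trace t₁ ∅) = 0 := by
      have h1 := ρ₁.rank_le_of_subset_cl (X := ∅) (Y := t₁ '' ρ₁.trace t₁ ∅) (by
        rintro _ ⟨t, ht, rfl⟩
        exact ht)
      have h2 := ρ₁.nonneg (t₁ '' ρ₁.trace t₁ ∅)
      rw [ρ₁.empty] at h1
      linarith
    simp [← h12, h0]
  mono' X Y h := by
    have h1 := ρ₁.mono (union_subset_union_left (range t₁) (preimage_mono (f := Sum.inl) h))
    have h2 := ρ₂.mono (union_subset_union (preimage_mono (f := Sum.inr) h)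
      (image_mono (f := t₂) (trace_mono (ρ₁ := ρ₁) (t₁ := t₁) (preimage_mono (f := Sum.inl) h))))
    linarith
  unit' x X := by
    rcases x with x | x
    · have e1 : (Sum.inl ⁻¹' insert (Sum.inl x) X : Set γ₁) = insert x (Sum.inl ⁻¹' X) := by
        ext; simp
      have e2 : (Sum.inr ⁻¹' insert (Sum.inl x) X : Set γ₂) = Sum.inr ⁻¹' X := by
        ext; simp
      have h1 := trace_increment hm h12 (subset_insert x (Sum.inl ⁻¹' X)) (Sum.inr ⁻¹' X)
      have h2 := ρ₁.insert_le x (Sum.inl ⁻¹' X)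
      rw [e1, e2]
      linarith
    · have e1 : (Sum.inl ⁻¹' insert (Sum.inr x) X : Set γ₁) = Sum.inl ⁻¹' X := by
        ext; simp
      have e2 : (Sum.inr ⁻¹' insert (Sum.inr x) X : Set γ₂) = insert x (Sum.inr ⁻¹' X) := by
        ext; simp
      have h2 := ρ₂.insert_le x (Sum.inr ⁻¹' X ∪ t₂ '' ρ₁.trace t₁ (Sum.inl ⁻¹' X))
      rw [e1, e2, insert_union]
      linarith
  loc' X Y h := by
    set Z := Sum.inl ⁻¹' X with hZ
    set Y₁ := Sum.inl ⁻¹' Y with hY₁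
    set C := ρ₂.cl (Sum.inr ⁻¹' X ∪ t₂ '' ρ₁.trace t₁ Z) with hC
    -- The elements of the common restriction that become available from the second side. Everything
    -- added from `Y` is shown to be spanned on the first side by `Z` and these, and on the second
    -- side by `C`.
    set T' : Set T := {t | t₂ t ∈ C} with hT'
    have hτ : ρ₁.trace t₁ Z ⊆ T' := fun t ht => ρ₂.subset_cl _ (Or.inr (mem_image_of_mem _ ht))
    have hY2 : Sum.inr ⁻¹' Y ⊆ C := by
      intro y hy
      have := h (Sum.inr y) hy
      have e1 : (Sum.inl ⁻¹' insert (Sum.inr y) X : Set γ₁) = Sum.inl ⁻¹' X := by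
        ext; simp
      have e2 : (Sum.inr ⁻¹' insert (Sum.inr y) X : Set γ₂) = insert y (Sum.inr ⁻¹' X) := by
        ext; simp
      rw [e1, e2, insert_union] at this
      rw [hC, mem_cl]
      linarith
    -- Since neither summand grows, the trace of `Z` with `z` stays in `T'`. If the trace gained an
    -- element, `z` could be exchanged for it; if it did not, modularity would make the first
    -- summand grow.
    have hstep : ∀ z ∈ Y₁, z ∈ ρ₁.cl (Z ∪ t₁ '' T') := by
      intro z hz
      have h0 := h (Sum.inl z) hz
      have e1 : (Sum.inl ⁻¹' insert (Sum.inl z) X : Set γ₁) = insert z (Sum.inl ⁻¹' X) := by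
        ext; simp
      have e2 : (Sum.inr ⁻¹' insert (Sum.inl z) X : Set γ₂) = Sum.inr ⁻¹' X := by
        ext; simp
      rw [e1, e2, ← hZ] at h0
      have h1 := ρ₁.mono (union_subset_union_left (range t₁) (subset_insert z Z))
      have h2 := ρ₂.mono (union_subset_union_right (Sum.inr ⁻¹' X)
        (image_mono (f := t₂) (trace_mono (ρ₁ := ρ₁) (t₁ := t₁) (subset_insert z Z))))
      have hT : ρ₁.trace t₁ (insert z Z) ⊆ T' := by
        have := ρ₂.subset_cl_of_rank_le (union_subset_union_right (Sum.inr ⁻¹' X)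
          (image_mono (f := t₂) (trace_mono (ρ₁ := ρ₁) (t₁ := t₁) (subset_insert z Z)))) (by linarith)
        exact fun t ht => this (Or.inr (mem_image_of_mem _ ht))
      by_cases hzc : z ∈ ρ₁.cl Z
      · exact ρ₁.cl_mono subset_union_left hzc
      · by_contra hcon
        have h3 : ρ₁.trace t₁ (insert z Z) ⊆ ρ₁.trace t₁ Z := by
          intro t ht
          by_contra hn
          refine hcon (ρ₁.cl_mono ?_ (ρ₁.exchange ht hn))
          exact insert_subset (Or.inr (mem_image_of_mem _ (hT ht))) subset_union_left
        have h4 := ρ₁.mono (image_mono (f := t₁) h3)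
        have h5 := hm Z
        have h6 := hm (insert z Z)
        have h7 := ρ₁.notMem_cl.1 hzc
        linarith
    -- By modularity, adding `T'` to `Z` raises the rank of the trace only to that of `T'`, and `T'`
    -- is closed within the second side.
    have hT'cl : ρ₁.trace t₁ (Z ∪ t₁ '' T') ⊆ T' := by
      have h1 := hm Z
      have h2 := hm (Z ∪ t₁ '' T')
      have e : Z ∪ t₁ '' T' ∪ range t₁ = Z ∪ range t₁ := by
        rw [union_assoc, union_eq_self_of_subset_left (image_subset_range _ _)]
      have h3 := ρ₁.submod_of_subset (X := Z ∪ t₁ '' ρ₁.trace t₁ Z) (Y := t₁ '' T')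
        (Z := t₁ '' ρ₁.trace t₁ Z) (W := Z ∪ t₁ '' T') subset_union_right (image_mono hτ)
        (union_subset (subset_union_left.trans subset_union_left) subset_union_right)
      have h4 : ρ₁ (Z ∪ t₁ '' ρ₁.trace t₁ Z) = ρ₁ Z := ρ₁.rank_union_of_subset_cl (by
        rintro _ ⟨t, ht, rfl⟩
        exact ht)
      rw [e] at h2
      have h5 : T' ⊆ ρ₁.trace t₁ (Z ∪ t₁ '' T') := fun t ht =>
        ρ₁.subset_cl _ (Or.inr (mem_image_of_mem _ ht))
      have h6 := ρ₂.subset_cl_of_rank_le (image_mono (f := t₂) h5) (by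
        rw [← h12, ← h12]
        linarith)
      intro t ht
      have h7 := h6 (mem_image_of_mem _ ht)
      rw [hT', mem_ofPred_eq, hC, ← ρ₂.cl_cl]
      refine ρ₂.cl_mono ?_ h7
      rintro _ ⟨s, hs, rfl⟩
      exact hs
    have e1 : ρ₁ (Z ∪ Y₁ ∪ range t₁) = ρ₁ (Z ∪ range t₁) := by
      refine ρ₁.rank_eq_of_subset_cl (union_subset_union_left _ subset_union_left) ?_
      refine union_subset (union_subset ?_ ?_) ?_
      · exact subset_union_left.trans (ρ₁.subset_cl _)
      · exact fun z hz => ρ₁.cl_mono (union_subset_union_right _ (image_subset_range _ _))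
          (hstep z hz)
      · exact subset_union_right.trans (ρ₁.subset_cl _)
    have e2 : ρ₂ (Sum.inr ⁻¹' X ∪ Sum.inr ⁻¹' Y ∪ t₂ '' ρ₁.trace t₁ (Z ∪ Y₁)) =
        ρ₂ (Sum.inr ⁻¹' X ∪ t₂ '' ρ₁.trace t₁ Z) := by
      refine ρ₂.rank_eq_of_subset_cl (union_subset_union subset_union_left
        (image_mono (trace_mono subset_union_left))) ?_
      refine union_subset (union_subset ?_ hY2) ?_
      · exact subset_union_left.trans (ρ₂.subset_cl _)
      · rintro _ ⟨t, ht, rfl⟩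
        refine hT'cl (ρ₁.cl_subset_cl (union_subset ?_ fun z hz => hstep z hz) ht)
        exact subset_union_left.trans (ρ₁.subset_cl _)
    rw [preimage_union, preimage_union, e1, e2]

variable {hm : ∀ Z, ρ₁ Z + ρ₁ (range t₁) = ρ₁ (Z ∪ range t₁) + ρ₁ (t₁ '' ρ₁.trace t₁ Z)}
    {h12 : ∀ S, ρ₁ (t₁ '' S) = ρ₂ (t₂ '' S)}

theorem glue_apply (Z : Set γ₁) (Y : Set γ₂) :
    glue ρ₁ ρ₂ t₁ t₂ hm h12 (Sum.inl '' Z ∪ Sum.inr '' Y) =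
      ρ₁ (Z ∪ range t₁) - ρ₁ (range t₁) + ρ₂ (Y ∪ t₂ '' ρ₁.trace t₁ Z) := by
  have e1 : (Sum.inl ⁻¹' (Sum.inl '' Z ∪ Sum.inr '' Y) : Set γ₁) = Z := by ext; simp
  have e2 : (Sum.inr ⁻¹' (Sum.inl '' Z ∪ Sum.inr '' Y) : Set γ₂) = Y := by ext; simp
  change ρ₁ (Sum.inl ⁻¹' (Sum.inl '' Z ∪ Sum.inr '' Y) ∪ range t₁) - _ + ρ₂ (Sum.inr ⁻¹'
    (Sum.inl '' Z ∪ Sum.inr '' Y) ∪ t₂ '' ρ₁.trace t₁ (Sum.inl ⁻¹' (Sum.inl '' Z ∪ Sum.inr '' Y))) = _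
  rw [e1, e2]

theorem glue_apply' (Z : Set γ₁) (Y : Set γ₂) :
    glue ρ₁ ρ₂ t₁ t₂ hm h12 (Sum.inl '' Z ∪ Sum.inr '' Y) =
      ρ₁ Z - ρ₁ (t₁ '' ρ₁.trace t₁ Z) + ρ₂ (Y ∪ t₂ '' ρ₁.trace t₁ Z) := by
  have := hm Z
  rw [glue_apply]
  linarith

theorem glue_inl (Z : Set γ₁) : glue ρ₁ ρ₂ t₁ t₂ hm h12 (Sum.inl '' Z) = ρ₁ Z := by
  have := glue_apply' (hm := hm) (h12 := h12) Z ∅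
  rw [image_empty, union_empty, empty_union, ← h12] at this
  linarith

theorem glue_inr (Y : Set γ₂) : glue ρ₁ ρ₂ t₁ t₂ hm h12 (Sum.inr '' Y) = ρ₂ Y := by
  have h := glue_apply' (hm := hm) (h12 := h12) ∅ Y
  have h0 : ρ₁ (t₁ '' ρ₁.trace t₁ ∅) = 0 := by
    have h1 := ρ₁.rank_le_of_subset_cl (X := ∅) (Y := t₁ '' ρ₁.trace t₁ ∅) (by
      rintro _ ⟨t, ht, rfl⟩
      exact ht)
    have h2 := ρ₁.nonneg (t₁ '' ρ₁.trace t₁ ∅)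
    rw [ρ₁.empty] at h1
    linarith
  have h1 := ρ₂.union_le Y (t₂ '' ρ₁.trace t₁ ∅)
  have h2 := ρ₂.mono (subset_union_left (s := Y) (t := t₂ '' ρ₁.trace t₁ ∅))
  rw [← h12] at h1
  rw [image_empty, empty_union, ρ₁.empty] at h
  linarith

theorem glue_mem_inl {x : γ₁} (h : x ∈ ρ₁.cl Z) :
    Sum.inl x ∈ (glue ρ₁ ρ₂ t₁ t₂ hm h12).cl (Sum.inl '' Z) := by
  rw [mem_cl, ← image_insert_eq, glue_inl, glue_inl]
  exact h

theorem glue_mem_inr {x : γ₂} (h : x ∈ ρ₂.cl Y) :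
    Sum.inr x ∈ (glue ρ₁ ρ₂ t₁ t₂ hm h12).cl (Sum.inr '' Y) := by
  rw [mem_cl, ← image_insert_eq, glue_inr, glue_inr]
  exact h

theorem glue_parallel (t : T) :
    Sum.inl (t₁ t) ∈ (glue ρ₁ ρ₂ t₁ t₂ hm h12).cl {Sum.inr (t₂ t)} := by
  have h1 := glue_apply' (hm := hm) (h12 := h12) {t₁ t} {t₂ t}
  have h2 := glue_inr (hm := hm) (h12 := h12) {t₂ t}
  have h3 : t ∈ ρ₁.trace t₁ {t₁ t} := ρ₁.subset_cl _ rfl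
  rw [image_singleton] at h2
  have e : ({t₂ t} : Set γ₂) ∪ t₂ '' ρ₁.trace t₁ {t₁ t} = t₂ '' ρ₁.trace t₁ {t₁ t} :=
    union_eq_self_of_subset_left (singleton_subset_iff.2 (mem_image_of_mem _ h3))
  rw [e, ← h12, image_singleton, image_singleton, singleton_union] at h1
  have h4 := h12 {t}
  rw [image_singleton, image_singleton] at h4
  rw [mem_cl]
  linarith

/-- When the first set meets the common part at most in the point `t₀`, the gluing rule reduces to
the rank formula of a 2-sum, with one unit lost exactly when both sides span this point. -/
theorem glue_of_trace_subset {t₀ : T} (hZ : ρ₁.trace t₁ Z ⊆ {t₀}) (h1 : ρ₁ {t₁ t₀} = 1) :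
    (t₁ t₀ ∈ ρ₁.cl Z → t₂ t₀ ∈ ρ₂.cl Y →
      glue ρ₁ ρ₂ t₁ t₂ hm h12 (Sum.inl '' Z ∪ Sum.inr '' Y) = ρ₁ Z + ρ₂ Y - 1) ∧
    (¬ (t₁ t₀ ∈ ρ₁.cl Z ∧ t₂ t₀ ∈ ρ₂.cl Y) →
      glue ρ₁ ρ₂ t₁ t₂ hm h12 (Sum.inl '' Z ∪ Sum.inr '' Y) = ρ₁ Z + ρ₂ Y) := by
  rw [glue_apply']
  by_cases h : t₁ t₀ ∈ ρ₁.cl Z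
  · have e : ρ₁.trace t₁ Z = {t₀} := hZ.antisymm (singleton_subset_iff.2 h)
    rw [e, image_singleton, image_singleton, h1, union_singleton]
    refine ⟨fun _ h2 => ?_, fun h2 => ?_⟩
    · rw [ρ₂.mem_cl.1 h2]
      ring
    · rw [ρ₂.notMem_cl.1 fun h' => h2 ⟨h, h'⟩]
      ring
  · have e : ρ₁.trace t₁ Z = ∅ := by
      rw [eq_empty_iff_forall_notMem]
      intro t ht
      obtain rfl : t = t₀ := hZ ht
      exact h ht
    refine ⟨fun h' => absurd h' h, fun _ => ?_⟩
    rw [e]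
    simp

end Glue

end RankFn

/-- The rank function `r` is that of the 2-sum of matroids with rank functions `r₁` and `r₂`,
restricted to the sets `A₁` and `A₂`, on elements that are spanned as described by `p₁`, `p₂`. -/
def TwoSumRank {α : Type u} (A₁ A₂ : Set α) (r r₁ r₂ : Set α → ℤ) (p₁ p₂ : Set α → Prop) : Prop :=
  ∀ U₁ ⊆ A₁, ∀ U₂ ⊆ A₂, (p₁ U₁ → p₂ U₂ → r (U₁ ∪ U₂) = r₁ U₁ + r₂ U₂ - 1) ∧
    (¬ (p₁ U₁ ∧ p₂ U₂) → r (U₁ ∪ U₂) = r₁ U₁ + r₂ U₂)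

/-- The joints of the glued frame are all those of the second frame and those of the first outside
`R`. A joint in `R` is identified through the common part with one of the second frame, so it
remains available for spanning elements. -/
theorem FrameRep.of_glue {α V₁ V₂ : Type u} {γ₁ γ₂ T : Type*} [Finite V₁] [Finite V₂]
    {ρ₁ : RankFn γ₁} {ρ₂ : RankFn γ₂} {t₁ : T → γ₁} {t₂ : T → γ₂}
    (hm : ∀ Z, ρ₁ Z + ρ₁ (range t₁) = ρ₁ (Z ∪ range t₁) + ρ₁ (t₁ '' ρ₁.trace t₁ Z))
    (h12 : ∀ S, ρ₁ (t₁ '' S) = ρ₂ (t₂ '' S)) {j₁ : V₁ → γ₁} {j₂ : V₂ → γ₂}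
    (hj₁ : ∀ S : Set V₁, ρ₁ (j₁ '' S) = S.ncard) (hj₂ : ∀ S : Set V₂, ρ₂ (j₂ '' S) = S.ncard)
    {R : Set V₁} (hR : ∀ w ∈ R, ∃ t w', j₁ w = t₁ t ∧ j₂ w' = t₂ t)
    (hRt : ∀ t, t₁ t ∈ ρ₁.cl (j₁ '' R)) (ht₂ : ∀ t, t₂ t ∈ ρ₂.cl (range j₂))
    {A₁ A₂ L₁ L₂ : Set α} {ι₁ : α → γ₁} {ι₂ : α → γ₂} {t₀ : T} (hA : Disjoint A₁ A₂)
    (hτ : ∀ U ⊆ A₁, ρ₁.trace t₁ (ι₁ '' U) ⊆ {t₀}) (h1 : ρ₁ {t₁ t₀} = 1) {r : RankFn α}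
    (hr : TwoSumRank A₁ A₂ r (fun U => ρ₁ (ι₁ '' U)) (fun U => ρ₂ (ι₂ '' U))
      (fun U => t₁ t₀ ∈ ρ₁.cl (ι₁ '' U)) (fun U => t₂ t₀ ∈ ρ₂.cl (ι₂ '' U)))
    (hE₁ : ∀ e ∈ A₁, ∃ v w, ι₁ e ∈ ρ₁.cl {j₁ v, j₁ w})
    (hE₂ : ∀ e ∈ A₂, ∃ v w, ι₂ e ∈ ρ₂.cl {j₂ v, j₂ w})
    (hL₁ : ∀ e ∈ L₁, e ∈ A₁ ∧ ∃ v, ι₁ e ∈ ρ₁.cl {j₁ v})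
    (hL₂ : ∀ e ∈ L₂, e ∈ A₂ ∧ ∃ v, ι₂ e ∈ ρ₂.cl {j₂ v}) :
    FrameRep (A₁ ∪ A₂) r (L₁ ∪ L₂) := by
  classical
  set F := RankFn.glue ρ₁ ρ₂ t₁ t₂ hm h12 with hF
  let j : ↥(Rᶜ) ⊕ V₂ → γ₁ ⊕ γ₂ := Sum.elim (fun v => Sum.inl (j₁ v.1)) (fun w => Sum.inr (j₂ w))
  let ι : α → γ₁ ⊕ γ₂ := fun e => if e ∈ A₁ then Sum.inl (ι₁ e) else Sum.inr (ι₂ e)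
  have hι₁ : ∀ U ⊆ A₁, ι '' U = Sum.inl '' (ι₁ '' U) := fun U hU => by
    rw [image_image]
    exact image_congr fun e he => if_pos (hU he)
  have hι₂ : ∀ U ⊆ A₂, ι '' U = Sum.inr '' (ι₂ '' U) := fun U hU => by
    rw [image_image]
    exact image_congr fun e he => if_neg fun h => hA.ne_of_mem h (hU he) rfl
  have hjv : ∀ v, ∃ v', Sum.inl (j₁ v) ∈ F.cl {j v'} := by
    intro v
    by_cases hv : v ∈ R
    · obtain ⟨t, w', h1, h2⟩ := hR v hv
      refine ⟨Sum.inr w', ?_⟩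
      rw [h1]
      change _ ∈ F.cl {Sum.inr (j₂ w')}
      rw [h2]
      exact RankFn.glue_parallel t
    · exact ⟨Sum.inl ⟨v, hv⟩, F.subset_cl _ rfl⟩
  -- The common part has rank `R.ncard`, being spanned by the joints in `R` and containing them. So
  -- the first summand counts the joints outside `R` and the second those of `V₂`; full rank then
  -- yields independence and injectivity of `j`.
  have hrange : F (range j) = Nat.card (↥(Rᶜ) ⊕ V₂) := by
    have e : range j = Sum.inl '' (j₁ '' Rᶜ) ∪ Sum.inr '' (range j₂) := by
      ext z
      constructor
      · rintro ⟨⟨v, hv⟩ | w, rfl⟩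
        · exact Or.inl ⟨_, ⟨v, hv, rfl⟩, rfl⟩
        · exact Or.inr ⟨_, ⟨w, rfl⟩, rfl⟩
      · rintro (⟨_, ⟨v, hv, rfl⟩, rfl⟩ | ⟨_, ⟨w, rfl⟩, rfl⟩)
        · exact ⟨Sum.inl ⟨v, hv⟩, rfl⟩
        · exact ⟨Sum.inr w, rfl⟩
    have hRr : j₁ '' R ⊆ range t₁ := by
      rintro _ ⟨w, hw, rfl⟩
      obtain ⟨t, w', h1, h2⟩ := hR w hw
      exact ⟨t, h1.symm⟩
    have e1 : ρ₁ (j₁ '' Rᶜ ∪ range t₁) = Nat.card V₁ := by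
      rw [← ncard_univ, ← hj₁]
      refine ρ₁.rank_congr_cl (union_subset ?_ ?_) ?_
      · exact (image_mono (subset_univ _)).trans (ρ₁.subset_cl _)
      · rintro _ ⟨t, rfl⟩
        exact ρ₁.cl_mono (image_mono (subset_univ _)) (hRt t)
      · rw [← union_compl_self R, image_union, union_comm]
        exact (union_subset_union_right _ hRr).trans (ρ₁.subset_cl _)
    have e2 : ρ₁ (range t₁) = R.ncard := by
      rw [← hj₁]
      refine ρ₁.rank_congr_cl ?_ (hRr.trans (ρ₁.subset_cl _))
      rintro _ ⟨t, rfl⟩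
      exact hRt t
    have e3 : ρ₂ (range j₂ ∪ t₂ '' ρ₁.trace t₁ (j₁ '' Rᶜ)) = Nat.card V₂ := by
      rw [ρ₂.rank_union_of_subset_cl, ← ncard_univ, ← hj₂, image_univ]
      rintro _ ⟨t, -, rfl⟩
      exact ht₂ t
    have e4 := ncard_add_ncard_compl R
    rw [e, hF, RankFn.glue_apply, e1, e2, e3, Nat.card_sum, Nat.card_coe_set_eq]
    push_cast
    have : (R.ncard : ℤ) + Rᶜ.ncard = Nat.card V₁ := by exact_mod_cast e4
    linarith
  have hjF : ∀ S, F (j '' S) = S.ncard := by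
    intro S
    have h2 : j.Injective := by
      by_contra hninj
      have : (range j).ncard < Nat.card (↥(Rᶜ) ⊕ V₂) := by
        rw [← image_univ, ← ncard_univ]
        exact (ncard_image_le (toFinite _)).lt_of_ne fun h =>
          hninj (injOn_univ.1 (injOn_of_ncard_image_eq h))
      have h3 := F.rank_le_ncard (finite_range j)
      omega
    have h1 : F.Ind (range j) := by
      refine ⟨finite_range _, ?_⟩
      rw [hrange, ← image_univ, ncard_image_of_injective _ h2, ncard_univ]
    rw [(h1.subset (image_subset_range j S)).2, ncard_image_of_injective _ h2]
  have sub₁ : ∀ {e B}, ι₁ e ∈ ρ₁.cl B → e ∈ A₁ → ι e ∈ F.cl (Sum.inl '' B) := by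
    intro e B h he
    have : ι e = Sum.inl (ι₁ e) := if_pos he
    rw [this]
    exact RankFn.glue_mem_inl h
  have sub₂ : ∀ {e B}, ι₂ e ∈ ρ₂.cl B → e ∈ A₂ → ι e ∈ F.cl (Sum.inr '' B) := by
    intro e B h he
    have : ι e = Sum.inr (ι₂ e) := if_neg fun h => hA.ne_of_mem h he rfl
    rw [this]
    exact RankFn.glue_mem_inr h
  refine FrameRep.of (ρ := F) (ι := ι) (j := j) hjF ?_ ?_ ?_
  · intro X hX
    have e : X = X ∩ A₁ ∪ X ∩ A₂ := by rw [← inter_union_distrib_left, inter_eq_self_of_subset_left hX]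
    have h2 := hr (X ∩ A₁) inter_subset_right (X ∩ A₂) inter_subset_right
    have h3 := RankFn.glue_of_trace_subset (hm := hm) (h12 := h12) (Y := ι₂ '' (X ∩ A₂))
      (hτ (X ∩ A₁) inter_subset_right) h1
    rw [e, image_union, hι₁ _ inter_subset_right, hι₂ _ inter_subset_right]
    by_cases hc : t₁ t₀ ∈ ρ₁.cl (ι₁ '' (X ∩ A₁)) ∧ t₂ t₀ ∈ ρ₂.cl (ι₂ '' (X ∩ A₂))
    · rw [h2.1 hc.1 hc.2, ← h3.1 hc.1 hc.2]
    · rw [h2.2 hc, ← h3.2 hc]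
  · rintro e (he | he)
    · obtain ⟨v, w, h⟩ := hE₁ e he
      obtain ⟨v', hv⟩ := hjv v
      obtain ⟨w', hw⟩ := hjv w
      refine ⟨v', w', F.cl_subset_cl ?_ (sub₁ h he)⟩
      rintro _ ⟨_, rfl | rfl, rfl⟩
      · exact F.cl_mono (by simp) hv
      · exact F.cl_mono (by simp) hw
    · obtain ⟨v, w, h⟩ := hE₂ e he
      refine ⟨Sum.inr v, Sum.inr w, ?_⟩
      have := sub₂ h he
      rwa [image_pair] at this
  · rintro e (he | he)
    · obtain ⟨he, v, h⟩ := hL₁ e he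
      obtain ⟨v', hv⟩ := hjv v
      refine ⟨v', F.cl_subset_cl ?_ (sub₁ h he)⟩
      rintro _ ⟨_, rfl, rfl⟩
      exact hv
    · obtain ⟨he, v, h⟩ := hL₂ e he
      refine ⟨Sum.inr v, ?_⟩
      have := sub₂ h he
      rwa [image_singleton] at this

end FrameMatroids

namespace FrameMatroids

universe u v

/-! ### 2-sums of frame matroids -/

namespace RankFn

variable {γ γ' : Type*}

theorem modular_point (ρ : RankFn γ) {x : γ} (hx : ρ {x} = 1) (Z : Set γ) :
    ρ Z + ρ (range fun _ : Unit => x) = ρ (Z ∪ range fun _ : Unit => x) +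
      ρ ((fun _ : Unit => x) '' ρ.trace (fun _ : Unit => x) Z) := by
  have e : (range fun _ : Unit => x) = {x} := range_const
  rw [e, hx, union_singleton]
  by_cases h : x ∈ ρ.cl Z
  · have : (fun _ : Unit => x) '' ρ.trace (fun _ : Unit => x) Z = {x} := by
      ext y
      simp [trace, h, eq_comm]
    rw [this, hx, ρ.mem_cl.1 h]
  · have : (fun _ : Unit => x) '' ρ.trace (fun _ : Unit => x) Z = ∅ := by
      ext y
      simp [trace, h]
    rw [this, ρ.notMem_cl.1 h, empty, add_zero]

theorem mem_cl_congr_of_parallel (ρ : RankFn γ) {x y : γ} (h : x ∈ ρ.cl {y}) (h' : y ∈ ρ.cl {x})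
    (Z : Set γ) : x ∈ ρ.cl Z ↔ y ∈ ρ.cl Z :=
  ⟨fun hx => ρ.cl_subset_cl (singleton_subset_iff.2 hx) h',
    fun hy => ρ.cl_subset_cl (singleton_subset_iff.2 hy) h⟩

/-- On three points of which any two span a line, the rank depends only on whether a set has none,
one or more of them. -/
theorem eq_of_line {σ : RankFn (Fin 3)} {σ' : RankFn (Fin 3)} (h1 : ∀ i, σ {i} = 1)
    (h1' : ∀ i, σ' {i} = 1) (h2 : ∀ i j, i ≠ j → 2 ≤ σ {i, j}) (h2' : ∀ i j, i ≠ j → 2 ≤ σ' {i, j})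
    (h3 : σ univ ≤ 2) (h3' : σ' univ ≤ 2) (S : Set (Fin 3)) : σ S = σ' S := by
  rcases S.eq_empty_or_nonempty with rfl | ⟨i, hi⟩
  · simp
  by_cases h : ∃ j ∈ S, i ≠ j
  · obtain ⟨j, hj, hij⟩ := h
    have a1 := h2 i j hij
    have a2 := h2' i j hij
    have a3 := σ.mono (pair_subset hi hj)
    have a4 := σ'.mono (pair_subset hi hj)
    have a5 := σ.mono (subset_univ S)
    have a6 := σ'.mono (subset_univ S)
    linarith
  · push Not at h
    have : S = {i} := by
      ext j
      exact ⟨fun hj => (h j hj).symm, fun hj => (mem_singleton_iff.1 hj) ▸ hi⟩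
    rw [this, h1, h1']

/-- If the family `t` runs through all nonzero vectors of a subspace, the trace of `Z` spans the
whole intersection of the span of `Z` with it. Modularity is then the dimension formula. -/
theorem modular_lin {K W T : Type*} [Field K] [AddCommGroup W] [Module K W]
    [FiniteDimensional K W] {t : T → W} {U : Submodule K W}
    (hU : ∀ w, w ∈ U ↔ w = 0 ∨ ∃ i, t i = w) (Z : Set W) :
    lin K id Z + lin K id (range t) = lin K id (Z ∪ range t) +
      lin K id (t '' (lin K (id : W → W)).trace t Z) := by
  have e1 : Submodule.span K (range t) = U := by
    refine le_antisymm (Submodule.span_le.2 ?_) fun w hw => ?_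
    · rintro _ ⟨i, rfl⟩
      exact (hU _).2 (Or.inr ⟨i, rfl⟩)
    · rcases (hU w).1 hw with rfl | ⟨i, rfl⟩
      · exact Submodule.zero_mem _
      · exact Submodule.subset_span ⟨i, rfl⟩
  have e2 : Submodule.span K (t '' (lin K (id : W → W)).trace t Z) = Submodule.span K Z ⊓ U := by
    refine le_antisymm (Submodule.span_le.2 ?_) fun w hw => ?_
    · rintro _ ⟨i, hi, rfl⟩
      refine ⟨?_, (hU _).2 (Or.inr ⟨i, rfl⟩)⟩
      have := (mem_cl_lin K id).1 hi
      rwa [image_id] at this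
    · rcases (hU w).1 hw.2 with rfl | ⟨i, rfl⟩
      · exact Submodule.zero_mem _
      · refine Submodule.subset_span ⟨i, (mem_cl_lin K id).2 ?_, rfl⟩
        rw [image_id]
        exact hw.1
  rw [lin_apply, lin_apply, lin_apply, lin_apply, image_id, image_id, image_id, image_id, e1, e2,
    Submodule.span_union, e1]
  exact_mod_cast (Submodule.finrank_sup_add_finrank_inf_eq _ _).symm

end RankFn

section

variable {α : Type u} {A₁ A₂ L₁ L₂ E : Set α} {e₁ e₂ e : α} {r r₁ r₂ : RankFn α}

theorem mem_cl_iff_of_rank_eq {V : Type*} {ρ : RankFn (α ⊕ V)} {A U : Set α}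
    (h : ∀ X ⊆ insert e A, r X = ρ (Sum.inl '' X)) (hU : U ⊆ A) :
    e ∈ r.cl U ↔ Sum.inl e ∈ ρ.cl (Sum.inl '' U) := by
  rw [RankFn.mem_cl, RankFn.mem_cl, h _ (insert_subset_insert hU),
    h _ (hU.trans (subset_insert _ _)), image_insert_eq]

/-- Each basepoint is parallel to a joint, and a single point is always modular. So the frames can
be glued at these two joints, which become one. -/
theorem FrameRep.parallel (h₁ : FrameRep (insert e₁ A₁) r₁ (insert e₁ L₁))
    (h₂ : FrameRep (insert e₂ A₂) r₂ (insert e₂ L₂)) (hA : Disjoint A₁ A₂) (hL₁ : L₁ ⊆ A₁)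
    (hL₂ : L₂ ⊆ A₂) (he₁ : r₁ {e₁} = 1) (he₂ : r₂ {e₂} = 1)
    (hr : TwoSumRank A₁ A₂ r r₁ r₂ (fun U => e₁ ∈ r₁.cl U) (fun U => e₂ ∈ r₂.cl U)) :
    FrameRep (A₁ ∪ A₂) r (L₁ ∪ L₂) := by
  obtain ⟨V₁, _, ρ₁, j₁, q₁, E₁, l₁⟩ := h₁
  obtain ⟨V₂, _, ρ₂, j₂, q₂, E₂, l₂⟩ := h₂
  have s₁ : A₁ ⊆ insert e₁ A₁ := subset_insert _ _
  have s₂ : A₂ ⊆ insert e₂ A₂ := subset_insert _ _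
  obtain ⟨v₁, hv₁⟩ := l₁ e₁ (mem_insert _ _)
  obtain ⟨v₂, hv₂⟩ := l₂ e₂ (mem_insert _ _)
  have hv₁' := ρ₁.parallel_symm hv₁ (by
    rw [← image_singleton, ← q₁ _ (by simp), he₁])
  have hv₂' := ρ₂.parallel_symm hv₂ (by
    rw [← image_singleton, ← q₂ _ (by simp), he₂])
  have o₁ : ρ₁ {Sum.inr v₁} = 1 := by simpa using j₁ {v₁}
  have o₂ : ρ₂ {Sum.inr v₂} = 1 := by simpa using j₂ {v₂}
  have m₁ : ∀ U ⊆ A₁, (e₁ ∈ r₁.cl U ↔ Sum.inr v₁ ∈ ρ₁.cl (Sum.inl '' U)) := fun U hU => by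
    rw [mem_cl_iff_of_rank_eq q₁ hU, ρ₁.mem_cl_congr_of_parallel hv₁ hv₁']
  have m₂ : ∀ U ⊆ A₂, (e₂ ∈ r₂.cl U ↔ Sum.inr v₂ ∈ ρ₂.cl (Sum.inl '' U)) := fun U hU => by
    rw [mem_cl_iff_of_rank_eq q₂ hU, ρ₂.mem_cl_congr_of_parallel hv₂ hv₂']
  refine FrameRep.of_glue (T := Unit) (t₁ := fun _ => Sum.inr v₁) (t₂ := fun _ => Sum.inr v₂)
    (ρ₁ := ρ₁) (ρ₂ := ρ₂) (ι₁ := Sum.inl) (ι₂ := Sum.inl) (R := {v₁}) (t₀ := ())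
    (ρ₁.modular_point o₁) ?_ j₁ j₂ ?_ ?_ ?_ hA (fun _ _ _ _ => rfl) o₁ ?_
    (fun e he => E₁ e (s₁ he)) (fun e he => E₂ e (s₂ he))
    (fun e he => ⟨hL₁ he, l₁ e (Or.inr he)⟩) (fun e he => ⟨hL₂ he, l₂ e (Or.inr he)⟩)
  · intro S
    rcases S.eq_empty_or_nonempty with rfl | hS
    · simp
    · rw [hS.image_const, hS.image_const, o₁, o₂]
  · rintro _ rfl
    exact ⟨(), v₂, rfl, rfl⟩
  · exact fun _ => ρ₁.mem_cl_of_mem (by simp)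
  · exact fun _ => ρ₂.mem_cl_of_mem (by simp)
  · intro U₁ hU₁ U₂ hU₂
    have h := hr U₁ hU₁ U₂ hU₂
    simp only [m₁ U₁ hU₁, m₂ U₂ hU₂, q₁ U₁ (hU₁.trans s₁), q₂ U₂ (hU₂.trans s₂)] at h
    exact h

end

/-! #### Graphic matroids -/

section

open Classical in
/-- The unit vector of a vertex. -/
noncomputable def pointVec {V : Type*} (v : V) : V → ZMod 2 := fun u => if u = v then 1 else 0

variable {V : Type*} {p q a b u v w : V}

theorem edgeVec_eq (p q : V) : edgeVec p q = pointVec p + pointVec q := rfl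

theorem pointVec_self (v : V) : pointVec v v = 1 := if_pos rfl

theorem pointVec_of_ne (h : u ≠ v) : pointVec v u = 0 := if_neg h

theorem edgeVec_ne_zero (h : p ≠ q) : edgeVec p q ≠ 0 := fun h0 => by
  have := congrFun h0 p
  rw [edgeVec_eq, Pi.add_apply, pointVec_self, pointVec_of_ne h] at this
  simp at this

theorem pointVec_ne_zero (p : V) : pointVec p ≠ 0 := fun h0 => by
  have := congrFun h0 p
  rw [pointVec_self] at this
  simp at this

theorem edgeVec_add (p q u : V) : edgeVec p u + edgeVec q u = edgeVec p q := by
  rw [edgeVec_eq, edgeVec_eq, edgeVec_eq]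
  have : pointVec p + pointVec u + (pointVec q + pointVec u) =
    pointVec p + pointVec q + (pointVec u + pointVec u) := by abel
  rw [this, zmod2_add_self, add_zero]

theorem edgeVec_comm (p q : V) : edgeVec p q = edgeVec q p := by
  rw [edgeVec_eq, edgeVec_eq, add_comm]

theorem pointVec_apply_eq_one : pointVec v w = 1 ↔ v = w := by
  constructor
  · intro h
    by_contra hne
    rw [pointVec_of_ne (Ne.symm hne)] at h
    simp at h
  · rintro rfl
    exact pointVec_self _

variable [Finite V]

/-- The sum of the coordinates of a vector. -/
theorem exists_coordSum (V : Type*) [Finite V] : ∃ φ : (V → ZMod 2) →ₗ[ZMod 2] ZMod 2,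
    ∀ v, φ (pointVec v) = 1 := by
  classical
  have := Fintype.ofFinite V
  refine ⟨∑ u, LinearMap.proj u, fun v => ?_⟩
  rw [LinearMap.sum_apply, Finset.sum_eq_single v]
  · exact pointVec_self v
  · exact fun u _ hu => pointVec_of_ne hu
  · simp

/-- The sum of the coordinates vanishes on edge vectors but not on unit vectors. -/
theorem pointVec_notMem_span {α : Type*} (p q : α → V) (U : Set α) (v : V) :
    pointVec v ∉ Submodule.span (ZMod 2) ((fun e => edgeVec (p e) (q e)) '' U) := by
  obtain ⟨φ, hφ⟩ := exists_coordSum V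
  have h : Submodule.span (ZMod 2) ((fun e => edgeVec (p e) (q e)) '' U) ≤ LinearMap.ker φ := by
    rw [Submodule.span_le]
    rintro _ ⟨e, -, rfl⟩
    rw [SetLike.mem_coe, LinearMap.mem_ker]
    change φ (edgeVec (p e) (q e)) = 0
    rw [edgeVec_eq, map_add, hφ, hφ]
    exact zmod2_add_self _
  intro hv
  have := h hv
  rw [LinearMap.mem_ker, hφ] at this
  simp at this

theorem rank_image_of_separated {V' : Type*} [Finite V'] (x : V' → (V → ZMod 2)) (c : V' → V)
    (hx : ∀ v w, x v (c w) = 1 ↔ v = w) (S : Set V') :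
    RankFn.lin (ZMod 2) id (x '' S) = S.ncard := by
  have h1 : (RankFn.lin (ZMod 2) x).Ind S := by
    refine RankFn.ind_of_forall_notMem _ fun v hv hcl => ?_
    rw [RankFn.mem_cl_lin] at hcl
    have : Submodule.span (ZMod 2) (x '' (S \ {v})) ≤
        LinearMap.ker (LinearMap.proj (R := ZMod 2) (φ := fun _ => ZMod 2) (c v)) := by
      rw [Submodule.span_le]
      rintro _ ⟨w, hw, rfl⟩
      have h1 : x w (c v) ≠ 1 := fun h => hw.2 ((hx w v).1 h)
      have h2 : ∀ z : ZMod 2, z ≠ 1 → z = 0 := by decide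
      exact h2 _ h1
    have h2 := this hcl
    rw [LinearMap.mem_ker, LinearMap.proj_apply, (hx v v).2 rfl] at h2
    simp at h2
  have := h1.2
  rwa [RankFn.lin_apply, ← image_id (x '' S), ← RankFn.lin_apply] at this

theorem rank_pointVec (S : Set V) : RankFn.lin (ZMod 2) id (pointVec '' S) = S.ncard :=
  rank_image_of_separated pointVec id (fun _ _ => pointVec_apply_eq_one) S

theorem lin_id_singleton {x : V → ZMod 2} (h : x ≠ 0) : RankFn.lin (ZMod 2) id {x} = 1 := by
  rw [RankFn.lin_apply, image_singleton]
  exact_mod_cast finrank_span_singleton h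

end

section

variable {α : Type u} {A₁ A₂ L₁ L₂ E : Set α} {e₁ e₂ e : α} {r r₁ r₂ : RankFn α}

theorem ne_of_rank_one {V : Type*} [Finite V] {p q : α → V}
    (h : ∀ X ⊆ E, r X = RankFn.lin (ZMod 2) (fun e => edgeVec (p e) (q e)) X) (he : e ∈ E)
    (h1 : r {e} = 1) : p e ≠ q e := by
  intro heq
  rw [h _ (by simpa using he), RankFn.lin_apply, image_singleton, heq, edgeVec_self,
    Submodule.span_zero_singleton, finrank_bot] at h1
  norm_num at h1

theorem lin_eq_lin_id {V : Type*} [Finite V] (x : α → V → ZMod 2) (X : Set α) :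
    RankFn.lin (ZMod 2) x X = RankFn.lin (ZMod 2) id (x '' X) := by
  rw [RankFn.lin_apply, RankFn.lin_apply, image_id]

/-- The joints are new edges from one end of `e` to all other vertices. They form a star, hence are
independent; an edge of the graph is the sum of the two rays to its ends, and `e` is itself parallel
to a ray. -/
theorem GraphicRep.frameRep (h : GraphicRep E r) (he : e ∈ E) (h1 : r {e} = 1) :
    FrameRep E r {e} := by
  obtain ⟨V, _, p, q, h⟩ := h
  have hne := ne_of_rank_one h he h1
  have key : ∀ v, ∃ w : {w // w ≠ p e},
      edgeVec v (p e) ∈ Submodule.span (ZMod 2) {edgeVec w.1 (p e)} := by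
    intro v
    by_cases hv : v = p e
    · refine ⟨⟨q e, hne.symm⟩, ?_⟩
      rw [hv, edgeVec_self]
      exact Submodule.zero_mem _
    · exact ⟨⟨v, hv⟩, Submodule.mem_span_singleton_self _⟩
  refine FrameRep.of (V := {w // w ≠ p e}) (ρ := RankFn.lin (ZMod 2) id)
    (ι := fun e => edgeVec (p e) (q e)) (j := fun w => edgeVec w.1 (p e)) (fun S => ?_)
    (fun X hX => ?_) (fun f hf => ?_) (fun f hf => ?_)
  · refine rank_image_of_separated _ (fun w => w.1) (fun v w => ?_) S
    rw [edgeVec_eq, Pi.add_apply, pointVec_of_ne w.2, add_zero, pointVec_apply_eq_one, Subtype.ext_iff]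
  · rw [h X hX, lin_eq_lin_id]
  · obtain ⟨v, hv⟩ := key (p f)
    obtain ⟨w, hw⟩ := key (q f)
    refine ⟨v, w, ?_⟩
    rw [RankFn.mem_cl_lin, image_id, id, ← edgeVec_add (p f) (q f) (p e)]
    exact Submodule.add_mem _ (Submodule.span_mono (by simp) hv) (Submodule.span_mono (by simp) hw)
  · obtain rfl : f = e := hf
    refine ⟨⟨q f, hne.symm⟩, ?_⟩
    rw [edgeVec_comm]
    exact RankFn.subset_cl _ _ rfl

/-- The space over the two-element field contains the line through the unit vectors of the ends of
`e₁`, and this line has just three points. It is modular, so it can be matched with `e₂` and the two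
joints spanning `e₂`; the ends of `e₁` become these joints. -/
theorem FrameRep.of_graphicRep (h₁ : GraphicRep (insert e₁ A₁) r₁)
    (h₂ : FrameRep (insert e₂ A₂) r₂ L₂) (hA : Disjoint A₁ A₂) (hL₂ : L₂ ⊆ A₂)
    (he₁ : r₁ {e₁} = 1) (he₂ : r₂ {e₂} = 1)
    (hr : TwoSumRank A₁ A₂ r r₁ r₂ (fun U => e₁ ∈ r₁.cl U) (fun U => e₂ ∈ r₂.cl U)) :
    FrameRep (A₁ ∪ A₂) r L₂ := by
  obtain ⟨V₂, _, ρ₂, j₂, q₂, E₂, l₂⟩ := h₂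
  -- If `e₂` is on a joint there is no three-point line to match. In this case the graphic side is
  -- framed so that `e₁` is a joint too.
  by_cases hjoint : ∃ v, Sum.inl e₂ ∈ ρ₂.cl {Sum.inr v}
  · have h₂' : FrameRep (insert e₂ A₂) r₂ (insert e₂ L₂) := by
      refine ⟨V₂, inferInstance, ρ₂, j₂, q₂, E₂, ?_⟩
      rintro e (rfl | he)
      exacts [hjoint, l₂ e he]
    have h₁' := h₁.frameRep (mem_insert _ _) he₁
    have := FrameRep.parallel (L₁ := ∅) (h₁'.congr subset_rfl (fun _ _ => rfl) (by simp)) h₂' hA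
      (empty_subset _) hL₂ he₁ he₂ hr
    rwa [empty_union] at this
  obtain ⟨a, b, hab⟩ := E₂ e₂ (mem_insert _ _)
  obtain ⟨V₁, _, p, q, h⟩ := h₁
  have hne := ne_of_rank_one h (mem_insert _ _) he₁
  have s₁ : A₁ ⊆ insert e₁ A₁ := subset_insert _ _
  have s₂ : A₂ ⊆ insert e₂ A₂ := subset_insert _ _
  set u := p e₁ with hu
  set v := q e₁ with hv
  push Not at hjoint
  have hne' : a ≠ b := fun h => hjoint b (by simpa [h] using hab)
  -- The two ends and the basepoint, in corresponding order on both sides; the index `2` of the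
  -- basepoint is the `t₀` of the gluing.
  let t₁ : Fin 3 → V₁ → ZMod 2 := ![pointVec u, pointVec v, edgeVec u v]
  let t₂ : Fin 3 → α ⊕ V₂ := ![Sum.inr a, Sum.inr b, Sum.inl e₂]
  set ρ₁ : RankFn (V₁ → ZMod 2) := RankFn.lin (ZMod 2) id with hρ₁
  have hcl : ∀ {x Z}, x ∈ ρ₁.cl Z ↔ x ∈ Submodule.span (ZMod 2) Z := fun {x Z} => by
    rw [hρ₁, RankFn.mem_cl_lin, image_id, id]
  have hU : ∀ w, w ∈ Submodule.span (ZMod 2) {pointVec u, pointVec v} ↔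
      w = 0 ∨ ∃ i, t₁ i = w := by
    intro w
    rw [Submodule.mem_span_pair]
    constructor
    · rintro ⟨c, d, rfl⟩
      have h2 : ∀ z : ZMod 2, z = 0 ∨ z = 1 := by decide
      rcases h2 c with rfl | rfl <;> rcases h2 d with rfl | rfl
      · simp
      · exact Or.inr ⟨1, by simp [t₁]⟩
      · exact Or.inr ⟨0, by simp [t₁]⟩
      · exact Or.inr ⟨2, by simp [t₁, edgeVec_eq]⟩
    · rintro (rfl | ⟨i, rfl⟩)
      · exact ⟨0, 0, by simp⟩
      · fin_cases i
        · exact ⟨1, 0, by simp [t₁]⟩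
        · exact ⟨0, 1, by simp [t₁]⟩
        · exact ⟨1, 1, by simp [t₁, edgeVec_eq]⟩
  have hspan : Submodule.span (ZMod 2) (range t₁) = Submodule.span (ZMod 2) {pointVec u, pointVec v} := by
    refine le_antisymm (Submodule.span_le.2 ?_) (Submodule.span_mono ?_)
    · rintro _ ⟨i, rfl⟩
      exact (hU _).2 (Or.inr ⟨i, rfl⟩)
    · rintro _ (rfl | rfl)
      exacts [⟨0, rfl⟩, ⟨1, rfl⟩]
  have huv : ρ₁ {pointVec u, pointVec v} = 2 := by
    have := rank_pointVec ({u, v} : Set V₁)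
    rw [image_pair, ncard_pair hne] at this
    exact this
  have hpair₁ : ∀ i j, i ≠ j → ({pointVec u, pointVec v} : Set _) ⊆ ρ₁.cl {t₁ i, t₁ j} := by
    have base : ∀ x y z : V₁ → ZMod 2, x + y = z → y ∈ ρ₁.cl {x, z} ∧ x ∈ ρ₁.cl {y, z} := by
      rintro x y _ rfl
      rw [hcl, hcl]
      constructor
      · exact mem_of_add_mem (m := x) (Submodule.subset_span (by simp)) (Submodule.subset_span (by simp))
      · refine mem_of_add_mem (m := y) ?_ (Submodule.subset_span (by simp))
        rw [add_comm]
        exact Submodule.subset_span (by simp)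
    obtain ⟨b1, b2⟩ := base (pointVec u) (pointVec v) (edgeVec u v) rfl
    intro i j hij
    have m : ∀ {x y z : V₁ → ZMod 2}, x = y ∨ x = z → x ∈ ρ₁.cl {y, z} := fun h =>
      ρ₁.subset_cl _ h
    fin_cases i <;> fin_cases j <;> first | exact absurd rfl hij | skip
    · exact pair_subset (m (Or.inl rfl)) (m (Or.inr rfl))
    · exact pair_subset (m (Or.inl rfl)) b1
    · exact pair_subset (m (Or.inr rfl)) (m (Or.inl rfl))
    · exact pair_subset b2 (m (Or.inl rfl))
    · exact pair_subset (m (Or.inr rfl)) (pair_comm (pointVec u) (edgeVec u v) ▸ b1)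
    · exact pair_subset (pair_comm (pointVec v) (edgeVec u v) ▸ b2) (m (Or.inr rfl))
  have hab2 : ρ₂ {Sum.inr a, Sum.inr b} = 2 := by
    have := j₂ {a, b}
    rw [image_pair, ncard_pair hne'] at this
    exact this
  have hpair₂ : ∀ i j, i ≠ j → ({Sum.inr a, Sum.inr b} : Set _) ⊆ ρ₂.cl {t₂ i, t₂ j} := by
    have b1 : Sum.inr b ∈ ρ₂.cl {Sum.inr a, Sum.inl e₂} := by
      rw [pair_comm]
      refine ρ₂.exchange ?_ (hjoint a)
      rwa [pair_comm]
    have b2 : Sum.inr a ∈ ρ₂.cl {Sum.inr b, Sum.inl e₂} := by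
      rw [pair_comm]
      exact ρ₂.exchange hab (hjoint b)
    intro i j hij
    have m : ∀ {x y z : α ⊕ V₂}, x = y ∨ x = z → x ∈ ρ₂.cl {y, z} := fun h =>
      ρ₂.subset_cl _ h
    fin_cases i <;> fin_cases j <;> first | exact absurd rfl hij | skip
    · exact pair_subset (m (Or.inl rfl)) (m (Or.inr rfl))
    · exact pair_subset (m (Or.inl rfl)) b1
    · exact pair_subset (m (Or.inr rfl)) (m (Or.inl rfl))
    · exact pair_subset b2 (m (Or.inl rfl))
    · exact pair_subset (m (Or.inr rfl)) (pair_comm (Sum.inr a) (Sum.inl e₂) ▸ b1)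
    · exact pair_subset (pair_comm (Sum.inr b) (Sum.inl e₂) ▸ b2) (m (Or.inr rfl))
  have hsing : ρ₁ {edgeVec u v} = 1 := lin_id_singleton (edgeVec_ne_zero hne)
  have h12 : ∀ S, ρ₁ (t₁ '' S) = ρ₂ (t₂ '' S) := by
    refine RankFn.eq_of_line (σ := ρ₁.comap t₁) (σ' := ρ₂.comap t₂) ?_ ?_ ?_ ?_ ?_ ?_
    · intro i
      rw [RankFn.comap_apply, image_singleton]
      fin_cases i
      · exact lin_id_singleton (pointVec_ne_zero u)
      · exact lin_id_singleton (pointVec_ne_zero v)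
      · exact hsing
    · intro i
      rw [RankFn.comap_apply, image_singleton]
      fin_cases i
      · change ρ₂ {Sum.inr a} = 1
        simpa using j₂ {a}
      · change ρ₂ {Sum.inr b} = 1
        simpa using j₂ {b}
      · change ρ₂ {Sum.inl e₂} = 1
        rw [← image_singleton, ← q₂ _ (by simp), he₂]
    · intro i j hij
      rw [RankFn.comap_apply, image_pair, ← huv]
      exact ρ₁.rank_le_of_subset_cl (hpair₁ i j hij)
    · intro i j hij
      rw [RankFn.comap_apply, image_pair, ← hab2]
      exact ρ₂.rank_le_of_subset_cl (hpair₂ i j hij)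
    · rw [RankFn.comap_apply, ← huv]
      refine ρ₁.rank_le_of_subset_cl ?_
      rintro _ ⟨i, -, rfl⟩
      rw [hcl, ← hspan]
      exact Submodule.subset_span ⟨i, rfl⟩
    · rw [RankFn.comap_apply, ← hab2]
      refine ρ₂.rank_le_of_subset_cl ?_
      rintro _ ⟨i, -, rfl⟩
      fin_cases i
      · exact ρ₂.subset_cl _ (Or.inl rfl)
      · exact ρ₂.subset_cl _ (Or.inr rfl)
      · exact hab
  have := FrameRep.of_glue (T := Fin 3) (t₁ := t₁) (t₂ := t₂) (ρ₁ := ρ₁) (ρ₂ := ρ₂)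
    (ι₁ := fun e => edgeVec (p e) (q e)) (ι₂ := Sum.inl) (R := {u, v}) (t₀ := 2)
    (L₁ := ∅) (L₂ := L₂) (r := r) (j₁ := pointVec)
    (RankFn.modular_lin hU) h12 rank_pointVec j₂ ?_ ?_ ?_ hA ?_ hsing ?_ ?_
    (fun e he => E₂ e (s₂ he)) (by simp) (fun e he => ⟨hL₂ he, l₂ e he⟩)
  · rwa [empty_union] at this
  · rintro _ (rfl | rfl)
    · exact ⟨0, a, rfl, rfl⟩
    · exact ⟨1, b, rfl, rfl⟩
  · intro i
    rw [hcl, image_pair, ← hspan]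
    exact Submodule.subset_span ⟨i, rfl⟩
  · intro i
    fin_cases i
    · exact ρ₂.subset_cl _ ⟨a, rfl⟩
    · exact ρ₂.subset_cl _ ⟨b, rfl⟩
    · exact ρ₂.cl_mono (pair_subset (mem_range_self a) (mem_range_self b)) hab
  -- Sets of edges never span a unit vector, so of the three points only the basepoint can be in the
  -- trace.
  · intro U hU' i hi
    have hi' : t₁ i ∈ Submodule.span (ZMod 2) ((fun e => edgeVec (p e) (q e)) '' U) := hcl.1 hi
    fin_cases i
    · exact absurd hi' (pointVec_notMem_span p q U u)
    · exact absurd hi' (pointVec_notMem_span p q U v)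
    · rfl
  · intro U₁ hU₁ U₂ hU₂
    have h' := hr U₁ hU₁ U₂ hU₂
    have m₁ : e₁ ∈ r₁.cl U₁ ↔ t₁ 2 ∈ ρ₁.cl ((fun e => edgeVec (p e) (q e)) '' U₁) := by
      rw [RankFn.mem_cl, RankFn.mem_cl, h _ (insert_subset_insert hU₁), h _ (hU₁.trans s₁),
        lin_eq_lin_id _ (insert _ _), lin_eq_lin_id _ U₁, image_insert_eq]
      rfl
    beta_reduce at h'
    rw [m₁, mem_cl_iff_of_rank_eq q₂ hU₂, h U₁ (hU₁.trans s₁), q₂ U₂ (hU₂.trans s₂),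
      lin_eq_lin_id] at h'
    exact h'
  · intro e he
    refine ⟨p e, q e, hcl.2 ?_⟩
    rw [edgeVec_eq]
    exact Submodule.add_mem _ (Submodule.subset_span (by simp)) (Submodule.subset_span (by simp))

end

end FrameMatroids

namespace FrameMatroids

universe u v

/-! ### Skew pairs and elements joining them -/

namespace RankFn

theorem ext {γ : Type*} {σ τ : RankFn γ} (h : ∀ X, σ X = τ X) : σ = τ := by
  obtain ⟨r, _, _, _, _⟩ := σ
  obtain ⟨r', _, _, _, _⟩ := τ
  congr
  exact funext h

variable {γ : Type*} (ρ : RankFn γ) {X Y A A₀ U Z₁ Z₂ I : Set γ} {f : γ}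

/-- If `X` and `Y` are skew up to one and both span `f`, then a subset of `X` spans `f` if and only if
it is not skew to `Y`. -/
theorem mem_cl_iff_not_skew (hX : f ∈ ρ.cl X) (hY : f ∈ ρ.cl Y) (h1 : ρ {f} = 1)
    (hr : ρ X + ρ Y ≤ ρ (X ∪ Y) + 1) (hU : U ⊆ X) : f ∈ ρ.cl U ↔ ρ (U ∪ Y) < ρ U + ρ Y := by
  constructor
  · intro hf
    have h2 := ρ.submod_of_subset (W := U ∪ Y) (Z := {f}) (X := insert f U) (Y := insert f Y)
      (by simp) (by simp)
      (union_subset_union (subset_insert _ _) (subset_insert _ _))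
    rw [ρ.mem_cl.1 hf, ρ.mem_cl.1 hY] at h2
    linarith
  · intro h
    by_contra hf
    have h2 := ρ.submod_of_subset (W := X ∪ Y) (Z := insert f U) (X := insert f X)
      (Y := insert f (U ∪ Y)) (insert_subset_insert hU) (insert_subset_insert subset_union_left)
      (by
        rintro z (hz | hz)
        · exact Or.inl (Or.inr hz)
        · exact Or.inr (Or.inr (Or.inr hz)))
    rw [ρ.notMem_cl.1 hf, ρ.mem_cl.1 hX, ρ.mem_cl.1 (ρ.cl_mono subset_union_right hY)] at h2
    linarith

/-- The version of `mem_cl_iff_not_skew` after contracting a part of `Y` skew to `X`. -/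
theorem mem_cl_union_iff_not_skew (hAY : A ⊆ Y) (hA : ρ (X ∪ A) = ρ X + ρ A)
    (hfX : f ∈ ρ.cl (X ∪ A)) (hfY : f ∈ Y) (hfA : f ∉ ρ.cl A)
    (hr : ρ X + ρ Y ≤ ρ (X ∪ Y) + 1) (hU : U ⊆ X) :
    f ∈ ρ.cl (U ∪ A) ↔ ρ (U ∪ Y) < ρ U + ρ Y := by
  have h1 := (ρ.contract A).mem_cl_iff_not_skew (f := f) (X := X) (Y := Y) (U := U)
    (ρ.mem_cl_contract.2 hfX) ((ρ.contract A).mem_cl_of_mem hfY) (by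
      rw [contract_apply, singleton_union, ρ.notMem_cl.1 hfA]
      ring) (by
      rw [contract_apply, contract_apply, contract_apply, union_assoc,
        union_eq_self_of_subset_right hAY]
      linarith) hU
  rw [mem_cl_contract, contract_apply, contract_apply, contract_apply, union_assoc,
    union_eq_self_of_subset_right hAY,
    ρ.skew_mono hA (hU.trans (ρ.subset_cl _)) (ρ.subset_cl _)] at h1
  rw [h1]
  constructor <;> intro h <;> linarith

/-- A maximal subset of `Y` that is skew to `X`. -/
theorem exists_maximal_skew (hY : Y.Finite) (hAY : A₀ ⊆ Y) (hA : ρ (X ∪ A₀) = ρ X + ρ A₀)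
    (hr : ρ (X ∪ Y) + 1 = ρ X + ρ Y) :
    ∃ A, A₀ ⊆ A ∧ A ⊆ Y ∧ ρ (X ∪ A) = ρ X + ρ A ∧ ρ Y = ρ A + 1 ∧ (∃ f ∈ Y, f ∉ A) ∧
      ∀ f ∈ Y, f ∉ A → f ∈ ρ.cl (X ∪ A) ∧ f ∉ ρ.cl A := by
  obtain ⟨A, ⟨h0, hAY', hAs⟩, hmax⟩ := (hY.finite_subsets.subset
    (t := {A | A₀ ⊆ A ∧ A ⊆ Y ∧ ρ (X ∪ A) = ρ X + ρ A}) fun A hA => hA.2.1).exists_maximal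
      ⟨A₀, subset_rfl, hAY, hA⟩
  have key : ∀ f ∈ Y, f ∉ A → f ∈ ρ.cl (X ∪ A) ∧ f ∉ ρ.cl A := by
    intro f hf hfA
    have hns : ρ (X ∪ insert f A) ≠ ρ X + ρ (insert f A) := fun h => by
      have := hmax (show insert f A ∈ _ from ⟨h0.trans (subset_insert _ _),
        insert_subset hf hAY', h⟩) (subset_insert _ _)
      exact hfA (this (mem_insert _ _))
    rw [union_insert] at hns
    constructor
    · by_contra hc
      rw [ρ.notMem_cl.1 hc] at hns
      by_cases hc' : f ∈ ρ.cl A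
      · exact hc (ρ.cl_mono subset_union_right hc')
      · rw [ρ.notMem_cl.1 hc'] at hns
        exact hns (by linarith)
    · intro hc
      rw [ρ.mem_cl.1 hc, ρ.mem_cl.1 (ρ.cl_mono subset_union_right hc)] at hns
      exact hns hAs
  have hXY : ρ (X ∪ Y) = ρ (X ∪ A) := by
    refine ρ.rank_eq_of_subset_cl (union_subset_union_right _ hAY') ?_
    refine union_subset (subset_union_left.trans (ρ.subset_cl _)) fun f hf => ?_
    by_cases hfA : f ∈ A
    · exact ρ.mem_cl_of_mem (Or.inr hfA)
    · exact (key f hf hfA).1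
  refine ⟨A, h0, hAY', hAs, by linarith, ?_, key⟩
  by_contra! hcon
  have : A = Y := hAY'.antisymm hcon
  rw [this] at hAs
  linarith

/-- If `Y` is the union of skew sets `Z₁` and `Z₂`, the subsets of `Y` not skew to `X` are determined
by those that contain `Z₁` or `Z₂`. -/
theorem not_skew_iff_of_skew (hr : ρ X + ρ (Z₁ ∪ Z₂) ≤ ρ (X ∪ (Z₁ ∪ Z₂)) + 1)
    (hZ : ρ (Z₁ ∪ Z₂) = ρ Z₁ + ρ Z₂) {U₁ U₂ : Set γ} (h₁ : U₁ ⊆ Z₁) (h₂ : U₂ ⊆ Z₂) :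
    ρ ((U₁ ∪ U₂) ∪ X) < ρ (U₁ ∪ U₂) + ρ X ↔
      ρ ((U₁ ∪ Z₂) ∪ X) < ρ (U₁ ∪ Z₂) + ρ X ∧ ρ ((Z₁ ∪ U₂) ∪ X) < ρ (Z₁ ∪ U₂) + ρ X := by
  have mono : ∀ {U U' : Set γ}, U ⊆ U' → ρ (U ∪ X) < ρ U + ρ X → ρ (U' ∪ X) < ρ U' + ρ X := by
    intro U U' hU h
    by_contra hc
    have h1 := ρ.skew_mono (X := U') (Y := X) (le_antisymm (ρ.union_le _ _) (not_lt.1 hc))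
      (hU.trans (ρ.subset_cl _)) (ρ.subset_cl _)
    linarith
  constructor
  · exact fun h => ⟨mono (union_subset_union_right _ h₂) h, mono (union_subset_union_left _ h₁) h⟩
  · rintro ⟨h, h'⟩
    have s : ∀ {V₁ V₂ : Set γ}, V₁ ⊆ Z₁ → V₂ ⊆ Z₂ → ρ (V₁ ∪ V₂) = ρ V₁ + ρ V₂ := fun h h' =>
      ρ.skew_mono hZ (h.trans (ρ.subset_cl _)) (h'.trans (ρ.subset_cl _))
    -- Uncrossing: the sets `U₁ ∪ Z₂ ∪ X` and `Z₁ ∪ U₂ ∪ X` each lose a unit, while their union,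
    -- which contains the whole ground set, loses only one in all. So the second unit is lost by
    -- their common part.
    have h3 := ρ.submod_of_subset (W := X ∪ (Z₁ ∪ Z₂)) (Z := U₁ ∪ U₂ ∪ X) (X := U₁ ∪ Z₂ ∪ X)
      (Y := Z₁ ∪ U₂ ∪ X) (union_subset_union_left _ (union_subset_union_right _ h₂))
      (union_subset_union_left _ (union_subset_union_left _ h₁)) (by
        rintro z (hz | hz | hz)
        · exact Or.inl (Or.inr hz)
        · exact Or.inr (Or.inl (Or.inl hz))
        · exact Or.inl (Or.inl (Or.inr hz)))
    rw [s h₁ subset_rfl] at h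
    rw [s subset_rfl h₂] at h'
    rw [s h₁ h₂]
    linarith

/-- Contracting elements spanned by pairs from an independent set leaves an independent set that
represents all of it. -/
theorem exists_contract_independent (hI : ρ I = I.ncard) (hIf : I.Finite) (hA : A.Finite)
    (hl : ∀ e ∈ A, ∃ v ∈ I, ∃ w ∈ I, e ∈ ρ.cl {v, w}) :
    ∃ J ⊆ I, ρ.contract A J = J.ncard ∧
      ∀ v ∈ I, v ∈ ρ.cl A ∨ ∃ w ∈ J, v ∈ ρ.cl (insert w A) := by
  induction A, hA using Set.Finite.induction_on with
  | empty =>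
    refine ⟨I, subset_rfl, ?_, fun v hv => Or.inr ⟨v, hv, ρ.mem_cl_of_mem (by simp)⟩⟩
    simpa [contract_apply] using hI
  | @insert e A heA hAf ih =>
    obtain ⟨J, hJI, hJ, hrep⟩ := ih fun f hf => hl f (mem_insert_of_mem _ hf)
    by_cases he : e ∈ ρ.cl A
    · refine ⟨J, hJI, ?_, fun v hv => ?_⟩
      · rw [contract_apply, union_insert, ρ.mem_cl.1 he,
          ρ.mem_cl.1 (ρ.cl_mono subset_union_right he), ← contract_apply, hJ]
      · refine (hrep v hv).imp (fun h => ρ.cl_mono (subset_insert _ _) h) ?_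
        rintro ⟨w, hw, h⟩
        exact ⟨w, hw, ρ.cl_mono (insert_subset_insert (subset_insert _ _)) h⟩
    · have hJf := hIf.subset hJI
      have hrep' : ∀ v ∈ I, v ∈ ρ.cl A ∨ ∃ w ∈ J, v ∈ ρ.cl (insert w A) := hrep
      -- Modulo `A`, the element `e` lies on the span of at most two members of `J`. One of them,
      -- `v`, is chosen so that the set `B` of the other, which may be empty, does not span `e`; `v`
      -- is the one to be discarded.
      have key : ∃ v ∈ J, ∃ B ⊆ J \ {v}, e ∈ ρ.cl (insert v (B ∪ A)) ∧ e ∉ ρ.cl (B ∪ A) ∧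
          ∀ w ∈ B, B = {w} := by
        have red : ∀ v ∈ I, ∃ B ⊆ J, v ∈ ρ.cl (B ∪ A) ∧ ∀ w ∈ B, B = {w} := by
          intro v hv
          rcases hrep v hv with h | ⟨w, hw, h⟩
          · exact ⟨∅, empty_subset _, by simpa using h, by simp⟩
          · exact ⟨{w}, by simpa using hw, by simpa using h, by simp⟩
        obtain ⟨v, hv, w, hw, hvw⟩ := hl e (mem_insert _ _)
        obtain ⟨B, hB, hvB, hB1⟩ := red v hv
        obtain ⟨D, hD, hwD, hD1⟩ := red w hw
        have hBD : e ∈ ρ.cl (B ∪ (D ∪ A)) := by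
          refine ρ.cl_subset_cl ?_ hvw
          rintro _ (rfl | rfl)
          · exact ρ.cl_mono (union_subset_union_right _ subset_union_right) hvB
          · exact ρ.cl_mono subset_union_right hwD
        have pick : ∀ D' ⊆ J, (∀ w ∈ D', D' = {w}) → ∀ B' ⊆ J, (∀ w ∈ B', B' = {w}) →
            e ∈ ρ.cl (B' ∪ (D' ∪ A)) → e ∉ ρ.cl (D' ∪ A) → ∃ v ∈ J, ∃ B ⊆ J \ {v},
              e ∈ ρ.cl (insert v (B ∪ A)) ∧ e ∉ ρ.cl (B ∪ A) ∧ ∀ w ∈ B, B = {w} := by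
          intro D' hD' hD1' B' hB' hB1' h1 h2
          rcases B'.eq_empty_or_nonempty with rfl | ⟨v', hv'⟩
          · rw [empty_union] at h1
            exact absurd h1 h2
          · rw [hB1' v' hv', singleton_union] at h1
            refine ⟨v', hB' hv', D', fun z hz => ⟨hD' hz, ?_⟩, h1, h2, hD1'⟩
            rintro rfl
            rw [insert_eq_of_mem (show z ∈ D' ∪ A from Or.inl hz)] at h1
            exact h2 h1
        by_cases heD : e ∈ ρ.cl (D ∪ A)
        · exact pick ∅ (empty_subset _) (by simp) D hD hD1 (by simpa using heD) (by simpa using he)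
        · exact pick D hD hD1 B hB hB1 hBD heD
      obtain ⟨v, hv, B, hB, h1, h2, hB1⟩ := key
      -- After contracting `e` too, the discarded `v` is a loop or parallel to the member of `B`, so
      -- whatever it represented is still represented.
      have hvB : v ∈ ρ.cl (insert e (B ∪ A)) := ρ.exchange h1 h2
      have hvJ : v ∈ ρ.cl (J \ {v} ∪ insert e A) := by
        refine ρ.cl_mono ?_ hvB
        rw [union_insert]
        exact insert_subset_insert (union_subset_union_left _ hB)
      refine ⟨J \ {v}, sdiff_subset.trans hJI, ?_, fun u hu => ?_⟩
      · have h3 : ρ (J \ {v} ∪ insert e A) = ρ (J ∪ A) := by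
          rw [← ρ.mem_cl.1 hvJ, ← insert_union, insert_sdiff_singleton, insert_eq_of_mem hv,
            union_insert]
          refine ρ.mem_cl.1 (ρ.cl_mono ?_ h1)
          exact insert_subset (Or.inl hv) (union_subset_union_left _ (hB.trans sdiff_subset))
        have h4 := ncard_sdiff_singleton_add_one hv hJf
        rw [contract_apply] at hJ ⊢
        rw [h3, ρ.notMem_cl.1 he]
        have : ((J \ {v}).ncard : ℤ) + 1 = J.ncard := by exact_mod_cast h4
        linarith
      · rcases hrep u hu with h | ⟨w, hw, h⟩
        · exact Or.inl (ρ.cl_mono (subset_insert _ _) h)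
        · by_cases hwv : w = v
          · subst hwv
            have h5 : u ∈ ρ.cl (B ∪ insert e A) := by
              refine ρ.cl_subset_cl (insert_subset ?_ ?_) h
              · rwa [union_insert]
              · exact ((subset_insert _ _).trans subset_union_right).trans (ρ.subset_cl _)
            rcases B.eq_empty_or_nonempty with rfl | ⟨b, hb⟩
            · exact Or.inl (by simpa using h5)
            · refine Or.inr ⟨b, hB hb, ?_⟩
              rwa [hB1 b hb, singleton_union] at h5
          · exact Or.inr ⟨w, ⟨hw, hwv⟩, ρ.cl_mono (insert_subset_insert (subset_insert _ _)) h⟩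

end RankFn

/-! ### Frames -/

section

variable {α : Type u} {E L X Y A U : Set α} {r r' : RankFn α} {link link' : Set α → Prop}

namespace Frame

variable {V : Type v} {ρ : RankFn (α ⊕ V)} {J K S T : Set V} {s x y v w : V} {e f : α}

/-- The contraction of a frame. -/
theorem contract (h : Frame ρ J E) (hA : A.Finite) (hAE : A ⊆ E) :
    ∃ J' ⊆ J, Frame (ρ.contract (Sum.inl '' A)) J' {e ∈ E | Sum.inl e ∉ ρ.cl (Sum.inl '' A)} ∧
      ∀ v ∈ J, Sum.inr v ∈ ρ.cl (Sum.inl '' A) ∨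
        ∃ w ∈ J', Sum.inr v ∈ (ρ.contract (Sum.inl '' A)).cl {Sum.inr w} := by
  obtain ⟨I, hI, hIr, hrep⟩ := ρ.exists_contract_independent (I := Sum.inr '' J)
    (A := Sum.inl '' A) (by
      rw [h.joints J subset_rfl, ncard_image_of_injective _ Sum.inr_injective])
    (h.finite.image _) (hA.image _) (by
      rintro _ ⟨e, he, rfl⟩
      obtain ⟨v, hv, w, hw, h'⟩ := h.line e (hAE he)
      exact ⟨_, mem_image_of_mem _ hv, _, mem_image_of_mem _ hw, h'⟩)
  obtain ⟨J', hJ', rfl⟩ := subset_image_iff.1 hI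
  have hf := h.finite.subset hJ'
  have hind : (ρ.contract (Sum.inl '' A)).Ind (Sum.inr '' J') := ⟨hf.image _, hIr⟩
  have hrep' : ∀ v ∈ J, Sum.inr v ∈ ρ.cl (Sum.inl '' A) ∨
        ∃ w ∈ J', Sum.inr v ∈ (ρ.contract (Sum.inl '' A)).cl {Sum.inr w} := by
    intro v hv
    refine (hrep _ (mem_image_of_mem _ hv)).imp_right ?_
    rintro ⟨_, ⟨w, hw, rfl⟩, h'⟩
    exact ⟨w, hw, by rwa [RankFn.mem_cl_contract, singleton_union]⟩
  refine ⟨J', hJ', ⟨hf, fun S hS => ?_, ?_, ?_⟩, hrep'⟩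
  · rw [(hind.subset (image_mono hS)).2, ncard_image_of_injective _ Sum.inr_injective]
  · rintro e ⟨heE, heA⟩
    obtain ⟨v, hv, w, hw, h'⟩ := h.line e heE
    have h1 : Sum.inl e ∈ (ρ.contract (Sum.inl '' A)).cl {Sum.inr v, Sum.inr w} := by
      rw [RankFn.mem_cl_contract]
      exact ρ.cl_mono subset_union_left h'
    have loop : ∀ {x : α ⊕ V} (Z), x ∈ ρ.cl (Sum.inl '' A) →
        x ∈ (ρ.contract (Sum.inl '' A)).cl Z := fun Z hx => by
      rw [RankFn.mem_cl_contract]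
      exact ρ.cl_mono subset_union_right hx
    rcases hrep' v hv with hv' | ⟨v', hvJ, hv'⟩ <;> rcases hrep' w hw with hw' | ⟨w', hwJ, hw'⟩
    · refine absurd (ρ.cl_subset_cl ?_ h') heA
      rintro _ (rfl | rfl) <;> assumption
    · refine ⟨w', hwJ, w', hwJ, RankFn.cl_subset_cl _ ?_ h1⟩
      rintro _ (rfl | rfl)
      · exact loop _ hv'
      · simpa using hw'
    · refine ⟨v', hvJ, v', hvJ, RankFn.cl_subset_cl _ ?_ h1⟩
      rintro _ (rfl | rfl)
      · simpa using hv'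
      · exact loop _ hw'
    · refine ⟨v', hvJ, w', hwJ, RankFn.cl_subset_cl _ ?_ h1⟩
      rintro _ (rfl | rfl)
      · exact RankFn.cl_mono _ (by simp) hv'
      · exact RankFn.cl_mono _ (by simp) hw'
  · rintro e ⟨-, heA⟩
    rw [RankFn.contract_apply, singleton_union, ρ.notMem_cl.1 heA]
    ring

/-- Joints are skew to elements spanned by joints, if the two sets of joints have at most one
common member, which the elements do not span. -/
theorem skew_edges (h : Frame ρ J E) (hT : T ⊆ J) (hK : K ⊆ J) (hTK : T ∩ K ⊆ {s})
    (hU : Sum.inl '' U ⊆ ρ.cl (Sum.inr '' K)) (hs : Sum.inr s ∉ ρ.cl (Sum.inl '' U)) :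
    ρ (Sum.inr '' T ∪ Sum.inl '' U) = ρ (Sum.inr '' T) + ρ (Sum.inl '' U) := by
  -- The common joint is moved to the other side: `T \ {s}` is skew to everything spanned by `K`, in
  -- particular to `U` together with `s`, and `s` is independent of `U`.
  by_cases hsT : s ∈ T ∩ K
  · have h1 := ρ.skew_mono (X' := Sum.inr '' (T \ {s})) (Y' := insert (Sum.inr s) (Sum.inl '' U))
      (h.skew (S := T \ {s}) (sdiff_subset.trans hT) hK (by
        rw [disjoint_left]
        intro v hv hvK
        exact hv.2 (hTK ⟨hv.1, hvK⟩))) (ρ.subset_cl _)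
      (insert_subset (ρ.mem_cl_of_mem (mem_image_of_mem _ hsT.2)) hU)
    rw [ρ.notMem_cl.1 hs, union_insert, ← insert_union, ← image_insert_eq, insert_sdiff_singleton,
      insert_eq_of_mem hsT.1, h.joints _ (sdiff_subset.trans hT)] at h1
    have h2 := ncard_sdiff_singleton_add_one hsT.1 (h.finite.subset hT)
    rw [h1, h.joints _ hT, ← h2]
    push_cast
    ring
  · refine ρ.skew_mono (h.skew hT hK ?_) (ρ.subset_cl _) hU
    rw [disjoint_left]
    intro v hv hvK
    have := hTK ⟨hv, hvK⟩
    rw [mem_singleton_iff] at this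
    subst this
    exact hsT ⟨hv, hvK⟩

end Frame

/-- The matroid on `X` with rank function `r` has a frame representation with a joint that is
spanned by exactly the sets in `link`; the elements of `L` are parallel to joints. -/
def RootedRep (X : Set α) (r : RankFn α) (L : Set α) (link : Set α → Prop) : Prop :=
  ∃ (V : Type u) (_ : Finite V) (ρ : RankFn (α ⊕ V)) (v₀ : V),
    (∀ S : Set V, ρ (Sum.inr '' S) = S.ncard) ∧
    (∀ U ⊆ X, r U = ρ (Sum.inl '' U)) ∧
    (∀ e ∈ X, ∃ v w, Sum.inl e ∈ ρ.cl {Sum.inr v, Sum.inr w}) ∧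
    (∀ e ∈ L, ∃ v, Sum.inl e ∈ ρ.cl {Sum.inr v}) ∧
    ∀ U ⊆ X, (Sum.inr v₀ ∈ ρ.cl (Sum.inl '' U) ↔ link U)

theorem RootedRep.congr (h : RootedRep X r L link) (hr : ∀ U ⊆ X, r' U = r U)
    (hl : ∀ U ⊆ X, (link' U ↔ link U)) : RootedRep X r' L link' := by
  obtain ⟨V, hV, ρ, v₀, h1, h2, h3, h4, h5⟩ := h
  exact ⟨V, hV, ρ, v₀, h1, fun U hU => (hr U hU).trans (h2 U hU), h3, h4,
    fun U hU => (h5 U hU).trans (hl U hU).symm⟩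

theorem RootedRep.of_frameRep {f : α} (h : FrameRep (insert f X) r (insert f L)) (h1 : r {f} = 1) :
    RootedRep X r L fun U => f ∈ r.cl U := by
  obtain ⟨V, hV, ρ, j, q, hE, hL⟩ := h
  obtain ⟨v, hv⟩ := hL f (mem_insert _ _)
  have h1' : ρ {Sum.inl f} = 1 := by
    rw [← image_singleton, ← q {f} (by simp), h1]
  refine ⟨V, hV, ρ, v, j, fun U hU => q U (hU.trans (subset_insert _ _)),
    fun e he => hE e (mem_insert_of_mem _ he), fun e he => hL e (mem_insert_of_mem _ he),
    fun U hU => ?_⟩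
  exact (ρ.mem_cl_congr_of_parallel (ρ.parallel_symm hv h1') hv _).trans
    (mem_cl_iff_of_rank_eq q hU).symm

/-- The element `f` is placed on the root joint. Which sets span the root joint is prescribed, and
this determines all ranks of sets containing `f`. -/
theorem RootedRep.frameRep {f : α} (h : RootedRep X r' L fun U => f ∈ r.cl U) (hf : f ∉ X)
    (hr : ∀ U ⊆ X, r U = r' U) : FrameRep (insert f X) r (insert f (L ∩ X)) := by
  classical
  obtain ⟨V, hV, ρ, v₀, j, q, hE, hL, hl⟩ := h
  have hι : ∀ U ⊆ X, (fun e => if e = f then Sum.inr v₀ else Sum.inl e : α → α ⊕ V) '' U =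
      Sum.inl '' U := fun U hU => image_congr fun e he => if_neg fun h : e = f => hf (h ▸ hU he)
  refine FrameRep.of (ρ := ρ) (j := Sum.inr) (ι := fun e => if e = f then Sum.inr v₀ else Sum.inl e)
    j (fun U hU => ?_) ?_ ?_
  · by_cases hfU : f ∈ U
    · obtain ⟨U', hU', rfl⟩ : ∃ U' ⊆ X, U = insert f U' :=
        ⟨U \ {f}, sdiff_singleton_subset_iff.2 hU, by
          rw [insert_sdiff_singleton, insert_eq_of_mem hfU]⟩
      rw [image_insert_eq, hι U' hU', if_pos rfl]
      by_cases hc : f ∈ r.cl U'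
      · rw [r.mem_cl.1 hc, ρ.mem_cl.1 ((hl U' hU').2 hc), hr U' hU', q U' hU']
      · rw [r.notMem_cl.1 hc, ρ.notMem_cl.1 (fun h => hc ((hl U' hU').1 h)), hr U' hU', q U' hU']
    · have hU' : U ⊆ X := fun e he => (hU he).resolve_left fun h => hfU (h ▸ he)
      rw [hι U hU', hr U hU', q U hU']
  · rintro e (rfl | he)
    · exact ⟨v₀, v₀, by rw [if_pos rfl]; exact ρ.mem_cl_of_mem (by simp)⟩
    · rw [if_neg fun h : e = f => hf (h ▸ he)]
      exact hE e he
  · rintro e (rfl | ⟨he, heX⟩)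
    · exact ⟨v₀, by rw [if_pos rfl]; exact ρ.mem_cl_of_mem (by simp)⟩
    · rw [if_neg fun h : e = f => hf (h ▸ heX)]
      exact hL e he

/-- A frame gives frame representations. -/
theorem Frame.comap_joints {V : Type u} {ρ : RankFn (α ⊕ V)} {J : Set V} (h : Frame ρ J E) :
    ∃ (_ : Finite J) (σ : RankFn (α ⊕ J)), (∀ S : Set J, σ (Sum.inr '' S) = S.ncard) ∧
      (∀ U, ρ.edge U = σ (Sum.inl '' U)) ∧
      (∀ e ∈ E, ∃ v w, Sum.inl e ∈ σ.cl {Sum.inr v, Sum.inr w}) ∧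
      (∀ e, ∀ v, ∀ hv : v ∈ J, Sum.inl e ∈ ρ.cl {Sum.inr v} → Sum.inl e ∈ σ.cl {Sum.inr ⟨v, hv⟩}) ∧
      ∀ v, ∀ hv : v ∈ J, ∀ U, Sum.inr v ∈ ρ.cl (Sum.inl '' U) ↔
        Sum.inr ⟨v, hv⟩ ∈ σ.cl (Sum.inl '' U) := by
  let φ : α ⊕ J → α ⊕ V := Sum.map id Subtype.val
  have hU : ∀ U : Set α, φ '' (Sum.inl '' U) = Sum.inl '' U := fun U => by
    rw [image_image]
    rfl
  refine ⟨h.finite, ρ.comap φ, fun S => ?_, fun U => ?_, fun e he => ?_, fun e v hv hev => ?_,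
    fun v hv U => ?_⟩
  · have : φ '' (Sum.inr '' S) = Sum.inr '' (Subtype.val '' S) := by
      rw [image_image, image_image]
      rfl
    rw [RankFn.comap_apply, this, h.joints _ (by simp),
      ncard_image_of_injective _ Subtype.val_injective]
  · rw [RankFn.comap_apply, hU]
    rfl
  · obtain ⟨v, hv, w, hw, h'⟩ := h.line e he
    refine ⟨⟨v, hv⟩, ⟨w, hw⟩, (ρ.mem_cl_comap _).2 ?_⟩
    rwa [image_pair]
  · rw [ρ.mem_cl_comap, image_singleton]
    exact hev
  · rw [ρ.mem_cl_comap, hU]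
    rfl

theorem Frame.rootedRep {V : Type u} {ρ : RankFn (α ⊕ V)} {J : Set V} (h : Frame ρ J X) {v₀ : V}
    (hv₀ : v₀ ∈ J) (hL : ∀ e ∈ L, ∃ v ∈ J, Sum.inl e ∈ ρ.cl {Sum.inr v}) :
    RootedRep X ρ.edge L fun U => Sum.inr v₀ ∈ ρ.cl (Sum.inl '' U) := by
  obtain ⟨hJ, σ, j, q, l, p, m⟩ := h.comap_joints
  exact ⟨J, hJ, σ, ⟨v₀, hv₀⟩, j, fun U _ => q U, l,
    fun e he => (hL e he).elim fun v ⟨hv, h⟩ => ⟨_, p e v hv h⟩, fun U _ => (m v₀ hv₀ U).symm⟩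

theorem Frame.frameRep {V : Type u} {ρ : RankFn (α ⊕ V)} {J : Set V} (h : Frame ρ J E)
    (hL : ∀ e ∈ L, ∃ v ∈ J, Sum.inl e ∈ ρ.cl {Sum.inr v}) : FrameRep E ρ.edge L := by
  obtain ⟨hJ, σ, j, q, l, p, m⟩ := h.comap_joints
  exact ⟨J, hJ, σ, j, fun U _ => q U, l,
    fun e he => (hL e he).elim fun v ⟨hv, h⟩ => ⟨_, p e v hv h⟩⟩

/-! ### Graphs with a root edge -/

/-- The matroid on `Y` with rank function `r` is represented by a graph in which a further edge
is spanned by exactly the sets in `link`. -/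
def RootedGraphic (Y : Set α) (r : RankFn α) (link : Set α → Prop) : Prop :=
  ∃ (V : Type u) (_ : Finite V) (p q : Option α → V),
    (∀ U ⊆ Y, r U = RankFn.lin (ZMod 2) (fun e => edgeVec (p e) (q e)) (some '' U)) ∧
    ∀ U ⊆ Y, (none ∈ (RankFn.lin (ZMod 2) fun e => edgeVec (p e) (q e)).cl (some '' U) ↔ link U)

theorem RootedGraphic.congr (h : RootedGraphic Y r link) (hr : ∀ U ⊆ Y, r' U = r U)
    (hl : ∀ U ⊆ Y, (link' U ↔ link U)) : RootedGraphic Y r' link' := by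
  obtain ⟨V, hV, p, q, h1, h2⟩ := h
  exact ⟨V, hV, p, q, fun U hU => (hr U hU).trans (h1 U hU),
    fun U hU => (h2 U hU).trans (hl U hU).symm⟩

theorem RootedGraphic.graphicRep {f : α} (h : RootedGraphic Y r' fun U => f ∈ r.cl U) (hf : f ∉ Y)
    (hr : ∀ U ⊆ Y, r U = r' U) : GraphicRep (insert f Y) r := by
  classical
  obtain ⟨V, hV, p, q, h1, h2⟩ := h
  let g : α → Option α := fun e => if e = f then none else some e
  have hg : ∀ U ⊆ Y, g '' U = some '' U := fun U hU =>
    image_congr fun e he => if_neg fun h : e = f => hf (h ▸ hU he)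
  have hgf : g f = none := if_pos rfl
  refine ⟨V, hV, p ∘ g, q ∘ g, fun U hU => ?_⟩
  have hc : RankFn.lin (ZMod 2) (fun e => edgeVec ((p ∘ g) e) ((q ∘ g) e)) U =
      RankFn.lin (ZMod 2) (fun e => edgeVec (p e) (q e)) (g '' U) := by
    rw [RankFn.lin_apply, RankFn.lin_apply, image_image]
    rfl
  rw [hc]
  by_cases hfU : f ∈ U
  · obtain ⟨U', hU', rfl⟩ : ∃ U' ⊆ Y, U = insert f U' :=
      ⟨U \ {f}, sdiff_singleton_subset_iff.2 hU, by
        rw [insert_sdiff_singleton, insert_eq_of_mem hfU]⟩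
    rw [image_insert_eq, hg U' hU', hgf]
    by_cases hc : f ∈ r.cl U'
    · rw [r.mem_cl.1 hc, RankFn.mem_cl _ |>.1 ((h2 U' hU').2 hc), hr U' hU', h1 U' hU']
    · rw [r.notMem_cl.1 hc, RankFn.notMem_cl _ |>.1 (fun h => hc ((h2 U' hU').1 h)), hr U' hU',
        h1 U' hU']
  · have hU' : U ⊆ Y := fun e he => (hU he).resolve_left fun h => hfU (h ▸ he)
    rw [hg U hU', hr U hU', h1 U hU']

/-- The series connection of graphs. -/
theorem RootedGraphic.series {Z₁ Z₂ : Set α} {link₁ link₂ : Set α → Prop}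
    (h₁ : RootedGraphic Z₁ r link₁) (h₂ : RootedGraphic Z₂ r link₂) (hd : Disjoint Z₁ Z₂)
    (hr : ∀ U₁ ⊆ Z₁, ∀ U₂ ⊆ Z₂, r (U₁ ∪ U₂) = r U₁ + r U₂)
    (hl : ∀ U₁ ⊆ Z₁, ∀ U₂ ⊆ Z₂, (link (U₁ ∪ U₂) ↔ link₁ U₁ ∧ link₂ U₂)) :
    RootedGraphic (Z₁ ∪ Z₂) r link := by
  classical
  obtain ⟨V₁, hV₁, p₁, q₁, r₁, l₁⟩ := h₁
  obtain ⟨V₂, hV₂, p₂, q₂, r₂, l₂⟩ := h₂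
  let f₁ : Option α → V₁ → ZMod 2 := fun e => edgeVec (p₁ e) (q₁ e)
  let f₂ : Option α → V₂ → ZMod 2 := fun e => edgeVec (p₂ e) (q₂ e)
  -- The direct sum of the two representations, in which the root edge is the sum of the two root
  -- edges. So it is spanned exactly when both of them are.
  let f : Option α → (V₁ → ZMod 2) × (V₂ → ZMod 2) := fun e =>
    (if ∀ a ∈ e, a ∈ Z₁ then f₁ e else 0, if ∃ a ∈ e, a ∈ Z₁ then 0 else f₂ e)
  -- The graph realizing this: an end of the second root edge is identified with an end of the
  -- first, and the new root edge joins the two remaining ends.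
  let φ : V₂ → V₁ ⊕ V₂ := fun v => if v = p₂ none then Sum.inl (q₁ none) else Sum.inr v
  let p : Option α → V₁ ⊕ V₂ := fun e =>
    if ∀ a ∈ e, a ∈ Z₁ then Sum.inl (p₁ e) else φ (p₂ e)
  let q : Option α → V₁ ⊕ V₂ := fun e =>
    if ∃ a ∈ e, a ∈ Z₁ then Sum.inl (q₁ e) else φ (q₂ e)
  have f_some : ∀ a ∈ Z₁, f (some a) = (f₁ (some a), 0) := fun a ha => by simp [f, ha]
  have f_some' : ∀ a ∈ Z₂, f (some a) = (0, f₂ (some a)) := fun a ha => by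
    have : a ∉ Z₁ := fun h => hd.ne_of_mem h ha rfl
    simp [f, this]
  have f_none : f none = (f₁ none, f₂ none) := by simp [f]
  -- The linear map induced by the identification of the two vertices. Its kernel contains no
  -- nonzero vector whose second component has coordinate sum zero, and all the vectors of `f` are
  -- of this kind.
  let T : (V₁ → ZMod 2) × (V₂ → ZMod 2) →ₗ[ZMod 2] (V₁ ⊕ V₂ → ZMod 2) :=
    { toFun := fun w => Sum.elim (fun v => w.1 v + if v = q₁ none then w.2 (p₂ none) else 0)
        (fun v => if v = p₂ none then 0 else w.2 v)
      map_add' := fun w w' => by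
        ext (v | v)
        · simp only [Sum.elim_inl, Pi.add_apply, Prod.fst_add, Prod.snd_add]
          split_ifs <;> ring
        · simp only [Sum.elim_inr, Pi.add_apply, Prod.snd_add]
          split_ifs <;> ring
      map_smul' := fun c w => by
        ext (v | v)
        · simp only [Sum.elim_inl, Pi.smul_apply, Prod.smul_fst, Prod.smul_snd, RingHom.id_apply,
            smul_eq_mul]
          split_ifs <;> ring
        · simp only [Sum.elim_inr, Pi.smul_apply, Prod.smul_snd, RingHom.id_apply, smul_eq_mul]
          split_ifs <;> ring }
  have T_inl : ∀ v, T (pointVec v, 0) = pointVec (Sum.inl v) := fun v => by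
    ext (u | u) <;> simp [T, pointVec]
  have T_inr : ∀ v, T (0, pointVec v) = pointVec (φ v) := fun v => by
    by_cases hv : v = p₂ none
    · subst hv
      ext (u | u) <;> simp +contextual [T, φ, pointVec]
    · ext (u | u)
      · simp [T, φ, pointVec, hv, Ne.symm hv]
      · by_cases hu : u = p₂ none
        · subst hu
          simp [T, φ, pointVec, hv, Ne.symm hv]
        · simp [T, φ, pointVec, hv, hu]
  have T_edge : ∀ u v u' v', T (edgeVec u v, edgeVec u' v') =
      edgeVec (Sum.inl u) (Sum.inl v) + edgeVec (φ u') (φ v') := fun u v u' v' => by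
    rw [edgeVec_eq, edgeVec_eq, edgeVec_eq, edgeVec_eq, ← T_inl, ← T_inl, ← T_inr, ← T_inr,
      ← map_add, ← map_add, ← map_add]
    simp
  have T_f : ∀ e, edgeVec (p e) (q e) = T (f e) := by
    rintro (_ | a)
    · rw [f_none, T_edge]
      have h1 : φ (p₂ none) = Sum.inl (q₁ none) := if_pos rfl
      rw [h1, edgeVec_comm (Sum.inl (q₁ none)), edgeVec_add]
      simp [p, q]
    · by_cases ha : a ∈ Z₁
      · have := T_edge (p₁ (some a)) (q₁ (some a)) (p₂ none) (p₂ none)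
        rw [edgeVec_self, edgeVec_self, add_zero] at this
        simp [p, q, ha, f, f₁, this]
      · have := T_edge (p₁ none) (p₁ none) (p₂ (some a)) (q₂ (some a))
        rw [edgeVec_self, edgeVec_self, zero_add] at this
        simp [p, q, ha, f, f₂, this]
  obtain ⟨ψ, hψ⟩ := exists_coordSum V₂
  have hlin : RankFn.lin (ZMod 2) (fun e => edgeVec (p e) (q e)) = RankFn.lin (ZMod 2) f := by
    refine RankFn.ext fun X => (RankFn.lin_map (S := LinearMap.ker (ψ.comp (LinearMap.snd _ _ _)))
      (φ := T) (fun e _ => ?_) (fun w hw h0 => ?_) fun e _ => T_f e).symm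
    · rw [LinearMap.mem_ker]
      change ψ (f e).2 = 0
      have h0 : ψ (f₂ e) = 0 := by
        change ψ (edgeVec (p₂ e) (q₂ e)) = 0
        rw [edgeVec_eq, map_add, hψ, hψ]
        exact zmod2_add_self _
      simp only [f]
      split_ifs
      · exact map_zero _
      · exact h0
    · have h2 : ∀ v, v ≠ p₂ none → w.2 v = 0 := fun v hv => by
        have := congrFun h0 (Sum.inr v)
        simpa [T, hv] using this
      have h3 : w.2 = w.2 (p₂ none) • pointVec (p₂ none) := by
        ext v
        by_cases hv : v = p₂ none
        · rw [hv, Pi.smul_apply, pointVec_self]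
          simp
        · rw [h2 v hv, Pi.smul_apply, pointVec_of_ne hv]
          simp
      have h4 : w.2 (p₂ none) = 0 := by
        have h5 : ψ w.2 = 0 := hw
        rw [h3, map_smul, hψ] at h5
        simpa using h5
      have h5 : w.2 = 0 := by rw [h3, h4, zero_smul]
      refine Prod.ext (funext fun v => ?_) h5
      have := congrFun h0 (Sum.inl v)
      simpa [T, h4] using this
  have hspan : ∀ U₁ ⊆ Z₁, ∀ U₂ ⊆ Z₂, Submodule.span (ZMod 2) (f '' (some '' (U₁ ∪ U₂))) =
      (Submodule.span (ZMod 2) (f₁ '' (some '' U₁))).prod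
        (Submodule.span (ZMod 2) (f₂ '' (some '' U₂))) := by
    intro U₁ h₁ U₂ h₂
    rw [← LinearMap.span_inl_union_inr, image_union, image_union]
    congr 2
    · rw [image_image, image_image, image_image]
      exact image_congr fun a ha => f_some a (h₁ ha)
    · rw [image_image, image_image, image_image]
      exact image_congr fun a ha => f_some' a (h₂ ha)
  have split : ∀ U ⊆ Z₁ ∪ Z₂, ∃ U₁ ⊆ Z₁, ∃ U₂ ⊆ Z₂, U = U₁ ∪ U₂ := fun U hU =>
    ⟨U ∩ Z₁, inter_subset_right, U ∩ Z₂, inter_subset_right, by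
      rw [← inter_union_distrib_left, inter_eq_self_of_subset_left hU]⟩
  refine ⟨V₁ ⊕ V₂, inferInstance, p, q, fun U hU => ?_, fun U hU => ?_⟩
  · obtain ⟨U₁, h₁, U₂, h₂, rfl⟩ := split U hU
    rw [hlin, hr _ h₁ _ h₂, r₁ _ h₁, r₂ _ h₂, RankFn.lin_apply, RankFn.lin_apply, RankFn.lin_apply,
      hspan _ h₁ _ h₂]
    have e : ∀ (A : Submodule (ZMod 2) (V₁ → ZMod 2)) (B : Submodule (ZMod 2) (V₂ → ZMod 2)),
        Module.finrank (ZMod 2) (A.prod B) = Module.finrank (ZMod 2) (A × B) := fun A B =>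
      LinearEquiv.finrank_eq
        { toFun := fun x => (⟨x.1.1, x.2.1⟩, ⟨x.1.2, x.2.2⟩)
          map_add' := fun x y => rfl
          map_smul' := fun c x => rfl
          invFun := fun x => ⟨(x.1.1, x.2.1), x.1.2, x.2.2⟩
          left_inv := fun x => rfl
          right_inv := fun x => rfl }
    rw [e, Module.finrank_prod]
    push_cast
    rfl
  · obtain ⟨U₁, h₁, U₂, h₂, rfl⟩ := split U hU
    rw [hlin, RankFn.mem_cl_lin, hspan _ h₁ _ h₂, f_none, Submodule.mem_prod, hl _ h₁ _ h₂,
      ← l₁ _ h₁, ← l₂ _ h₂, RankFn.mem_cl_lin, RankFn.mem_cl_lin]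

end

end FrameMatroids

namespace FrameMatroids

universe u v

/-! ### Cycles through a vertex next to a balanced set of edges. -/

section

variable {V : Type v} {α : Type u} {ρ σ : RankFn (α ⊕ V)} {G : Graph V α}

/-- Rank functions framed by the same graph agree on edges if they agree on its cycles. -/
theorem Framing.edge_eq (hρ : Framing ρ G) (hσ : Framing σ G) (hV : G.vertexSet.Finite)
    (hE : G.edgeSet.Finite)
    (h : ∀ W D, IsCycleOn G W D → (ρ.edge D < D.ncard ↔ σ.edge D < D.ncard)) {X : Set α}
    (hX : X ⊆ G.edgeSet) : ρ.edge X = σ.edge X := by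
  have hΩ : hρ.biasedGraph hV hE = hσ.biasedGraph hV hE := by
    have : {C | IsCycle G C ∧ ρ.edge C < C.ncard} = {C | IsCycle G C ∧ σ.edge C < C.ncard} := by
      ext C
      exact and_congr_right fun ⟨W, hC⟩ => h W C hC
    simp only [Framing.biasedGraph, this]
  refine RankFn.eq_of_forall_circ hE (fun C hC => ⟨fun hc => ?_, fun hc => ?_⟩) hX
  · exact (hσ.circ_of_isFrameCircuit hV hE
      (hΩ ▸ hρ.isFrameCircuit_of_circ hV hE hC hc)).1
  · exact (hρ.circ_of_isFrameCircuit hV hE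
      (hΩ ▸ hσ.isFrameCircuit_of_circ hV hE hC hc)).1

/-- Let `B` be a set of edges inside `A` that spans no vertex of `A`.  A cycle in the graph formed by
`B` and edges joining `y` to `A` is dependent if and only if its edges at `y` are parallel modulo
`B`. -/
theorem Framing.cycle_dependent_iff (hF : Framing ρ G) {A W : Set V} {B D : Set α} {y : V}
    (hAV : A ⊆ G.vertexSet) (hV : G.vertexSet.Finite)
    (hy : y ∈ G.vertexSet) (hyA : y ∉ A) (hBE : B ⊆ G.edgeSet)
    (hB : ∀ e ∈ B, ∀ v, G.Inc e v → v ∈ A) (hAB : ∀ v ∈ A, Sum.inr v ∉ ρ.cl (Sum.inl '' B))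
    (hD : IsCycleOn G W D) (hDB : ∀ e ∈ D, e ∉ B → ∃ a ∈ A, G.IsLink e y a) :
    ρ.edge D < D.ncard ↔ ∀ d ∈ D, d ∉ B → ∀ d' ∈ D, d' ∉ B →
      Sum.inl d' ∈ ρ.cl (insert (Sum.inl d) (Sum.inl '' B)) := by
  have hBA : Sum.inl '' B ⊆ ρ.cl (Sum.inr '' A) := hF.subset_cl hBE hB
  constructor
  · intro hdep d hd hdB d' hd' hdB'
    by_cases hne : d' = d
    · rw [hne]
      exact ρ.mem_cl_of_mem (mem_insert _ _)
    obtain ⟨a, ha, hl⟩ := hDB d hd hdB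
    obtain ⟨a', ha', hl'⟩ := hDB d' hd' hdB'
    -- Opened at `d`, the cycle is a path from `y`. Its first edge is the only one at `y`, so it
    -- must be `d'`, and the rest of the path lies in `B`. As `D` is a circuit, `d'` is spanned by
    -- `d` and this rest.
    obtain ⟨P, hP, rfl, hdP⟩ : ∃ P, (∃ U, IsPath G y a U P) ∧ D = insert d P ∧ d ∉ P := by
      obtain ⟨x₁, x₂, P, hP, hl₁, hdP, rfl⟩ := hD.rotate hd
      rcases hl.eq_and_eq_or_eq_and_eq hl₁ with ⟨rfl, rfl⟩ | ⟨rfl, rfl⟩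
      · exact ⟨P, ⟨_, hP⟩, rfl, hdP⟩
      · exact ⟨P, ⟨_, hP.reverse⟩, rfl, hdP⟩
    obtain ⟨U, hP⟩ := hP
    have hd'P : d' ∈ P := hd'.resolve_left hne
    cases hP with
    | nil => exact absurd hd'P (notMem_empty _)
    | @cons _ z _ U e Q he hQ hyU =>
      have hQy : ∀ e ∈ Q, ∀ v, ¬ G.IsLink e y v := fun e he v h =>
        hyU (hQ.mem_of_inc he h.inc_left)
      have hde : d' = e := hd'P.resolve_right fun h => hQy _ h _ hl'
      subst hde
      have hQB : Q ⊆ B := fun e he => by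
        by_contra heB
        obtain ⟨v, -, h⟩ := hDB e (Or.inr (Or.inr he)) heB
        exact hQy e he v h
      have hc := hF.circ_of_cycle hD hdep
      have hi := hF.ind_of_ssubset hD (D := insert d Q) (by
        refine ⟨insert_subset_insert (subset_insert _ _), fun h => ?_⟩
        rcases h (Or.inr (mem_insert _ _)) with h | h
        · exact hne h
        · exact hQy _ h _ hl')
      have h1 : d' ∈ ρ.edge.cl (insert d Q) := by
        rw [RankFn.mem_cl, insert_comm]
        refine le_antisymm ?_ (ρ.edge.mono (insert_subset_insert (subset_insert _ _)))
        rw [hi.2]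
        have h2 := hc.2.1
        have h3 : (insert d (insert d' Q)).ncard = (insert d Q).ncard + 1 := by
          rw [insert_comm, ncard_insert_of_notMem ?_ hi.1]
          rintro (h | h)
          · exact hne h
          · exact hQy _ h _ hl'
        rw [h3] at h2
        push_cast at h2
        linarith
      rw [RankFn.edge, RankFn.mem_cl_comap, image_insert_eq] at h1
      exact ρ.cl_mono (insert_subset_insert (image_mono hQB)) h1
  · intro h
    by_contra hind
    by_cases hDsub : D ⊆ B
    · obtain ⟨v, hv⟩ := hD.nonempty_vertices
      obtain ⟨e, he⟩ := hD.nonempty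
      obtain ⟨x₁, x₂, hl⟩ := Graph.exists_isLink_of_mem_edgeSet (hBE (hDsub he))
      exact hAB x₁ (hB e (hDsub he) _ hl.inc_left) (ρ.cl_mono (image_mono hDsub)
        (hF.mem_cl_of_cycle hD hind (hD.mem_of_inc he hl.inc_left)))
    · obtain ⟨d, hd, hdB⟩ := not_subset.1 hDsub
      obtain ⟨a, ha, hl⟩ := hDB d hd hdB
      -- An independent cycle would span `y`. As all its edges at `y` are parallel to `d` modulo
      -- `B`, already `d` and `B` would span `y`; exchanging `d` for `y` then makes `B` and `y` span
      -- the other end `a`, and by skewness `B` alone would.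
      have h1 : Sum.inr y ∈ ρ.cl (insert (Sum.inl d) (Sum.inl '' B)) := by
        refine ρ.cl_subset_cl ?_ (hF.mem_cl_of_cycle hD hind (hD.mem_of_inc hd hl.inc_left))
        rintro _ ⟨e, he, rfl⟩
        by_cases heB : e ∈ B
        · exact ρ.mem_cl_of_mem (Or.inr (mem_image_of_mem _ heB))
        · exact h d hd hdB e he heB
      have hsk := hF.skew hV hAV
      have hyc : Sum.inr y ∈ ρ.cl (Sum.inr '' (G.vertexSet \ A)) :=
        ρ.mem_cl_of_mem (mem_image_of_mem _ ⟨hy, hyA⟩)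
      have h2 : Sum.inr y ∉ ρ.cl (Sum.inl '' B) := fun hc => by
        have h3 := ρ.cl_inter_of_skew hsk (ρ.cl_subset_cl hBA hc) hyc
        have h4 := hF.joints {y} (singleton_subset_iff.2 hy)
        rw [image_singleton, h3] at h4
        simp at h4
      have h3 := ρ.exchange h1 h2
      have h4 : Sum.inr a ∈ ρ.cl (Sum.inl '' B ∪ {Sum.inr y}) := by
        refine ρ.cl_subset_cl ?_ (hF.swap hl)
        rintro _ (rfl | rfl)
        · rwa [union_singleton]
        · exact ρ.mem_cl_of_mem (Or.inr rfl)
      exact hAB a ha (ρ.mem_cl_of_skew hsk hBA (singleton_subset_iff.2 hyc)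
        (ρ.mem_cl_of_mem (mem_image_of_mem _ ha)) h4)

end

end FrameMatroids

namespace FrameMatroids

universe u v

/-! ### Rational coordinates for a balanced set of edges and the edges joining it to a vertex. -/

section

variable {V : Type v} {α : Type u} {σ : RankFn (α ⊕ V)} {G : Graph V α}

/-- The standard basis vectors over the rationals. -/
noncomputable def ratVec (v : V) : V → ℚ :=
  open Classical in Pi.single v 1

theorem exists_functional [Finite V] (g : V → ℚ) :
    ∃ φ : (V → ℚ) →ₗ[ℚ] ℚ, ∀ v, φ (ratVec v) = g v := by
  classical
  refine ⟨(Pi.basisFun ℚ V).constr ℚ g, fun v => ?_⟩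
  have : ratVec v = Pi.basisFun ℚ V v := by
    rw [Pi.basisFun_apply, ratVec]
  rw [this, Module.Basis.constr_basis]

theorem rank_ratVec [Finite V] (S : Set V) : RankFn.lin ℚ id (ratVec '' S) = S.ncard := by
  classical
  have h1 : LinearIndependent ℚ (fun v : S => ratVec v.1) := by
    have : (fun v : S => ratVec v.1) = fun v : S => Pi.basisFun ℚ V v.1 := by
      ext v
      rw [Pi.basisFun_apply, ratVec]
    rw [this]
    exact (Pi.basisFun ℚ V).linearIndependent.comp _ Subtype.val_injective
  have := Fintype.ofFinite S
  rw [RankFn.lin_apply, image_id, image_eq_range, finrank_span_eq_card h1,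
    ← Nat.card_eq_fintype_card, Nat.card_coe_set_eq]

/-- Let `B` be a set of edges inside `A` that connects `A` and spans no vertex of `A`.  Then `B` and
the edges joining `A` to a further vertex `y` have a rational representation. -/
theorem Framing.exists_ratVec [Finite V] (hF : Framing σ G) {A : Set V} {B Y : Set α} {y : V}
    (hAV : A ⊆ G.vertexSet) (hy : y ∈ G.vertexSet) (hyA : y ∉ A) (hBf : B.Finite) (hYf : Y.Finite)
    (hBE : B ⊆ G.edgeSet) (hB : ∀ e ∈ B, ∀ v, G.Inc e v → v ∈ A)
    (hAB : ∀ v ∈ A, Sum.inr v ∉ σ.cl (Sum.inl '' B)) (hY : ∀ e ∈ Y, ∃ a ∈ A, G.IsLink e y a)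
    (hconn : ∀ a ∈ A, ∀ b ∈ A, Reach G B a b) :
    ∃ (w : α → V → ℚ) (c : α → ℚ),
      (∀ e ∈ B, ∃ a ∈ A, ∃ b ∈ A, w e = ratVec a - ratVec b) ∧
      (∀ e ∈ Y, ∃ a ∈ A, w e = ratVec a - c e • ratVec y) ∧
      (∀ U ⊆ B ∪ Y, σ (Sum.inl '' U) = RankFn.lin ℚ id (w '' U)) ∧
      ∀ U ⊆ B ∪ Y, σ (insert (Sum.inr y) (Sum.inl '' U)) =
        RankFn.lin ℚ id (insert (ratVec y) (w '' U)) := by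
  classical
  have hBY : ∀ e ∈ Y, e ∉ B := fun e he heB => by
    obtain ⟨a, -, hl⟩ := hY e he
    exact hyA (hB e heB y hl.inc_left)
  have hVf : G.vertexSet.Finite := toFinite _
  -- labels of the edges at `y`
  obtain ⟨c, hc0, hc⟩ : ∃ c : α → ℚ, (∀ e, c e ≠ 0) ∧ ∀ d ∈ Y, ∀ d' ∈ Y,
      (Sum.inl d' ∈ σ.cl (insert (Sum.inl d) (Sum.inl '' B)) ↔ c d = c d') := by
    have hn : ∀ d ∈ Y, Sum.inl d ∉ σ.cl (Sum.inl '' B) := by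
      intro d hd hdc
      obtain ⟨a, ha, hl⟩ := hY d hd
      have h1 := hF.joints (insert y A) (insert_subset hy hAV)
      have h2 := hF.joints A hAV
      have h3 : Sum.inl d ∈ σ.cl (Sum.inr '' A) := σ.cl_subset_cl (hF.subset_cl hBE hB) hdc
      have h4 : Sum.inr y ∈ σ.cl (Sum.inr '' A) := by
        refine σ.cl_subset_cl ?_ (hF.swap hl.symm)
        rintro _ (rfl | rfl)
        · exact h3
        · exact σ.mem_cl_of_mem (mem_image_of_mem _ ha)
      rw [image_insert_eq, σ.mem_cl.1 h4, h2, ncard_insert_of_notMem hyA] at h1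
      push_cast at h1
      linarith
    -- The class of edges at `y` parallel to `d` modulo `B`. Edges get equal labels exactly when
    -- they are in the same class.
    let g : α → Set α := fun d => {d' ∈ Y | Sum.inl d' ∈ σ.cl (insert (Sum.inl d) (Sum.inl '' B))}
    obtain ⟨m, hm⟩ := countable_iff_exists_injOn.1 (hYf.image g).countable
    have hsub : ∀ d d', Sum.inl d' ∈ σ.cl (insert (Sum.inl d) (Sum.inl '' B)) →
        σ.cl (insert (Sum.inl d') (Sum.inl '' B)) ⊆ σ.cl (insert (Sum.inl d) (Sum.inl '' B)) :=
      fun d d' h => σ.cl_subset_cl (insert_subset h ((subset_insert _ _).trans (σ.subset_cl _)))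
    -- The summand one keeps the labels away from zero, so that an edge at `y` is not parallel to
    -- its end in `A`.
    refine ⟨fun d => (m (g d) : ℚ) + 1, fun e => by positivity, fun d hd d' hd' => ?_⟩
    constructor
    · intro h
      have h' := σ.exchange h (hn d' hd')
      have : g d = g d' := by
        ext e
        exact and_congr_right fun _ => ⟨fun he => hsub _ _ h' he, fun he => hsub _ _ h he⟩
      simp only [this]
    · intro h
      have h1 : m (g d) = m (g d') := by exact_mod_cast add_right_cancel h
      have h2 := hm (mem_image_of_mem g hd) (mem_image_of_mem g hd') h1
      have h3 : d' ∈ g d' := ⟨hd', σ.mem_cl_of_mem (mem_insert _ _)⟩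
      rw [← h2] at h3
      exact h3.2
  -- the vectors
  have hpq : ∀ e, ∃ a b, e ∈ B ∪ Y → a ∈ A ∧ G.IsLink e a b ∧ (e ∈ B → b ∈ A) ∧ (e ∉ B → b = y) := by
    intro e
    by_cases he : e ∈ B ∪ Y
    · by_cases heB : e ∈ B
      · obtain ⟨a, b, hl⟩ := Graph.exists_isLink_of_mem_edgeSet (hBE heB)
        exact ⟨a, b, fun _ => ⟨hB e heB _ hl.inc_left, hl, fun _ => hB e heB _ hl.inc_right,
          fun h => absurd heB h⟩⟩
      · obtain ⟨a, ha, hl⟩ := hY e (he.resolve_left heB)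
        exact ⟨a, y, fun _ => ⟨ha, hl.symm, fun h => absurd h heB, fun _ => rfl⟩⟩
    · exact ⟨y, y, fun h => absurd h he⟩
  choose p q hpq using hpq
  let k : α → ℚ := fun e => if e ∈ B then 1 else c e
  have hk0 : ∀ e, k e ≠ 0 := fun e => by
    simp only [k]
    split_ifs
    · exact one_ne_zero
    · exact hc0 e
  let w : α → V → ℚ := fun e => ratVec (p e) - k e • ratVec (q e)
  have hne : ∀ e ∈ B ∪ Y, p e ≠ q e := by
    intro e he h
    obtain ⟨h1, h2, h3, h4⟩ := hpq e he
    by_cases heB : e ∈ B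
    · rw [← h] at h2
      refine hAB _ h1 (σ.cl_mono ?_ (hF.loop h2))
      exact singleton_subset_iff.2 (mem_image_of_mem _ heB)
    · rw [h, h4 heB] at h1
      exact hyA h1
  have hwB : ∀ e ∈ B, w e = ratVec (p e) - ratVec (q e) := fun e he => by
    simp [w, k, he]
  have hwY : ∀ e ∈ Y, w e = ratVec (p e) - c e • ratVec y := fun e he => by
    simp [w, k, hBY e he, (hpq e (Or.inr he)).2.2.2 (hBY e he)]
  -- comparison in the graph with a loop added at `y`
  let H : Graph V (Option α) :=
    { vertexSet := G.vertexSet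
      IsLink := fun o a b => (∃ e ∈ B ∪ Y, o = some e ∧ G.IsLink e a b) ∨ (o = none ∧ a = y ∧ b = y)
      isLink_symm := fun o _ => ⟨by
        rintro a b (⟨e, he, h1, h2⟩ | ⟨h1, h2, h3⟩)
        · exact Or.inl ⟨e, he, h1, h2.symm⟩
        · exact Or.inr ⟨h1, h3, h2⟩⟩
      eq_or_eq_of_isLink_of_isLink := by
        rintro o a b a' b' (⟨e, he, rfl, h2⟩ | ⟨rfl, rfl, rfl⟩) (⟨e', he', h1, h2'⟩ | ⟨h1, rfl, rfl⟩)
        · obtain rfl := Option.some_injective _ h1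
          exact h2.left_eq_or_eq h2'
        · exact absurd h1 (by simp)
        · exact absurd h1 (by simp)
        · exact Or.inl rfl
      left_mem_of_isLink := by
        rintro o a b (⟨e, he, h1, h2⟩ | ⟨h1, rfl, h3⟩)
        · exact h2.left_mem
        · exact hy }
  have H_some : ∀ {e a b}, H.IsLink (some e) a b ↔ e ∈ B ∪ Y ∧ G.IsLink e a b := by
    intro e a b
    constructor
    · rintro (⟨e', he, h1, h2⟩ | ⟨h1, -⟩)
      · obtain rfl := Option.some_injective _ h1
        exact ⟨he, h2⟩
      · exact absurd h1 (by simp)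
    · exact fun h => Or.inl ⟨e, h.1, rfl, h.2⟩
  have H_none : H.IsLink none y y := Or.inr ⟨rfl, rfl, rfl⟩
  have H_edge : H.edgeSet = insert none (some '' (B ∪ Y)) := by
    ext o
    constructor
    · rintro ⟨a, b, (⟨e, he, rfl, -⟩ | ⟨rfl, -⟩)⟩
      · exact Or.inr (mem_image_of_mem _ he)
      · exact Or.inl rfl
    · rintro (rfl | ⟨e, he, rfl⟩)
      · exact H_none.edge_mem
      · exact (H_some.2 ⟨he, (hpq e he).2.1⟩).edge_mem
  have H_fin : H.edgeSet.Finite := by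
    rw [H_edge]
    exact ((hBf.union hYf).image _).insert _
  let g : Option α ⊕ V → α ⊕ V := Sum.elim (fun o => o.elim (Sum.inr y) Sum.inl) Sum.inr
  let z : Option α ⊕ V → V → ℚ := Sum.elim (fun o => o.elim (ratVec y) w) ratVec
  have hσ : Framing (σ.comap g) H := by
    refine ⟨fun S hS => ?_, ?_, ?_, ?_⟩
    · rw [RankFn.comap_apply, image_image]
      exact hF.joints S hS
    · rintro (_ | e) a b hl
      · obtain ⟨e, -, h, -⟩ | ⟨-, rfl, rfl⟩ := hl
        · simp at h
        · rw [RankFn.mem_cl_comap, image_pair]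
          exact σ.mem_cl_of_mem (by simp [g])
      · rw [RankFn.mem_cl_comap, image_pair]
        exact hF.mem_cl (H_some.1 hl).2
    · rintro (_ | e) a b hl
      · obtain ⟨e, -, h, -⟩ | ⟨-, rfl, rfl⟩ := hl
        · simp at h
        · exact RankFn.mem_cl_of_mem _ (by simp)
      · rw [RankFn.mem_cl_comap, image_pair]
        exact hF.swap (H_some.1 hl).2
    · rintro (_ | e) a hl
      · obtain ⟨e, -, h, -⟩ | ⟨-, rfl, -⟩ := hl
        · simp at h
        · rw [RankFn.mem_cl_comap, image_singleton]
          exact σ.mem_cl_of_mem (by simp [g])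
      · rw [RankFn.mem_cl_comap, image_singleton]
        exact hF.loop (H_some.1 hl).2
  have hends : ∀ {e a b}, H.IsLink (some e) a b → (a = p e ∧ b = q e) ∨ (a = q e ∧ b = p e) := by
    intro e a b hl
    obtain ⟨he, hl⟩ := H_some.1 hl
    exact hl.eq_and_eq_or_eq_and_eq (hpq e he).2.1
  have hτ : Framing (RankFn.lin ℚ z) H := by
    refine ⟨fun S hS => ?_, ?_, ?_, ?_⟩
    · rw [← rank_ratVec S, RankFn.lin_apply, RankFn.lin_apply, image_image, image_id]
      rfl
    · rintro (_ | e) a b hl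
      · obtain ⟨e, -, h, -⟩ | ⟨-, rfl, rfl⟩ := hl
        · simp at h
        · rw [RankFn.mem_cl_lin, image_pair]
          exact Submodule.subset_span (by simp [z])
      · rw [RankFn.mem_cl_lin, image_pair]
        change ratVec (p e) - k e • ratVec (q e) ∈ Submodule.span ℚ {ratVec a, ratVec b}
        rcases hends hl with ⟨rfl, rfl⟩ | ⟨rfl, rfl⟩
        · exact Submodule.sub_mem _ (Submodule.subset_span (by simp))
            (Submodule.smul_mem _ _ (Submodule.subset_span (by simp)))
        · exact Submodule.sub_mem _ (Submodule.subset_span (by simp))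
            (Submodule.smul_mem _ _ (Submodule.subset_span (by simp)))
    · rintro (_ | e) a b hl
      · obtain ⟨e, -, h, -⟩ | ⟨-, rfl, rfl⟩ := hl
        · simp at h
        · exact RankFn.mem_cl_of_mem _ (by simp)
      · rw [RankFn.mem_cl_lin, image_pair]
        change ratVec b ∈ Submodule.span ℚ {w e, ratVec a}
        rcases hends hl with ⟨rfl, rfl⟩ | ⟨rfl, rfl⟩
        · have h1 : ratVec (q e) = (k e)⁻¹ • (ratVec (p e) - w e) := by
            simp only [w]
            rw [sub_sub_cancel, smul_smul, inv_mul_cancel₀ (hk0 e), one_smul]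
          rw [h1]
          exact Submodule.smul_mem _ _ (Submodule.sub_mem _ (Submodule.subset_span (by simp))
            (Submodule.subset_span (by simp)))
        · have h1 : ratVec (p e) = w e + k e • ratVec (q e) := by
            simp only [w]
            rw [sub_add_cancel]
          rw [h1]
          exact Submodule.add_mem _ (Submodule.subset_span (by simp))
            (Submodule.smul_mem _ _ (Submodule.subset_span (by simp)))
    · rintro (_ | e) a hl
      · obtain ⟨e, -, h, -⟩ | ⟨-, rfl, -⟩ := hl
        · simp at h
        · rw [RankFn.mem_cl_lin, image_singleton]
          exact Submodule.subset_span (by simp [z])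
      · have := hne e (H_some.1 hl).1
        rcases hends hl with ⟨h1, h2⟩ | ⟨h1, h2⟩
        · exact absurd (h1.symm.trans h2) this
        · exact absurd (h2.symm.trans h1) this
  have hzU : ∀ U : Set α, z '' (Sum.inl '' (some '' U)) = w '' U := fun U => by
    rw [image_image, image_image]
    rfl
  have hgU : ∀ U : Set α, g '' (Sum.inl '' (some '' U)) = Sum.inl '' U := fun U => by
    rw [image_image, image_image]
    rfl
  -- The coordinate sum vanishes on the differences representing `B`, so these span no unit vector.
  obtain ⟨sumφ, hsum⟩ := exists_functional fun _ : V => 1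
  have hτB : ∀ v ∈ A, Sum.inr v ∉ (RankFn.lin ℚ z).cl (Sum.inl '' (some '' B)) := by
    intro v hv h
    rw [RankFn.mem_cl_lin, hzU] at h
    have h1 : Submodule.span ℚ (w '' B) ≤ LinearMap.ker sumφ := by
      rw [Submodule.span_le]
      rintro _ ⟨e, he, rfl⟩
      rw [SetLike.mem_coe, LinearMap.mem_ker, hwB e he, map_sub, hsum, hsum, sub_self]
    have h2 : sumφ (ratVec v) = 0 := h1 h
    rw [hsum] at h2
    exact one_ne_zero h2
  have hdiff : ∀ a ∈ A, ∀ b ∈ A, ratVec a - ratVec b ∈ Submodule.span ℚ (w '' B) := by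
    intro a ha b hb
    obtain ⟨W, P, hP, hPB⟩ := hconn a ha b hb
    clear ha hb
    induction hP with
    | nil => rw [sub_self]; exact Submodule.zero_mem _
    | @cons x₁ x₂ x₃ W e P hl hP hx ih =>
      have heB := hPB (mem_insert _ _)
      have h1 : ratVec x₁ - ratVec x₂ ∈ Submodule.span ℚ (w '' B) := by
        have h2 : w e ∈ Submodule.span ℚ (w '' B) :=
          Submodule.subset_span (mem_image_of_mem _ heB)
        rcases hends (H_some.2 ⟨Or.inl heB, hl⟩) with ⟨rfl, rfl⟩ | ⟨rfl, rfl⟩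
        · rwa [hwB e heB] at h2
        · have h3 := Submodule.neg_mem _ h2
          rwa [hwB e heB, neg_sub] at h3
      have h2 := Submodule.add_mem _ h1 (ih ((subset_insert _ _).trans hPB))
      rwa [sub_add_sub_cancel] at h2
  have hτc : ∀ d ∈ Y, ∀ d' ∈ Y, (Sum.inl (some d') ∈ (RankFn.lin ℚ z).cl
      (insert (Sum.inl (some d)) (Sum.inl '' (some '' B))) ↔ c d = c d') := by
    intro d hd d' hd'
    rw [RankFn.mem_cl_lin, image_insert_eq, hzU]
    change w d' ∈ Submodule.span ℚ (insert (w d) (w '' B)) ↔ _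
    constructor
    · intro h
      -- This functional is constant on `A`, hence kills `B`, and its constant is chosen to kill `w
      -- d`. On `w d'` it takes the value `c d - c d'`.
      obtain ⟨φ, hφ⟩ := exists_functional fun v : V => if v = y then 1 else c d
      have hφA : ∀ v ∈ A, φ (ratVec v) = c d := fun v hv => by
        rw [hφ, if_neg]
        rintro rfl
        exact hyA hv
      have hφy : φ (ratVec y) = 1 := by rw [hφ, if_pos rfl]
      have h1 : Submodule.span ℚ (insert (w d) (w '' B)) ≤ LinearMap.ker φ := by
        rw [Submodule.span_le]
        rintro _ (rfl | ⟨e, he, rfl⟩)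
        · rw [SetLike.mem_coe, LinearMap.mem_ker, hwY d hd, map_sub, map_smul,
            hφA _ (hpq d (Or.inr hd)).1, hφy]
          simp
        · obtain ⟨h1, -, h2, -⟩ := hpq e (Or.inl he)
          rw [SetLike.mem_coe, LinearMap.mem_ker, hwB e he, map_sub, hφA _ h1, hφA _ (h2 he),
            sub_self]
      have h2 : φ (w d') = 0 := h1 h
      rw [hwY d' hd', map_sub, map_smul, hφA _ (hpq d' (Or.inr hd')).1, hφy, smul_eq_mul,
        mul_one] at h2
      linarith
    · intro h
      have h1 : w d' = w d + (ratVec (p d') - ratVec (p d)) := by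
        rw [hwY d' hd', hwY d hd, h]
        abel
      rw [h1]
      exact Submodule.add_mem _ (Submodule.subset_span (mem_insert _ _))
        (Submodule.span_mono (subset_insert _ _)
          (hdiff _ (hpq d' (Or.inr hd')).1 _ (hpq d (Or.inr hd)).1))
  have hcyc : ∀ W D, IsCycleOn H W D →
      ((σ.comap g).edge D < D.ncard ↔ (RankFn.lin ℚ z).edge D < D.ncard) := by
    intro W D hD
    by_cases hnD : none ∈ D
    -- A cycle through the added loop is this loop alone, and it is independent for both rank
    -- functions.
    · have hn : IsCycleOn H {y} {none} := ⟨y, y, ∅, none, .nil hy, H_none, by simp, by simp⟩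
      have hDn : D = {none} := (hD.eq_of_subset hn (singleton_subset_iff.2 hnD)).symm
      have key : ∀ {ρ : RankFn (Option α ⊕ V)}, Framing ρ H → ¬ ρ.edge D < D.ncard := by
        intro ρ hρ
        have h1 := hρ.joints {y} (singleton_subset_iff.2 hy)
        have h2 := ρ.rank_le_of_subset_cl (singleton_subset_iff.2 (hρ.loop H_none))
        rw [image_singleton] at h1
        rw [hDn, RankFn.edge_apply, image_singleton, ncard_singleton]
        rw [ncard_singleton] at h1
        push_cast at h1 ⊢
        linarith
      exact iff_of_false (key hσ) (key hτ)
    · have hDE := hD.subset_edgeSet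
      rw [H_edge] at hDE
      have hB' : ∀ o ∈ some '' B, ∀ v, H.Inc o v → v ∈ A := by
        rintro _ ⟨e, he, rfl⟩ v ⟨u, hl⟩
        exact hB e he v ⟨u, (H_some.1 hl).2⟩
      have hDY : ∀ o ∈ D, o ∉ some '' B → ∃ e ∈ Y, o = some e := by
        intro o ho hoB
        rcases hDE ho with rfl | ⟨e, he, rfl⟩
        · exact absurd ho hnD
        · exact ⟨e, he.resolve_left fun h => hoB (mem_image_of_mem _ h), rfl⟩
      have hDB : ∀ o ∈ D, o ∉ some '' B → ∃ a ∈ A, H.IsLink o y a := by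
        intro o ho hoB
        obtain ⟨e, he, rfl⟩ := hDY o ho hoB
        obtain ⟨a, ha, hl⟩ := hY e he
        exact ⟨a, ha, H_some.2 ⟨Or.inr he, hl⟩⟩
      have hBH : some '' B ⊆ H.edgeSet := by
        rw [H_edge]
        exact (image_mono subset_union_left).trans (subset_insert _ _)
      rw [hσ.cycle_dependent_iff hAV hVf hy hyA hBH hB' ?_ hD hDB,
        hτ.cycle_dependent_iff hAV hVf hy hyA hBH hB' hτB hD hDB]
      · refine forall₃_congr fun d hd hdB => forall₃_congr fun d' hd' hdB' => ?_
        obtain ⟨e, he, rfl⟩ := hDY d hd hdB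
        obtain ⟨e', he', rfl⟩ := hDY d' hd' hdB'
        rw [hτc e he e' he', ← hc e he e' he', RankFn.mem_cl_comap, image_insert_eq, hgU]
        rfl
      · intro v hv
        rw [RankFn.mem_cl_comap, hgU]
        exact hAB v hv
  refine ⟨w, c, fun e he => ?_, fun e he => ⟨_, (hpq e (Or.inr he)).1, hwY e he⟩, fun U hU => ?_,
    fun U hU => ?_⟩
  · obtain ⟨h1, -, h2, -⟩ := hpq e (Or.inl he)
    exact ⟨_, h1, _, h2 he, hwB e he⟩
  · have := hσ.edge_eq hτ hVf H_fin hcyc (X := some '' U) (by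
      rw [H_edge]
      exact (image_mono hU).trans (subset_insert _ _))
    rw [RankFn.edge_apply, RankFn.edge_apply, RankFn.comap_apply, hgU, RankFn.lin_apply, hzU] at this
    rw [this, RankFn.lin_apply, image_id]
  · have := hσ.edge_eq hτ hVf H_fin hcyc (X := insert none (some '' U)) (by
      rw [H_edge]
      exact insert_subset_insert (image_mono hU))
    rw [RankFn.edge_apply, RankFn.edge_apply, RankFn.comap_apply, image_insert_eq, image_insert_eq,
      hgU, RankFn.lin_apply, image_insert_eq, hzU] at this
    rw [RankFn.lin_apply, image_id]
    exact this

end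

end FrameMatroids

namespace FrameMatroids

universe u v

/-! ### Rolling a link into a joint. -/

section

variable {V α : Type u} {σ : RankFn (α ⊕ V)} {J K₁ K₂ S T : Set V} {E X L U₁ U₂ : Set α} {x y : V}
  {f : α}

theorem Frame.mem_cl_inter (h : Frame σ J E) (hS : S ⊆ J) (hT : T ⊆ J) {z : α ⊕ V}
    (hzS : z ∈ σ.cl (Sum.inr '' S)) (hzT : z ∈ σ.cl (Sum.inr '' T)) :
    z ∈ σ.cl (Sum.inr '' (S ∩ T)) := by
  by_contra hn
  have h1 := σ.submod_of_subset (W := Sum.inr '' (S ∪ T)) (Z := insert z (Sum.inr '' (S ∩ T)))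
    (X := insert z (Sum.inr '' S)) (Y := insert z (Sum.inr '' T))
    (insert_subset_insert (image_mono inter_subset_left))
    (insert_subset_insert (image_mono inter_subset_right))
    (by rw [image_union]; exact union_subset_union (subset_insert _ _) (subset_insert _ _))
  rw [σ.notMem_cl.1 hn, σ.mem_cl.1 hzS, σ.mem_cl.1 hzT, h.joints _ (union_subset hS hT),
    h.joints _ hS, h.joints _ hT, h.joints _ (inter_subset_left.trans hS)] at h1
  have h2 := ncard_union_add_ncard_inter S T (h.finite.subset hS) (h.finite.subset hT)
  have : ((S ∪ T).ncard : ℤ) + (S ∩ T).ncard = S.ncard + T.ncard := by exact_mod_cast h2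
  linarith

/-- Sets of elements spanned by sets of joints with at most one common member `y` are skew unless
both span `y`. -/
theorem Frame.twoSumRank (h : Frame σ J E) (h₁ : K₁ ⊆ J) (h₂ : K₂ ⊆ J) (hy : y ∈ J)
    (hK : K₁ ∩ K₂ ⊆ {y}) :
    TwoSumRank {e | Sum.inl e ∈ σ.cl (Sum.inr '' K₁)} {e | Sum.inl e ∈ σ.cl (Sum.inr '' K₂)}
      σ.edge σ.edge σ.edge (fun U => Sum.inr y ∈ σ.cl (Sum.inl '' U))
      (fun U => Sum.inr y ∈ σ.cl (Sum.inl '' U)) := by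
  intro U₁ hU₁ U₂ hU₂
  have hU₁' : Sum.inl '' U₁ ⊆ σ.cl (Sum.inr '' K₁) := by
    rintro _ ⟨e, he, rfl⟩
    exact hU₁ he
  have hU₂' : Sum.inl '' U₂ ⊆ σ.cl (Sum.inr '' K₂) := by
    rintro _ ⟨e, he, rfl⟩
    exact hU₂ he
  simp only [RankFn.edge_apply, image_union]
  constructor
  · intro hy₁ hy₂
    -- When both sides span `y`, the count is made in the contraction of `y`, where `K₁` and `K₂`
    -- are skew.
    have hu : ∀ K : Set V, K ⊆ J → (σ.contract {Sum.inr y}) (Sum.inr '' K) =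
        ((K ∪ {y}).ncard : ℤ) - 1 := by
      intro K hK
      rw [RankFn.contract_apply, h.joint_nonloop hy, ← image_singleton, ← image_union,
        h.joints _ (union_subset hK (singleton_subset_iff.2 hy))]
    have h3 : ((K₁ ∪ K₂) ∪ {y}).ncard + 1 = (K₁ ∪ {y}).ncard + (K₂ ∪ {y}).ncard := by
      have h4 := ncard_union_add_ncard_inter (K₁ ∪ {y}) (K₂ ∪ {y})
        ((h.finite.subset h₁).union (finite_singleton _))
        ((h.finite.subset h₂).union (finite_singleton _))
      have h5 : (K₁ ∪ {y}) ∩ (K₂ ∪ {y}) = {y} := by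
        rw [← inter_union_distrib_right, union_eq_right.2 hK]
      rw [h5, ncard_singleton, ← union_union_distrib_right] at h4
      exact h4
    have h4 : (σ.contract {Sum.inr y}) (Sum.inr '' K₁ ∪ Sum.inr '' K₂) =
        (σ.contract {Sum.inr y}) (Sum.inr '' K₁) + (σ.contract {Sum.inr y}) (Sum.inr '' K₂) := by
      rw [← image_union, hu _ (union_subset h₁ h₂), hu _ h₁, hu _ h₂]
      have : (((K₁ ∪ K₂) ∪ {y}).ncard : ℤ) + 1 = (K₁ ∪ {y}).ncard + (K₂ ∪ {y}).ncard := by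
        exact_mod_cast h3
      linarith
    have hsub : ∀ K : Set V, σ.cl (Sum.inr '' K) ⊆ (σ.contract {Sum.inr y}).cl (Sum.inr '' K) := by
      intro K
      rw [RankFn.cl_contract]
      exact σ.cl_mono subset_union_left
    have h5 := (σ.contract {Sum.inr y}).skew_mono h4 (hU₁'.trans (hsub _)) (hU₂'.trans (hsub _))
    rw [RankFn.contract_apply, RankFn.contract_apply, RankFn.contract_apply, h.joint_nonloop hy,
      union_singleton, union_singleton, union_singleton, σ.mem_cl.1 hy₁, σ.mem_cl.1 hy₂,
      σ.mem_cl.1 (σ.cl_mono subset_union_left hy₁)] at h5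
    linarith
  · intro hn
    rw [not_and_or] at hn
    rcases hn with hn | hn
    · have h1 := h.skew_edges h₂ h₁ (by rwa [inter_comm]) hU₁' hn
      have h2 := σ.skew_mono h1 hU₂' (σ.subset_cl _)
      rw [union_comm, h2, add_comm]
    · exact σ.skew_mono (h.skew_edges h₁ h₂ hK hU₂' hn) hU₁' (σ.subset_cl _)

/-- If the elements of `X` not incident to `y` do not span `x`, the element `f`, which joins `x` to
`y`, can be turned into a joint. -/
theorem Frame.roll [Finite V] (h : Frame σ J (insert f X)) (hX : X.Finite) (hx : x ∈ J) (hy : y ∈ J)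
    (hxy : x ≠ y) (hf : Sum.inl f ∈ σ.cl {Sum.inr x, Sum.inr y})
    (hfx : Sum.inl f ∉ σ.cl {Sum.inr x}) (hfy : Sum.inl f ∉ σ.cl {Sum.inr y})
    (hL : ∀ e ∈ L, e ∈ X ∧ ∃ v ∈ J, Sum.inl e ∈ σ.cl {Sum.inr v})
    (hxX : Sum.inr x ∉ σ.cl (Sum.inl '' {e ∈ X | Sum.inl e ∈ σ.cl (Sum.inr '' (J \ {y}))})) :
    RootedRep X σ.edge L fun U => f ∈ σ.edge.cl U := by
  classical
  obtain ⟨G, hGV, hGE, hF, hloop⟩ := h.exists_graph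
  have hfl : G.IsLink f x y := by
    obtain ⟨a, b, hl⟩ := Graph.exists_isLink_of_mem_edgeSet (G := G) (e := f)
      (by rw [hGE]; exact mem_insert _ _)
    have ha : a ∈ J := hGV ▸ hl.left_mem
    have hb : b ∈ J := hGV ▸ hl.right_mem
    have h1 := h.mem_cl_inter (S := {x, y}) (T := {a, b}) (z := Sum.inl f)
      (insert_subset hx (singleton_subset_iff.2 hy))
      (insert_subset ha (singleton_subset_iff.2 hb)) (by rwa [image_pair])
      (by rw [image_pair]; exact hF.mem_cl hl)
    have h2 : x ∈ ({a, b} : Set V) := by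
      by_contra hn
      refine hfy (σ.cl_mono ?_ h1)
      rintro _ ⟨v, ⟨rfl | rfl, hv⟩, rfl⟩
      · exact absurd hv hn
      · rfl
    have h3 : y ∈ ({a, b} : Set V) := by
      by_contra hn
      refine hfx (σ.cl_mono ?_ h1)
      rintro _ ⟨v, ⟨rfl | rfl, hv⟩, rfl⟩
      · rfl
      · exact absurd hv hn
    rcases h2 with rfl | rfl <;> rcases h3 with rfl | rfl
    · exact absurd rfl hxy
    · exact hl
    · exact hl.symm
    · exact absurd rfl hxy
  -- The component of `x` after the removal of `y` has vertex set `A` and edge set `B`. It is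
  -- balanced because it does not span `x`. The set `Y` consists of the edges from it to `y`,
  -- including `f`.
  set X₀ : Set α := {e ∈ X | ¬ G.Inc e y} with hX₀
  have hX₀E : X₀ ⊆ G.edgeSet := by
    rw [hGE]
    exact (sep_subset _ _).trans (subset_insert _ _)
  have hxX₀ : Sum.inr x ∉ σ.cl (Sum.inl '' X₀) := by
    refine fun hc => hxX (σ.cl_mono (image_mono ?_) hc)
    rintro e ⟨heX, hey⟩
    refine ⟨heX, ?_⟩
    have := hF.subset_cl (X := {e}) (U := J \ {y})
      (singleton_subset_iff.2 (hX₀E ⟨heX, hey⟩)) (by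
        rintro _ rfl v hv
        refine ⟨hGV ▸ hv.vertex_mem, ?_⟩
        rintro rfl
        exact hey hv)
    exact this (by simp)
  set A : Set V := {v | Reach G X₀ x v} with hA
  have hAV : A ⊆ G.vertexSet := fun v hv => by
    obtain ⟨_, _, h', -⟩ := hv.symm
    exact h'.left_vertex
  have hyA : y ∉ A := by
    rintro ⟨W, P, hP, hPX⟩
    have hP' := hP.reverse
    cases hP' with
    | nil => exact hxy rfl
    | cons he _ _ => exact (hPX (mem_insert _ _)).2 he.inc_left
  have hxA : x ∈ A := Reach.refl hfl.left_mem
  set B : Set α := {e ∈ X₀ | ∃ a ∈ A, G.Inc e a} with hB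
  set Y : Set α := {e ∈ insert f X | ∃ a ∈ A, G.IsLink e y a} with hY
  have hBX : B ⊆ X₀ := sep_subset _ _
  have hBends : ∀ e ∈ B, ∀ v, G.Inc e v → v ∈ A := by
    rintro e ⟨he, a, ha, b, hl⟩ v hv
    rcases hv.eq_or_eq_of_isLink hl with rfl | rfl
    · exact ha
    · exact Reach.trans ha (Reach.of_isLink hl he)
  have hAX₀ : ∀ v ∈ A, Sum.inr v ∉ σ.cl (Sum.inl '' X₀) := fun v hv hc =>
    hxX₀ (hF.reach' (Reach.symm hv) (σ.subset_cl _) hc)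
  have hconn : ∀ a ∈ A, ∀ b ∈ A, Reach G B a b := by
    have key : ∀ a ∈ A, Reach G B x a := by
      rintro a ⟨W, P, hP, hPX⟩
      refine ⟨W, P, hP, fun e he => ⟨hPX he, ?_⟩⟩
      obtain ⟨u, v, hl⟩ := Graph.exists_isLink_of_mem_edgeSet (hP.edge_mem he)
      exact ⟨u, (hP.reach (hP.mem_of_inc he hl.inc_left)).mono hPX, hl.inc_left⟩
    exact fun a ha b hb => (key a ha).symm.trans (key b hb)
  have hXf : (insert f X).Finite := hX.insert f
  -- In these coordinates an edge of `B` is a difference of unit vectors, and an edge of `Y` is a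
  -- unit vector of `A` minus a multiple of that of `y`.
  obtain ⟨w, c, hwB, hwY, hw, hwy⟩ := hF.exists_ratVec hAV hfl.right_mem hyA
    (hX.subset (hBX.trans (sep_subset _ _))) (hXf.subset (sep_subset _ _)) (hBX.trans hX₀E) hBends
    (fun v hv hc => hAX₀ v hv (σ.cl_mono (image_mono hBX) hc)) (fun e he => he.2) hconn
  have hAJ : A ⊆ J := hGV ▸ hAV
  have hBY : B ∪ Y ⊆ insert f X :=
    union_subset (hBX.trans ((sep_subset _ _).trans (subset_insert _ _))) (sep_subset _ _)
  have hWends : ∀ e ∈ insert f X \ (B ∪ Y), ∀ a b, G.IsLink e a b → a ∉ A := by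
    rintro e ⟨he, hn⟩ a b hl ha
    by_cases hey : G.Inc e y
    · refine hn (Or.inr ⟨he, ?_⟩)
      rcases hey.eq_or_eq_of_isLink hl with rfl | rfl
      · exact absurd ha hyA
      · exact ⟨a, ha, hl.symm⟩
    · refine hn (Or.inl ⟨⟨he.resolve_left ?_, hey⟩, a, ha, hl.inc_left⟩)
      rintro rfl
      exact hey hfl.inc_right
  have hfY : f ∈ Y := ⟨mem_insert _ _, x, hxA, hfl.symm⟩
  -- the new joints
  let j₁ : ↥(insert y A) → V → ℚ := fun v =>
    if v.1 = y then ratVec y else ratVec v.1 - c f • ratVec y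
  let y₁ : ↥(insert y A) := ⟨y, mem_insert _ _⟩
  have hj₁y : j₁ y₁ = ratVec y := if_pos rfl
  have hj₁A : ∀ a, ∀ ha : a ∈ A, j₁ ⟨a, Or.inr ha⟩ = ratVec a - c f • ratVec y := fun a ha =>
    if_neg fun h : a = y => hyA (h ▸ ha)
  have hj₁ : ∀ S : Set ↥(insert y A), RankFn.lin ℚ id (j₁ '' S) = S.ncard := by
    intro S
    -- The new joints arise from the old ones by the map that subtracts from each vector its value
    -- under `φ` times the unit vector of `y`. This map is injective, since `φ` vanishes on the
    -- latter.
    obtain ⟨φ, hφ⟩ := exists_functional fun v : V => if v = y then 0 else c f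
    have h1 : RankFn.lin ℚ ratVec (Subtype.val '' S) = S.ncard := by
      rw [← ncard_image_of_injective S Subtype.val_injective, ← rank_ratVec, RankFn.lin_apply,
        RankFn.lin_apply, image_id]
    rw [← h1, RankFn.lin_map (g := fun v => if v = y then ratVec y else ratVec v - c f • ratVec y)
      (φ := LinearMap.id - φ.smulRight (ratVec y)) (S := ⊤) (fun _ _ => trivial), RankFn.lin_apply,
      RankFn.lin_apply, image_id, image_image]
    · intro v _ hv
      have h2 : v = φ v • ratVec y := sub_eq_zero.1 hv
      have h3 : φ v = 0 := by
        rw [h2, map_smul, hφ, if_pos rfl]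
        simp
      rw [h2, h3, zero_smul]
    · intro v _
      by_cases hv : v = y
      · subst hv
        simp [hφ]
      · simp [hφ, hv]
  have hq : RankFn.lin ℚ id {ratVec y} = 1 := by
    have := rank_ratVec {y}
    simpa using this
  -- The changed part is glued back at the joint `y`, which is the only one it shares with the rest.
  -- Edges of `B` are still differences of two joints, an edge of `Y` lies on the line of a new
  -- joint and `y`, and `f` has become a joint.
  have hrep : FrameRep ((B ∪ Y) ∪ (insert f X \ (B ∪ Y))) σ.edge ({f} ∪ L) := by
    refine FrameRep.of_glue (T := Unit) (ρ₁ := RankFn.lin ℚ id) (ρ₂ := σ)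
      (t₁ := fun _ => ratVec y) (t₂ := fun _ => Sum.inr y) (ι₁ := w) (ι₂ := Sum.inl) (j₁ := j₁)
      (j₂ := fun v : ↥(J \ A) => Sum.inr v.1) (R := {y₁}) (t₀ := ()) (RankFn.modular_point _ hq)
      ?_ hj₁ ?_ ?_ ?_ ?_ disjoint_sdiff_right (fun _ _ _ _ => rfl) hq ?_ ?_ ?_ ?_ ?_
    · intro S
      rcases S.eq_empty_or_nonempty with rfl | hS
      · simp
      · rw [hS.image_const, hS.image_const, hq, h.joint_nonloop hy]
    · intro S
      rw [← ncard_image_of_injective S Subtype.val_injective,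
        ← h.joints (Subtype.val '' S) (by
          rintro _ ⟨v, -, rfl⟩
          exact v.2.1), image_image]
    · rintro _ rfl
      exact ⟨(), ⟨y, hy, hyA⟩, hj₁y, rfl⟩
    · intro _
      exact RankFn.mem_cl_of_mem _ ⟨y₁, rfl, hj₁y⟩
    · intro _
      exact RankFn.mem_cl_of_mem _ ⟨⟨y, hy, hyA⟩, rfl⟩
    · have h1 := h.twoSumRank (K₁ := insert y A) (K₂ := J \ A) (y := y) (insert_subset hy hAJ)
        sdiff_subset hy (by
          rintro v ⟨rfl | hv, hv'⟩
          · rfl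
          · exact absurd hv hv'.2)
      intro U₁ hU₁ U₂ hU₂
      have h2 := h1 U₁ (fun e he => ?_) U₂ (fun e he => ?_)
      · have h3 : ratVec y ∈ (RankFn.lin ℚ id).cl (w '' U₁) ↔
            Sum.inr y ∈ σ.cl (Sum.inl '' U₁) := by
          rw [RankFn.mem_cl, RankFn.mem_cl, ← hw U₁ hU₁, ← hwy U₁ hU₁]
        simp only [h3, ← hw U₁ hU₁]
        exact h2
      · have h3 := hF.subset_cl (X := {e}) (U := insert y A)
          (by rw [hGE]; exact singleton_subset_iff.2 (hBY (hU₁ he))) (by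
            rintro _ rfl v hv
            rcases hU₁ he with h4 | ⟨-, a, ha, hl⟩
            · exact Or.inr (hBends _ h4 v hv)
            · rcases hv.eq_or_eq_of_isLink hl with rfl | rfl
              · exact Or.inl rfl
              · exact Or.inr ha)
        exact h3 (by simp)
      · have h3 := hF.subset_cl (X := {e}) (U := J \ A)
          (by rw [hGE]; exact singleton_subset_iff.2 (hU₂ he).1) (by
            rintro _ rfl v ⟨u, hl⟩
            exact ⟨hGV ▸ hl.left_mem, hWends _ (hU₂ he) v u hl⟩)
        exact h3 (by simp)
    · rintro e (he | he)
      · obtain ⟨a, ha, b, hb, hab⟩ := hwB e he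
        refine ⟨⟨a, Or.inr ha⟩, ⟨b, Or.inr hb⟩, ?_⟩
        have : w e = j₁ ⟨a, Or.inr ha⟩ - j₁ ⟨b, Or.inr hb⟩ := by
          rw [hj₁A a ha, hj₁A b hb, hab]
          abel
        rw [RankFn.mem_cl_lin, image_id, id, this]
        exact Submodule.sub_mem _ (Submodule.subset_span (by simp))
          (Submodule.subset_span (by simp))
      · obtain ⟨a, ha, hab⟩ := hwY e he
        refine ⟨⟨a, Or.inr ha⟩, y₁, ?_⟩
        have : w e = j₁ ⟨a, Or.inr ha⟩ + (c f - c e) • j₁ y₁ := by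
          rw [hj₁A a ha, hj₁y, hab, sub_smul]
          abel
        rw [RankFn.mem_cl_lin, image_id, id, this]
        exact Submodule.add_mem _ (Submodule.subset_span (by simp))
          (Submodule.smul_mem _ _ (Submodule.subset_span (by simp)))
    · intro e he
      obtain ⟨a, b, hl⟩ := Graph.exists_isLink_of_mem_edgeSet (G := G) (e := e)
        (by rw [hGE]; exact he.1)
      exact ⟨⟨a, hGV ▸ hl.left_mem, hWends e he a b hl⟩,
        ⟨b, hGV ▸ hl.right_mem, hWends e he b a hl.symm⟩, hF.mem_cl hl⟩
    · rintro _ rfl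
      obtain ⟨a, ha, hab⟩ := hwY _ hfY
      refine ⟨Or.inr hfY, ⟨a, Or.inr ha⟩, ?_⟩
      rw [hab, ← hj₁A a ha]
      exact RankFn.mem_cl_of_mem _ rfl
    · intro e he
      obtain ⟨heX, v, hv, hev⟩ := hL e he
      have hl := hloop e (Or.inr heX) v hv hev
      -- A member of `L` is a loop at its joint. A loop at a vertex of `A` would make `X₀` span this
      -- vertex, so the elements of `L` all lie in the unchanged part.
      have hvA : v ∉ A := fun hvA => by
        have hey : ¬ G.Inc e y := fun hey => by
          rcases hey.eq_or_eq_of_isLink hl with rfl | rfl <;> exact hyA hvA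
        refine hAX₀ v hvA (σ.cl_mono (singleton_subset_iff.2 ?_) (hF.loop hl))
        exact mem_image_of_mem _ ⟨heX, hey⟩
      refine ⟨⟨Or.inr heX, ?_⟩, ⟨v, hv, hvA⟩, hev⟩
      rintro (⟨-, a, ha, hea⟩ | ⟨-, a, ha, hea⟩)
      · rcases hea.eq_or_eq_of_isLink hl with rfl | rfl <;> exact hvA ha
      · rcases hea.inc_right.eq_or_eq_of_isLink hl with rfl | rfl <;> exact hvA ha
  rw [union_sdiff_cancel hBY, singleton_union] at hrep
  exact RootedRep.of_frameRep hrep (by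
    rw [RankFn.edge_apply, image_singleton]
    exact h.nonloop f (mem_insert _ _))

end

end FrameMatroids

namespace FrameMatroids

universe u v

/-! ### Two links in series, attached to three joints. -/

section

variable {V α : Type u} {σ : RankFn (α ⊕ V)} {J K S T : Set V} {E X L U F : Set α}
  {v₁ v₂ v₃ v w : V} {f f₁ f₂ e : α}

namespace Frame

/-- An element spanned by two joints but parallel to neither spans one together with the other. -/
theorem swap_link (hf : Sum.inl f ∈ σ.cl {Sum.inr v, Sum.inr w}) (hv : Sum.inl f ∉ σ.cl {Sum.inr v}) :
    Sum.inr w ∈ σ.cl {Sum.inl f, Sum.inr v} :=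
  σ.exchange (by rwa [pair_comm]) hv

/-- The set of joints reachable from `v` with the elements of `X` but not spanned by `X` cannot
be left by an element of `X`. -/
theorem mem_cl_or_mem_cl_sdiff (h : Frame σ J E) (hXE : X ⊆ E)
    (he : e ∈ X) (hK : K = {w ∈ J | Sum.inr w ∈ σ.cl (insert (Sum.inr v) (Sum.inl '' X)) ∧
      Sum.inr w ∉ σ.cl (Sum.inl '' X)}) :
    Sum.inl e ∈ σ.cl (Sum.inr '' K) ∨ Sum.inl e ∈ σ.cl (Sum.inr '' (J \ K)) := by
  have heX : Sum.inl e ∈ σ.cl (Sum.inl '' X) := σ.mem_cl_of_mem (mem_image_of_mem _ he)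
  have key : ∀ a ∈ J, ∀ b ∈ J, Sum.inl e ∈ σ.cl {Sum.inr a, Sum.inr b} → a ∈ K →
      Sum.inl e ∈ σ.cl (Sum.inr '' K) ∨ Sum.inl e ∈ σ.cl (Sum.inr '' (J \ K)) := by
    intro a ha b hb hab haK
    by_cases hea : Sum.inl e ∈ σ.cl {Sum.inr a}
    · exact Or.inl (σ.cl_mono (singleton_subset_iff.2 (mem_image_of_mem _ haK)) hea)
    by_cases heb : Sum.inl e ∈ σ.cl {Sum.inr b}
    · have h1 : Sum.inr b ∈ σ.cl (Sum.inl '' X) :=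
        σ.cl_subset_cl (singleton_subset_iff.2 heX) (swap_of_nonloop (h.nonloop e (hXE he)) heb)
      have hbK : b ∉ K := fun hbK => by
        rw [hK] at hbK
        exact hbK.2.2 h1
      exact Or.inr (σ.cl_mono (singleton_subset_iff.2
        (mem_image_of_mem Sum.inr (show b ∈ J \ K from ⟨hb, hbK⟩))) heb)
    have hb' := swap_link hab hea
    have ha' := swap_link (by rwa [pair_comm]) heb
    rw [hK] at haK
    have hbK : b ∈ K := by
      rw [hK]
      refine ⟨hb, σ.cl_subset_cl ?_ hb', fun hbX => haK.2.2 (σ.cl_subset_cl ?_ ha')⟩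
      · rintro _ (rfl | rfl)
        · exact σ.cl_mono (subset_insert _ _) heX
        · exact haK.2.1
      · rintro _ (rfl | rfl)
        · exact heX
        · exact hbX
    refine Or.inl (σ.cl_mono ?_ hab)
    rw [← hK] at haK
    rintro _ (rfl | rfl)
    · exact mem_image_of_mem _ haK
    · exact mem_image_of_mem _ hbK
  obtain ⟨a, ha, b, hb, hab⟩ := h.line e (hXE he)
  by_cases haK : a ∈ K
  · exact (key a ha b hb hab haK)
  by_cases hbK : b ∈ K
  · exact (key b hb a ha (by rwa [pair_comm]) hbK)
  refine Or.inr (σ.cl_mono ?_ hab)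
  rintro _ (rfl | rfl)
  · exact mem_image_of_mem _ ⟨ha, haK⟩
  · exact mem_image_of_mem _ ⟨hb, hbK⟩

/-- If `X` does not span the joint `v` but has an element incident to it, there is a nonempty subset
of `X` skew to the rest of `X` together with elements `F` spanned by `v` and joints in the
closure of `X`. -/
theorem exists_skew_part (h : Frame σ J X) (hv : v ∈ J) (hvX : Sum.inr v ∉ σ.cl (Sum.inl '' X))
    (he : e ∈ X) (hev : Sum.inl e ∉ σ.cl (Sum.inr '' (J \ {v}))) (hS : S ⊆ J)
    (hSX : ∀ w ∈ S, w = v ∨ Sum.inr w ∈ σ.cl (Sum.inl '' X))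
    (hF : Sum.inl '' F ⊆ σ.cl (Sum.inr '' S)) :
    ∃ Z ⊆ X, Z.Nonempty ∧ σ.edge (X ∪ F) = σ.edge Z + σ.edge ((X \ Z) ∪ F) := by
  -- The joints of the balanced component of `v`. No element of `X` leaves `K`, and the other joints
  -- in `S` are spanned by `X`, so the elements on `K` touch the rest of `X` and `F` at most in `v`,
  -- which they do not span.
  obtain ⟨K, hK⟩ : ∃ K, K = {w ∈ J | Sum.inr w ∈ σ.cl (insert (Sum.inr v) (Sum.inl '' X)) ∧
      Sum.inr w ∉ σ.cl (Sum.inl '' X)} := ⟨_, rfl⟩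
  have hvK : v ∈ K := by
    rw [hK]
    exact ⟨hv, σ.mem_cl_of_mem (mem_insert _ _), hvX⟩
  have hKJ : K ⊆ J := by
    rw [hK]
    exact sep_subset _ _
  have hor := fun e he => h.mem_cl_or_mem_cl_sdiff (e := e) subset_rfl he hK
  refine ⟨{e ∈ X | Sum.inl e ∈ σ.cl (Sum.inr '' K)}, sep_subset _ _, ⟨e, he, ?_⟩, ?_⟩
  · refine (hor e he).resolve_right fun hc => hev (σ.cl_mono (image_mono ?_) hc)
    rintro w ⟨hw, hwK⟩
    exact ⟨hw, fun hwv => hwK (by rw [mem_singleton_iff.1 hwv]; exact hvK)⟩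
  · have h1 := h.skew_edges (T := (J \ K) ∪ {v}) (K := K) (s := v)
      (U := {e ∈ X | Sum.inl e ∈ σ.cl (Sum.inr '' K)})
      (union_subset sdiff_subset (singleton_subset_iff.2 hv)) hKJ (by
        rintro w ⟨hw | hw, hwK⟩
        · exact absurd hwK hw.2
        · exact hw) (by
        rintro _ ⟨e, he, rfl⟩
        exact he.2) (fun hc => hvX (σ.cl_mono (image_mono (sep_subset _ _)) hc))
    have h2 := σ.skew_mono (X' := Sum.inl '' ((X \ {e ∈ X | Sum.inl e ∈ σ.cl (Sum.inr '' K)}) ∪ F))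
      h1 (by
        rintro _ ⟨e, he | he, rfl⟩
        · exact σ.cl_mono (image_mono subset_union_left)
            ((hor e he.1).resolve_left fun hc => he.2 ⟨he.1, hc⟩)
        · refine σ.cl_mono (image_mono fun w hw => ?_) (hF (mem_image_of_mem _ he))
          rcases hSX w hw with rfl | hwX
          · exact Or.inr rfl
          · refine Or.inl ⟨hS hw, fun hwK => ?_⟩
            rw [hK] at hwK
            exact hwK.2.2 hwX) (σ.subset_cl _)
    rw [← image_union, union_right_comm, sdiff_union_of_subset (sep_subset _ _)] at h2
    rw [RankFn.edge_apply, RankFn.edge_apply, RankFn.edge_apply, h2, add_comm]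

theorem notMem_cl_sdiff (h : Frame σ J E) (hv : v ∈ J) (hw : w ∈ J)
    (hf : Sum.inl f ∈ σ.cl {Sum.inr v, Sum.inr w}) (hfv : Sum.inl f ∉ σ.cl {Sum.inr v}) :
    Sum.inl f ∉ σ.cl (Sum.inr '' (J \ {w})) := fun hc => by
  refine hfv (σ.cl_mono ?_ (h.mem_cl_inter (S := {v, w}) (insert_subset hv
    (singleton_subset_iff.2 hw)) sdiff_subset (by rwa [image_pair]) hc))
  rintro _ ⟨u, ⟨rfl | rfl, hu⟩, rfl⟩
  · rfl
  · exact absurd rfl hu.2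

/-- The contraction of a link. -/
theorem contract_link (h : Frame σ J E) (hv : v ∈ J) (hw : w ∈ J) (hvw : v ≠ w)
    (hf : Sum.inl f ∈ σ.cl {Sum.inr v, Sum.inr w}) (hfv : Sum.inl f ∉ σ.cl {Sum.inr v})
    (hE : ∀ e ∈ E, Sum.inl e ∉ σ.cl {Sum.inl f}) :
    Frame (σ.contract {Sum.inl f}) (J \ {w}) E ∧
      Sum.inr w ∈ (σ.contract {Sum.inl f}).cl {Sum.inr v} := by
  have hfJ := h.notMem_cl_sdiff hv hw hf hfv
  have hf0 : σ {Sum.inl f} = 1 := by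
    have h1 : Sum.inl f ∉ σ.cl ∅ := fun hc => hfv (σ.cl_mono (empty_subset _) hc)
    have h2 := σ.notMem_cl.1 h1
    rw [σ.empty] at h2
    simpa using h2
  have hwv : Sum.inr w ∈ (σ.contract {Sum.inl f}).cl {Sum.inr v} := by
    rw [RankFn.mem_cl_contract, singleton_union, pair_comm]
    exact swap_link hf hfv
  refine ⟨⟨h.finite.sdiff, fun S hS => ?_, fun e he => ?_, fun e he => ?_⟩, hwv⟩
  · rw [RankFn.contract_apply, union_singleton,
      σ.notMem_cl.1 fun hc => hfJ (σ.cl_mono (image_mono hS) hc), h.joints _ (hS.trans sdiff_subset),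
      hf0]
    ring
  · have key : ∀ a ∈ J, ∃ b ∈ J \ {w}, Sum.inr a ∈ (σ.contract {Sum.inl f}).cl {Sum.inr b} := by
      intro a ha
      by_cases haw : a = w
      · exact ⟨v, ⟨hv, hvw⟩, haw ▸ hwv⟩
      · exact ⟨a, ⟨ha, haw⟩, RankFn.mem_cl_of_mem _ rfl⟩
    obtain ⟨a, ha, b, hb, hab⟩ := h.line e he
    obtain ⟨a', ha', haa⟩ := key a ha
    obtain ⟨b', hb', hbb⟩ := key b hb
    refine ⟨a', ha', b', hb', RankFn.cl_subset_cl _ (X := {Sum.inr a', Sum.inr b'})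
      (Y := {Sum.inr a, Sum.inr b}) ?_ ?_⟩
    · rintro _ (rfl | rfl)
      · exact RankFn.cl_mono _ (by simp) haa
      · exact RankFn.cl_mono _ (by simp) hbb
    · rw [RankFn.mem_cl_contract]
      exact σ.cl_mono subset_union_left hab
  · rw [RankFn.contract_apply, singleton_union, σ.notMem_cl.1 (hE e he)]
    ring

/-- An element spanned by joints other than the ends of a link `f`, and `f`, is spanned by these
joints. -/
theorem mem_cl_of_mem_cl_insert_link (h : Frame σ J E) (he : e ∈ E) (hv : v ∈ J) (hw : w ∈ J)
    (hvw : v ≠ w) (hf : Sum.inl f ∈ σ.cl {Sum.inr v, Sum.inr w})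
    (hfv : Sum.inl f ∉ σ.cl {Sum.inr v}) (hfw : Sum.inl f ∉ σ.cl {Sum.inr w})
    (hef : Sum.inl f ∉ σ.cl {Sum.inl e})
    (hec : Sum.inl e ∈ σ.cl (insert (Sum.inl f) (Sum.inr '' (J \ {v, w})))) :
    Sum.inl e ∈ σ.cl (Sum.inr '' (J \ {v, w})) := by
  have hvwJ : ({v, w} : Set V) ⊆ J := insert_subset hv (singleton_subset_iff.2 hw)
  have hsk := h.skew (S := {v, w}) (T := J \ {v, w}) hvwJ sdiff_subset disjoint_sdiff_right
  have hfc : Sum.inl f ∈ σ.cl (Sum.inr '' {v, w}) := by rwa [image_pair]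
  by_contra hn
  -- the ends of `e` cannot be spanned by `f` and the other joints
  have hno : ∀ u ∈ ({v, w} : Set V),
      Sum.inr u ∉ σ.cl (insert (Sum.inl f) (Sum.inr '' (J \ {v, w}))) := by
    intro u hu hc
    have h1 := σ.mem_cl_of_skew (X' := {Sum.inl f}) (Y' := Sum.inr '' (J \ {v, w})) hsk
      (singleton_subset_iff.2 hfc) (σ.subset_cl _) (σ.mem_cl_of_mem (mem_image_of_mem _ hu))
      (by rwa [singleton_union])
    have h2 := σ.parallel_symm h1 (h.joint_nonloop (hvwJ hu))
    rcases hu with rfl | rfl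
    · exact hfv h2
    · exact hfw h2
  obtain ⟨a, ha, b, hb, hab⟩ := h.line e he
  have hsub : ∀ a ∈ J, ∀ b ∈ J, Sum.inl e ∈ σ.cl {Sum.inr a, Sum.inr b} → a ∉ ({v, w} : Set V) →
      b ∈ ({v, w} : Set V) → False := by
    intro a ha b hb hab ha' hb'
    refine hno b hb' ?_
    have h1 := σ.exchange (x := Sum.inr b) (y := Sum.inl e) (X := Sum.inr '' (J \ {v, w}))
      (σ.cl_mono (by
        rintro _ (rfl | rfl)
        · exact Or.inr (mem_image_of_mem _ ⟨ha, ha'⟩)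
        · exact Or.inl rfl) hab) hn
    exact σ.cl_subset_cl (insert_subset hec ((subset_insert _ _).trans (σ.subset_cl _))) h1
  by_cases ha' : a ∈ ({v, w} : Set V) <;> by_cases hb' : b ∈ ({v, w} : Set V)
  · have h1 : Sum.inl e ∈ σ.cl (Sum.inr '' {v, w}) := by
      refine σ.cl_mono ?_ hab
      rintro _ (rfl | rfl)
      · exact mem_image_of_mem _ ha'
      · exact mem_image_of_mem _ hb'
    have h2 := σ.mem_cl_of_skew (X' := {Sum.inl f}) (Y' := Sum.inr '' (J \ {v, w})) hsk
      (singleton_subset_iff.2 hfc) (σ.subset_cl _) h1 (by rwa [singleton_union])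
    exact hef (σ.parallel_symm h2 (h.nonloop e he))
  · exact hsub b hb a ha (by rwa [pair_comm]) hb' ha'
  · exact hsub a ha b hb hab ha' hb'
  · refine hn (σ.cl_mono ?_ hab)
    rintro _ (rfl | rfl)
    · exact mem_image_of_mem _ ⟨ha, ha'⟩
    · exact mem_image_of_mem _ ⟨hb, hb'⟩

end Frame

/-- Two elements in series stand for a basepoint. If one of them is spanned by `X`, the other is
not, so within `X` only the first can make the pair dependent. -/
theorem RankFn.link_iff_of_mem {γ : Type*} (τ : RankFn γ) {X U : Set γ} {a b : γ} (ha : a ∈ τ.cl X)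
    (hr : τ (X ∪ {a, b}) = τ X + 1) (hU : U ⊆ X) : a ∈ τ.cl U ↔ τ (U ∪ {a, b}) < τ U + 2 := by
  have hUab : U ∪ {a, b} = insert b (insert a U) := by
    rw [insert_eq a {b}, ← union_assoc, union_singleton, union_singleton]
  constructor
  · intro h
    have := τ.insert_le b (insert a U)
    rw [hUab]
    rw [τ.mem_cl.1 h] at this
    linarith
  · intro h
    by_contra hn
    have hb : b ∈ τ.cl (insert a U) := by
      by_contra hb
      rw [hUab, τ.notMem_cl.1 hb, τ.notMem_cl.1 hn] at h
      linarith
    have hbX : b ∈ τ.cl X := τ.cl_subset_cl (insert_subset ha (hU.trans (τ.subset_cl _))) hb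
    rw [τ.rank_union_of_subset_cl (insert_subset ha (singleton_subset_iff.2 hbX))] at hr
    linarith

/-- If `X` does not span `a`, contracting `a` leaves the ranks on `X` alone, and `b` becomes the
basepoint. -/
theorem RankFn.link_iff_of_notMem {γ : Type*} (τ : RankFn γ) {X U : Set γ} {a b : γ}
    (ha : a ∉ τ.cl X) (hU : U ⊆ X) :
    b ∈ τ.cl (insert a U) ↔ τ (U ∪ {a, b}) < τ U + 2 := by
  have hUab : U ∪ {a, b} = insert b (insert a U) := by
    rw [insert_eq a {b}, ← union_assoc, union_singleton, union_singleton]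
  have haU := τ.notMem_cl.1 fun h => ha (τ.cl_mono hU h)
  rw [hUab, RankFn.mem_cl, haU]
  have := τ.insert_le b (insert a U)
  have := τ.le_insert b (insert a U)
  constructor <;> intro _ <;> omega

/-- Two links `f₁` and `f₂` that form a path on the joints `v₁`, `v₃`, `v₂`, span none of
them, and meet the span of `X` in rank one. -/
structure IsTriangle (σ : RankFn (α ⊕ V)) (J : Set V) (X : Set α) (f₁ f₂ : α) (v₁ v₂ v₃ : V) :
    Prop where
  frame : Frame σ J (X ∪ {f₁, f₂})
  mem₁ : v₁ ∈ J
  mem₂ : v₂ ∈ J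
  mem₃ : v₃ ∈ J
  ne₁₂ : v₁ ≠ v₂
  ne₁₃ : v₁ ≠ v₃
  ne₂₃ : v₂ ≠ v₃
  line₁ : Sum.inl f₁ ∈ σ.cl {Sum.inr v₁, Sum.inr v₃}
  line₂ : Sum.inl f₂ ∈ σ.cl {Sum.inr v₂, Sum.inr v₃}
  notMem₁ : Sum.inr v₁ ∉ σ.cl {Sum.inl f₁, Sum.inl f₂}
  notMem₂ : Sum.inr v₂ ∉ σ.cl {Sum.inl f₁, Sum.inl f₂}
  notMem₃ : Sum.inr v₃ ∉ σ.cl {Sum.inl f₁, Sum.inl f₂}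
  rank : σ.edge (X ∪ {f₁, f₂}) = σ.edge X + 1

namespace IsTriangle

theorem symm (h : IsTriangle σ J X f₁ f₂ v₁ v₂ v₃) : IsTriangle σ J X f₂ f₁ v₂ v₁ v₃ := by
  obtain ⟨h1, h2, h3, h4, h5, h6, h7, h8, h9, h10, h11, h12, h13⟩ := h
  rw [pair_comm] at h1 h13
  rw [pair_comm (Sum.inl f₁)] at h10 h11 h12
  exact ⟨h1, h3, h2, h4, h5.symm, h7, h6, h9, h8, h11, h10, h12, h13⟩

theorem proper (h : IsTriangle σ J X f₁ f₂ v₁ v₂ v₃) :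
    Sum.inl f₁ ∉ σ.cl {Sum.inr v₁} ∧ Sum.inl f₁ ∉ σ.cl {Sum.inr v₃} := by
  have h1 := h.frame.nonloop f₁ (Or.inr (mem_insert _ _))
  exact ⟨fun hc => h.notMem₁ (σ.cl_mono (by simp) (Frame.swap_of_nonloop h1 hc)),
    fun hc => h.notMem₃ (σ.cl_mono (by simp) (Frame.swap_of_nonloop h1 hc))⟩

/-- Here `f₁` itself is the basepoint, and it can be rolled from either of its ends that is not
spanned by `X`. -/
theorem rootedRep_or_of_mem [Finite V] (h : IsTriangle σ J X f₁ f₂ v₁ v₂ v₃) (hX : X.Finite)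
    (hL : ∀ e ∈ L, e ∈ X ∧ ∃ v ∈ J, Sum.inl e ∈ σ.cl {Sum.inr v}) (hf : f₁ ∈ σ.edge.cl X) :
    RootedRep X σ.edge L (fun U => σ.edge (U ∪ {f₁, f₂}) < σ.edge U + 2) ∨
      Sum.inr v₁ ∈ σ.cl (Sum.inl '' X) ∧ Sum.inr v₃ ∈ σ.cl (Sum.inl '' X) := by
  have hF : Frame σ J (insert f₁ X) := h.frame.subset (by
    rintro e (rfl | he)
    · exact Or.inr (mem_insert _ _)
    · exact Or.inl he)
  have hl : ∀ U ⊆ X, (σ.edge (U ∪ {f₁, f₂}) < σ.edge U + 2 ↔ f₁ ∈ σ.edge.cl U) := fun U hU =>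
    (σ.edge.link_iff_of_mem hf h.rank hU).symm
  by_cases h1 : Sum.inr v₁ ∈ σ.cl (Sum.inl '' X)
  · by_cases h3 : Sum.inr v₃ ∈ σ.cl (Sum.inl '' X)
    · exact Or.inr ⟨h1, h3⟩
    · exact Or.inl ((hF.roll hX h.mem₃ h.mem₁ h.ne₁₃.symm (by rw [pair_comm]; exact h.line₁)
        h.proper.2 h.proper.1 hL fun hc => h3 (σ.cl_mono (image_mono (sep_subset _ _)) hc)).congr
        (fun _ _ => rfl) hl)
  · exact Or.inl ((hF.roll hX h.mem₁ h.mem₃ h.ne₁₃ h.line₁ h.proper.1 h.proper.2 hL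
      fun hc => h1 (σ.cl_mono (image_mono (sep_subset _ _)) hc)).congr (fun _ _ => rfl) hl)

/-- Contracting `f₁` merges `v₃` with `v₁` and makes `f₂` a link from `v₂` to `v₁`, which stands for
the basepoint. It can be rolled from `v₂` unless `X` spans `v₂`. -/
theorem rootedRep_or_of_notMem [Finite V] (h : IsTriangle σ J X f₁ f₂ v₁ v₂ v₃) (hX : X.Finite)
    (hL : ∀ e ∈ L, e ∈ X ∧ ∃ v ∈ J, Sum.inl e ∈ σ.cl {Sum.inr v}) (hf : f₁ ∉ σ.edge.cl X) :
    RootedRep X σ.edge L (fun U => σ.edge (U ∪ {f₁, f₂}) < σ.edge U + 2) ∨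
      Sum.inr v₂ ∈ σ.cl (Sum.inl '' X) := by
  rw [or_iff_not_imp_right]
  intro h2
  obtain ⟨p11, p13⟩ := h.proper
  obtain ⟨p22, p23⟩ := h.symm.proper
  have hfX : Sum.inl f₁ ∉ σ.cl (Sum.inl '' X) := fun hc => hf ((σ.mem_cl_comap _).2 hc)
  have hpair : ∀ {a b : V}, a ∈ J → b ∈ J → ({a, b} : Set V) ⊆ J := fun ha hb =>
    insert_subset ha (singleton_subset_iff.2 hb)
  have hf21 : Sum.inl f₂ ∉ σ.cl {Sum.inr v₁, Sum.inr v₃} := by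
    intro hc
    refine p23 (σ.cl_mono ?_ (h.frame.mem_cl_inter (S := {v₁, v₃}) (T := {v₂, v₃})
      (hpair h.mem₁ h.mem₃) (hpair h.mem₂ h.mem₃) (by rwa [image_pair])
      (by rw [image_pair]; exact h.line₂)))
    rintro _ ⟨u, ⟨rfl | rfl, hu⟩, rfl⟩
    · rcases hu with hu | hu
      · exact absurd hu h.ne₁₂
      · exact absurd hu h.ne₁₃
    · rfl
  have hF : Frame σ J (insert f₂ X) := h.frame.subset (by
    rintro e (rfl | he)
    · exact Or.inr (by simp)
    · exact Or.inl he)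
  have heX : ∀ e ∈ X, Sum.inl f₁ ∉ σ.cl {Sum.inl e} := fun e he hc =>
    hfX (σ.cl_mono (singleton_subset_iff.2 (mem_image_of_mem _ he)) hc)
  obtain ⟨hT, h31⟩ := hF.contract_link h.mem₁ h.mem₃ h.ne₁₃ h.line₁ p11 (by
    rintro e (rfl | he) hc
    · exact hf21 (σ.cl_subset_cl (singleton_subset_iff.2 h.line₁) hc)
    · exact heX e he (σ.parallel_symm hc (hF.nonloop e (Or.inr he))))
  set τ := σ.contract {Sum.inl f₁} with hτ
  have hX1 : ∀ U ⊆ X, τ.edge U = σ.edge U := by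
    intro U hU
    have h3 : σ {Sum.inl f₁} = 1 := h.frame.nonloop f₁ (Or.inr (mem_insert _ _))
    rw [RankFn.edge_apply, RankFn.edge_apply, hτ, RankFn.contract_apply, union_singleton,
      σ.notMem_cl.1 fun hc => hfX (σ.cl_mono (image_mono hU) hc), h3]
    ring
  have hlink : ∀ U ⊆ X, (σ.edge (U ∪ {f₁, f₂}) < σ.edge U + 2 ↔ f₂ ∈ τ.edge.cl U) := by
    intro U hU
    rw [← σ.edge.link_iff_of_notMem hf hU, RankFn.edge, RankFn.mem_cl_comap, RankFn.edge,
      RankFn.mem_cl_comap, hτ, RankFn.mem_cl_contract, union_singleton, image_insert_eq]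
  have hv3 : Sum.inr v₃ ∈ σ.cl {Sum.inl f₁, Sum.inr v₁} := Frame.swap_link h.line₁ p11
  refine (hT.roll (x := v₂) (y := v₁) hX ⟨h.mem₂, h.ne₂₃⟩ ⟨h.mem₁, h.ne₁₃⟩ h.ne₁₂.symm ?_ ?_ ?_
    ?_ ?_).congr (fun U hU => (hX1 U hU).symm) hlink
  · rw [hτ, RankFn.mem_cl_contract]
    refine σ.cl_subset_cl ?_ h.line₂
    rintro _ (rfl | rfl)
    · exact σ.mem_cl_of_mem (by simp)
    · refine σ.cl_mono ?_ hv3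
      rintro _ (rfl | rfl) <;> simp
  · intro hc
    rw [hτ, RankFn.mem_cl_contract, singleton_union] at hc
    have h3 : Sum.inr v₃ ∈ σ.cl {Sum.inr v₂, Sum.inl f₁} := by
      refine σ.cl_subset_cl ?_ (Frame.swap_link h.line₂ p22)
      rintro _ (rfl | rfl)
      · exact hc
      · exact σ.mem_cl_of_mem (by simp)
    have h1 : Sum.inr v₁ ∈ σ.cl {Sum.inr v₂, Sum.inl f₁} := by
      refine σ.cl_subset_cl ?_ (Frame.swap_link (by rw [pair_comm]; exact h.line₁) p13)
      rintro _ (rfl | rfl)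
      · exact σ.mem_cl_of_mem (by simp)
      · exact h3
    have h4 := σ.rank_le_of_subset_cl (X := {Sum.inr v₂, Sum.inl f₁})
      (Y := Sum.inr '' {v₁, v₂, v₃}) (by
        rintro _ ⟨u, (rfl | rfl | rfl), rfl⟩
        · exact h1
        · exact σ.mem_cl_of_mem (by simp)
        · exact h3)
    rw [h.frame.joints _ (insert_subset h.mem₁ (hpair h.mem₂ h.mem₃)),
      ncard_eq_three.2 ⟨_, _, _, h.ne₁₂, h.ne₁₃, h.ne₂₃, rfl⟩] at h4
    have h5 := σ.rank_le_ncard (F := {Sum.inr v₂, Sum.inl f₁}) (by simp)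
    rw [ncard_pair (by simp)] at h5
    push_cast at h4 h5
    linarith
  · intro hc
    rw [hτ, RankFn.mem_cl_contract, singleton_union] at hc
    refine hf21 (σ.cl_subset_cl ?_ hc)
    rintro _ (rfl | rfl)
    · exact σ.mem_cl_of_mem (by simp)
    · exact h.line₁
  · intro e he
    obtain ⟨heX, v, hv, hev⟩ := hL e he
    refine ⟨heX, ?_⟩
    have hev' : Sum.inl e ∈ τ.cl {Sum.inr v} := by
      rw [hτ, RankFn.mem_cl_contract]
      exact σ.cl_mono subset_union_left hev
    by_cases hv3 : v = v₃
    · rw [hv3] at hev'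
      exact ⟨v₁, ⟨h.mem₁, h.ne₁₃⟩, τ.cl_subset_cl (singleton_subset_iff.2 h31) hev'⟩
    · exact ⟨v, ⟨hv, hv3⟩, hev'⟩
  · intro hc
    refine h2 ?_
    have hJ : (J \ {v₃}) \ {v₁} = J \ {v₁, v₃} := by
      rw [Set.sdiff_sdiff, union_singleton]
    rw [hJ, hτ, RankFn.mem_cl_contract] at hc
    -- Elements that avoid the merged joint in the contraction avoid both `v₁` and `v₃` before it.
    -- They are therefore skew to `f₁`, which cannot help them to span `v₂`.
    have hsub : {e ∈ X | Sum.inl e ∈ τ.cl (Sum.inr '' (J \ {v₁, v₃}))} ⊆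
        {e ∈ X | Sum.inl e ∈ σ.cl (Sum.inr '' (J \ {v₁, v₃}))} := by
      rintro e ⟨he, hec⟩
      refine ⟨he, hF.mem_cl_of_mem_cl_insert_link (Or.inr he) h.mem₁ h.mem₃ h.ne₁₃ h.line₁ p11 p13
        (heX e he) ?_⟩
      rwa [hτ, RankFn.mem_cl_contract, union_singleton] at hec
    have hsk := h.frame.skew (S := J \ {v₁, v₃}) (T := {v₁, v₃}) sdiff_subset
      (hpair h.mem₁ h.mem₃) disjoint_sdiff_left
    have h3 := σ.mem_cl_of_skew hsk (X' := Sum.inl '' {e ∈ X | Sum.inl e ∈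
        σ.cl (Sum.inr '' (J \ {v₁, v₃}))}) (Y' := {Sum.inl f₁}) (x := Sum.inr v₂) (by
        rintro _ ⟨e, he, rfl⟩
        exact he.2) (by
        rw [singleton_subset_iff, image_pair]
        exact h.line₁) (σ.mem_cl_of_mem (mem_image_of_mem _ ⟨h.mem₂, by
          rintro (hc | hc)
          · exact h.ne₁₂ hc.symm
          · exact h.ne₂₃ hc⟩))
        (σ.cl_mono (union_subset_union_left _ (image_mono hsub)) hc)
    exact σ.cl_mono (image_mono (sep_subset _ _)) h3

/-- When no rolling is possible, `X` spans two of the three joints but not the third. The component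
at the third joint is then skew to everything else, contrary to connectedness. -/
theorem rootedRep [Finite V] (h : IsTriangle σ J X f₁ f₂ v₁ v₂ v₃) (hX : X.Finite)
    (hL : ∀ e ∈ L, e ∈ X ∧ ∃ v ∈ J, Sum.inl e ∈ σ.cl {Sum.inr v})
    (hinc : ∀ v ∈ ({v₁, v₂, v₃} : Set V), ∃ e ∈ X, Sum.inl e ∉ σ.cl (Sum.inr '' (J \ {v})))
    (hconn : ∀ Z ⊆ X, Z.Nonempty →
      σ.edge (X ∪ {f₁, f₂}) < σ.edge Z + σ.edge ((X \ Z) ∪ {f₁, f₂})) :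
    RootedRep X σ.edge L fun U => σ.edge (U ∪ {f₁, f₂}) < σ.edge U + 2 := by
  have hX' : Frame σ J X := h.frame.subset subset_union_left
  have hmem : ({v₁, v₂, v₃} : Set V) ⊆ J :=
    insert_subset h.mem₁ (insert_subset h.mem₂ (singleton_subset_iff.2 h.mem₃))
  have hf12 : Sum.inl '' {f₁, f₂} ⊆ σ.cl (Sum.inr '' {v₁, v₂, v₃}) := by
    rintro _ ⟨_, (rfl | rfl), rfl⟩
    · refine σ.cl_mono ?_ h.line₁
      rintro _ (rfl | rfl) <;> simp
    · refine σ.cl_mono ?_ h.line₂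
      rintro _ (rfl | rfl) <;> simp
  have final : ∀ v ∈ ({v₁, v₂, v₃} : Set V), Sum.inr v ∉ σ.cl (Sum.inl '' X) →
      ¬ ∀ w ∈ ({v₁, v₂, v₃} : Set V), w = v ∨ Sum.inr w ∈ σ.cl (Sum.inl '' X) := by
    intro v hv hvX hS
    obtain ⟨e, he, hev⟩ := hinc v hv
    obtain ⟨Z, hZX, hZ, hr⟩ := hX'.exists_skew_part (hmem hv) hvX he hev hmem hS hf12
    exact (hconn Z hZX hZ).ne hr
  have hedge : ∀ f, f ∈ σ.edge.cl X ↔ Sum.inl f ∈ σ.cl (Sum.inl '' X) := fun f => σ.mem_cl_comap _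
  have hnot : f₁ ∈ σ.edge.cl X → f₂ ∉ σ.edge.cl X := by
    -- With both links spanned by `X`, adding them would not raise the rank.
    intro h1 h2
    have h3 := h.rank
    rw [σ.edge.rank_union_of_subset_cl (insert_subset h1 (singleton_subset_iff.2 h2))] at h3
    linarith
  have span₁ : Sum.inr v₁ ∈ σ.cl (Sum.inl '' X) → Sum.inr v₃ ∈ σ.cl (Sum.inl '' X) →
      f₁ ∈ σ.edge.cl X := fun h1 h3 => by
    rw [hedge]
    exact σ.cl_subset_cl (insert_subset h1 (singleton_subset_iff.2 h3)) h.line₁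
  have span₂ : Sum.inr v₂ ∈ σ.cl (Sum.inl '' X) → Sum.inr v₃ ∈ σ.cl (Sum.inl '' X) →
      f₂ ∈ σ.edge.cl X := fun h1 h3 => by
    rw [hedge]
    exact σ.cl_subset_cl (insert_subset h1 (singleton_subset_iff.2 h3)) h.line₂
  have hcomm : ∀ {P : Prop}, RootedRep X σ.edge L
      (fun U => σ.edge (U ∪ {f₂, f₁}) < σ.edge U + 2) ∨ P →
      RootedRep X σ.edge L (fun U => σ.edge (U ∪ {f₁, f₂}) < σ.edge U + 2) ∨ P := fun hP => by
    rwa [pair_comm]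
  by_cases hf₁ : f₁ ∈ σ.edge.cl X
  · refine (h.rootedRep_or_of_mem hX hL hf₁).resolve_right ?_
    rintro ⟨h1, h3⟩
    refine final v₂ (by simp) (fun h2 => hnot hf₁ (span₂ h2 h3)) ?_
    rintro w (rfl | rfl | rfl)
    · exact Or.inr h1
    · exact Or.inl rfl
    · exact Or.inr h3
  by_cases hf₂ : f₂ ∈ σ.edge.cl X
  · refine (hcomm (h.symm.rootedRep_or_of_mem hX hL hf₂)).resolve_right ?_
    rintro ⟨h2, h3⟩
    refine final v₁ (by simp) (fun h1 => hf₁ (span₁ h1 h3)) ?_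
    rintro w (rfl | rfl | rfl)
    · exact Or.inl rfl
    · exact Or.inr h2
    · exact Or.inr h3
  rcases h.rootedRep_or_of_notMem hX hL hf₁ with hR | h2
  · exact hR
  refine (hcomm (h.symm.rootedRep_or_of_notMem hX hL hf₂)).resolve_right fun h1 => ?_
  refine final v₃ (by simp) (fun h3 => hf₁ (span₁ h1 h3)) ?_
  rintro w (rfl | rfl | rfl)
  · exact Or.inr h1
  · exact Or.inr h2
  · exact Or.inl rfl

end IsTriangle

end

end FrameMatroids

namespace FrameMatroids

universe u v

/-! ### Framed 2-sums and their contractions. -/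

section

variable {V α : Type u} {ρ : RankFn (α ⊕ V)} {J : Set V} {X Y L E A U Z₁ Z₂ : Set α}
  {G : Graph V α} {v w a b : V} {e f : α}

theorem RankFn.edge_contract (ρ : RankFn (α ⊕ V)) (A U : Set α) :
    (ρ.contract (Sum.inl '' A)).edge U = ρ.edge (U ∪ A) - ρ.edge A := by
  rw [edge_apply, edge_apply, edge_apply, contract_apply, image_union]

theorem RankFn.mem_cl_edge : e ∈ ρ.edge.cl U ↔ Sum.inl e ∈ ρ.cl (Sum.inl '' U) := ρ.mem_cl_comap _

/-- The contraction of elements `A` skew to `X` does not change the rank function on `X`. -/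
theorem Frame.contract_skew (h : Frame ρ J E) (hA : A.Finite) (hAE : A ⊆ E) (hXE : X ⊆ E)
    (hs : ρ.edge (X ∪ A) = ρ.edge X + ρ.edge A) :
    ∃ J' ⊆ J, Frame (ρ.contract (Sum.inl '' A)) J' {e ∈ E | Sum.inl e ∉ ρ.cl (Sum.inl '' A)} ∧
      (∀ v ∈ J, Sum.inr v ∉ ρ.cl (Sum.inl '' A) →
        ∃ w ∈ J', Sum.inr v ∈ (ρ.contract (Sum.inl '' A)).cl {Sum.inr w} ∧
          Sum.inr w ∈ (ρ.contract (Sum.inl '' A)).cl {Sum.inr v}) ∧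
      X ⊆ {e ∈ E | Sum.inl e ∉ ρ.cl (Sum.inl '' A)} ∧
      (∀ U ⊆ X, (ρ.contract (Sum.inl '' A)).edge U = ρ.edge U) ∧
      ∀ e, Sum.inl e ∉ ρ.cl (Sum.inl '' A) → (∃ v ∈ J, Sum.inl e ∈ ρ.cl {Sum.inr v}) →
        ∃ w ∈ J', Sum.inl e ∈ (ρ.contract (Sum.inl '' A)).cl {Sum.inr w} := by
  obtain ⟨J', hJ', hF, hrep⟩ := h.contract hA hAE
  refine ⟨J', hJ', hF, fun v hv hvA => ?_, fun e he => ⟨hXE he, fun hc => ?_⟩, fun U hU => ?_,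
    fun e he ⟨v, hv, hev⟩ => ?_⟩
  · obtain ⟨w, hw, hvw⟩ := (hrep v hv).resolve_left hvA
    refine ⟨w, hw, hvw, RankFn.parallel_symm _ hvw ?_⟩
    rw [RankFn.contract_apply, singleton_union, ρ.notMem_cl.1 hvA]
    ring
  · have h1 := ρ.edge.cl_inter_of_skew hs (ρ.edge.mem_cl_of_mem he) (RankFn.mem_cl_edge.2 hc)
    rw [RankFn.edge_apply, image_singleton, h.nonloop e (hXE he)] at h1
    exact one_ne_zero h1
  · rw [ρ.edge_contract, ρ.edge.skew_mono hs (hU.trans (ρ.edge.subset_cl _)) (ρ.edge.subset_cl _)]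
    ring
  · have hev' : Sum.inl e ∈ (ρ.contract (Sum.inl '' A)).cl {Sum.inr v} := by
      rw [RankFn.mem_cl_contract]
      exact ρ.cl_mono subset_union_left hev
    obtain ⟨w, hw, hvw⟩ := (hrep v hv).resolve_left fun hc =>
      he (ρ.cl_subset_cl (singleton_subset_iff.2 hc) hev)
    exact ⟨w, hw, RankFn.cl_subset_cl _ (singleton_subset_iff.2 hvw) hev'⟩

/-- A framed matroid on `X ∪ Y` that is a 2-sum of connected matroids with parts `X` and `Y`, where
the elements of `L` are parallel to joints. -/
structure FramedSum (ρ : RankFn (α ⊕ V)) (J : Set V) (X Y L : Set α) : Prop where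
  frame : Frame ρ J (X ∪ Y)
  finite_left : X.Finite
  finite_right : Y.Finite
  disjoint : Disjoint X Y
  joint : ∀ e ∈ L, e ∈ X ∪ Y ∧ ∃ v ∈ J, Sum.inl e ∈ ρ.cl {Sum.inr v}
  rank : ρ.edge (X ∪ Y) + 1 = ρ.edge X + ρ.edge Y
  left : ∀ Z ⊆ X, Z.Nonempty → ρ.edge (X ∪ Y) < ρ.edge Z + ρ.edge ((X \ Z) ∪ Y)
  right : ∀ Z ⊆ Y, Z.Nonempty → ρ.edge (X ∪ Y) < ρ.edge Z + ρ.edge (X ∪ (Y \ Z))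

namespace FramedSum

/-- The two sides meet in rank one only, and by connectedness `Z₁` already needs this one unit to be
tied to `X` and `Z₂`. So nothing is left by which `Z₂` alone could be tied to `X`. -/
theorem skew_of_skew (h : FramedSum ρ J X (Z₁ ∪ Z₂) L) (hd : Disjoint Z₁ Z₂) (hZ : Z₁.Nonempty)
    (hr : ρ.edge (Z₁ ∪ Z₂) = ρ.edge Z₁ + ρ.edge Z₂) :
    ρ.edge (X ∪ Z₂) = ρ.edge X + ρ.edge Z₂ := by
  have h1 := h.right Z₁ subset_union_left hZ
  rw [union_sdiff_cancel_left (by rw [hd.inter_eq])] at h1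
  have h2 := h.rank
  have h3 := ρ.edge.union_le X Z₂
  linarith

/-- The contraction of a part of `Y` that is skew to the rest of `Y`. -/
theorem contract_part (h : FramedSum ρ J X (Z₁ ∪ Z₂) L) (hd : Disjoint Z₁ Z₂) (hZ : Z₁.Nonempty)
    (hr : ρ.edge (Z₁ ∪ Z₂) = ρ.edge Z₁ + ρ.edge Z₂) :
    ∃ J', FramedSum (ρ.contract (Sum.inl '' Z₂)) J' X Z₁ (L ∩ (X ∪ Z₁)) ∧
      (∀ U ⊆ X, (ρ.contract (Sum.inl '' Z₂)).edge U = ρ.edge U) ∧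
      ∀ U ⊆ Z₁, (ρ.contract (Sum.inl '' Z₂)).edge U = ρ.edge U := by
  have hs := h.skew_of_skew hd hZ hr
  have hf := h.finite_right.subset (subset_union_right (s := Z₁) (t := Z₂))
  obtain ⟨J', -, hF, -, hX, hrX, hj⟩ := h.frame.contract_skew hf
    (subset_union_right.trans subset_union_right) subset_union_left hs
  have hr1 : ∀ U ⊆ Z₁, (ρ.contract (Sum.inl '' Z₂)).edge U = ρ.edge U := by
    intro U hU
    rw [ρ.edge_contract, ρ.edge.skew_mono hr (hU.trans (ρ.edge.subset_cl _)) (ρ.edge.subset_cl _)]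
    ring
  have hZ1 : Z₁ ⊆ {e ∈ X ∪ (Z₁ ∪ Z₂) | Sum.inl e ∉ ρ.cl (Sum.inl '' Z₂)} := by
    refine fun e he => ⟨Or.inr (Or.inl he), fun hc => ?_⟩
    have h1 := ρ.edge.cl_inter_of_skew hr (ρ.edge.mem_cl_of_mem he) (RankFn.mem_cl_edge.2 hc)
    rw [RankFn.edge_apply, image_singleton, h.frame.nonloop e (Or.inr (Or.inl he))] at h1
    exact one_ne_zero h1
  have hXZ : X ∪ Z₁ ⊆ {e ∈ X ∪ (Z₁ ∪ Z₂) | Sum.inl e ∉ ρ.cl (Sum.inl '' Z₂)} := union_subset hX hZ1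
  refine ⟨J', ⟨hF.subset hXZ, h.finite_left, h.finite_right.subset subset_union_left,
    h.disjoint.mono_right subset_union_left, fun e he => ⟨he.2, hj e (hXZ he.2).2 (h.joint e he.1).2⟩,
    ?_, fun Z hZX hZ0 => ?_, fun Z hZY hZ0 => ?_⟩, hrX, hr1⟩
  · rw [hrX X subset_rfl, hr1 Z₁ subset_rfl, ρ.edge_contract, union_assoc]
    have := h.rank
    linarith
  · rw [hrX Z hZX, ρ.edge_contract, ρ.edge_contract, union_assoc, union_assoc]
    have := h.left Z hZX hZ0
    linarith
  · rw [hr1 Z hZY, ρ.edge_contract, ρ.edge_contract, union_assoc, union_assoc]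
    have h1 := h.right Z (hZY.trans subset_union_left) hZ0
    have h2 : (Z₁ ∪ Z₂) \ Z = (Z₁ \ Z) ∪ Z₂ := by
      rw [union_sdiff_distrib, (hd.symm.mono_right hZY).sdiff_eq_left]
    rw [h2] at h1
    linarith

/-- After the contraction of `A` the element `f` is spanned by the same subsets of `X` as the
basepoint. So the side of `X` is a minor of the sum, with `f` in place of the basepoint. -/
theorem exists_maximal_skew (h : FramedSum ρ J X Y L) :
    ∃ A ⊆ Y, ρ.edge (X ∪ A) = ρ.edge X + ρ.edge A ∧ ρ.edge Y = ρ.edge A + 1 ∧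
      ∃ f ∈ Y, f ∉ ρ.edge.cl A ∧ f ∈ ρ.edge.cl (X ∪ A) ∧ ∀ U ⊆ X,
        (f ∈ ρ.edge.cl (U ∪ A) ↔ ρ.edge (U ∪ Y) < ρ.edge U + ρ.edge Y) := by
  obtain ⟨A, -, hAY, hs, hr, ⟨f, hf, hfA⟩, hA⟩ := ρ.edge.exists_maximal_skew (X := X)
    h.finite_right (empty_subset _) (by simp) h.rank
  obtain ⟨h1, h2⟩ := hA f hf hfA
  exact ⟨A, hAY, hs, hr, f, hf, h2, h1, fun U hU =>
    ρ.edge.mem_cl_union_iff_not_skew hAY hs h1 hf h2 h.rank.ge hU⟩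

/-- If `Y` spans its ends, contracting a maximal part of `Y` that is skew to `X` makes the remaining
elements of `Y` joints. -/
theorem rootedRep_of_spanning (h : FramedSum ρ J X Y L)
    (hY : ∀ e ∈ Y, ∃ a ∈ J, ∃ b ∈ J, Sum.inl e ∈ ρ.cl {Sum.inr a, Sum.inr b} ∧
      Sum.inr a ∈ ρ.cl (Sum.inl '' Y) ∧ Sum.inr b ∈ ρ.cl (Sum.inl '' Y)) :
    RootedRep X ρ.edge (L ∩ X) fun U => ρ.edge (U ∪ Y) < ρ.edge U + ρ.edge Y := by
  obtain ⟨A, hAY, hs, hr, f, hf, hfA, -, hlink⟩ := h.exists_maximal_skew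
  obtain ⟨a, ha, b, hb, hab, haY, hbY⟩ := hY f hf
  -- Some end of `f` is not spanned by `A`, for otherwise `f` would be. As `Y` has rank only one
  -- more than `A`, this joint is parallel to `f` modulo `A`.
  obtain ⟨c, hc, hcY, hcA⟩ : ∃ c ∈ J, Sum.inr c ∈ ρ.cl (Sum.inl '' Y) ∧
      Sum.inr c ∉ ρ.cl (Sum.inl '' A) := by
    by_contra! hcon
    refine hfA (RankFn.mem_cl_edge.2 (ρ.cl_subset_cl ?_ hab))
    exact insert_subset (hcon a ha haY) (singleton_subset_iff.2 (hcon b hb hbY))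
  obtain ⟨J', -, hF, hrep, hX, hrX, hj⟩ := h.frame.contract_skew (h.finite_right.subset hAY)
    (hAY.trans subset_union_right) subset_union_left hs
  obtain ⟨w, hw, hcw, hwc⟩ := hrep c hc hcA
  have hYf : Sum.inl '' Y ⊆ ρ.cl (Sum.inl '' insert f A) := by
    refine ρ.subset_cl_of_rank_le (image_mono (insert_subset hf hAY)) ?_
    have h1 := ρ.edge.notMem_cl.1 hfA
    rw [RankFn.edge_apply, RankFn.edge_apply] at h1 hr
    linarith
  have hcf : Sum.inr c ∈ (ρ.contract (Sum.inl '' A)).cl {Sum.inl f} := by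
    rw [RankFn.mem_cl_contract, singleton_union, ← image_insert_eq]
    exact ρ.cl_subset_cl hYf hcY
  have hfc : Sum.inl f ∈ (ρ.contract (Sum.inl '' A)).cl {Sum.inr c} := by
    refine RankFn.parallel_symm _ hcf ?_
    rw [RankFn.contract_apply, singleton_union, ρ.notMem_cl.1 hcA]
    ring
  refine ((hF.subset hX).rootedRep hw (L := L ∩ X) fun e he =>
    hj e (hX he.2).2 (h.joint e he.1).2).congr (fun U hU => (hrX U hU).symm) fun U hU => ?_
  rw [← hlink U hU, RankFn.mem_cl_edge, image_union, ← RankFn.mem_cl_contract]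
  exact RankFn.mem_cl_congr_of_parallel _
    (RankFn.cl_subset_cl _ (singleton_subset_iff.2 hcw) hfc)
    (RankFn.cl_subset_cl _ (singleton_subset_iff.2 hcf) hwc) _

/-- If no part of `Y` is skew to the rest of it, the graph formed by `Y` is connected. -/
theorem reach (hF : Framing ρ G) (hV : G.vertexSet.Finite) (hYE : Y ⊆ G.edgeSet)
    (hY : ∀ Z ⊆ Y, Z.Nonempty → Z ≠ Y → ρ.edge Y ≠ ρ.edge Z + ρ.edge (Y \ Z))
    (ha : a ∈ ends G Y) (hb : b ∈ ends G Y) : Reach G Y a b := by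
  set K : Set V := {v | Reach G Y a v} with hK
  have hKV : K ⊆ G.vertexSet := fun v hv => by
    obtain ⟨_, _, h', -⟩ := hv.symm
    exact h'.left_vertex
  set Z : Set α := {e ∈ Y | ∃ v ∈ K, G.Inc e v} with hZ
  have hends : ∀ e ∈ Z, ∀ v, G.Inc e v → v ∈ K := by
    rintro e ⟨he, u, hu, u', hl⟩ v hv
    rcases hv.eq_or_eq_of_isLink hl with rfl | rfl
    · exact hu
    · exact Reach.trans hu (Reach.of_isLink hl he)
  obtain ⟨e, he, hea⟩ := ha
  have heZ : e ∈ Z := ⟨he, a, Reach.refl hea.vertex_mem, hea⟩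
  have hZY : Z = Y := by
    by_contra hne
    refine hY Z (sep_subset _ _) ⟨e, heZ⟩ hne ?_
    have h1 := ρ.skew_mono (hF.skew hV hKV) (hF.subset_cl ((sep_subset _ _).trans hYE) hends)
      (hF.subset_cl (X := Y \ Z) (U := G.vertexSet \ K) (sdiff_subset.trans hYE) fun e he v hv =>
        ⟨hv.vertex_mem, fun hvK => he.2 ⟨he.1, v, hvK, hv⟩⟩)
    rwa [← image_union, union_sdiff_cancel (sep_subset _ _)] at h1
  obtain ⟨e', he', heb⟩ := hb
  rw [← hZY] at he'
  exact hends e' he' b heb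

end FramedSum

end

end FrameMatroids

namespace FrameMatroids

universe u v

/-! ### Parts that are graphic. -/

section

variable {V α : Type u} {ρ : RankFn (α ⊕ V)} {J T : Set V} {X Y L E A U Z₁ Z₂ : Set α}
  {H : Graph V α} {v w a b s t : V} {e f : α}

namespace FramedSum

theorem subset_cl_ends (hF : Framing ρ H) (hU : U ⊆ H.edgeSet) :
    Sum.inl '' U ⊆ ρ.cl (Sum.inr '' ends H U) :=
  hF.subset_cl hU fun e he _ hv => ⟨e, he, hv⟩

theorem ends_subset : ends H U ⊆ H.vertexSet := fun _ ⟨_, _, hv⟩ => hv.vertex_mem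

/-- If `X` and `Y` have just two common ends, which are not spanned by `Y`, the subsets of `Y` that
are not skew to `X` are those that connect the two ends. -/
theorem reach_iff (h : FramedSum ρ J X Y L) (hF : Framing ρ H) (hE : H.edgeSet = Y)
    (hV : H.vertexSet = J) (hTJ : T ⊆ J) (hXT : Sum.inl '' X ⊆ ρ.cl (Sum.inr '' T)) (hst : s ≠ t)
    (hs : s ∈ ends H Y) (ht : t ∈ ends H Y) (htT : t ∈ T) (hT : T ∩ ends H Y ⊆ {s, t})
    (hno : ∀ v ∈ ends H Y, Sum.inr v ∉ ρ.cl (Sum.inl '' Y)) (hU : U ⊆ Y) :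
    Reach H U s t ↔ ρ.edge (U ∪ X) < ρ.edge U + ρ.edge X := by
  have hYJ : ends H Y ⊆ J := hV ▸ ends_subset
  have hYE : Y ⊆ H.edgeSet := hE.ge
  have hTf : T.Finite := h.frame.finite.subset hTJ
  constructor
  · intro hst'
    by_contra hn
    have h1 := h.frame.skew_edges (T := T \ {t}) (K := ends H Y) (s := s) (U := Y)
      (sdiff_subset.trans hTJ) hYJ (by
        rintro v ⟨⟨hv, hvt⟩, hvY⟩
        exact (hT ⟨hv, hvY⟩).resolve_right hvt) (subset_cl_ends hF hYE) (hno s hs)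
    -- Since `U` connects `s` to `t`, the joint `t` is redundant next to `s` and `U`. Joints `T \
    -- {t}` are skew to `Y`, so skewness of `U` and `X` would give a contradiction by submodularity.
    -- If `s` were not an end of `X`, all of `T` would be skew to `Y`, which the rank of the sum
    -- forbids.
    have h2 : ρ (Sum.inr '' T ∪ Sum.inl '' U) ≤ ρ (Sum.inr '' (T \ {t})) + ρ (Sum.inl '' U) := by
      by_cases hsT : s ∈ T
      · refine le_trans (ρ.rank_le_of_subset_cl ?_) (ρ.union_le _ _)
        rintro _ (⟨v, hv, rfl⟩ | hx)
        · by_cases hvt : v = t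
          · rw [hvt]
            refine ρ.cl_mono ?_ (hF.reach hst')
            exact insert_subset (Or.inl (mem_image_of_mem _ ⟨hsT, hst⟩)) subset_union_right
          · exact ρ.mem_cl_of_mem (Or.inl (mem_image_of_mem _ ⟨hv, hvt⟩))
        · exact ρ.mem_cl_of_mem (Or.inr hx)
      · exfalso
        have h3 := h.frame.skew_edges (T := T) (K := ends H Y) (s := t) (U := Y) hTJ hYJ (by
          rintro v ⟨hv, hvY⟩
          refine (hT ⟨hv, hvY⟩).resolve_left ?_
          rintro rfl
          exact hsT hv) (subset_cl_ends hF hYE) (hno t ht)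
        have h4 := ρ.skew_mono h3 hXT (ρ.subset_cl _)
        have h5 := h.rank
        rw [RankFn.edge_apply, RankFn.edge_apply, RankFn.edge_apply, image_union] at h5
        linarith
    have h3 := ρ.submod_of_subset (W := Sum.inr '' T ∪ Sum.inl '' Y)
      (Z := Sum.inl '' U ∪ Sum.inl '' X)
      (X := Sum.inr '' T ∪ Sum.inl '' U ∪ Sum.inl '' X) (Y := Sum.inl '' X ∪ Sum.inl '' Y)
      (union_subset_union_left _ subset_union_right)
      (union_subset (subset_union_of_subset_right (image_mono hU) _) subset_union_left)
      (union_subset_union (subset_union_left.trans subset_union_left) subset_union_right)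
    rw [ρ.rank_union_of_subset_cl (hXT.trans (ρ.cl_mono subset_union_left))] at h3
    have h4 := h.rank
    simp only [RankFn.edge_apply, image_union] at h4 hn
    have h5 := ρ.mono (union_subset_union_left (Sum.inl '' Y)
      (image_mono (f := Sum.inr) (sdiff_subset (s := T) (t := {t}))))
    linarith
  · intro hlink
    by_contra hn
    -- If `U` does not connect `s` to `t`, its part around `s` shares only `s` with the joints of
    -- `X`, and the rest shares only `t`. Neither is spanned, so `U` is skew to `X`.
    set K : Set V := {v | Reach H U s v} with hK
    have hKJ : K ⊆ J := fun v hv => by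
      obtain ⟨_, _, h', -⟩ := hv.symm
      exact hV ▸ h'.left_vertex
    have hsK : s ∈ K := Reach.refl (ends_subset hs)
    set U₁ : Set α := {e ∈ U | ∃ v ∈ K, H.Inc e v} with hU₁
    have hends : ∀ e ∈ U₁, ∀ v, H.Inc e v → v ∈ K := by
      rintro e ⟨he, u, hu, u', hl⟩ v hv
      rcases hv.eq_or_eq_of_isLink hl with rfl | rfl
      · exact hu
      · exact Reach.trans hu (Reach.of_isLink hl he)
    have hU₁U : U₁ ⊆ U := sep_subset _ _
    have hc₁ : Sum.inl '' U₁ ⊆ ρ.cl (Sum.inr '' (K ∩ ends H Y)) :=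
      hF.subset_cl ((hU₁U.trans hU).trans hYE) fun e he v hv =>
        ⟨hends e he v hv, e, hU (hU₁U he), hv⟩
    have hc₂ : Sum.inl '' (U \ U₁) ⊆ ρ.cl (Sum.inr '' ((J \ K) ∩ ends H Y)) :=
      hF.subset_cl ((sdiff_subset.trans hU).trans hYE) fun e he v hv =>
        ⟨⟨hV ▸ hv.vertex_mem, fun hvK => he.2 ⟨he.1, v, hvK, hv⟩⟩, e, hU he.1, hv⟩
    have h1 := h.frame.skew_edges (T := T ∩ K) (K := K ∩ ends H Y) (s := s) (U := U₁)
      (inter_subset_left.trans hTJ) (inter_subset_left.trans hKJ) (by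
        rintro v ⟨⟨hv, hvK⟩, -, hvY⟩
        refine (hT ⟨hv, hvY⟩).resolve_right ?_
        rintro rfl
        exact hn hvK) hc₁ fun hc => hno s hs (ρ.cl_mono (image_mono (hU₁U.trans hU)) hc)
    have h2 := h.frame.skew_edges (T := T \ K) (K := (J \ K) ∩ ends H Y) (s := t) (U := U \ U₁)
      (sdiff_subset.trans hTJ) (inter_subset_left.trans sdiff_subset) (by
        rintro v ⟨⟨hv, hvK⟩, -, hvY⟩
        refine (hT ⟨hv, hvY⟩).resolve_left ?_
        rintro rfl
        exact hvK hsK) hc₂ fun hc => hno t ht (ρ.cl_mono (image_mono (sdiff_subset.trans hU)) hc)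
    have h3 := ρ.skew_mono (h.frame.skew hKJ sdiff_subset disjoint_sdiff_right)
      (X' := Sum.inr '' (T ∩ K) ∪ Sum.inl '' U₁) (Y' := Sum.inr '' (T \ K) ∪ Sum.inl '' (U \ U₁))
      (union_subset ((image_mono inter_subset_right).trans (ρ.subset_cl _))
        (hc₁.trans (ρ.cl_mono (image_mono inter_subset_left))))
      (union_subset ((image_mono (sdiff_subset_sdiff_left hTJ)).trans (ρ.subset_cl _))
        (hc₂.trans (ρ.cl_mono (image_mono inter_subset_left))))
    rw [union_union_union_comm, ← image_union, ← image_union, inter_union_sdiff,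
      union_sdiff_cancel hU₁U, h1, h2] at h3
    have h4 := ρ.union_le (Sum.inl '' U₁) (Sum.inl '' (U \ U₁))
    rw [← image_union, union_sdiff_cancel hU₁U] at h4
    have h5 := ρ.union_le (Sum.inr '' (T ∩ K)) (Sum.inr '' (T \ K))
    rw [← image_union, inter_union_sdiff] at h5
    have h6 := ρ.union_le (Sum.inr '' T) (Sum.inl '' U)
    have h7 := ρ.skew_mono (X' := Sum.inl '' X) (Y' := Sum.inl '' U)
      (show ρ (Sum.inr '' T ∪ Sum.inl '' U) = ρ (Sum.inr '' T) + ρ (Sum.inl '' U) by linarith)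
      hXT (ρ.subset_cl _)
    rw [RankFn.edge_apply, RankFn.edge_apply, RankFn.edge_apply, image_union, union_comm] at hlink
    linarith

/-- If `Y` spans none of its ends and has only two of them in common with `X`, it is graphic. -/
theorem rootedGraphic (h : FramedSum ρ J X Y L) (hF : Framing ρ H) (hE : H.edgeSet = Y)
    (hV : H.vertexSet = J) (hTJ : T ⊆ J) (hXT : Sum.inl '' X ⊆ ρ.cl (Sum.inr '' T)) (hst : s ≠ t)
    (hs : s ∈ ends H Y) (ht : t ∈ ends H Y) (htT : t ∈ T) (hT : T ∩ ends H Y ⊆ {s, t})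
    (hno : ∀ v ∈ ends H Y, Sum.inr v ∉ ρ.cl (Sum.inl '' Y)) :
    RootedGraphic Y ρ.edge fun U => ρ.edge (U ∪ X) < ρ.edge U + ρ.edge X := by
  classical
  have hVf : H.vertexSet.Finite := hV ▸ h.frame.finite
  have hEf : H.edgeSet.Finite := hE ▸ h.finite_right
  have : Finite H.vertexSet := hVf
  have hend : ∀ {e a b}, H.IsLink e a b → e ∈ Y ∧ a ∈ ends H Y := fun hl =>
    ⟨hE ▸ hl.edge_mem, _, hE ▸ hl.edge_mem, hl.inc_left⟩
  -- An independent cycle would span its vertices, but `Y` spans none of its ends. So all cycles are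
  -- balanced, as in the biased graph of `H` with every cycle balanced.
  have hcyc : ∀ W D, IsCycleOn H W D → ρ.edge D < D.ncard := by
    intro W D hD
    by_contra hn
    obtain ⟨e, he⟩ := hD.nonempty
    obtain ⟨a, b, hl⟩ := Graph.exists_isLink_of_mem_edgeSet (hD.subset_edgeSet he)
    exact hno a (hend hl).2 (ρ.cl_mono (image_mono (hE ▸ hD.subset_edgeSet))
      (hF.mem_cl_of_cycle hD hn (hD.mem_of_inc he hl.inc_left)))
  have hΩ : ∀ e x, (BiasedGraph.ofGraph H hVf hEf).graph.IsLink e x x →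
      {e} ∉ (BiasedGraph.ofGraph H hVf hEf).balanced := fun e x hl =>
    absurd (ρ.cl_mono (singleton_subset_iff.2 (mem_image_of_mem _ (hend hl).1)) (hF.loop hl))
      (hno x (hend hl).2)
  have hrank : ∀ U ⊆ Y, ρ.edge U = (BiasedGraph.ofGraph H hVf hEf).rankFn.edge U := fun U hU =>
    hF.edge_eq (BiasedGraph.framing hΩ) hVf hEf (fun W D hD => iff_of_true (hcyc W D hD)
      ((BiasedGraph.mem_balanced_iff (Ω := BiasedGraph.ofGraph H hVf hEf) hD).1 ⟨W, hD⟩))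
      (hE.symm ▸ hU)
  have hends : ∀ e, ∃ x y : H.vertexSet, e ∈ H.edgeSet → H.IsLink e x y := by
    intro e
    by_cases he : e ∈ H.edgeSet
    · obtain ⟨x, y, hl⟩ := Graph.exists_isLink_of_mem_edgeSet he
      exact ⟨⟨x, hl.left_mem⟩, ⟨y, hl.right_mem⟩, fun _ => hl⟩
    · exact ⟨⟨s, ends_subset hs⟩, ⟨s, ends_subset hs⟩, fun h => absurd h he⟩
  choose p q hpq using hends
  have himage : ∀ U : Set α, (fun o : Option α => edgeVec (o.elim ⟨s, ends_subset hs⟩ p : H.vertexSet)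
      (o.elim ⟨t, ends_subset ht⟩ q)) '' (some '' U) = (fun e => edgeVec (p e) (q e)) '' U :=
    fun U => by
      rw [image_image]
      rfl
  refine ⟨H.vertexSet, hVf, fun o => o.elim ⟨s, ends_subset hs⟩ p,
    fun o => o.elim ⟨t, ends_subset ht⟩ q, fun U hU => ?_, fun U hU => ?_⟩
  · rw [hrank U hU, ofGraph_rankFn hVf hEf hpq (hE.symm ▸ hU), RankFn.lin_apply, RankFn.lin_apply,
      himage]
  · refine Iff.trans ?_ (h.reach_iff hF hE hV hTJ hXT hst hs ht htT hT hno hU)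
    rw [RankFn.mem_cl_lin, himage]
    have hl := image_edgeVec (X := U) fun e he => hpq e (hE.symm ▸ hU he)
    rw [hl]
    change edgeVec _ _ ∈ _ ↔ _
    rw [← unitVec_add_unitVec]
    constructor
    · intro hm
      refine reach_of_unitVec_add_mem (J := ∅) (empty_subset _) (ends_subset hs) (ends_subset ht)
        (by rwa [image_empty, union_empty]) ?_
      rw [image_empty, union_empty, ← hl]
      have h1 : unitVec H s = pointVec (⟨s, ends_subset hs⟩ : H.vertexSet) := by
        ext u
        exact ite_congr_iff ⟨fun h => Subtype.ext h, fun h => congrArg Subtype.val h⟩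
      rw [h1]
      exact pointVec_notMem_span _ _ _ _
    · exact fun hr => hr.unitVec_add_mem Submodule.subset_span

end FramedSum

end

end FrameMatroids

namespace FrameMatroids

universe u v

/-! ### Three common ends, and the dichotomy for a framed 2-sum. -/

section

variable {V α : Type u} {ρ : RankFn (α ⊕ V)} {J T : Set V} {X Y L E A U Z₁ Z₂ : Set α}
  {G H : Graph V α} {v w a b s t s₁ s₂ s₃ : V} {e f : α}

namespace FramedSum

/-- Suppose that `X` and `Y` have three common ends `s₁`, `s₂`, `s₃` that are not spanned by `Y`. If a
maximal part `A` of `Y` that is skew to `X` connects `s₂` and `s₃`, then contracting all but one of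
the elements needed to do so makes the rest of `Y` part of a triangle. -/
theorem rootedRep_of_three [Finite V] (h : FramedSum ρ J X Y L) (hA : A ⊆ Y)
    (hs : ρ.edge (X ∪ A) = ρ.edge X + ρ.edge A) (hr : ρ.edge Y = ρ.edge A + 1) (hf : f ∈ Y)
    (hfA : f ∉ ρ.edge.cl A)
    (hinc : ∀ s ∈ ({s₁, s₂, s₃} : Set V), s ∈ J ∧ Sum.inr s ∉ ρ.cl (Sum.inl '' Y) ∧
      ∃ e ∈ X, ∃ u ∈ J, Sum.inl e ∈ ρ.cl {Sum.inr s, Sum.inr u} ∧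
        Sum.inr s ∈ ρ.cl {Sum.inl e, Sum.inr u})
    (h32 : s₃ ≠ s₂) (h3 : Sum.inr s₃ ∈ ρ.cl (insert (Sum.inr s₂) (Sum.inl '' A)))
    (h1 : Sum.inr s₁ ∉ ρ.cl (insert (Sum.inr s₂) (Sum.inl '' A)))
    (hf1 : Sum.inl f ∈ ρ.cl (insert (Sum.inr s₁) (insert (Sum.inr s₂) (Sum.inl '' A))))
    (hf2 : Sum.inl f ∉ ρ.cl (insert (Sum.inr s₂) (Sum.inl '' A))) :
    RootedRep X ρ.edge (L ∩ X) fun U => ρ.edge (U ∪ Y) < ρ.edge U + ρ.edge Y := by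
  obtain ⟨hJ₁, hn₁, -⟩ := hinc s₁ (by simp)
  obtain ⟨hJ₂, hn₂, -⟩ := hinc s₂ (by simp)
  obtain ⟨hJ₃, hn₃, -⟩ := hinc s₃ (by simp)
  have hAf := h.finite_right.subset hA
  -- `A₀` is a maximal subset of `A` that does not yet connect `s₃` to `s₂`. Contracting it leaves
  -- the three joints distinct, while any further element `g` of `A` becomes a link between `s₂` and
  -- `s₃`.
  obtain ⟨A₀, ⟨hA₀, h30⟩, hmax⟩ := (hAf.finite_subsets.subset
    (t := {B | B ⊆ A ∧ Sum.inr s₃ ∉ ρ.cl (insert (Sum.inr s₂) (Sum.inl '' B))})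
    fun B hB => hB.1).exists_maximal ⟨∅, empty_subset _, fun hc => h32 (h.frame.mem_of_mem_cl
      (S := {s₂}) (singleton_subset_iff.2 hJ₂) hJ₃ (by simpa using hc))⟩
  have hmax' : ∀ e ∈ A, e ∉ A₀ →
      Sum.inr s₃ ∈ ρ.cl (insert (Sum.inr s₂) (insert (Sum.inl e) (Sum.inl '' A₀))) := by
    intro e he he0
    by_contra hc
    exact he0 (hmax (y := insert e A₀) ⟨insert_subset he hA₀, by rwa [image_insert_eq]⟩
      (subset_insert _ _) (mem_insert _ _))
  have hAs : Sum.inl '' A ⊆ ρ.cl (insert (Sum.inr s₃) (insert (Sum.inr s₂) (Sum.inl '' A₀))) := by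
    rintro _ ⟨e, he, rfl⟩
    by_cases he0 : e ∈ A₀
    · exact ρ.mem_cl_of_mem (Or.inr (Or.inr (mem_image_of_mem _ he0)))
    · exact ρ.exchange (by rw [insert_comm]; exact hmax' e he he0) h30
  obtain ⟨g, hg, hg0⟩ : ∃ g ∈ A, g ∉ A₀ := not_subset.1 fun hc => h30 (by rwa [hA₀.antisymm hc])
  have hgA : Sum.inl g ∉ ρ.cl (Sum.inl '' A₀) := fun hc => h30 (ρ.cl_subset_cl (by
    rintro _ (rfl | rfl | hx)
    · exact ρ.mem_cl_of_mem (mem_insert _ _)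
    · exact ρ.cl_mono (subset_insert _ _) hc
    · exact ρ.mem_cl_of_mem (Or.inr hx)) (hmax' g hg hg0))
  have hfA' : Sum.inl f ∉ ρ.cl (Sum.inl '' A) := fun hc => hfA (RankFn.mem_cl_edge.2 hc)
  have hgr := ρ.notMem_cl.1 hgA
  have hfr := ρ.notMem_cl.1 hfA'
  -- The joints `s₂`, `s₃` with `A₀` span both `A` and `s₂`, and `A` does not span `s₂`. Hence `f`
  -- and `g` together account for all of `Y` modulo `A₀`.
  have hrA : ρ (Sum.inl '' A) ≤ ρ (Sum.inl '' A₀) + 1 := by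
    have h2 := ρ.notMem_cl.1 fun hc : Sum.inr s₂ ∈ ρ.cl (Sum.inl '' A) =>
      hn₂ (ρ.cl_mono (image_mono hA) hc)
    have h4 := ρ.rank_le_of_subset_cl (insert_subset
      (ρ.mem_cl_of_mem (Or.inr (mem_insert (Sum.inr s₂) (Sum.inl '' A₀)))) hAs)
    have h5 := ρ.insert_le (Sum.inr s₃) (insert (Sum.inr s₂) (Sum.inl '' A₀))
    have h6 := ρ.insert_le (Sum.inr s₂) (Sum.inl '' A₀)
    linarith
  rw [RankFn.edge_apply, RankFn.edge_apply] at hr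
  have hgA' : insert (Sum.inl g) (Sum.inl '' A₀) ⊆ (Sum.inl '' A : Set (α ⊕ V)) :=
    insert_subset (mem_image_of_mem _ hg) (image_mono hA₀)
  have hfg := ρ.mono hgA'
  have hYr : Sum.inl '' Y ⊆ ρ.cl (insert (Sum.inl f) (insert (Sum.inl g) (Sum.inl '' A₀))) := by
    refine Subset.trans ?_ (ρ.cl_subset_cl (insert_subset (ρ.mem_cl_of_mem (mem_insert _ _))
      ((ρ.subset_cl_of_rank_le hgA' (by linarith)).trans (ρ.cl_mono (subset_insert _ _)))))
    exact ρ.subset_cl_of_rank_le (insert_subset (mem_image_of_mem _ hf) (image_mono hA))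
      (by linarith)
  have hYr' : ρ.edge Y = ρ.edge A₀ + 2 := by
    rw [RankFn.edge_apply, RankFn.edge_apply]
    linarith
  obtain ⟨J', hJ', hF, hrep, hX, hrX, hj⟩ := h.frame.contract_skew (hAf.subset hA₀)
    ((hA₀.trans hA).trans subset_union_right) subset_union_left
    (ρ.edge.skew_mono hs (ρ.edge.subset_cl _) (hA₀.trans (ρ.edge.subset_cl _)))
  have hUY : ∀ U, (ρ.contract (Sum.inl '' A₀)).edge (U ∪ {f, g}) = ρ.edge (U ∪ Y) - ρ.edge A₀ := by
    intro U
    rw [ρ.edge_contract, sub_left_inj, RankFn.edge_apply, RankFn.edge_apply]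
    refine ρ.rank_congr_cl ((image_mono ?_).trans (ρ.subset_cl _)) ?_
    · rw [union_assoc]
      refine union_subset_union_right _ (union_subset ?_ (hA₀.trans hA))
      exact insert_subset hf (singleton_subset_iff.2 (hA hg))
    · rw [image_union, image_union, image_union, union_assoc]
      refine union_subset (subset_union_left.trans (ρ.subset_cl _))
        (hYr.trans (ρ.cl_mono ?_))
      rw [image_pair, insert_union, singleton_union]
      exact subset_union_right
  have hσ : ∀ {x : α ⊕ V} {S}, x ∈ (ρ.contract (Sum.inl '' A₀)).cl S ↔
      x ∈ ρ.cl (S ∪ Sum.inl '' A₀) := RankFn.mem_cl_contract _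
  set σ := ρ.contract (Sum.inl '' A₀) with hσdef
  have hAY : Sum.inl '' A₀ ⊆ ρ.cl (Sum.inl '' Y) :=
    (image_mono (hA₀.trans hA)).trans (ρ.subset_cl _)
  have hnon : ∀ {s}, Sum.inr s ∉ ρ.cl (Sum.inl '' Y) → Sum.inr s ∉ ρ.cl (Sum.inl '' A₀) :=
    fun hs hc => hs (ρ.cl_subset_cl hAY hc)
  have hfg' : ∀ {s v}, Sum.inr s ∉ ρ.cl (Sum.inl '' Y) → Sum.inr s ∈ σ.cl {Sum.inr v} →
      Sum.inr v ∉ σ.cl {Sum.inl f, Sum.inl g} := by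
    intro s v hs hsv hc
    refine hs (ρ.cl_subset_cl (union_subset ?_ hAY)
      (hσ.1 (σ.cl_subset_cl (singleton_subset_iff.2 hc) hsv)))
    exact insert_subset (ρ.mem_cl_of_mem (mem_image_of_mem _ hf))
      (singleton_subset_iff.2 (ρ.mem_cl_of_mem (mem_image_of_mem _ (hA hg))))
  -- An element of `X` at `s` is not lost in the contraction: it stays incident to the joint `v`
  -- that represents `s`, even if its other end becomes a loop or is identified with `v`.
  have hincσ : ∀ s ∈ ({s₁, s₂, s₃} : Set V), ∀ v ∈ J', Sum.inr s ∈ σ.cl {Sum.inr v} →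
      Sum.inr v ∈ σ.cl {Sum.inr s} → ∃ e ∈ X, Sum.inl e ∉ σ.cl (Sum.inr '' (J' \ {v})) := by
    intro s hs v hv hsv hvs
    obtain ⟨-, -, e, he, u, hu, heu, hse⟩ := hinc s hs
    refine ⟨e, he, fun hc => ?_⟩
    suffices hvc : Sum.inr v ∈ σ.cl (Sum.inr '' (J' \ {v})) from
      (hF.mem_of_mem_cl sdiff_subset hv hvc).2 rfl
    have hse' : Sum.inr s ∈ σ.cl {Sum.inl e, Sum.inr u} := hσ.2 (ρ.cl_mono subset_union_left hse)
    have heu' : Sum.inl e ∈ σ.cl {Sum.inr s, Sum.inr u} := hσ.2 (ρ.cl_mono subset_union_left heu)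
    have hfin : Sum.inr u ∈ σ.cl (Sum.inr '' (J' \ {v})) →
        Sum.inr v ∈ σ.cl (Sum.inr '' (J' \ {v})) := fun huc =>
      σ.cl_subset_cl (singleton_subset_iff.2 (σ.cl_subset_cl (insert_subset hc
        (singleton_subset_iff.2 huc)) hse')) hvs
    by_cases hu0 : Sum.inr u ∈ ρ.cl (Sum.inl '' A₀)
    · exact hfin (hσ.2 (ρ.cl_mono subset_union_right hu0))
    · obtain ⟨w, hw, huw, hwu⟩ := hrep u hu hu0
      by_cases hwv : w = v
      · subst hwv
        have hew := σ.cl_subset_cl (insert_subset hsv (singleton_subset_iff.2 huw)) heu'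
        exact σ.cl_subset_cl (singleton_subset_iff.2 hc)
          (σ.parallel_symm hew (hF.nonloop e (hX he)))
      · exact hfin (σ.cl_mono (singleton_subset_iff.2
          (mem_image_of_mem _ (show w ∈ J' \ {v} from ⟨hw, hwv⟩))) huw)
  obtain ⟨v₁, hv₁, sv₁, vs₁⟩ := hrep s₁ hJ₁ (hnon hn₁)
  obtain ⟨v₂, hv₂, sv₂, vs₂⟩ := hrep s₂ hJ₂ (hnon hn₂)
  obtain ⟨v₃, hv₃, sv₃, vs₃⟩ := hrep s₃ hJ₃ (hnon hn₃)
  have hA₀' : Sum.inl '' A₀ ⊆ ρ.cl (insert (Sum.inr s₂) (Sum.inl '' A)) :=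
    ((image_mono hA₀).trans (subset_insert _ _)).trans (ρ.subset_cl _)
  have hs₂ : Sum.inr s₂ ∈ ρ.cl (insert (Sum.inr s₂) (Sum.inl '' A)) :=
    ρ.mem_cl_of_mem (mem_insert _ _)
  have h23 : v₂ ≠ v₃ := by
    rintro rfl
    refine h30 ?_
    rw [← singleton_union]
    exact hσ.1 (σ.cl_subset_cl (singleton_subset_iff.2 vs₂) sv₃)
  have h12 : v₁ ≠ v₂ := by
    rintro rfl
    exact h1 (ρ.cl_subset_cl (union_subset (singleton_subset_iff.2 hs₂) hA₀')
      (hσ.1 (σ.cl_subset_cl (singleton_subset_iff.2 vs₂) sv₁)))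
  have h13 : v₁ ≠ v₃ := by
    rintro rfl
    exact h1 (ρ.cl_subset_cl (union_subset (singleton_subset_iff.2 h3) hA₀')
      (hσ.1 (σ.cl_subset_cl (singleton_subset_iff.2 vs₃) sv₁)))
  have hvv : ({Sum.inr s₂, Sum.inr s₃} : Set (α ⊕ V)) ⊆ σ.cl {Sum.inr v₂, Sum.inr v₃} :=
    insert_subset (σ.cl_mono (by simp) sv₂)
      (singleton_subset_iff.2 (σ.cl_mono (by simp) sv₃))
  have hAσ : Sum.inl '' A ⊆ σ.cl {Sum.inr v₂, Sum.inr v₃} := fun x hx => by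
    refine σ.cl_subset_cl hvv (hσ.2 ?_)
    rw [insert_union, singleton_union, insert_comm]
    exact hAs hx
  have hfv : Sum.inl f ∉ σ.cl {Sum.inr v₂, Sum.inr v₃} := fun hc => by
    refine hf2 (ρ.cl_subset_cl (union_subset (insert_subset hs₂ (singleton_subset_iff.2 h3)) hA₀')
      (hσ.1 (σ.cl_subset_cl ?_ hc)))
    exact insert_subset (σ.cl_mono (by simp) vs₂)
      (singleton_subset_iff.2 (σ.cl_mono (by simp) vs₃))
  have hfv' : Sum.inl f ∈ σ.cl (Sum.inr '' {v₁, v₂, v₃}) := by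
    rw [image_insert_eq, image_pair]
    refine σ.cl_subset_cl (insert_subset (σ.cl_mono (by simp) sv₁) (insert_subset
      (σ.cl_mono (by simp) sv₂) (hAσ.trans (σ.cl_mono (by simp)))))
      (hσ.2 (ρ.cl_mono subset_union_left hf1))
  have hfE : Sum.inl f ∉ ρ.cl (Sum.inl '' A₀) := fun hc => hfA' (ρ.cl_mono (image_mono hA₀) hc)
  -- On the one hand `f` lies on a line of two joints, on the other it is spanned by `v₁`, `v₂`,
  -- `v₃` but not by `v₂` and `v₃`. So `v₁` is one of its ends, and it forms a path with `g` whose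
  -- middle is `v₂` or `v₃`.
  have hline : Sum.inl f ∈ σ.cl {Sum.inr v₁, Sum.inr v₃} ∨
      Sum.inl f ∈ σ.cl {Sum.inr v₁, Sum.inr v₂} := by
    obtain ⟨c, hc, d, hd, hcd⟩ := hF.line f ⟨Or.inr hf, hfE⟩
    have hcdJ : ({c, d} : Set V) ⊆ J' := insert_subset hc (singleton_subset_iff.2 hd)
    have hf' := hF.mem_cl_inter (S := {c, d}) hcdJ (insert_subset hv₁
      (insert_subset hv₂ (singleton_subset_iff.2 hv₃))) (by rwa [image_pair]) hfv'
    have hm₁ : v₁ ∈ ({c, d} : Set V) := by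
      by_contra hn
      refine hfv (σ.cl_mono ?_ hf')
      rintro _ ⟨x, ⟨hx, rfl | rfl | rfl⟩, rfl⟩
      · exact absurd hx hn
      · simp
      · simp
    by_cases hm₂ : v₂ ∈ ({c, d} : Set V)
    · right
      rcases hm₁ with rfl | rfl
      · rwa [hm₂.resolve_left h12.symm]
      · rw [pair_comm]
        rwa [hm₂.resolve_right h12.symm]
    · left
      refine σ.cl_mono ?_ hf'
      rintro _ ⟨x, ⟨hx, rfl | rfl | rfl⟩, rfl⟩
      · simp
      · exact absurd hx hm₂
      · simp
  have key : ∀ {a b}, a ∈ J' → b ∈ J' → v₁ ≠ a → v₁ ≠ b → a ≠ b →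
      Sum.inl f ∈ σ.cl {Sum.inr v₁, Sum.inr b} → Sum.inl g ∈ σ.cl {Sum.inr a, Sum.inr b} →
      Sum.inr a ∉ σ.cl {Sum.inl f, Sum.inl g} → Sum.inr b ∉ σ.cl {Sum.inl f, Sum.inl g} →
      (∃ e ∈ X, Sum.inl e ∉ σ.cl (Sum.inr '' (J' \ {a}))) →
      (∃ e ∈ X, Sum.inl e ∉ σ.cl (Sum.inr '' (J' \ {b}))) →
      RootedRep X ρ.edge (L ∩ X) fun U => ρ.edge (U ∪ Y) < ρ.edge U + ρ.edge Y := by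
    intro a b ha hb h1a h1b hab hfb hgab hna hnb hia hib
    have hT : IsTriangle σ J' X f g v₁ a b :=
      { frame := hF.subset (union_subset hX (insert_subset ⟨Or.inr hf, hfE⟩
          (singleton_subset_iff.2 ⟨Or.inr (hA hg), hgA⟩)))
        mem₁ := hv₁, mem₂ := ha, mem₃ := hb, ne₁₂ := h1a, ne₁₃ := h1b, ne₂₃ := hab
        line₁ := hfb, line₂ := hgab
        notMem₁ := hfg' hn₁ sv₁, notMem₂ := hna, notMem₃ := hnb
        rank := by
          have := h.rank
          rw [hUY, hrX X subset_rfl]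
          linarith }
    refine (hT.rootedRep h.finite_left (L := L ∩ X) (fun e he => ⟨he.2, hj e (hX he.2).2
      (h.joint e he.1).2⟩) ?_ fun Z hZ hZ0 => ?_).congr (fun U hU => (hrX U hU).symm)
      fun U hU => ?_
    · rintro v (rfl | rfl | rfl)
      · exact hincσ s₁ (by simp) v hv₁ sv₁ vs₁
      · exact hia
      · exact hib
    · have := h.left Z hZ hZ0
      rw [hUY, hUY, hrX Z hZ]
      linarith
    · rw [hUY, hrX U hU, hYr']
      constructor <;> intro <;> linarith
  have hi₂ := hincσ s₂ (by simp) v₂ hv₂ sv₂ vs₂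
  have hi₃ := hincσ s₃ (by simp) v₃ hv₃ sv₃ vs₃
  have hgv := hAσ (mem_image_of_mem _ hg)
  rcases hline with hl | hl
  · exact key hv₂ hv₃ h12 h13 h23 hl hgv (hfg' hn₂ sv₂) (hfg' hn₃ sv₃) hi₂ hi₃
  · exact key hv₃ hv₂ h13 h12 h23.symm hl (by rwa [pair_comm]) (hfg' hn₃ sv₃) (hfg' hn₂ sv₂) hi₃ hi₂

/-- The main dichotomy for a part `Y` with no part skew to the rest of it. -/
theorem rootedRep_or_rootedGraphic_of_connected [Finite V] (h : FramedSum ρ J X Y L)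
    (hY : ∀ Z ⊆ Y, Z.Nonempty → Z ≠ Y → ρ.edge Y ≠ ρ.edge Z + ρ.edge (Y \ Z)) :
    RootedRep X ρ.edge (L ∩ X) (fun U => ρ.edge (U ∪ Y) < ρ.edge U + ρ.edge Y) ∨
      L ∩ Y = ∅ ∧ RootedGraphic Y ρ.edge fun U => ρ.edge (U ∪ X) < ρ.edge U + ρ.edge X := by
  obtain ⟨H, hHV, hHE, hH, hloop⟩ := (h.frame.subset subset_union_right).exists_graph
  have hVf : H.vertexSet.Finite := hHV ▸ h.frame.finite
  have hends : ∀ {e a b}, H.IsLink e a b → a ∈ ends H Y := fun hl =>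
    ⟨_, hHE ▸ hl.edge_mem, hl.inc_left⟩
  have hlink : ∀ e ∈ Y, ∃ a b, H.IsLink e a b := fun e he =>
    Graph.exists_isLink_of_mem_edgeSet (hHE ▸ he)
  have hendJ : ends H Y ⊆ J := hHV ▸ ends_subset
  have hreach : ∀ {a b}, a ∈ ends H Y → b ∈ ends H Y →
      Sum.inr b ∈ ρ.cl (insert (Sum.inr a) (Sum.inl '' Y)) := fun ha hb =>
    hH.reach (reach hH hVf hHE.ge hY ha hb)
  -- The graph of `Y` is connected, so as soon as one of its ends is spanned by `Y`, all of them
  -- are.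
  by_cases hsp : ∃ v ∈ ends H Y, Sum.inr v ∈ ρ.cl (Sum.inl '' Y)
  · obtain ⟨v, hv, hvY⟩ := hsp
    have hall : ∀ {a}, a ∈ ends H Y → Sum.inr a ∈ ρ.cl (Sum.inl '' Y) := fun ha =>
      ρ.cl_subset_cl (insert_subset hvY (ρ.subset_cl _)) (hreach hv ha)
    refine Or.inl (h.rootedRep_of_spanning fun e he => ?_)
    obtain ⟨a, b, hl⟩ := hlink e he
    exact ⟨a, hendJ (hends hl), b, hendJ (hends hl.symm), hH.mem_cl hl, hall (hends hl),
      hall (hends hl.symm)⟩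
  push Not at hsp
  have hLY : L ∩ Y = ∅ := by
    refine eq_empty_of_forall_notMem fun e he => ?_
    obtain ⟨v, hv, hev⟩ := (h.joint e he.1).2
    have hl := hloop e he.2 v hv hev
    exact hsp v (hends hl) (ρ.cl_mono (singleton_subset_iff.2 (mem_image_of_mem _ he.2))
      (hH.loop hl))
  obtain ⟨A, hAY, hs, hr, f, hf, hfA, hfX, -⟩ := h.exists_maximal_skew
  obtain ⟨G, hGV, hGE, hG, -⟩ := (h.frame.subset subset_union_left).exists_graph
  have hTJ : ends G X ⊆ J := hGV ▸ ends_subset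
  have hXT : Sum.inl '' X ⊆ ρ.cl (Sum.inr '' ends G X) := subset_cl_ends hG hGE.ge
  obtain ⟨J', hJ', hF, hrep, -⟩ := h.frame.contract_skew (h.finite_right.subset hAY)
    (hAY.trans subset_union_right) subset_union_left hs
  have hσ : ∀ {x : α ⊕ V} {S}, x ∈ (ρ.contract (Sum.inl '' A)).cl S ↔
      x ∈ ρ.cl (S ∪ Sum.inl '' A) := RankFn.mem_cl_contract _
  set σ := ρ.contract (Sum.inl '' A) with hσdef
  have hfA' : Sum.inl f ∉ ρ.cl (Sum.inl '' A) := fun hc => hfA (RankFn.mem_cl_edge.2 hc)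
  have hYf : Sum.inl '' Y ⊆ ρ.cl (Sum.inl '' insert f A) := by
    refine ρ.subset_cl_of_rank_le (image_mono (insert_subset hf hAY)) ?_
    have h1 := ρ.notMem_cl.1 hfA'
    rw [RankFn.edge_apply, RankFn.edge_apply] at hr
    rw [image_insert_eq]
    linarith
  obtain ⟨a, b, hab⟩ := hlink f hf
  have ha := hends hab
  have hb := hends hab.symm
  have hfab : Sum.inl f ∈ σ.cl {Sum.inr a, Sum.inr b} :=
    hσ.2 (ρ.cl_mono subset_union_left (hH.mem_cl hab))
  have hrep' : ∀ v ∈ ends H Y, ∃ w ∈ J', Sum.inr v ∈ σ.cl {Sum.inr w} ∧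
      Sum.inr w ∈ σ.cl {Sum.inr v} := fun v hv =>
    hrep v (hendJ hv) fun hc => hsp v hv (ρ.cl_mono (image_mono hAY) hc)
  -- Modulo `A`, all of `Y` is spanned by `f`, so every end of `Y` lies on the line of the two ends
  -- `a`, `b` of `f`. Being represented by a joint, it is parallel to `a` or to `b`.
  have hclass : ∀ v ∈ ends H Y, (Sum.inr v ∈ σ.cl {Sum.inr a} ∧ Sum.inr a ∈ σ.cl {Sum.inr v}) ∨
      (Sum.inr v ∈ σ.cl {Sum.inr b} ∧ Sum.inr b ∈ σ.cl {Sum.inr v}) := by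
    intro v hv
    obtain ⟨a', ha', haa, haa'⟩ := hrep' a ha
    obtain ⟨b', hb', hbb, hbb'⟩ := hrep' b hb
    obtain ⟨w, hw, hvw, hwv⟩ := hrep' v hv
    have hvab : Sum.inr v ∈ σ.cl {Sum.inr a, Sum.inr b} := by
      refine σ.cl_subset_cl ?_ (hσ.2 (ρ.cl_mono subset_union_left (hreach ha hv)))
      refine insert_subset (σ.mem_cl_of_mem (mem_insert _ _)) fun x hx => ?_
      have hx' := hYf hx
      rw [image_insert_eq, ← singleton_union] at hx'
      exact σ.cl_subset_cl (singleton_subset_iff.2 hfab) (hσ.2 hx')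
    have hwab : Sum.inr w ∈ σ.cl (Sum.inr '' {a', b'}) := by
      rw [image_pair]
      refine σ.cl_subset_cl (insert_subset (σ.cl_mono (by simp) haa)
        (singleton_subset_iff.2 (σ.cl_mono (by simp) hbb))) ?_
      exact σ.cl_subset_cl (singleton_subset_iff.2 hvab) hwv
    rcases hF.mem_of_mem_cl (insert_subset ha' (singleton_subset_iff.2 hb')) hw hwab with rfl | rfl
    · exact Or.inl ⟨σ.cl_subset_cl (singleton_subset_iff.2 haa') hvw,
        σ.cl_subset_cl (singleton_subset_iff.2 hwv) haa⟩
    · exact Or.inr ⟨σ.cl_subset_cl (singleton_subset_iff.2 hbb') hvw,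
        σ.cl_subset_cl (singleton_subset_iff.2 hwv) hbb⟩
  -- If all common ends were in the class of `c`, then `X`, and with it `f`, would be spanned by
  -- `A`, the joint `c` and joints off `Y`. These joints are skew to `Y`, so they cannot help `A` to
  -- span `f`.
  have hmeet : ∀ c ∈ ends H Y, ∃ s ∈ ends G X ∩ ends H Y, Sum.inr s ∉ σ.cl {Sum.inr c} := by
    intro c hc
    by_contra! hall
    have h1 := h.frame.skew_edges (T := insert c (ends G X \ ends H Y)) (K := ends H Y) (s := c)
      (U := insert f A) (insert_subset (hendJ hc) (sdiff_subset.trans hTJ)) hendJ (by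
        rintro v ⟨rfl | hv, hvY⟩
        · rfl
        · exact absurd hvY hv.2)
      ((image_mono (insert_subset hf hAY)).trans (subset_cl_ends hH hHE.ge))
      fun hc' => hsp c hc (ρ.cl_mono (image_mono (insert_subset hf hAY)) hc')
    have h2 : Sum.inl '' X ⊆
        ρ.cl (Sum.inr '' insert c (ends G X \ ends H Y) ∪ Sum.inl '' A) := by
      refine hXT.trans (ρ.cl_subset_cl ?_)
      rintro _ ⟨v, hv, rfl⟩
      by_cases hvY : v ∈ ends H Y
      · refine ρ.cl_mono (union_subset_union_left _ ?_) (hσ.1 (hall v ⟨hv, hvY⟩))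
        exact singleton_subset_iff.2 (mem_image_of_mem _ (mem_insert _ _))
      · exact ρ.mem_cl_of_mem (Or.inl (mem_image_of_mem _ (Or.inr ⟨hv, hvY⟩)))
    have hfX' := RankFn.mem_cl_edge.1 hfX
    rw [image_union] at hfX'
    have h3 : Sum.inr '' insert c (ends G X \ ends H Y) ∪ Sum.inl '' insert f A ⊆
        ρ.cl (Sum.inr '' insert c (ends G X \ ends H Y) ∪ Sum.inl '' A) := by
      refine union_subset (subset_union_left.trans (ρ.subset_cl _)) ?_
      rw [image_insert_eq]
      exact insert_subset (ρ.cl_subset_cl (union_subset h2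
        (subset_union_right.trans (ρ.subset_cl _))) hfX')
        (subset_union_right.trans (ρ.subset_cl _))
    have h4 := ρ.rank_le_of_subset_cl h3
    have h5 := ρ.union_le (Sum.inr '' insert c (ends G X \ ends H Y)) (Sum.inl '' A)
    have h6 := ρ.notMem_cl.1 hfA'
    rw [← image_insert_eq] at h6
    linarith
  obtain ⟨s, hsS, hsa⟩ := hmeet a ha
  obtain ⟨t, htS, htb⟩ := hmeet b hb
  have hs' := (hclass s hsS.2).resolve_left fun hc => hsa hc.1
  have ht' := (hclass t htS.2).resolve_right fun hc => htb hc.1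
  -- Both classes contain common ends. A third common end is in the class of `s` or of `t`, which
  -- means that `A` connects it to this one.
  by_cases hst : ends G X ∩ ends H Y ⊆ {s, t}
  · refine Or.inr ⟨hLY, h.rootedGraphic hH hHE hHV hTJ hXT ?_ hsS.2 htS.2 htS.1 hst hsp⟩
    rintro rfl
    exact hsa ht'.1
  obtain ⟨s₃, hs₃, hne⟩ := not_subset.1 hst
  left
  have key : ∀ {s t}, s ∈ ends G X ∩ ends H Y → t ∈ ends G X ∩ ends H Y → s₃ ≠ s →
      Sum.inr s₃ ∈ σ.cl {Sum.inr s} → Sum.inr t ∉ σ.cl {Sum.inr s} →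
      Sum.inl f ∈ σ.cl {Sum.inr t, Sum.inr s} →
      RootedRep X ρ.edge (L ∩ X) fun U => ρ.edge (U ∪ Y) < ρ.edge U + ρ.edge Y := by
    intro s t hsS htS hne h3 ht hfst
    refine h.rootedRep_of_three (s₁ := t) (s₂ := s) (s₃ := s₃) hAY hs hr hf hfA ?_ hne
      (by simpa only [hσ, singleton_union] using h3)
      (by simpa only [hσ, singleton_union] using ht)
      (by simpa only [hσ, insert_union, singleton_union] using hfst) fun hc => ?_
    · have hall : ∀ v ∈ ends G X ∩ ends H Y, v ∈ J ∧ Sum.inr v ∉ ρ.cl (Sum.inl '' Y) ∧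
          ∃ e ∈ X, ∃ u ∈ J, Sum.inl e ∈ ρ.cl {Sum.inr v, Sum.inr u} ∧
            Sum.inr v ∈ ρ.cl {Sum.inl e, Sum.inr u} := by
        rintro v ⟨⟨e, he, u, hl⟩, hvY⟩
        exact ⟨hendJ hvY, hsp v hvY, e, he, u, hGV ▸ hl.right_mem, hG.mem_cl hl, hG.swap hl.symm⟩
      rintro v (rfl | rfl | rfl)
      exacts [hall _ htS, hall _ hsS, hall _ hs₃]
    · rw [← singleton_union] at hc
      have hc' := σ.parallel_symm (hσ.2 hc) (hF.nonloop f ⟨Or.inr hf, hfA'⟩)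
      refine hsp s hsS.2 (ρ.cl_mono ?_ (hσ.1 hc'))
      rw [← image_singleton, ← image_union]
      exact image_mono (union_subset (singleton_subset_iff.2 hf) hAY)
  rcases hclass s₃ hs₃.2 with h3 | h3
  · refine key htS hsS (fun h => hne (by simp [h]))
      (σ.cl_subset_cl (singleton_subset_iff.2 ht'.2) h3.1)
      (fun hc => hsa (σ.cl_subset_cl (singleton_subset_iff.2 ht'.1) hc)) ?_
    rw [pair_comm]
    exact σ.cl_subset_cl (insert_subset (σ.cl_mono (by simp) ht'.2)
      (singleton_subset_iff.2 (σ.cl_mono (by simp) hs'.2))) hfab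
  · refine key hsS htS (fun h => hne (by simp [h]))
      (σ.cl_subset_cl (singleton_subset_iff.2 hs'.2) h3.1)
      (fun hc => htb (σ.cl_subset_cl (singleton_subset_iff.2 hs'.1) hc)) ?_
    exact σ.cl_subset_cl (insert_subset (σ.cl_mono (by simp) ht'.2)
      (singleton_subset_iff.2 (σ.cl_mono (by simp) hs'.2))) hfab

/-- The inductive step for `Y` split into skew parts. Contracting `Z₂` leaves a framed 2-sum of `X`
and `Z₁` with unchanged ranks on both, so conclusions about `X` carry over directly, and those about
`Z₁` hold in the presence of all of `Z₂`. -/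
theorem of_contract_part (h : FramedSum ρ J X (Z₁ ∪ Z₂) L) (hd : Disjoint Z₁ Z₂)
    (hZ : Z₁.Nonempty) (hr : ρ.edge (Z₁ ∪ Z₂) = ρ.edge Z₁ + ρ.edge Z₂)
    (ih : ∀ {σ : RankFn (α ⊕ V)} {J' L'}, FramedSum σ J' X Z₁ L' →
      RootedRep X σ.edge (L' ∩ X) (fun U => σ.edge (U ∪ Z₁) < σ.edge U + σ.edge Z₁) ∨
        L' ∩ Z₁ = ∅ ∧ RootedGraphic Z₁ σ.edge fun U => σ.edge (U ∪ X) < σ.edge U + σ.edge X) :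
    RootedRep X ρ.edge (L ∩ X) (fun U => ρ.edge (U ∪ (Z₁ ∪ Z₂)) < ρ.edge U + ρ.edge (Z₁ ∪ Z₂)) ∨
      L ∩ Z₁ = ∅ ∧ RootedGraphic Z₁ ρ.edge fun U =>
        ρ.edge ((U ∪ Z₂) ∪ X) < ρ.edge (U ∪ Z₂) + ρ.edge X := by
  obtain ⟨J', h', hX, hZ₁⟩ := h.contract_part hd hZ hr
  refine (ih h').imp (fun h1 => ?_) fun ⟨h1, h2⟩ => ⟨?_, ?_⟩
  · rw [inter_assoc, inter_eq_self_of_subset_right subset_union_left] at h1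
    refine h1.congr (fun U hU => (hX U hU).symm) fun U hU => ?_
    rw [hX U hU, hZ₁ Z₁ subset_rfl, ρ.edge_contract, union_assoc, hr]
    constructor <;> intro <;> linarith
  · rwa [inter_assoc, inter_eq_self_of_subset_right subset_union_right] at h1
  · refine h2.congr (fun U hU => (hZ₁ U hU).symm) fun U hU => ?_
    rw [hZ₁ U hU, hX X subset_rfl, ρ.edge_contract, union_right_comm,
      ρ.edge.skew_mono hr (hU.trans (ρ.edge.subset_cl _)) (ρ.edge.subset_cl _)]
    constructor <;> intro <;> linarith

/-- In a framed 2-sum with parts `X` and `Y`, either the basepoint can be made a joint on the side of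
`X`, or the side of `Y` is graphic. -/
theorem rootedRep_or_rootedGraphic [Finite V] (h : FramedSum ρ J X Y L) :
    RootedRep X ρ.edge (L ∩ X) (fun U => ρ.edge (U ∪ Y) < ρ.edge U + ρ.edge Y) ∨
      L ∩ Y = ∅ ∧ RootedGraphic Y ρ.edge fun U => ρ.edge (U ∪ X) < ρ.edge U + ρ.edge X := by
  induction hn : Y.ncard using Nat.strong_induction_on generalizing ρ J Y L with
  | _ n ih =>
    by_cases hY : ∀ Z ⊆ Y, Z.Nonempty → Z ≠ Y → ρ.edge Y ≠ ρ.edge Z + ρ.edge (Y \ Z)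
    · exact h.rootedRep_or_rootedGraphic_of_connected hY
    push Not at hY
    obtain ⟨Z, hZY, hZ, hne, hr⟩ := hY
    obtain ⟨W, hW⟩ : ∃ W, W = Y \ Z := ⟨_, rfl⟩
    have hd : Disjoint Z W := hW ▸ disjoint_sdiff_right
    have hW0 : W.Nonempty := hW ▸ sdiff_nonempty.2 fun hc => hne (hZY.antisymm hc)
    have hYZ : Y = Z ∪ W := by rw [hW, union_sdiff_cancel hZY]
    have hZn := ncard_lt_ncard (hZY.ssubset_of_ne hne) h.finite_right
    have hWn : W.ncard < Y.ncard := ncard_lt_ncard ⟨hW ▸ sdiff_subset, fun hc => by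
      obtain ⟨z, hz⟩ := hZ
      exact hd.notMem_of_mem_left hz (hc (hZY hz))⟩ h.finite_right
    rw [← hW] at hr
    clear hW
    subst hYZ
    have hr' : ρ.edge (W ∪ Z) = ρ.edge W + ρ.edge Z := by rw [union_comm, hr, add_comm]
    rcases h.of_contract_part hd hZ hr fun h' => ih _ (hn ▸ hZn) h' rfl with h1 | ⟨e1, h1⟩
    · exact Or.inl h1
    rcases (show FramedSum ρ J X (W ∪ Z) L from union_comm Z W ▸ h).of_contract_part hd.symm hW0 hr'
      fun h' => ih _ (hn ▸ hWn) h' rfl with h2 | ⟨e2, h2⟩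
    · rw [union_comm W] at h2
      exact Or.inl h2
    refine Or.inr ⟨by rw [inter_union_distrib_left, e1, e2, union_empty], ?_⟩
    -- Both parts are graphic. A subset of `Y` is tied to `X` exactly when it is so after completing
    -- it by either part, which is the rule for the root edge of a series connection.
    refine h1.series h2 hd (fun U₁ hU₁ U₂ hU₂ => ρ.edge.skew_mono hr
      (hU₁.trans (ρ.edge.subset_cl _)) (hU₂.trans (ρ.edge.subset_cl _))) fun U₁ hU₁ U₂ hU₂ => ?_
    rw [union_comm U₂ Z]
    exact ρ.edge.not_skew_iff_of_skew h.rank.ge hr hU₁ hU₂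

end FramedSum

end

end FrameMatroids

namespace FrameMatroids

universe u v

/-! ### 2-sums of connected matroids in terms of rank functions. -/

section

variable {α : Type u} {A₁ A₂ L L₁ L₂ U : Set α} {e₁ e₂ : α} {r r₁ r₂ : RankFn α}

theorem RankFn.rank_insert_congr {γ δ : Type*} {ρ : RankFn γ} {σ : RankFn δ} {x : γ} {y : δ}
    {X : Set γ} {Y : Set δ} (h : ρ X = σ Y) (hxy : x ∈ ρ.cl X ↔ y ∈ σ.cl Y) :
    ρ (insert x X) = σ (insert y Y) := by
  by_cases hx : x ∈ ρ.cl X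
  · rw [ρ.mem_cl.1 hx, σ.mem_cl.1 (hxy.1 hx), h]
  · rw [ρ.notMem_cl.1 hx, σ.notMem_cl.1 (mt hxy.2 hx), h]

/-- The rank function `r` is that of the 2-sum of the connected matroids on `A₁ ∪ {e₁}` and
`A₂ ∪ {e₂}` with rank functions `r₁` and `r₂`. -/
structure ConnectedTwoSum (A₁ A₂ : Set α) (e₁ e₂ : α) (r r₁ r₂ : RankFn α) : Prop where
  finite₁ : A₁.Finite
  finite₂ : A₂.Finite
  disjoint : Disjoint A₁ A₂
  notMem₁ : e₁ ∉ A₁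
  notMem₂ : e₂ ∉ A₂
  nonempty₁ : A₁.Nonempty
  nonempty₂ : A₂.Nonempty
  nonloop₁ : ∀ e ∈ insert e₁ A₁, r₁ {e} = 1
  nonloop₂ : ∀ e ∈ insert e₂ A₂, r₂ {e} = 1
  connected₁ : ∀ Z ⊆ A₁, Z.Nonempty → r₁ (insert e₁ A₁) < r₁ Z + r₁ (insert e₁ (A₁ \ Z))
  connected₂ : ∀ Z ⊆ A₂, Z.Nonempty → r₂ (insert e₂ A₂) < r₂ Z + r₂ (insert e₂ (A₂ \ Z))
  rank : TwoSumRank A₁ A₂ r r₁ r₂ (fun U => e₁ ∈ r₁.cl U) (fun U => e₂ ∈ r₂.cl U)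

namespace ConnectedTwoSum

theorem symm (h : ConnectedTwoSum A₁ A₂ e₁ e₂ r r₁ r₂) :
    ConnectedTwoSum A₂ A₁ e₂ e₁ r r₂ r₁ := by
  obtain ⟨h1, h2, h3, h4, h5, h6, h7, h8, h9, h10, h11, h12⟩ := h
  refine ⟨h2, h1, h3.symm, h5, h4, h7, h6, h9, h8, h11, h10, fun U hU W hW => ⟨fun hu hw => ?_,
    fun hn => ?_⟩⟩
  · rw [union_comm, (h12 W hW U hU).1 hw hu, add_comm (r₂ U)]
  · rw [union_comm, (h12 W hW U hU).2 fun hc => hn hc.symm, add_comm]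

theorem mem_cl (h : ConnectedTwoSum A₁ A₂ e₁ e₂ r r₁ r₂) : e₁ ∈ r₁.cl A₁ := by
  by_contra hn
  have h1 := h.connected₁ A₁ subset_rfl h.nonempty₁
  rw [sdiff_self, insert_empty_eq, h.nonloop₁ e₁ (mem_insert _ _), r₁.notMem_cl.1 hn] at h1
  exact lt_irrefl _ h1

theorem rank_left (h : ConnectedTwoSum A₁ A₂ e₁ e₂ r r₁ r₂) (hU : U ⊆ A₁) : r U = r₁ U := by
  have h1 := (h.rank U hU ∅ (empty_subset _)).2 fun hc => by
    have h2 : r₂ (insert e₂ ∅) = r₂ ∅ := hc.2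
    rw [insert_empty_eq, h.nonloop₂ e₂ (mem_insert _ _), r₂.empty] at h2
    exact one_ne_zero h2
  rwa [union_empty, r₂.empty, add_zero] at h1

theorem rank_add (h : ConnectedTwoSum A₁ A₂ e₁ e₂ r r₁ r₂) : r (A₁ ∪ A₂) + 1 = r A₁ + r A₂ := by
  rw [h.rank_left subset_rfl, h.symm.rank_left subset_rfl,
    (h.rank A₁ subset_rfl A₂ subset_rfl).1 h.mem_cl h.symm.mem_cl]
  ring

/-- The basepoint can be recovered from the sum: it is spanned by exactly those subsets of one side
that are not skew to the other side. -/
theorem link_iff (h : ConnectedTwoSum A₁ A₂ e₁ e₂ r r₁ r₂) (hU : U ⊆ A₁) :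
    r (U ∪ A₂) < r U + r A₂ ↔ e₁ ∈ r₁.cl U := by
  rw [h.rank_left hU, h.symm.rank_left subset_rfl]
  obtain ⟨h1, h2⟩ := h.rank U hU A₂ subset_rfl
  by_cases he : e₁ ∈ r₁.cl U
  · rw [h1 he h.symm.mem_cl]
    simp [he]
  · rw [h2 fun hc => he hc.1]
    simp [he]

theorem lt_rank_add (h : ConnectedTwoSum A₁ A₂ e₁ e₂ r r₁ r₂) {Z : Set α} (hZ : Z ⊆ A₁)
    (hZ0 : Z.Nonempty) : r (A₁ ∪ A₂) < r Z + r ((A₁ \ Z) ∪ A₂) := by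
  have h1 := h.connected₁ Z hZ hZ0
  have h2 := h.rank_add
  rw [h.rank_left subset_rfl, h.symm.rank_left subset_rfl] at h2
  have h3 := r₁.mem_cl.1 h.mem_cl
  obtain ⟨h4, h5⟩ := h.rank (A₁ \ Z) sdiff_subset A₂ subset_rfl
  rw [h.rank_left hZ]
  by_cases he : e₁ ∈ r₁.cl (A₁ \ Z)
  · have h6 := h4 he h.symm.mem_cl
    rw [r₁.mem_cl.1 he] at h1
    linarith
  · have h6 := h5 fun hc => he hc.1
    rw [r₁.notMem_cl.1 he] at h1
    linarith

theorem exists_framedSum (h : ConnectedTwoSum A₁ A₂ e₁ e₂ r r₁ r₂) (hL : L ⊆ A₁ ∪ A₂)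
    (hF : FrameRep (A₁ ∪ A₂) r L) : ∃ (V : Type u) (_ : Finite V) (ρ : RankFn (α ⊕ V)),
      FramedSum ρ univ A₁ A₂ L ∧ ∀ U ⊆ A₁ ∪ A₂, ρ.edge U = r U := by
  obtain ⟨V, hV, ρ, hj, hr, hE, hLj⟩ := hF
  have hr' : ∀ U ⊆ A₁ ∪ A₂, ρ.edge U = r U := fun U hU => (hr U hU).symm
  refine ⟨V, hV, ρ, ⟨⟨finite_univ, fun S _ => hj S, fun e he => ?_, fun e he => ?_⟩, h.finite₁,
    h.finite₂, h.disjoint, fun e he => ⟨hL he, ?_⟩, ?_, fun Z hZ hZ0 => ?_, fun Z hZ hZ0 => ?_⟩, hr'⟩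
  · obtain ⟨v, w, hvw⟩ := hE e he
    exact ⟨v, mem_univ _, w, mem_univ _, hvw⟩
  · rw [← image_singleton, ← hr {e} (singleton_subset_iff.2 he)]
    rcases he with he | he
    · rw [h.rank_left (singleton_subset_iff.2 he), h.nonloop₁ e (Or.inr he)]
    · rw [h.symm.rank_left (singleton_subset_iff.2 he), h.nonloop₂ e (Or.inr he)]
  · exact (hLj e he).imp fun v hv => ⟨mem_univ _, hv⟩
  · rw [hr' _ subset_rfl, hr' _ subset_union_left, hr' _ subset_union_right]
    exact h.rank_add
  · rw [hr' _ subset_rfl, hr' _ (hZ.trans subset_union_left),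
      hr' _ (union_subset_union_left _ sdiff_subset)]
    exact h.lt_rank_add hZ hZ0
  · rw [hr' _ subset_rfl, hr' _ (hZ.trans subset_union_right),
      hr' _ (union_subset_union_right _ sdiff_subset), union_comm, union_comm A₁]
    exact h.symm.lt_rank_add hZ hZ0

/-- The dichotomy for framed 2-sums, with the basepoints put back. It is one-sided; the theorem
results from applying it also with the two sides interchanged. -/
theorem frameRep_insert_or_graphicRep (h : ConnectedTwoSum A₁ A₂ e₁ e₂ r r₁ r₂)
    (hL : L ⊆ A₁ ∪ A₂) (hF : FrameRep (A₁ ∪ A₂) r L) :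
    FrameRep (insert e₁ A₁) r₁ (insert e₁ (L ∩ A₁)) ∨
      L ∩ A₂ = ∅ ∧ GraphicRep (insert e₂ A₂) r₂ := by
  obtain ⟨V, hV, ρ, hS, hr⟩ := h.exists_framedSum hL hF
  refine hS.rootedRep_or_rootedGraphic.imp (fun h1 => ?_) (And.imp_right fun h1 => ?_)
  · have h2 := (h1.congr (fun U _ => rfl) (link' := fun U => e₁ ∈ r₁.cl U) fun U hU => by
      rw [hr _ (union_subset_union_left _ hU), hr _ (hU.trans subset_union_left),
        hr _ subset_union_right]
      exact (h.link_iff hU).symm).frameRep h.notMem₁ fun U hU =>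
        ((hr U (hU.trans subset_union_left)).trans (h.rank_left hU)).symm
    rwa [inter_assoc, inter_self] at h2
  · exact (h1.congr (fun U _ => rfl) (link' := fun U => e₂ ∈ r₂.cl U) fun U hU => by
      rw [hr _ (union_comm A₁ A₂ ▸ union_subset_union_left _ hU),
        hr _ (hU.trans subset_union_right), hr _ subset_union_left]
      exact (h.symm.link_iff hU).symm).graphicRep h.notMem₂ fun U hU =>
        ((hr U (hU.trans subset_union_right)).trans (h.symm.rank_left hU)).symm

/-- The parts of a framed 2-sum are frame. -/
theorem frameRep_left (h : ConnectedTwoSum A₁ A₂ e₁ e₂ r r₁ r₂) (hF : FrameRep (A₁ ∪ A₂) r ∅) :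
    FrameRep (insert e₁ A₁) r₁ ∅ := by
  classical
  obtain ⟨V, hV, ρ, hS, hr⟩ := h.exists_framedSum (empty_subset _) hF
  -- The left side is a minor of the sum: `A` is contracted and `f` is renamed `e₁`.
  obtain ⟨A, hA, hs, -, f, hf, hfA, -, hlink⟩ := hS.exists_maximal_skew
  obtain ⟨J', -, hF', -, hX, hrX, -⟩ := hS.frame.contract_skew (h.finite₂.subset hA)
    (hA.trans subset_union_right) subset_union_left hs
  have hF' := (hF'.subset (insert_subset ⟨Or.inr hf, fun hc => hfA (RankFn.mem_cl_edge.2 hc)⟩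
    hX)).frameRep (L := ∅) (by simp)
  obtain ⟨V', hV', σ, hj, hrσ, hE, -⟩ := hF'
  have himage : ∀ U ⊆ A₁, (fun e => Sum.inl (if e = e₁ then f else e) : α → α ⊕ V') '' U =
      Sum.inl '' U := fun U hU => image_congr fun e he => by
    rw [if_neg fun h' : e = e₁ => h.notMem₁ (h' ▸ hU he)]
  have hrU : ∀ U ⊆ A₁, r₁ U = (ρ.contract (Sum.inl '' A)).edge U := fun U hU => by
    rw [hrX U hU, hr U (hU.trans subset_union_left), h.rank_left hU]
  refine FrameRep.of (ρ := σ) (ι := fun e => Sum.inl (if e = e₁ then f else e)) (j := Sum.inr) hj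
    (fun U hU => ?_) (fun e he => ?_) (by simp)
  · by_cases he : e₁ ∈ U
    · have hU' : U \ {e₁} ⊆ A₁ := fun x hx => (hU hx.1).resolve_left hx.2
      rw [← insert_sdiff_self_of_mem he, image_insert_eq, himage _ hU', if_pos rfl,
        ← image_insert_eq, ← hrσ _ (insert_subset_insert hU')]
      refine RankFn.rank_insert_congr (hrU _ hU') ?_
      rw [← h.link_iff hU', RankFn.mem_cl_edge, RankFn.mem_cl_contract, ← image_union,
        ← RankFn.mem_cl_edge, hlink _ hU', hr _ (union_subset_union_left _ hU'),
        hr _ (hU'.trans subset_union_left), hr _ subset_union_right]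
    · have hU' : U ⊆ A₁ := fun x hx => (hU hx).resolve_left fun h' => he (h' ▸ hx)
      rw [himage U hU', hrU U hU', hrσ U (hU'.trans (subset_insert _ _))]
  · rcases he with rfl | he
    · rw [if_pos rfl]
      exact hE f (mem_insert _ _)
    · rw [if_neg fun h' : e = e₁ => h.notMem₁ (h' ▸ he)]
      exact hE e (Or.inr he)

theorem frameRep_union_of_graphicRep (h : ConnectedTwoSum A₁ A₂ e₁ e₂ r r₁ r₂)
    (h₁ : GraphicRep (insert e₁ A₁) r₁) (h₂ : FrameRep (insert e₂ A₂) r₂ L₂) (hL₂ : L₂ ⊆ A₂) :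
    FrameRep (A₁ ∪ A₂) r L₂ :=
  .of_graphicRep h₁ h₂ h.disjoint hL₂ (h.nonloop₁ _ (mem_insert _ _))
    (h.nonloop₂ _ (mem_insert _ _)) h.rank

theorem frameRep_union (h : ConnectedTwoSum A₁ A₂ e₁ e₂ r r₁ r₂)
    (h₁ : FrameRep (insert e₁ A₁) r₁ (insert e₁ L₁)) (h₂ : FrameRep (insert e₂ A₂) r₂ (insert e₂ L₂))
    (hL₁ : L₁ ⊆ A₁) (hL₂ : L₂ ⊆ A₂) : FrameRep (A₁ ∪ A₂) r (L₁ ∪ L₂) :=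
  h₁.parallel h₂ h.disjoint hL₁ hL₂ (h.nonloop₁ _ (mem_insert _ _))
    (h.nonloop₂ _ (mem_insert _ _)) h.rank

/-- A 2-sum is frame if and only if one part is graphic and the other is frame, or both parts are
frame with the basepoint as a joint. -/
theorem frameRep_iff (h : ConnectedTwoSum A₁ A₂ e₁ e₂ r r₁ r₂) :
    FrameRep (A₁ ∪ A₂) r ∅ ↔
      ((GraphicRep (insert e₁ A₁) r₁ ∧ FrameRep (insert e₂ A₂) r₂ ∅) ∨
        (GraphicRep (insert e₂ A₂) r₂ ∧ FrameRep (insert e₁ A₁) r₁ ∅)) ∨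
      (FrameRep (insert e₁ A₁) r₁ {e₁} ∧ FrameRep (insert e₂ A₂) r₂ {e₂}) := by
  constructor
  · intro hF
    have hF' : FrameRep (A₂ ∪ A₁) r ∅ := union_comm A₁ A₂ ▸ hF
    rcases h.frameRep_insert_or_graphicRep (empty_subset _) hF with h1 | ⟨-, h1⟩
    · rcases h.symm.frameRep_insert_or_graphicRep (empty_subset _) hF' with h2 | ⟨-, h2⟩
      · rw [empty_inter, insert_empty_eq] at h1 h2
        exact Or.inr ⟨h1, h2⟩
      · exact Or.inl (Or.inl ⟨h2, h.symm.frameRep_left hF'⟩)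
    · exact Or.inl (Or.inr ⟨h1, h.frameRep_left hF⟩)
  · rintro ((⟨h1, h2⟩ | ⟨h1, h2⟩) | ⟨h1, h2⟩)
    · exact h.frameRep_union_of_graphicRep h1 h2 (empty_subset _)
    · rw [union_comm]
      exact h.symm.frameRep_union_of_graphicRep h1 h2 (empty_subset _)
    · rw [← union_empty ∅]
      rw [← insert_empty_eq] at h1 h2
      exact h.frameRep_union h1 h2 (empty_subset _) (empty_subset _)

theorem frameRep_union_iff (h : ConnectedTwoSum A₁ A₂ e₁ e₂ r r₁ r₂) (hL₁ : L₁ ⊆ A₁)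
    (hL₂ : L₂ ⊆ A₂) (hF₁ : FrameRep (insert e₁ A₁) r₁ L₁) (hF₂ : FrameRep (insert e₂ A₂) r₂ L₂) :
    FrameRep (A₁ ∪ A₂) r (L₁ ∪ L₂) ↔
      ((L₁ = ∅ ∧ GraphicRep (insert e₁ A₁) r₁) ∨ (L₂ = ∅ ∧ GraphicRep (insert e₂ A₂) r₂)) ∨
      (FrameRep (insert e₁ A₁) r₁ (insert e₁ L₁) ∧
        FrameRep (insert e₂ A₂) r₂ (insert e₂ L₂)) := by
  have hL : L₁ ∪ L₂ ⊆ A₁ ∪ A₂ := union_subset_union hL₁ hL₂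
  have e₁' : (L₁ ∪ L₂) ∩ A₁ = L₁ := by
    rw [union_inter_distrib_right, inter_eq_left.2 hL₁, (h.disjoint.symm.mono_left hL₂).inter_eq,
      union_empty]
  have e₂' : (L₁ ∪ L₂) ∩ A₂ = L₂ := by
    rw [union_inter_distrib_right, inter_eq_left.2 hL₂, (h.disjoint.mono_left hL₁).inter_eq,
      empty_union]
  constructor
  · intro hF
    rcases h.frameRep_insert_or_graphicRep hL hF with h1 | h1
    · rcases h.symm.frameRep_insert_or_graphicRep (union_comm A₁ A₂ ▸ hL)
        (union_comm A₁ A₂ ▸ hF) with h2 | h2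
      · rw [e₁'] at h1
        rw [e₂'] at h2
        exact Or.inr ⟨h1, h2⟩
      · rw [e₁'] at h2
        exact Or.inl (Or.inl h2)
    · rw [e₂'] at h1
      exact Or.inl (Or.inr h1)
  · rintro ((⟨rfl, h1⟩ | ⟨rfl, h1⟩) | ⟨h1, h2⟩)
    · rw [empty_union]
      exact h.frameRep_union_of_graphicRep h1 hF₂ hL₂
    · rw [union_empty, union_comm]
      exact h.symm.frameRep_union_of_graphicRep h1 hF₁ hL₁
    · exact h.frameRep_union h1 h2 hL₁ hL₂

end ConnectedTwoSum

end

/-! ### From matroids to rank functions, and the rank function of a 2-sum. -/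

section

variable {α : Type u} {M : Matroid α} [M.Finite] {I : Set α} {e : α}

theorem exists_isCircuit_of_mem_cl (hI : M.Indep I) (he : e ∈ M.E) (heI : e ∉ I)
    (hcl : e ∈ (rankFn M).cl I) : ∃ C, M.IsCircuit C ∧ e ∈ C ∧ C ⊆ insert e I := by
  have hdep : M.Dep (insert e I) := by
    refine ⟨fun hc => ?_, insert_subset he hI.subset_ground⟩
    have h1 := (ind_rankFn.2 hc).2
    rw [(rankFn M).mem_cl.1 hcl, (ind_rankFn.2 hI).2, ncard_insert_of_notMem heI hI.finite] at h1
    push_cast at h1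
    linarith
  obtain ⟨C, hC, hCc⟩ := hdep.exists_isCircuit_subset
  refine ⟨C, hCc, by_contra fun heC => ?_, hC⟩
  exact hCc.not_indep (hI.subset ((subset_insert_iff_of_notMem heC).1 hC))

theorem mem_cl_of_isCircuit {C : Set α} (hI : M.Indep I) (hC : M.IsCircuit C)
    (h : C ⊆ insert e I) : e ∈ (rankFn M).cl I := by
  by_contra hn
  exact hC.not_indep ((ind_rankFn.1 ((ind_rankFn.2 hI).insert hn)).subset h)

/-- Connectedness as a strict inequality, with the basepoint kept in the second part so that this
part is never empty. -/
theorem IsConnected.rank_lt (h : IsConnected M) (he : e ∈ M.E) {Z : Set α} (hZ : Z ⊆ M.E \ {e})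
    (hZ0 : Z.Nonempty) : rankFn M (insert e (M.E \ {e})) <
      rankFn M Z + rankFn M (insert e ((M.E \ {e}) \ Z)) := by
  have heZ : e ∉ Z := fun hc => (hZ hc).2 rfl
  have h1 : insert e ((M.E \ {e}) \ Z) = M.E \ Z := by
    rw [sdiff_sdiff_comm, insert_sdiff_self_of_mem (show e ∈ M.E \ Z from ⟨he, heZ⟩)]
  rw [h1, insert_sdiff_self_of_mem he]
  have h2 := (rankFn M).union_le Z (M.E \ Z)
  have hZE := hZ.trans sdiff_subset
  rw [union_sdiff_cancel hZE] at h2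
  refine h2.lt_of_ne fun hc => h Z hZE hZ0 ⟨e, he, heZ⟩ ?_
  rw [Matroid.eRank_def, ← coe_rankFn M Z, ← coe_rankFn M (M.E \ Z), ← coe_rankFn M M.E]
  rw [rankFn_apply, rankFn_apply, rankFn_apply] at hc
  exact_mod_cast hc.symm

theorem IsConnected.rankFn_singleton (h : IsConnected M) (hE : M.E.Nontrivial) (he : e ∈ M.E) :
    rankFn M {e} = 1 := by
  have := (ind_rankFn.2 (h.isNonloop hE he).indep).2
  rwa [ncard_singleton, Nat.cast_one] at this

theorem isFrameMatroidal_iff [M.Loopless] {L : Set α} (hL : L ⊆ M.E) :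
    IsFrameMatroidal M L ↔ FrameRep M.E (rankFn M) L := ⟨fun h => h.frameRep, fun h => h.isFrameMatroidal hL⟩

theorem isFrame_iff : IsFrame M ↔ FrameRep M.E (rankFn M) ∅ := ⟨fun h => h.frameRep, fun h => h.isFrame⟩

theorem isGraphic_iff [M.Loopless] : IsGraphic M ↔ GraphicRep M.E (rankFn M) :=
  ⟨fun h => h.graphicRep, fun h => h.isGraphic⟩

theorem loopless_of_rankFn (h : ∀ e ∈ M.E, rankFn M {e} = 1) : M.Loopless := by
  rw [Matroid.loopless_iff_forall_isNonloop]
  intro e he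
  rw [← Matroid.indep_singleton, ← ind_rankFn]
  exact ⟨finite_singleton e, by rw [h e he, ncard_singleton, Nat.cast_one]⟩

end

section

variable {α : Type u} {M M₁ M₂ : Matroid α} [M₁.Finite] [M₂.Finite] {I₁ I₂ : Set α}
  {e₁ e₂ : α}

/-- The independent sets of a 2-sum. -/
theorem IsTwoSum.indep_iff (h : IsTwoSum M₁ M₂ e₁ e₂ M) (hd : Disjoint M₁.E M₂.E)
    (he₁ : e₁ ∈ M₁.E) (he₂ : e₂ ∈ M₂.E) (hI₁ : I₁ ⊆ M₁.E \ {e₁}) (hI₂ : I₂ ⊆ M₂.E \ {e₂}) :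
    M.Indep (I₁ ∪ I₂) ↔ M₁.Indep I₁ ∧ M₂.Indep I₂ ∧
      ¬ (e₁ ∈ (rankFn M₁).cl I₁ ∧ e₂ ∈ (rankFn M₂).cl I₂) := by
  have hn₁ : e₁ ∉ I₁ := fun hc => (hI₁ hc).2 rfl
  have hn₂ : e₂ ∉ I₂ := fun hc => (hI₂ hc).2 rfl
  have hE : I₁ ∪ I₂ ⊆ M.E := by
    rw [h.1]
    rintro x (hx | hx)
    · refine ⟨Or.inl (hI₁ hx).1, ?_⟩
      rintro (rfl | rfl)
      exacts [hn₁ hx, hd.notMem_of_mem_left (hI₁ hx).1 he₂]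
    · refine ⟨Or.inr (hI₂ hx).1, ?_⟩
      rintro (rfl | rfl)
      exacts [hd.notMem_of_mem_left he₁ (hI₂ hx).1, hn₂ hx]
  constructor
  · intro hI
    have i₁ : M₁.Indep I₁ := (Matroid.indep_iff_forall_subset_not_isCircuit
      (hI₁.trans sdiff_subset)).2 fun C hC hCc => ((h.2 C).2 (Or.inl ⟨hCc, fun hc => hn₁ (hC hc)⟩)
        ).not_indep (hI.subset (hC.trans subset_union_left))
    have i₂ : M₂.Indep I₂ := (Matroid.indep_iff_forall_subset_not_isCircuit
      (hI₂.trans sdiff_subset)).2 fun C hC hCc => ((h.2 C).2 (Or.inr (Or.inl ⟨hCc, fun hc =>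
        hn₂ (hC hc)⟩))).not_indep (hI.subset (hC.trans subset_union_right))
    refine ⟨i₁, i₂, fun ⟨c₁, c₂⟩ => ?_⟩
    obtain ⟨C₁, hC₁, m₁, s₁⟩ := exists_isCircuit_of_mem_cl i₁ he₁ hn₁ c₁
    obtain ⟨C₂, hC₂, m₂, s₂⟩ := exists_isCircuit_of_mem_cl i₂ he₂ hn₂ c₂
    refine ((h.2 _).2 (Or.inr (Or.inr ⟨C₁, C₂, hC₁, m₁, hC₂, m₂, rfl⟩))).not_indep (hI.subset ?_)
    rintro x ⟨hx | hx, hne⟩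
    · exact Or.inl ((s₁ hx).resolve_left fun h' => hne (Or.inl h'))
    · exact Or.inr ((s₂ hx).resolve_left fun h' => hne (Or.inr h'))
  · rintro ⟨i₁, i₂, hn⟩
    refine (Matroid.indep_iff_forall_subset_not_isCircuit hE).2 fun C hC hCc => ?_
    have key₁ : ∀ {x}, x ∈ C → x ∈ M₁.E → x ∈ I₁ := fun hx hx₁ =>
      (hC hx).resolve_right fun h' => hd.notMem_of_mem_left hx₁ (hI₂ h').1
    have key₂ : ∀ {x}, x ∈ C → x ∈ M₂.E → x ∈ I₂ := fun hx hx₂ =>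
      (hC hx).resolve_left fun h' => hd.notMem_of_mem_left (hI₁ h').1 hx₂
    rcases (h.2 C).1 hCc with ⟨hc, -⟩ | ⟨hc, -⟩ | ⟨C₁, C₂, hC₁, -, hC₂, -, rfl⟩
    · exact hc.not_indep (i₁.subset fun x hx => key₁ hx (hc.subset_ground hx))
    · exact hc.not_indep (i₂.subset fun x hx => key₂ hx (hc.subset_ground hx))
    · refine hn ⟨mem_cl_of_isCircuit i₁ hC₁ fun x hx => ?_,
        mem_cl_of_isCircuit i₂ hC₂ fun x hx => ?_⟩
      · by_cases hxe : x = e₁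
        · exact Or.inl hxe
        · refine Or.inr (key₁ ⟨Or.inl hx, ?_⟩ (hC₁.subset_ground hx))
          rintro (h' | rfl)
          exacts [hxe h', hd.notMem_of_mem_left (hC₁.subset_ground hx) he₂]
      · by_cases hxe : x = e₂
        · exact Or.inl hxe
        · refine Or.inr (key₂ ⟨Or.inr hx, ?_⟩ (hC₂.subset_ground hx))
          rintro (rfl | h')
          exacts [hd.notMem_of_mem_left he₁ (hC₂.subset_ground hx), hxe h']

variable [M.Finite]

/-- The rank function of a 2-sum. -/
theorem IsTwoSum.twoSumRank (h : IsTwoSum M₁ M₂ e₁ e₂ M) (hd : Disjoint M₁.E M₂.E)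
    (he₁ : M₁.IsNonloop e₁) (he₂ : e₂ ∈ M₂.E) :
    TwoSumRank (M₁.E \ {e₁}) (M₂.E \ {e₂}) (rankFn M) (rankFn M₁) (rankFn M₂)
      (fun U => e₁ ∈ (rankFn M₁).cl U) (fun U => e₂ ∈ (rankFn M₂).cl U) := by
  intro U₁ hU₁ U₂ hU₂
  have hdU : Disjoint U₁ U₂ := hd.mono (hU₁.trans sdiff_subset) (hU₂.trans sdiff_subset)
  have lower : ∀ {I₁ I₂}, I₁ ⊆ U₁ → I₂ ⊆ U₂ → (rankFn M₁).Ind I₁ → (rankFn M₂).Ind I₂ →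
      ¬ (e₁ ∈ (rankFn M₁).cl I₁ ∧ e₂ ∈ (rankFn M₂).cl I₂) →
      rankFn M₁ I₁ + rankFn M₂ I₂ ≤ rankFn M (U₁ ∪ U₂) := by
    intro I₁ I₂ h₁ h₂ i₁ i₂ hn
    have hi := ind_rankFn.2 ((h.indep_iff hd he₁.mem_ground he₂ (h₁.trans hU₁) (h₂.trans hU₂)).2
      ⟨ind_rankFn.1 i₁, ind_rankFn.1 i₂, hn⟩)
    have h1 := hi.2
    rw [ncard_union_eq (hdU.mono h₁ h₂) i₁.1 i₂.1] at h1
    have h2 := (rankFn M).mono (union_subset_union h₁ h₂)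
    have h3 := i₁.2
    have h4 := i₂.2
    push_cast at h1
    linarith
  obtain ⟨I, hIU, hI, hIr⟩ := (rankFn M).exists_basis (U₁ ∪ U₂)
  have hIU' : I = (I ∩ U₁) ∪ (I ∩ U₂) := by rw [← inter_union_distrib_left, inter_eq_left.2 hIU]
  have hI' := ind_rankFn.1 hI
  rw [hIU', h.indep_iff hd he₁.mem_ground he₂ (inter_subset_right.trans hU₁)
    (inter_subset_right.trans hU₂)] at hI'
  obtain ⟨i₁, i₂, hn⟩ := hI'
  have hIc : rankFn M (U₁ ∪ U₂) = rankFn M₁ (I ∩ U₁) + rankFn M₂ (I ∩ U₂) := by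
    rw [(ind_rankFn.2 i₁).2, (ind_rankFn.2 i₂).2, ← hIr, hI.2, hIU',
      ncard_union_eq (hdU.mono inter_subset_right inter_subset_right) (hI.1.inter_of_left _)
        (hI.1.inter_of_left _), ← hIU']
    push_cast
    rfl
  have m₁ := (rankFn M₁).mono (inter_subset_right (s := I) (t := U₁))
  have m₂ := (rankFn M₂).mono (inter_subset_right (s := I) (t := U₂))
  obtain ⟨B₁, hB₁, b₁, br₁⟩ := (rankFn M₁).exists_basis U₁
  obtain ⟨B₂, hB₂, b₂, br₂⟩ := (rankFn M₂).exists_basis U₂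
  refine ⟨fun c₁ c₂ => le_antisymm ?_ ?_, fun hc => le_antisymm (by linarith) ?_⟩
  -- With a larger rank, a basis of the union would contain bases of both `U₁` and `U₂`, and its two
  -- parts would span both basepoints.
  · by_contra! hlt
    refine hn ⟨?_, ?_⟩
    · exact (rankFn M₁).cl_subset_cl ((rankFn M₁).subset_cl_of_rank_le inter_subset_right
        (by linarith)) c₁
    · exact (rankFn M₂).cl_subset_cl ((rankFn M₂).subset_cl_of_rank_le inter_subset_right
        (by linarith)) c₂
  -- A basis of `U₁` with `e₁` is taken through `e₁`. Without `e₁` it has one element less than a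
  -- basis of `U₁` and does not span `e₁`, so it can be combined with any basis of `U₂`.
  · obtain ⟨K, hK, hKU, k, kr⟩ := (ind_rankFn.2 he₁.indep).exists_extension
      (singleton_subset_iff.2 (mem_insert e₁ U₁))
    have heK : e₁ ∈ K := hK rfl
    have hKi := k.subset (sdiff_subset (s := K) (t := {e₁}))
    have hKr : rankFn M₁ (K \ {e₁}) + 1 = rankFn M₁ U₁ := by
      rw [hKi.2, ← (rankFn M₁).mem_cl.1 c₁, ← kr, k.2, ← ncard_sdiff_singleton_add_one heK k.1]
      push_cast
      rfl
    have hKn : e₁ ∉ (rankFn M₁).cl (K \ {e₁}) := by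
      rw [RankFn.notMem_cl, insert_sdiff_self_of_mem heK, hKr, kr, (rankFn M₁).mem_cl.1 c₁]
    have := lower (fun x hx => (hKU hx.1).resolve_left hx.2) hB₂ hKi b₂ fun hc => hKn hc.1
    linarith
  · have := lower hB₁ hB₂ b₁ b₂ fun ⟨c₁, c₂⟩ =>
      hc ⟨(rankFn M₁).cl_mono hB₁ c₁, (rankFn M₂).cl_mono hB₂ c₂⟩
    linarith

theorem IsTwoSum.connectedTwoSum (h : IsTwoSum M₁ M₂ e₁ e₂ M) (hd : Disjoint M₁.E M₂.E)
    (h₁ : IsConnected M₁) (h₂ : IsConnected M₂) (hE₁ : M₁.E.Nontrivial) (hE₂ : M₂.E.Nontrivial)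
    (he₁ : e₁ ∈ M₁.E) (he₂ : e₂ ∈ M₂.E) :
    ConnectedTwoSum (M₁.E \ {e₁}) (M₂.E \ {e₂}) e₁ e₂ (rankFn M) (rankFn M₁) (rankFn M₂) where
  finite₁ := M₁.ground_finite.sdiff
  finite₂ := M₂.ground_finite.sdiff
  disjoint := hd.mono sdiff_subset sdiff_subset
  notMem₁ := fun hc => hc.2 rfl
  notMem₂ := fun hc => hc.2 rfl
  nonempty₁ := hE₁.exists_ne e₁
  nonempty₂ := hE₂.exists_ne e₂
  nonloop₁ := fun _ he => h₁.rankFn_singleton hE₁ (insert_sdiff_self_of_mem he₁ ▸ he)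
  nonloop₂ := fun _ he => h₂.rankFn_singleton hE₂ (insert_sdiff_self_of_mem he₂ ▸ he)
  connected₁ := fun _ hZ hZ0 => h₁.rank_lt he₁ hZ hZ0
  connected₂ := fun _ hZ hZ0 => h₂.rank_lt he₂ hZ hZ0
  rank := h.twoSumRank hd (h₁.isNonloop hE₁ he₁) he₂

end

section

variable {α : Type u} {M M₁ M₂ : Matroid α} {e₁ e₂ : α}

theorem IsTwoSum.ground_eq (h : IsTwoSum M₁ M₂ e₁ e₂ M) (hd : Disjoint M₁.E M₂.E)
    (he₁ : e₁ ∈ M₁.E) (he₂ : e₂ ∈ M₂.E) : M.E = M₁.E \ {e₁} ∪ M₂.E \ {e₂} := by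
  have h1 := hd.notMem_of_mem_left he₁
  have h2 := hd.notMem_of_mem_right he₂
  rw [h.1, union_sdiff_distrib, insert_eq, ← Set.sdiff_sdiff, ← Set.sdiff_sdiff,
    sdiff_singleton_eq_self h1, sdiff_singleton_eq_self fun hc => h2 hc.1]

end

end FrameMatroids

theorem mainTheorem2 {α : Type*} (M₁ M₂ : Matroid α) (hM₁ : M₁.Finite) (hM₂ : M₂.Finite)
    (hdisj : Disjoint M₁.E M₂.E)
    (hconn₁ : FrameMatroids.IsConnected M₁) (hconn₂ : FrameMatroids.IsConnected M₂)
    (hE₁ : M₁.E.Nontrivial) (hE₂ : M₂.E.Nontrivial)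
    (e₁ e₂ : α) (he₁ : e₁ ∈ M₁.E) (he₂ : e₂ ∈ M₂.E) :
    (FrameMatroids.IsFrame (FrameMatroids.twoSum M₁ M₂ e₁ e₂) ↔
      ((FrameMatroids.IsGraphic M₁ ∧ FrameMatroids.IsFrame M₂) ∨
        (FrameMatroids.IsGraphic M₂ ∧ FrameMatroids.IsFrame M₁)) ∨
      (FrameMatroids.IsFrameMatroidal M₁ {e₁} ∧ FrameMatroids.IsFrameMatroidal M₂ {e₂})) ∧
    (∀ L₁ L₂ : Set α, L₁ ⊆ M₁.E \ {e₁} → L₂ ⊆ M₂.E \ {e₂} →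
      FrameMatroids.IsFrameMatroidal M₁ L₁ → FrameMatroids.IsFrameMatroidal M₂ L₂ →
      (FrameMatroids.IsFrameMatroidal (FrameMatroids.twoSum M₁ M₂ e₁ e₂) (L₁ ∪ L₂) ↔
        ((L₁ = ∅ ∧ FrameMatroids.IsGraphic M₁) ∨ (L₂ = ∅ ∧ FrameMatroids.IsGraphic M₂)) ∨
        (FrameMatroids.IsFrameMatroidal M₁ (insert e₁ L₁) ∧
          FrameMatroids.IsFrameMatroidal M₂ (insert e₂ L₂)))) := by
  have h := FrameMatroids.isTwoSum_twoSum hdisj (hconn₁.isNonloop hE₁ he₁) (hconn₂.isNonloop hE₂ he₂)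
  have hE := h.ground_eq hdisj he₁ he₂
  have hfin : (FrameMatroids.twoSum M₁ M₂ e₁ e₂).Finite :=
    ⟨hE ▸ M₁.ground_finite.sdiff.union M₂.ground_finite.sdiff⟩
  have hS := h.connectedTwoSum hdisj hconn₁ hconn₂ hE₁ hE₂ he₁ he₂
  have hl₁ : M₁.Loopless := FrameMatroids.loopless_of_rankFn fun e he => hconn₁.rankFn_singleton hE₁ he
  have hl₂ : M₂.Loopless := FrameMatroids.loopless_of_rankFn fun e he => hconn₂.rankFn_singleton hE₂ he
  have hl : (FrameMatroids.twoSum M₁ M₂ e₁ e₂).Loopless := by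
    refine FrameMatroids.loopless_of_rankFn fun e he => ?_
    rw [hE] at he
    rcases he with he | he
    · rw [hS.rank_left (Set.singleton_subset_iff.2 he), hS.nonloop₁ e (Or.inr he)]
    · rw [hS.symm.rank_left (Set.singleton_subset_iff.2 he), hS.nonloop₂ e (Or.inr he)]
  have hi₁ := Set.insert_sdiff_self_of_mem he₁
  have hi₂ := Set.insert_sdiff_self_of_mem he₂
  constructor
  · rw [FrameMatroids.isFrame_iff, FrameMatroids.isFrame_iff, FrameMatroids.isFrame_iff, FrameMatroids.isGraphic_iff, FrameMatroids.isGraphic_iff,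
      FrameMatroids.isFrameMatroidal_iff (Set.singleton_subset_iff.2 he₁),
      FrameMatroids.isFrameMatroidal_iff (Set.singleton_subset_iff.2 he₂), hE, hS.frameRep_iff, hi₁, hi₂]
  · intro L₁ L₂ hL₁ hL₂ hF₁ hF₂
    have hL₁' := hL₁.trans Set.sdiff_subset
    have hL₂' := hL₂.trans Set.sdiff_subset
    rw [FrameMatroids.isFrameMatroidal_iff hL₁', ← hi₁] at hF₁
    rw [FrameMatroids.isFrameMatroidal_iff hL₂', ← hi₂] at hF₂
    rw [FrameMatroids.isFrameMatroidal_iff (hE ▸ Set.union_subset_union hL₁ hL₂), FrameMatroids.isGraphic_iff, FrameMatroids.isGraphic_iff,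
      FrameMatroids.isFrameMatroidal_iff (Set.insert_subset he₁ hL₁'),
      FrameMatroids.isFrameMatroidal_iff (Set.insert_subset he₂ hL₂'), hE,
      hS.frameRep_union_iff hL₁ hL₂ hF₁ hF₂, hi₁, hi₂]
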